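/- **Conventions.** Let $X$ be a finite set of $n$ external particles. Vectors live in $\mathbb C^m$ with the bilinear product $v\cdot w$. The data are momenta $k_i$, polarisations $\epsilon_i,\tilde\epsilon_i$ ($i\in X$) and a loop momentum $\ell$ with $$\sum_i k_i=0,\qquad k_i^2=\epsilon_i\cdot k_i=\tilde\epsilon_i\cdot k_i=0,$$ and $\ell^2$ arbitrary. Write $\sigma_{ij}=\sigma_i-\sigma_j$ for points of $\mathbb{CP}^1$ (homogeneous coordinates are used for points at $\infty$). *Sums over solutions.* For marked points $\Lambda$ and symmetric pairings $s_{ij}$ put $E_i=\sum_{j\ne i}s_{ij}/\sigma_{ij}$. Fix three points at $0,1,\infty$, and let $J=\det(\partial E_i/\partial\sigma_j)$ over the other points. Then $\langle f\rangle_s=-\sum f/J$, summed over the gauge-fixed solutions of $E_i=0$ (for the unfixed $i$) with pairwise distinct $\sigma_i$. *Tree amplitudes.* $M^{(0)}=\langle f\rangle_s$ with $s_{ij}=2k_i\cdot k_j$, for massless momenta that add up to $0$. *One-loop integrands.* The marked points are $\sigma_{\ell^+},\sigma_{\ell^-}$ and the $\sigma_i$, $i\in X$. The residues of $P(\sigma)$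 at them are $\ell,-\ell,k_i$; the pairings are $s_{ij}=2k_i\cdot k_j$, $s_{i\ell^\pm}=\pm 2\ell\cdot k_i$, $s_{\ell^+\ell^-}=0$. Then $$M^{(1)}=\frac1{\ell^2}\,\Big\langle\frac{\mathcal I}{\sigma_{\ell^+\ell^-}^{4}}\Big\rangle_s .$$ *Matrices.* For legs with momenta $k_i$ and polarisations $\epsilon_i$, and a propagator $S_{ij}$, let $M=\begin{pmatrix}A&-C^T\\C&B\end{pmatrix}$ with $A_{ij}=k_i\cdot k_jS_{ij}$, $B_{ij}=\epsilon_i\cdot\epsilon_jS_{ij}$, $C_{ij}=\epsilon_i\cdot k_jS_{ij}$ for $i\neq j$, $A_{ii}=B_{ii}=0$ and $C_{ii}=-\epsilon_i\cdot P(\sigma_i)$ (singular term omitted). At tree level $S_{ij}=1/\sigma_{ij}$, and $\mathrm{Pf}'(M)=\sigma_{ab}^{-1}\mathrm{Pf}(M^{ab}_{ab})$, where the rows and columns of $k_a,k_b$ are removed. Pfaffians are signed so that they do not depend on the order of the legs: rows are listed pairwise, $k_i,\epsilon_i$, with $\epsilon_a,\epsilon_b$ as one pair. For two marked legs $\ell^\pm$,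 let $M_3$ have rows for the unmarked legs only, with $$S_{ij}=\frac1{\sigma_{ij}}\Big(1+\sqrt q\,\frac{(\sigma_{ij}\sigma_{\ell^+\ell^-})^2}{\sigma_{i\ell^+}\sigma_{i\ell^-}\sigma_{j\ell^+}\sigma_{j\ell^-}}\Big)$$ and with $P$ including the marked legs. $\mathrm{Pf}(M_3)|_{q^0}$ and $\mathrm{Pf}(M_3)|_{\sqrt q}$ are the coefficients of $1$ and $\sqrt q$. *Theories.* Let $$\mathcal I^{cPT}_w=\sum_{\rho}\frac{\sigma_{\ell^+\ell^-}}{\sigma_{\ell^+\rho(1)}\sigma_{\rho(1)\rho(2)}\cdots\sigma_{\rho(n)\ell^-}},$$ summed over the cyclic rotations $\rho$ of the colour ordering $w$ of $X$; let $\mathcal I^{NS}_\epsilon=\mathrm{Pf}(M_3)|_{\sqrt q}+(d-2)\mathrm{Pf}(M_3)|_{q^0}$ and $\mathcal I^0_\epsilon=\mathrm{Pf}(M_3)|_{q^0}$. The integrand $\mathcal I$ is * $n$-gon: $\prod_i\big(\sigma_{\ell^+\ell^-}/(\sigma_{i\ell^+}\sigma_{i\ell^-})\big)^2$; * bi-adjoint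 scalar: $\mathcal I^{cPT}_w\mathcal I^{cPT}_{w'}$; * pure Yang–Mills: $\mathcal I^{NS}_\epsilon\,\mathcal I^{cPT}_w$; * NS–NS gravity: $\mathcal I^{NS}_\epsilon\mathcal I^{NS}_{\tilde\epsilon}$; * pure gravity: $\mathcal I^{NS}_\epsilon\mathcal I^{NS}_{\tilde\epsilon}-\alpha\,\mathcal I^0_\epsilon\mathcal I^0_{\tilde\epsilon}$ with $\alpha=\tfrac12(d-2)(d-3)+1$. The tree factors are $-1/(\sigma_{w_1w_2}\cdots\sigma_{w_Nw_1})$ for an ordering $w$, and $\mathrm{Pf}'(M)$ for vectors. For two scalars on marked legs $\ell^\pm$ the vector factor is $\mathrm{Pf}(M_3)|_{q^0}/\sigma_{\ell^+\ell^-}^2$. The $n$-gon tree factor with two marked legs is $\sigma_{\ell^+\ell^-}^{-4}\prod_i(\sigma_{\ell^+\ell^-}/(\sigma_{i\ell^+}\sigma_{i\ell^-}))^2$, and there is no $n$-gon tree without marked legs. *Channels.* Let $I\subseteq X$ and $k_I=\sum_{i\in I}k_i$. In case I the channel consists of the $\sigma_i$, $i\in I$ (both loop punctures outside), and $\tilde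 s_I=k_I^2$. In case II it consists of these and $\sigma_{\ell^+}$ ($\sigma_{\ell^-}$ outside), and $\tilde s_I=2\ell\cdot k_I+k_I^2$. **Theorem. Part 1 (scattering equations).** Let $\varepsilon\to0$ along any filter of non-zero complex numbers, let the kinematic data $k_i(\varepsilon),\epsilon_i(\varepsilon),\tilde\epsilon_i(\varepsilon),\ell(\varepsilon)$ be bounded, and let $\sigma(\varepsilon)$ be pairwise distinct points that solve all the one-loop scattering equations $E_i=0$ at the finite points. Suppose $\sigma_i=\sigma_I+\varepsilon x_i+O(\varepsilon^2)$ for the points in the channel, while the points outside stay at a distance bounded below from those in the channel (they may be or tend to $\infty$). Then $\tilde s_I=O(\varepsilon)$, in case I and in case II. **Part 2 (poles and residues).** Choose the gauge so that one point $a$ of the channel is at $0$ and two points $b,c$ outside of it are at $1,\infty$. Choose another point $\mu$ of the channel, to define $\varepsilon$ by $\sigma_i=\varepsilon x_i$ ($i$ in the channel), $x_\mu=1$. On the side of the channel, put $a,\mu$, and the node at $0,1,\infty$; on the other side, put the node, $b,c$ at $0,1,\infty$. Let $K_0$ be kinematic data with $\ell^2\neq0$, $\tilde s_I=0$, such that the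 scattering equations on each of the two sides (those of the two amplitudes in the residue $R$ below) have finitely many solutions, all with $J\ne0$, and such that $$\mathcal F=\sum_{i}\sum_{j}\frac{x_i\,s_{ij}}{\sigma_I-\sigma_j}\neq0$$ for each pair of them ($i$ in the channel, $j$ outside; $\sigma_I$ is the node on the side of the complement). Then $M^{(1)}\sim R/\tilde s_I$ at $K_0$ in this factorisation channel, in the following sense. (i) *Channel.* For $\delta>0$, $\rho>0$, let $D_{\delta,\rho}$ be the configurations $\sigma_i=\varepsilon x_i$ ($i$ in the channel) with $0<|\varepsilon|<\rho$, $x_\mu=1$, $|x_i|\le1/\delta$, $|x_i-x_j|\ge\delta$, and with the points outside at distance at least $\delta$ from $0$ and from each other, and, where in coordinates $(\sigma,1)$, of absolute value at most $1/\delta$. For all small enough $\delta$, and then all small enough $\rho$, $$\tilde s_I\cdot M^{(1)}\big|_{D_{\delta,\rho}}\longrightarrow R$$ as the kinematic data tend to $K_0$ with $\tilde s_I\ne0$, where $M^{(1)}|_{D}$ is the part of $M^{(1)}$ that comes from the solutions in $D$. (ii) *Full integrand.* If for some $\delta>0$ and every $\rho>0$, near $K_0$ with $\tilde s_I\neq0$,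 every solution is in $D_{\delta,\rho}$ or stays away from all degenerations (in coordinates $(\sigma,1)$ or $\infty=(1,0)$: all $|\sigma_{ij}|\ge\delta$, $|\sigma_i|\le1/\delta$ and $|J|\geq\delta$), then $\tilde s_I M^{(1)}\to R$. *Case I.* $\displaystyle\frac{R}{\tilde s_I}=M_I^{(0)}\,\frac1{s_I}\,M^{(1)}_{\bar I}$, $s_I=k_I^2$: $M_I^{(0)}$ is the tree amplitude of the particles in $I$ and the node with momentum $-k_I$, and $M_{\bar I}^{(1)}$ is the one-loop integrand, in the same theory, of the particles not in $I$ and the node with momentum $k_I$, summed over the states of the node. For Yang–Mills and gravity the node carries an orthonormal basis of $m-2$ vectors orthogonal to $k_I\ne0$ (for gravity: pairs of these). For a coloured theory, $I$ must be consecutive in the cyclic ordering(s), with the induced orderings on the two sides; otherwise $R=0$. For the $n$-gon $R=0$. *Case II.* Let $\eta\in\mathbb C^m$ satisfy $\eta^2=-\ell^2$, $\eta\cdot\ell=\eta\cdot k_i=0$, and for Yang–Mills and gravity $\eta\cdot\epsilon_i=\eta\cdot\tilde\epsilon_i=0$; put $\ell_I=\ell+\eta$, so $\ell_I^2=0=(\ell_I+k_I)^2$.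 Then $$\frac R{\tilde s_I}=M^{(0)}_I(\ldots,\ell_I,-\ell_I-k_I)\;\frac1{\ell^2\,\tilde s_I}\;M^{(0)}_{\bar I}(\ell_I+k_I,-\ell_I,\ldots),$$ the Q-cut product, summed over the states of the two cut legs. For Yang–Mills these are the pairs of physical polarisations $e_r,e'_{r'}$ ($r,r'=1,\dots,m-2$, orthonormal and orthogonal to $\ell_I\neq0$ and $\ell_I+k_I\neq0$ respectively) with weight $1$, and a scalar running through both cut legs with weight $d-m$: a vector with $d-2$ states is an $m$-dimensional vector and $d-m$ scalars. For NS–NS gravity the states are pairs of such states, for $\epsilon$ and for $\tilde\epsilon$, with the product weights. For pure gravity, $\alpha$ times the (scalar, scalar) contribution is subtracted. For a coloured theory, $I$ must be consecutive in the cyclic ordering(s), and the two trees have the orderings $(\ell_I,\text{the block of }I,-\ell_I-k_I)$ and $(\ell_I+k_I,\text{the block of }\bar I,-\ell_I)$; otherwise $R=0$. -/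

import Mathlib

open Filter Topology

noncomputable section

namespace OneLoop

/-! ### Marked points, scattering equations, sums over solutions -/

/-- Complexified space-time; the metric is the complex bilinear dot product `v ⬝ᵥ w`. -/
abbrev V (m : ℕ) := Fin m → ℂ

/-- Marked points on the Riemann sphere in homogeneous coordinates: `σ ∈ ℂ` is `(σ, 1)`, and
`∞` is `(1, 0)`. -/
abbrev Config (Λ : Type*) := Λ → ℂ × ℂ

/-- `σ_{ij} = σ_i - σ_j` in homogeneous coordinates. -/
def br (u v : ℂ × ℂ) : ℂ := u.1 * v.2 - u.2 * v.1

/-- The residue at the (finite) marked point `i` of the quadratic differential with pairings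
`s i j`. For finite points this is `∑_{j ≠ i} s i j / (σ_i - σ_j)`; a point `j` at infinity does
not contribute. -/
def scatEq {Λ : Type*} [Fintype Λ] [DecidableEq Λ] (s : Λ → Λ → ℂ) (u : Config Λ) (i : Λ) : ℂ :=
  ∑ j ∈ Finset.univ.erase i, s i j * (u j).2 / ((u i).2 * br (u i) (u j))

/-- An `SL(2,ℂ)` gauge: the three marked points that are put at `0`, `1` and `∞`. -/
structure Gauge (Λ : Type*) where
  zero : Λ
  one : Λ
  inf : Λ

/-- The labels whose marked points are not fixed. -/
abbrev Gauge.Free {Λ : Type*} (g : Gauge Λ) (i : Λ) : Prop := i ≠ g.zero ∧ i ≠ g.one ∧ i ≠ g.inf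

/-- `u` is in the gauge `g`: three points at `0`, `1`, `∞`, all the other points finite. -/
def Gauge.Normalised {Λ : Type*} (g : Gauge Λ) (u : Config Λ) : Prop :=
  u g.zero = (0, 1) ∧ u g.one = (1, 1) ∧ u g.inf = (1, 0) ∧ ∀ i, i ≠ g.inf → (u i).2 = 1

/-- The gauge-fixed solutions of the scattering equations with pairwise distinct points. -/
def Sols {Λ : Type*} [Fintype Λ] [DecidableEq Λ] (s : Λ → Λ → ℂ) (g : Gauge Λ) :
    Set (Config Λ) :=
  {u | g.Normalised u ∧ (∀ i j, i ≠ j → br (u i) (u j) ≠ 0) ∧ ∀ i, g.Free i → scatEq s u i = 0}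

/-- The Jacobian `det (∂ E_i / ∂ σ_j)` over the unfixed labels, with `E_i = scatEq s u i`. The
Faddeev-Popov factor `(σ_{ab} σ_{bc} σ_{ca})²` is `1` in the gauge `(0, 1, ∞)`. -/
def jac {Λ : Type*} [Fintype Λ] [DecidableEq Λ] (s : Λ → Λ → ℂ) (g : Gauge Λ)
    (u : Config Λ) : ℂ :=
  Matrix.det (Matrix.of fun i j : {i // g.Free i} =>
    if i = j then
      -∑ k ∈ Finset.univ.erase i.1, s i.1 k * (u k).2 / br (u i.1) (u k) ^ 2
    else s i.1 j.1 / br (u i.1) (u j.1) ^ 2)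

/-- Minus the sum over the solutions in `U` of integrand over Jacobian. The overall sign is that
of the one-loop formula; it is used for tree and one-loop amplitudes alike. -/
def chySum {Λ : Type*} [Fintype Λ] [DecidableEq Λ] (s : Λ → Λ → ℂ) (g : Gauge Λ)
    (U : Set (Config Λ)) (f : Config Λ → ℂ) : ℂ :=
  -∑ᶠ (u : Config Λ) (_ : u ∈ Sols s g ∩ U), f u / jac s g u

/-- Finitely many solutions, all of them simple. -/
def Generic {Λ : Type*} [Fintype Λ] [DecidableEq Λ] (s : Λ → Λ → ℂ) (g : Gauge Λ) : Prop :=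
  (Sols s g).Finite ∧ ∀ u ∈ Sols s g, jac s g u ≠ 0

/-! ### Kinematics -/

/-- `2 k_i · k_j`, so that `scatEq (mandel k) u i = 2 k_i · P(σ_i) = Res_{σ_i} P²`. -/
def mandel {Λ : Type*} {m : ℕ} (k : Λ → V m) (i j : Λ) : ℂ := 2 * (k i ⬝ᵥ k j)

/-- Two marked legs `inl true`, `inl false` with values `p`, `q`, besides the legs of `Y`. -/
def marked {Y : Type*} {m : ℕ} (p q : V m) (k : Y → V m) : Bool ⊕ Y → V m :=
  Sum.elim (fun b => bif b then p else q) k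

/-- Kinematic data of a one-loop integrand: momenta `k_i`, polarisations `ε_i`, second
polarisations `ε̃_i` (gravitons have `ε_i^μ ε̃_i^ν`), loop momentum `ℓ`. -/
abbrev Kin (X : Type*) (m : ℕ) := (X → V m) × (X → V m) × (X → V m) × V m

def Kin.k {X : Type*} {m : ℕ} (K : Kin X m) : X → V m := K.1
def Kin.eps {X : Type*} {m : ℕ} (K : Kin X m) : X → V m := K.2.1
def Kin.epst {X : Type*} {m : ℕ} (K : Kin X m) : X → V m := K.2.2.1
def Kin.ell {X : Type*} {m : ℕ} (K : Kin X m) : V m := K.2.2.2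

/-- Momentum conservation, massless external legs, transverse polarisations; `ℓ` is off shell. -/
def Admissible {X : Type*} [Fintype X] {m : ℕ} (K : Kin X m) : Prop :=
  ∑ i, K.k i = 0 ∧
    ∀ i, K.k i ⬝ᵥ K.k i = 0 ∧ K.eps i ⬝ᵥ K.k i = 0 ∧ K.epst i ⬝ᵥ K.k i = 0

/-- The residues of `P(σ)` at `σ_{ℓ⁺}` (`inl true`), `σ_{ℓ⁻}` (`inl false`), `σ_i`
(`inr i`): `ℓ`, `-ℓ`, `k_i`. -/
def loopMom {X : Type*} {m : ℕ} (K : Kin X m) : Bool ⊕ X → V m := marked K.ell (-K.ell) K.k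

/-- Pairings of `S = P² - (ℓ/(σ-σ_{ℓ⁺}) - ℓ/(σ-σ_{ℓ⁻}))² dσ²`, so that
`scatEq (loopMandel K) u i = Res_{σ_i} S`: the mixed `ℓ⁺ℓ⁻` term is removed. -/
def loopMandel {X : Type*} {m : ℕ} (K : Kin X m) : Bool ⊕ X → Bool ⊕ X → ℂ
  | Sum.inl _, Sum.inl _ => 0
  | i, j => mandel (loopMom K) i j

/-- The momentum `k_I` of the external particles in `I`. -/
def kSum {X : Type*} {m : ℕ} (K : Kin X m) (I : Finset X) : V m := ∑ i ∈ I, K.k i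

/-- The subset of the marked points: `I`, together with `ℓ⁺` if `b` is `true`. -/
def chan {X : Type*} (b : Bool) (I : Finset X) : Set (Bool ⊕ X) :=
  {i | match i with
    | Sum.inl c => c = true ∧ b = true
    | Sum.inr x => x ∈ I}

/-- `s̃_I`: `k_I²` if both loop punctures are outside `I`, and `2 ℓ·k_I + k_I²` if just
`σ_{ℓ⁺}` is inside. -/
def sTilde {X : Type*} {m : ℕ} (b : Bool) (I : Finset X) (K : Kin X m) : ℂ :=
  if b then 2 * (K.ell ⬝ᵥ kSum K I) + kSum K I ⬝ᵥ kSum K I else kSum K I ⬝ᵥ kSum K I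

/-! ### Pfaffians -/

/-- The Pfaffian of a skew matrix with rows `(i, false), (i, true)` for `i : ι`. Reordering the
pairs does not change it, so `ι` needs no order. -/
def pf {ι : Type*} [Fintype ι] [DecidableEq ι] (A : Matrix (ι × Bool) (ι × Bool) ℂ) : ℂ :=
  ((2 : ℂ) ^ Fintype.card ι * (Fintype.card ι).factorial)⁻¹ *
    ∑ π : Equiv.Perm (ι × Bool), ((Equiv.Perm.sign π : ℤ) : ℂ) *
      ∏ i, A (π (i, false)) (π (i, true))

/-- `e · P(σ_i)` with the pole at `σ_i` left out: `∑_{j ≠ i} e·k_j / (σ_i - σ_j)` for finite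
`σ_i`; for `σ_i = ∞`, in the local coordinate, `∑_{j ≠ i} (e·k_j) σ_j`. -/
def polP {Λ : Type*} [Fintype Λ] [DecidableEq Λ] {m : ℕ} (k : Λ → V m) (u : Config Λ) (i : Λ)
    (e : V m) : ℂ :=
  if (u i).2 = 0 then
    ∑ j ∈ Finset.univ.erase i, (e ⬝ᵥ k j) * (u j).1 / ((u i).1 * br (u i) (u j))
  else
    ∑ j ∈ Finset.univ.erase i, (e ⬝ᵥ k j) * (u j).2 / ((u i).2 * br (u i) (u j))

/-- The matrix `M = (A, -Cᵀ; C, B)` with propagator `S` (`S i j = 1 / σ_{ij}` at tree level):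
`A_ij = k_i·k_j S_ij`, `B_ij = ε_i·ε_j S_ij`, `C_ij = ε_i·k_j S_ij`, `C_ii = -ε_i·P(σ_i)`.
The row `(i, false)` belongs to `k_i` and the row `(i, true)` to `ε_i`; `S` is antisymmetric. -/
def chyMat {Λ : Type*} [Fintype Λ] [DecidableEq Λ] {m : ℕ} (k e : Λ → V m) (S : Λ → Λ → ℂ)
    (u : Config Λ) : Matrix (Λ × Bool) (Λ × Bool) ℂ :=
  Matrix.of fun a b =>
    if a.1 = b.1 then
      if a.2 = b.2 then 0
      else if b.2 then polP k u a.1 (e a.1) else -polP k u a.1 (e a.1)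
    else ((if a.2 then e a.1 else k a.1) ⬝ᵥ (if b.2 then e b.1 else k b.1)) * S a.1 b.1

/-- The rows left after the rows of `k_a` and `k_b` are removed; `ε_a`, `ε_b` form a pair. -/
def redRow {Λ : Type*} (a b : Λ) : Option {i : Λ // i ≠ a ∧ i ≠ b} × Bool → Λ × Bool
  | (none, false) => (a, true)
  | (none, true) => (b, true)
  | (some i, β) => (i.1, β)

/-- The reduced Pfaffian `Pf'(M) = Pf(M with the rows and columns of k_a, k_b removed) / σ_{ab}`
of the tree-level matrix. -/
def redPf {Λ : Type*} [Fintype Λ] [DecidableEq Λ] {m : ℕ} (k e : Λ → V m) (a b : Λ)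
    (u : Config Λ) : ℂ :=
  pf ((chyMat k e (fun i j => (br (u i) (u j))⁻¹) u).submatrix (redRow a b) (redRow a b)) /
    br (u a) (u b)

/-! ### Spheres with two marked legs `inl true` (`ℓ⁺`) and `inl false` (`ℓ⁻`) -/

/-- `σ_{ℓ⁺ ℓ⁻}` -/
def brPM {Y : Type*} (u : Config (Bool ⊕ Y)) : ℂ := br (u (Sum.inl true)) (u (Sum.inl false))

/-- The Szegő kernel `S₃` on the nodal sphere to first order in `t = √q`. -/
def szego {Y : Type*} (t : ℂ) (u : Config (Bool ⊕ Y)) (i j : Bool ⊕ Y) : ℂ :=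
  (br (u i) (u j))⁻¹ * (1 + t * ((br (u i) (u j) * brPM u) ^ 2 /
    (br (u i) (u (Sum.inl true)) * br (u i) (u (Sum.inl false)) *
      br (u j) (u (Sum.inl true)) * br (u j) (u (Sum.inl false)))))

/-- The matrix `M₃`, with rows for the unmarked legs only; `P(σ)` includes the marked legs. -/
def M3 {Y : Type*} [Fintype Y] [DecidableEq Y] {m : ℕ} (kk : Bool ⊕ Y → V m) (e : Y → V m)
    (t : ℂ) (u : Config (Bool ⊕ Y)) : Matrix (Y × Bool) (Y × Bool) ℂ :=
  (chyMat kk (marked 0 0 e) (szego t u) u).submatrix (fun a => (Sum.inr a.1, a.2))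
    (fun a => (Sum.inr a.1, a.2))

/-- `Pf(M₃)|_{q⁰} / σ_{ℓ⁺ℓ⁻}²`: scalars on the two marked legs. -/
def scalHalf {Y : Type*} [Fintype Y] [DecidableEq Y] {m : ℕ} (kk : Bool ⊕ Y → V m)
    (e : Y → V m) (u : Config (Bool ⊕ Y)) : ℂ :=
  pf (M3 kk e 0 u) / brPM u ^ 2

/-- `(Pf(M₃)|_{√q} + (d-2) Pf(M₃)|_{q⁰}) / σ_{ℓ⁺ℓ⁻}²`: the NS sector (a vector in the loop). -/
def nsHalf {Y : Type*} [Fintype Y] [DecidableEq Y] {m : ℕ} (d : ℕ) (kk : Bool ⊕ Y → V m)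
    (e : Y → V m) (u : Config (Bool ⊕ Y)) : ℂ :=
  (deriv (fun t => pf (M3 kk e t u)) 0 + ((d : ℂ) - 2) * pf (M3 kk e 0 u)) / brPM u ^ 2

/-- The one-loop Parke-Taylor factor over `σ_{ℓ⁺ℓ⁻}²`: the sum over the rotations `ρ` of the
colour ordering `w` of `σ_{ℓ⁺ℓ⁻} / (σ_{ℓ⁺ρ(1)} σ_{ρ(1)ρ(2)} ⋯ σ_{ρ(n)ℓ⁻})`. -/
def cptHalf {Y : Type*} (w : List Y) (u : Config (Bool ⊕ Y)) : ℂ :=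
  (∑ r ∈ Finset.range w.length, brPM u /
    (List.zipWith (fun i j => br (u i) (u j))
      (Sum.inl true :: (w.rotate r).map Sum.inr)
      ((w.rotate r).map Sum.inr ++ [Sum.inl false])).prod) / brPM u ^ 2

/-- The tree Parke-Taylor factor `-1 / (σ_{w₁w₂} ⋯ σ_{w_N w₁})`. The sign is such that
`cptHalf` is the sum of the `ptHalf` of the words `(ℓ⁺, ρ, ℓ⁻)`. -/
def ptHalf {Λ : Type*} (w : List Λ) (u : Config Λ) : ℂ :=
  -(List.zipWith (fun i j => br (u i) (u j)) w (w.rotate 1)).prod⁻¹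

/-- The `n`-gon integrand, with two marked legs. -/
def ngonInt {Y : Type*} [Fintype Y] (u : Config (Bool ⊕ Y)) : ℂ :=
  (brPM u ^ 4)⁻¹ * ∏ i : Y, (brPM u /
    (br (u (Sum.inr i)) (u (Sum.inl true)) * br (u (Sum.inr i)) (u (Sum.inl false)))) ^ 2

/-! ### The theories and their one-loop integrands -/

/-- `X` labels the external particles, `w`, `w'` are colour orderings, and `d - 2` is the number of
polarisation states of a vector in the loop. `gravity` is NS-NS gravity (with dilaton and
`B`-field), `pureGravity` subtracts these. (Pure Yang-Mills is `yangMills`.) -/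
inductive Theory (X : Type*) where
  | nGon : Theory X
  | biAdjoint (w w' : List X) : Theory X
  | yangMills (d : ℕ) (w : List X) : Theory X
  | gravity (d : ℕ) : Theory X
  | pureGravity (d : ℕ) : Theory X

/-- Each external particle occurs exactly once. -/
def IsOrdering {X : Type*} (w : List X) : Prop := w.Nodup ∧ ∀ x, x ∈ w

/-- The colour orderings are orderings of all the external particles. -/
def Theory.Valid {X : Type*} : Theory X → Prop
  | .biAdjoint w w' => IsOrdering w ∧ IsOrdering w'
  | .yangMills _ w => IsOrdering w
  | _ => True

/-- The theories with polarisation vectors. -/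
def Theory.Spinning {X : Type*} : Theory X → Prop
  | .nGon => False
  | .biAdjoint _ _ => False
  | _ => True

/-- `½ (d-2)(d-3) + 1`, the number of degrees of freedom of dilaton and `B`-field. -/
def alphaB (d : ℕ) : ℂ := ((d : ℂ) - 2) * ((d : ℂ) - 3) / 2 + 1

/-- `Î = I / σ_{ℓ⁺ℓ⁻}⁴` -/
def loopInt {Y : Type*} [Fintype Y] [DecidableEq Y] {m : ℕ} (T : Theory Y) (K : Kin Y m)
    (u : Config (Bool ⊕ Y)) : ℂ :=
  match T with
  | .nGon => ngonInt u
  | .biAdjoint w w' => cptHalf w u * cptHalf w' u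
  | .yangMills d w => nsHalf d (loopMom K) K.eps u * cptHalf w u
  | .gravity d => nsHalf d (loopMom K) K.eps u * nsHalf d (loopMom K) K.epst u
  | .pureGravity d => nsHalf d (loopMom K) K.eps u * nsHalf d (loopMom K) K.epst u -
      alphaB d * (scalHalf (loopMom K) K.eps u * scalHalf (loopMom K) K.epst u)

/-- The one-loop integrand (the integrand of `∫ d^d ℓ`), restricted to the solutions in `U`:
`M⁽¹⁾ = -(1/ℓ²) ∑ Î / J`. The full integrand is the one with `U = univ`. -/
def loopAmp {Y : Type*} [Fintype Y] [DecidableEq Y] {m : ℕ} (T : Theory Y)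
    (g : Gauge (Bool ⊕ Y)) (U : Set (Config (Bool ⊕ Y))) (K : Kin Y m) : ℂ :=
  (K.ell ⬝ᵥ K.ell)⁻¹ * chySum (loopMandel K) g U (loopInt T K)

/-- The tree amplitude with momenta `k` and integrand `f`. -/
def treeAmp {Λ : Type*} [Fintype Λ] [DecidableEq Λ] {m : ℕ} (k : Λ → V m) (g : Gauge Λ)
    (f : Config Λ → ℂ) : ℂ :=
  chySum (mandel k) g Set.univ f

/-! ### State sums and colour orderings in a factorisation channel -/

/-- `e` is an orthonormal basis of the physical polarisations of a massless particle of
momentum `p`. -/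
def PolBasis {m : ℕ} (p : V m) (e : Fin (m - 2) → V m) : Prop :=
  p ≠ 0 ∧ p ⬝ᵥ p = 0 ∧ (∀ r, e r ⬝ᵥ p = 0) ∧ ∀ r s, e r ⬝ᵥ e s = if r = s then 1 else 0

/-- The rotations of the cyclic word `w` that begin with a block consisting of all of `I`. For a
proper non-empty subset `I` there is one if `I` is consecutive in `w`, and otherwise none. -/
def cuts {X : Type*} [DecidableEq X] (I : Finset X) (w : List X) : Finset ℕ :=
  (Finset.range w.length).filter fun r => ∀ x ∈ (w.rotate r).take I.card, x ∈ I

/-- The letters of `w` that satisfy `p`, in the same order. -/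
def restr {X : Type*} (p : X → Prop) [DecidablePred p] (w : List X) : List {x // p x} :=
  w.filterMap fun x => if h : p x then some ⟨x, h⟩ else none

/-- The block of `I` in the `r`-th rotation of `w`. -/
def inBlock {X : Type*} [DecidableEq X] (I : Finset X) (w : List X) (r : ℕ) : List {x // x ∈ I} :=
  restr (fun x => x ∈ I) (w.rotate r)

/-- The block of the complement of `I` in the `r`-th rotation of `w`. -/
def outBlock {X : Type*} [DecidableEq X] (I : Finset X) (w : List X) (r : ℕ) :
    List {x // x ∉ I} :=
  restr (fun x => x ∉ I) (w.rotate r)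

/-! ### Case I: both loop punctures outside `I`; tree `×` one-loop

The node is `none` on the tree side and the external particle `inr none` on the loop side. -/

/-- Momenta on the tree side. -/
def momI {X : Type*} {m : ℕ} (K : Kin X m) (I : Finset X) : Option {x // x ∈ I} → V m :=
  fun o => o.elim (-kSum K I) (fun i => K.k i.1)

/-- Data on the loop side: the node has momentum `k_I` and polarisations `ε`, `ε'`. -/
def kinI {X : Type*} {m : ℕ} (K : Kin X m) (I : Finset X) (ε ε' : V m) :
    Kin (Option {x // x ∉ I}) m :=
  (fun o => o.elim (kSum K I) (fun i => K.k i.1), fun o => o.elim ε (fun i => K.eps i.1),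
    fun o => o.elim ε' (fun i => K.epst i.1), K.ell)

/-- The reduced Pfaffian on the tree side, external polarisations `ε`, node polarisation `ν`. -/
def halfI {X : Type*} [DecidableEq X] {m : ℕ} (K : Kin X m) (I : Finset X) (ε : X → V m)
    (a : {x // x ∈ I}) (ν : V m) (u : Config (Option {x // x ∈ I})) : ℂ :=
  redPf (momI K I) (fun o => o.elim ν (fun i => ε i.1)) (some a) none u

/-- `M_I⁽⁰⁾ · M_Ī⁽¹⁾`, summed over the states of the particle in the node. There is no `n`-gon
tree without loop legs. -/
def residueI {X : Type*} [Fintype X] [DecidableEq X] {m : ℕ} (T : Theory X) (I : Finset X)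
    (K : Kin X m) (e : Fin (m - 2) → V m) (a : {x // x ∈ I}) (gL : Gauge (Option {x // x ∈ I}))
    (gR : Gauge (Bool ⊕ Option {x // x ∉ I})) : ℂ :=
  match T with
  | .nGon => 0
  | .biAdjoint w w' => ∑ r ∈ cuts I w, ∑ r' ∈ cuts I w',
      treeAmp (momI K I) gL (fun u => ptHalf ((inBlock I w r).map some ++ [none]) u *
        ptHalf ((inBlock I w' r').map some ++ [none]) u) *
      loopAmp (.biAdjoint (none :: (outBlock I w r).map some)
        (none :: (outBlock I w' r').map some)) gR Set.univ (kinI K I 0 0)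
  | .yangMills d w => ∑ r ∈ cuts I w, ∑ s : Fin (m - 2),
      treeAmp (momI K I) gL (fun u => halfI K I K.eps a (e s) u *
        ptHalf ((inBlock I w r).map some ++ [none]) u) *
      loopAmp (.yangMills d (none :: (outBlock I w r).map some)) gR Set.univ (kinI K I (e s) 0)
  | .gravity d => ∑ s : Fin (m - 2), ∑ s' : Fin (m - 2),
      treeAmp (momI K I) gL (fun u => halfI K I K.eps a (e s) u * halfI K I K.epst a (e s') u) *
      loopAmp (.gravity d) gR Set.univ (kinI K I (e s) (e s'))
  | .pureGravity d => ∑ s : Fin (m - 2), ∑ s' : Fin (m - 2),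
      treeAmp (momI K I) gL (fun u => halfI K I K.eps a (e s) u * halfI K I K.epst a (e s') u) *
      loopAmp (.pureGravity d) gR Set.univ (kinI K I (e s) (e s'))

/-! ### Case II: `ℓ⁺` inside, `ℓ⁻` outside; Q-cut

On the side of `I` the marked legs are `ℓ_I` and the node, of momentum `-(ℓ_I + k_I)`; on the side
of the complement they are the node, of momentum `ℓ_I + k_I`, and `-ℓ_I`. -/

/-- Momenta on the side of `I`; `p = ℓ_I`. -/
def momL {X : Type*} {m : ℕ} (K : Kin X m) (I : Finset X) (p : V m) : Bool ⊕ {x // x ∈ I} → V m :=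
  marked p (-(p + kSum K I)) (fun i => K.k i.1)

/-- Momenta on the side of the complement of `I`; `p = ℓ_I`. -/
def momR {X : Type*} {m : ℕ} (K : Kin X m) (I : Finset X) (p : V m) : Bool ⊕ {x // x ∉ I} → V m :=
  marked (p + kSum K I) (-p) (fun i => K.k i.1)

/-- The states of the pair of cut legs: `some (r, s)` are vectors with the physical polarisations
`r` and `s`, and `none` is a scalar. -/
abbrev CutState (m : ℕ) := Option (Fin (m - 2) × Fin (m - 2))

/-- A vector with `d - 2` states, seen in the `m`-dimensional space of the cut momenta, consists of
an `m`-dimensional vector and `d - m` scalars. -/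
def cutWeight (d m : ℕ) : CutState m → ℂ
  | none => (d : ℂ) - m
  | some _ => 1

/-- The tree half-integrand with two scalars (`none`) or two vectors (`some (x, y)`) on the
marked legs. -/
def cutHalf {Y : Type*} [Fintype Y] [DecidableEq Y] {m : ℕ} (kk : Bool ⊕ Y → V m)
    (ε : Y → V m) (A : Option (V m × V m)) (u : Config (Bool ⊕ Y)) : ℂ :=
  match A with
  | none => scalHalf kk ε u
  | some (x, y) => redPf kk (marked x y ε) (Sum.inl true) (Sum.inl false) u

/-- Half-integrand on the side of `I`; `e`, `e'` are the polarisations of `ℓ_I`, `ℓ_I + k_I`. -/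
def halfL {X : Type*} [DecidableEq X] {m : ℕ} (K : Kin X m) (I : Finset X) (p : V m)
    (e e' : Fin (m - 2) → V m) (ε : X → V m) (A : CutState m)
    (u : Config (Bool ⊕ {x // x ∈ I})) : ℂ :=
  cutHalf (momL K I p) (fun i => ε i.1) (A.map fun c => (e c.1, e' c.2)) u

/-- Half-integrand on the side of the complement of `I`. -/
def halfR {X : Type*} [Fintype X] [DecidableEq X] {m : ℕ} (K : Kin X m) (I : Finset X) (p : V m)
    (e e' : Fin (m - 2) → V m) (ε : X → V m) (A : CutState m)
    (u : Config (Bool ⊕ {x // x ∉ I})) : ℂ :=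
  cutHalf (momR K I p) (fun i => ε i.1) (A.map fun c => (e' c.2, e c.1)) u

/-- The word `(inl true, w, inl false)`. -/
def cutWord {Y : Type*} (w : List Y) : List (Bool ⊕ Y) :=
  Sum.inl true :: (w.map Sum.inr ++ [Sum.inl false])

/-- `M_I⁽⁰⁾ M_Ī⁽⁰⁾` for given states of the cut legs in the left and right sector of gravity. -/
def gravCut {X : Type*} [Fintype X] [DecidableEq X] {m : ℕ} (I : Finset X) (K : Kin X m)
    (p : V m) (e e' : Fin (m - 2) → V m) (gL : Gauge (Bool ⊕ {x // x ∈ I}))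
    (gR : Gauge (Bool ⊕ {x // x ∉ I})) (A B : CutState m) : ℂ :=
  treeAmp (momL K I p) gL
      (fun u => halfL K I p e e' K.eps A u * halfL K I p e e' K.epst B u) *
    treeAmp (momR K I p) gR
      (fun u => halfR K I p e e' K.eps A u * halfR K I p e e' K.epst B u)

/-- `M_I⁽⁰⁾(…, ℓ_I, -(ℓ_I+k_I)) · (1/ℓ²) · M_Ī⁽⁰⁾(ℓ_I+k_I, -ℓ_I, …)` with `p = ℓ_I`, summed
over the states of the two cut legs; in pure gravity, `alphaB d` scalars are subtracted. -/
def residueII {X : Type*} [Fintype X] [DecidableEq X] {m : ℕ} (T : Theory X) (I : Finset X)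
    (K : Kin X m) (p : V m) (e e' : Fin (m - 2) → V m) (gL : Gauge (Bool ⊕ {x // x ∈ I}))
    (gR : Gauge (Bool ⊕ {x // x ∉ I})) : ℂ :=
  (K.ell ⬝ᵥ K.ell)⁻¹ * match T with
  | .nGon => treeAmp (momL K I p) gL ngonInt * treeAmp (momR K I p) gR ngonInt
  | .biAdjoint w w' => ∑ r ∈ cuts I w, ∑ r' ∈ cuts I w',
      treeAmp (momL K I p) gL (fun u => ptHalf (cutWord (inBlock I w r)) u *
        ptHalf (cutWord (inBlock I w' r')) u) *
      treeAmp (momR K I p) gR (fun u => ptHalf (cutWord (outBlock I w r)) u *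
        ptHalf (cutWord (outBlock I w' r')) u)
  | .yangMills d w => ∑ r ∈ cuts I w, ∑ A : CutState m, cutWeight d m A *
      (treeAmp (momL K I p) gL (fun u => halfL K I p e e' K.eps A u *
          ptHalf (cutWord (inBlock I w r)) u) *
        treeAmp (momR K I p) gR (fun u => halfR K I p e e' K.eps A u *
          ptHalf (cutWord (outBlock I w r)) u))
  | .gravity d => ∑ A : CutState m, ∑ B : CutState m, cutWeight d m A * cutWeight d m B *
      gravCut I K p e e' gL gR A B
  | .pureGravity d => (∑ A : CutState m, ∑ B : CutState m, cutWeight d m A * cutWeight d m B *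
      gravCut I K p e e' gL gR A B) - alphaB d * gravCut I K p e e' gL gR none none

/-! ### Degenerating solutions and the residue in a channel -/

/-- Configurations `σ_i = σ_I + ε x_i` (`i` in the channel, `σ_I = 0`, `x_μ = 1`) with
`0 < |ε| < ρ`, with the `x_i` bounded and separated, and with the points outside of the channel
separated from each other and from `σ_I`; `δ` makes `O(1)` quantitative. -/
def degen {Λ : Type*} (S : Set Λ) (μ : Λ) (δ ρ : ℝ) : Set (Config Λ) :=
  {u | ∃ (ε : ℂ) (x : Λ → ℂ), 0 < ‖ε‖ ∧ ‖ε‖ < ρ ∧ x μ = 1 ∧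
    (∀ i ∈ S, u i = (ε * x i, 1) ∧ ‖x i‖ ≤ δ⁻¹ ∧ ∀ j ∈ S, i ≠ j → δ ≤ ‖x i - x j‖) ∧
    ∀ p ∉ S, δ ≤ ‖(u p).1‖ ∧ ‖(u p).1‖ ≤ δ⁻¹ ∧ ∀ q ∉ S, p ≠ q → δ ≤ ‖br (u p) (u q)‖}

/-- Configurations that stay away from all degenerations, with Jacobian away from zero. -/
def bulk {Λ : Type*} [Fintype Λ] [DecidableEq Λ] (s : Λ → Λ → ℂ) (g : Gauge Λ) (δ : ℝ) :
    Set (Config Λ) :=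
  {u | (∀ i j, i ≠ j → δ ≤ ‖br (u i) (u j)‖) ∧ (∀ i, ‖(u i).1‖ ≤ δ⁻¹) ∧ δ ≤ ‖jac s g u‖}

/-- Kinematics approaching the point `K₀` of `s̃_I = 0`, off this hypersurface. -/
def approach {X : Type*} [Fintype X] {m : ℕ} (b : Bool) (I : Finset X) (K₀ : Kin X m) :
    Filter (Kin X m) :=
  𝓝[{K | Admissible K ∧ sTilde b I K ≠ 0}] K₀

/-- `M⁽¹⁾ ∼ R / s̃_I` at `K₀` in the channel: (i) for the part of `M⁽¹⁾` that comes from the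
degenerating solutions; (ii) for all of `M⁽¹⁾`, whenever the other solutions stay away from the
degenerations. -/
def HasResidue {X : Type*} [Fintype X] [DecidableEq X] {m : ℕ} (T : Theory X)
    (g : Gauge (Bool ⊕ X)) (b : Bool) (I : Finset X) (μ : Bool ⊕ X) (K₀ : Kin X m) (R : ℂ) :
    Prop :=
  (∃ δ₀ > 0, ∀ δ, 0 < δ → δ < δ₀ → ∃ ρ₀ > 0, ∀ ρ, 0 < ρ → ρ < ρ₀ →
    Tendsto (fun K => sTilde b I K * loopAmp T g (degen (chan b I) μ δ ρ) K)
      (approach b I K₀) (𝓝 R)) ∧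
  ∀ δ, 0 < δ →
    (∀ ρ, 0 < ρ → ∀ᶠ K in approach b I K₀, Sols (loopMandel K) g ⊆
      degen (chan b I) μ δ ρ ∪ bulk (loopMandel K) g δ) →
    Tendsto (fun K => sTilde b I K * loopAmp T g Set.univ K) (approach b I K₀) (𝓝 R)

/-- The coefficient `𝓕 = ∑ x_i s_{ij} / (σ_I - σ_j)` of `ε` in `s̃_I + ε 𝓕 + O(ε²) = 0`, the
equation that fixes `ε`; `i` runs over the channel and `j` over its complement. -/
def calF {A B : Type*} [Fintype A] [Fintype B] (s : A → B → ℂ) (x : A → ℂ × ℂ) (node : ℂ × ℂ)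
    (y : B → ℂ × ℂ) : ℂ :=
  ∑ i, ∑ j, (x i).1 * s i j * (y j).2 / br node (y j)

/-- A marked leg or an element of `Y`. -/
def leg (b : Bool) {Y : Type*} : Option Y → Bool ⊕ Y
  | none => Sum.inl b
  | some y => Sum.inr y

/-- Labels of a part as labels of the whole. -/
def toX {X : Type*} {p : X → Prop} : Bool ⊕ {x // p x} → Bool ⊕ X := Sum.map id Subtype.val

/-- Labels outside of `I` as labels of the loop side in case I. -/
def toR {Y : Type*} : Bool ⊕ Y → Bool ⊕ Option Y := Sum.map id some

end OneLoop

end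

open Filter Topology

noncomputable section

namespace OneLoop

set_option linter.unusedSectionVars false

open Asymptotics
open Equiv (Perm swap_apply_of_ne_of_ne)
open Finset (add_sum_erase card_univ mem_univ mul_sum ne_of_mem_erase prod_congr sum_add_distrib)
open Finset (sum_coe_sort sum_comm sum_congr sum_const sum_const_zero sum_div sum_eq_zero sum_erase)
open Finset (sum_filter sum_mul sum_mul_sum sum_neg_distrib sum_sub_distrib univ)
open Fintype (card card_coe card_subtype equivOfCardEq sum_bool sum_equiv sum_option sum_prod_type)
open Fintype (sum_sum_type)
open List (append_assoc cons_append countP_eq_zero isChain_cons_cons length_rotate nil_append)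
open Matrix (det_one det_submatrix_equiv_self fromBlocks mulVec of_apply submatrix_apply vecMul)
open Option (elim_none elim_some some_injective)
open Sum (elim_inl elim_inr inl inr inr_injective isLeft_inl)

/-- Matrices with a pair of rows for each element of `ι`. -/
abbrev RowMat (ι : Type*) := Matrix (ι × Bool) (ι × Bool) ℂ

/-- The complement of `I`. -/
abbrev Out {X : Type*} (I : Finset X) := {x // x ∉ I}

/-- The elements other than `a` and `b`. -/
abbrev Off {A : Type*} (a b : A) := {i : A // i ≠ a ∧ i ≠ b}

/-! ### Pfaffians -/

section Pfaffian

lemma prod_pairs {ι : Type*} [Fintype ι] (h : ι × Bool → ℂ) : ∏ x, h x = ∏ i, h (i, false) * h (i, true) := by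
  rw [Fintype.prod_prod_type]
  exact prod_congr rfl fun i _ => by rw [Fintype.prod_bool, mul_comm]

variable {ι ι' : Type*} [Fintype ι] [DecidableEq ι] [Fintype ι'] [DecidableEq ι']

/-- The map on rows that is induced by a map on pairs of rows. -/
abbrev rowMap {ι ι' : Type*} (f : ι → ι') (x : ι × Bool) : ι' × Bool := (f x.1, x.2)

/-- The unnormalised Pfaffian. -/
def pfSum (A : RowMat ι) : ℂ := ∑ π : Perm (ι × Bool), ((Equiv.Perm.sign π : ℤ) : ℂ) *
    ∏ i, A (π (i, false)) (π (i, true))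

lemma pf_eq_pfSum (A : RowMat ι) : pf A = ((2 : ℂ) ^ card ι * (card ι).factorial)⁻¹ * pfSum A := rfl

lemma pf_mul_mul_transpose (P A : RowMat ι) :
    pf (P * A * P.transpose) = P.det * pf A := by
  rw [pf_eq_pfSum, pf_eq_pfSum, mul_left_comm]
  congr 1
  let E : (ι × Bool → ι × Bool) ≃ (ι → (ι × Bool) × (ι × Bool)) :=
    (Equiv.curry ι Bool (ι × Bool)).trans
      (Equiv.piCongrRight fun _ => Equiv.boolArrowEquivProd (ι × Bool))
  have h1 : ∀ π : Perm (ι × Bool), ∏ i, (P * A * P.transpose) (π (i, false)) (π (i, true)) =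
        ∑ f : ι × Bool → ι × Bool, (∏ x, P (π x) (f x)) * ∏ i, A (f (i, false)) (f (i, true)) := by
    intro π
    have h2 : ∀ i, (P * A * P.transpose) (π (i, false)) (π (i, true)) =
        ∑ p : (ι × Bool) × (ι × Bool),
          P (π (i, false)) p.1 * P (π (i, true)) p.2 * A p.1 p.2 := by
      intro i
      rw [Matrix.mul_apply]
      refine Eq.trans ?_ (Fintype.sum_prod_type_right _).symm
      refine sum_congr rfl fun l _ => ?_
      rw [Matrix.mul_apply, sum_mul]
      refine sum_congr rfl fun k _ => ?_
      rw [Matrix.transpose_apply]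
      ring
    simp_rw [h2]
    rw [Finset.prod_univ_sum, Fintype.piFinset_univ]
    refine (sum_equiv E _ _ fun f => ?_).symm
    rw [prod_pairs, ← Finset.prod_mul_distrib]
    rfl
  have h3 : ∀ f : ι × Bool → ι × Bool,
      ∑ π : Perm (ι × Bool), ((Equiv.Perm.sign π : ℤ) : ℂ) * ∏ x, P (π x) (f x) =
        (P.submatrix id f).det := by
    intro f
    rw [Matrix.det_apply']
    rfl
  unfold pfSum
  simp_rw [h1, mul_sum]
  rw [sum_comm]
  simp_rw [← mul_assoc, ← sum_mul, h3]
  symm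
  refine Fintype.sum_of_injective (fun π : Perm (ι × Bool) => (π : ι × Bool → ι × Bool))
    Equiv.coe_fn_injective _ _ ?_ ?_
  · intro f hf
    have : ¬ Function.Injective f := fun hinj => hf
      ⟨Equiv.ofBijective f (Finite.injective_iff_bijective.1 hinj), rfl⟩
    simp only [Function.Injective, not_forall] at this
    obtain ⟨x, y, hxy, hne⟩ := this
    rw [Matrix.det_zero_of_column_eq hne, zero_mul]
    intro k
    simp [hxy]
  · intro π
    change _ = (P.submatrix id π).det * _
    rw [Matrix.det_permute']
    ring

lemma pf_diag_smul (d : ι × Bool → ℂ) (A : RowMat ι) :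
    pf (Matrix.of fun x y => d x * A x y * d y) = (∏ x, d x) * pf A := by
  rw [pf_eq_pfSum, pf_eq_pfSum, mul_left_comm]
  congr 1
  unfold pfSum
  rw [mul_sum]
  refine sum_congr rfl fun π _ => ?_
  rw [← Equiv.prod_comp π d, prod_pairs, mul_left_comm, ← Finset.prod_mul_distrib]
  congr 1
  refine prod_congr rfl fun i _ => ?_
  simp only [of_apply]
  ring

lemma pf_eq_zero_of_row_eq_zero (A : RowMat ι) (x : ι × Bool)
    (hr : ∀ y, A x y = 0) (hc : ∀ y, A y x = 0) : pf A = 0 := by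
  have h := pf_diag_smul (fun y => if y = x then 0 else 1) A
  rw [Finset.prod_eq_zero (mem_univ x) (by simp), zero_mul] at h
  rw [← h]
  congr 1
  ext y z
  by_cases hy : y = x
  · simp [hy, hr]
  · by_cases hz : z = x
    · simp [hz, hc]
    · simp [hy, hz]

lemma pf_add_row {A B C : RowMat ι} (x : ι × Bool)
    (hB : ∀ r s, r ≠ x → s ≠ x → B r s = A r s) (hC : ∀ r s, r ≠ x → s ≠ x → C r s = A r s)
    (hr : ∀ s, s ≠ x → A x s = B x s + C x s) (hc : ∀ s, s ≠ x → A s x = B s x + C s x) :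
    pf A = pf B + pf C := by
  simp only [pf_eq_pfSum]
  rw [← mul_add]
  congr 1
  unfold pfSum
  rw [← sum_add_distrib]
  refine sum_congr rfl fun π _ => ?_
  rw [← mul_add]
  congr 1
  obtain ⟨⟨i, β⟩, hi⟩ := π.surjective x
  have hne : ∀ j γ, (j, γ) ≠ (i, β) → π (j, γ) ≠ x := fun j γ h h' =>
    h (π.injective (h'.trans hi.symm))
  simp only [← Finset.mul_prod_erase univ _ (mem_univ i)]
  have hBe : ∏ j ∈ univ.erase i, B (π (j, false)) (π (j, true)) =
      ∏ j ∈ univ.erase i, A (π (j, false)) (π (j, true)) :=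
    prod_congr rfl fun j hj => hB _ _ (hne _ _ fun h => ne_of_mem_erase hj (congrArg Prod.fst h))
      (hne _ _ fun h => ne_of_mem_erase hj (congrArg Prod.fst h))
  have hCe : ∏ j ∈ univ.erase i, C (π (j, false)) (π (j, true)) =
      ∏ j ∈ univ.erase i, A (π (j, false)) (π (j, true)) :=
    prod_congr rfl fun j hj => hC _ _ (hne _ _ fun h => ne_of_mem_erase hj (congrArg Prod.fst h))
      (hne _ _ fun h => ne_of_mem_erase hj (congrArg Prod.fst h))
  rw [hBe, hCe, ← add_mul]
  congr 1
  cases β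
  · rw [hi]; exact hr _ (hne _ _ (by simp))
  · rw [hi]; exact hc _ (hne _ _ (by simp))

lemma pf_submatrix_perm (σ : Perm (ι × Bool)) (A : RowMat ι) :
    pf (A.submatrix σ σ) = ((Equiv.Perm.sign σ : ℤ) : ℂ) * pf A := by
  rw [pf_eq_pfSum, pf_eq_pfSum, mul_left_comm]
  congr 1
  unfold pfSum
  rw [mul_sum]
  refine sum_equiv (Equiv.mulLeft σ) _ _ fun π => ?_
  have h : ((Equiv.Perm.sign σ : ℤ) : ℂ) * ((Equiv.Perm.sign σ : ℤ) : ℂ) = 1 := by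
    rw [← Int.cast_mul, ← Units.val_mul, Int.units_mul_self]; simp
  simp only [Equiv.coe_mulLeft, Equiv.Perm.sign_mul, Units.val_mul, Int.cast_mul,
    Equiv.Perm.mul_apply, submatrix_apply]
  rw [← mul_assoc, ← mul_assoc, h, one_mul]

lemma pf_submatrix_equiv (e : ι ≃ ι') (A : RowMat ι') :
    pf (A.submatrix (rowMap e) (rowMap e)) = pf A := by
  rw [pf_eq_pfSum, pf_eq_pfSum, Fintype.card_congr e]
  congr 1
  unfold pfSum
  refine sum_equiv (Equiv.permCongr (Equiv.prodCongr e (Equiv.refl Bool))) _ _ fun π => ?_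
  rw [Equiv.Perm.sign_permCongr]
  congr 1
  refine Fintype.prod_equiv e _ _ fun i => ?_
  simp [Equiv.permCongr_apply, Prod.map]

lemma pf_unique [Unique ι] (A : RowMat ι)
    (h : A (default, true) (default, false) = -A (default, false) (default, true)) :
    pf A = A (default, false) (default, true) := by
  let e : ι × Bool ≃ Bool := Equiv.uniqueProd Bool ι
  have h1 : pfSum A = ∑ π : Perm Bool, ((Equiv.Perm.sign π : ℤ) : ℂ) *
      A (default, π false) (default, π true) := by
    unfold pfSum
    refine sum_equiv (Equiv.permCongr e) _ _ fun π => ?_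
    rw [Equiv.Perm.sign_permCongr, Fintype.prod_unique]
    congr 2 <;> · simp only [Equiv.permCongr_apply]; exact Prod.ext (Subsingleton.elim _ _) rfl
  have h2 : (univ : Finset (Perm Bool)) = {1, Equiv.swap false true} := by decide
  rw [pf_eq_pfSum, h1, h2, Finset.sum_insert (by decide), Finset.sum_singleton]
  rw [Equiv.Perm.sign_swap (by decide)]
  simp [h, Equiv.swap_apply_left, Equiv.swap_apply_right]
  ring

lemma sum_perm_isLeft {κ κ' : Type*} [Fintype κ] [DecidableEq κ] [Fintype κ'] [DecidableEq κ']
    (f : Perm (κ ⊕ κ') → ℂ) :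
    (∑ σ, if ∀ x, (σ x).isLeft = x.isLeft then f σ else 0) =
      ∑ a : Perm κ, ∑ b : Perm κ', f (Equiv.sumCongr a b) := by
  rw [← Fintype.sum_prod_type']
  symm
  refine Fintype.sum_of_injective (fun p : Perm κ × Perm κ' => Equiv.sumCongr p.1 p.2)
    Equiv.Perm.sumCongrHom_injective _ _ ?_ ?_
  · intro σ hσ
    refine if_neg fun h => hσ ?_
    have : σ ∈ (Equiv.Perm.sumCongrHom κ κ').range := by
      refine Equiv.Perm.mem_sumCongrHom_range_of_perm_mapsTo_inl ?_
      rintro _ ⟨a, rfl⟩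
      have := h (inl a)
      rw [isLeft_inl, Sum.isLeft_iff] at this
      obtain ⟨b, hb⟩ := this
      exact ⟨b, hb.symm⟩
    exact this
  · rintro ⟨a, b⟩
    rw [if_pos]
    rintro (x | x) <;> simp

lemma card_perm_preserving (A : (ι ⊕ ι') × Bool → Bool) (π : Perm ((ι ⊕ ι') × Bool))
    (hA : ∀ x, A x = (π x).1.isLeft) (hp : ∀ i, A (i, false) = A (i, true)) :
    (univ.filter fun τ : Perm (ι ⊕ ι') => ∀ x : (ι ⊕ ι') × Bool, A (τ x.1, x.2) = x.1.isLeft).card =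
    (univ.filter fun σ : Perm (ι ⊕ ι') => ∀ x, (σ x).isLeft = x.isLeft).card := by
  have hA' : ∀ i β, A (i, β) = A (i, false) := by
    rintro i (_ | _)
    · rfl
    · exact (hp i).symm
  have h1 : ∑ x : (ι ⊕ ι') × Bool, (if A x then 1 else 0) =
      ∑ x : (ι ⊕ ι') × Bool, (if x.1.isLeft then 1 else 0) := by
    simp_rw [hA]
    exact Equiv.sum_comp π fun x => if x.1.isLeft then 1 else 0
  simp only [sum_prod_type, sum_bool, hA' _ true, sum_add_distrib] at h1
  have h2 : card {i : ι ⊕ ι' // i.isLeft} = card {i : ι ⊕ ι' // A (i, false)} := by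
    rw [card_subtype, card_subtype, Finset.card_filter, Finset.card_filter]
    omega
  let τ₀ : Perm (ι ⊕ ι') := (equivOfCardEq h2).extendSubtype
  have h3 : ∀ i, A (τ₀ i, false) = i.isLeft := by
    intro i
    by_cases hi : i.isLeft = true
    · rw [hi]; exact Equiv.extendSubtype_mem (equivOfCardEq h2) i hi
    · have := Equiv.extendSubtype_not_mem (equivOfCardEq h2) i hi
      rw [Bool.not_eq_true] at hi this
      rw [hi]; exact this
  symm
  refine Finset.card_equiv (Equiv.mulLeft τ₀) fun σ => ?_
  simp only [Finset.mem_filter, mem_univ, true_and, Equiv.coe_mulLeft,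
    Equiv.Perm.mul_apply, hA' _ _, h3, Prod.forall]
  exact ⟨fun h a _ => h a, fun h a => h a false⟩

lemma pf_sum_blocks (A : Matrix ((ι ⊕ ι') × Bool) ((ι ⊕ ι') × Bool) ℂ)
    (h₁ : ∀ i β j γ, A (inl i, β) (inr j, γ) = 0) (h₂ : ∀ i β j γ, A (inr j, γ) (inl i, β) = 0) :
    pf A = pf (A.submatrix (rowMap inl) (rowMap inl)) *
      pf (A.submatrix (rowMap inr) (rowMap inr)) := by
  set A₁ := A.submatrix (rowMap (inl : ι → ι ⊕ ι')) (rowMap inl)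
  set A₂ := A.submatrix (rowMap (inr : ι' → ι ⊕ ι')) (rowMap inr)
  let term : Perm ((ι ⊕ ι') × Bool) → ℂ := fun π => ((Equiv.Perm.sign π : ℤ) : ℂ) *
    ∏ i, A (π (i, false)) (π (i, true))
  let tau : Perm (ι ⊕ ι') → Perm ((ι ⊕ ι') × Bool) := fun τ =>
    Equiv.prodCongrLeft fun _ => τ
  have hterm : ∀ π τ, term (π * tau τ) = term π := by
    intro π τ
    have hs : Equiv.Perm.sign (tau τ) = 1 := by
      simp only [tau]
      rw [Equiv.Perm.sign_prodCongrLeft, Fintype.prod_bool, Int.units_mul_self]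
    simp only [term, Equiv.Perm.sign_mul, hs, mul_one]
    congr 1
    exact Equiv.prod_comp τ fun i => A (π (i, false)) (π (i, true))
  let N : ℂ := (univ.filter fun σ : Perm (ι ⊕ ι') =>
    ∀ x, (σ x).isLeft = x.isLeft).card
  have hN : N = (card ι).factorial * (card ι').factorial := by
    have := sum_perm_isLeft (κ := ι) (κ' := ι') fun _ => (1 : ℂ)
    rw [← sum_filter, sum_const, nsmul_eq_mul, mul_one] at this
    simp only [N, this]
    simp [Fintype.card_perm]
  have hcount : ∀ π, N * term π =
      ∑ τ, if ∀ x, ((π * tau τ) x).1.isLeft = x.1.isLeft then term (π * tau τ) else 0 := by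
    intro π
    simp_rw [hterm]
    by_cases hz : term π = 0
    · simp [hz]
    rw [← sum_filter, sum_const, nsmul_eq_mul]
    congr 1
    refine congrArg Nat.cast (card_perm_preserving (fun x => (π x).1.isLeft) π (fun _ => rfl) fun i => ?_).symm
    by_contra hne
    refine hz ?_
    simp only [term]
    rw [Finset.prod_eq_zero (mem_univ i), mul_zero]
    rcases hx : π (i, false) with ⟨a | a, β⟩ <;> rcases hy : π (i, true) with ⟨b | b, γ⟩
    · simp [hx, hy] at hne
    · exact h₁ _ _ _ _
    · exact h₂ _ _ _ _
    · simp [hx, hy] at hne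
  have hS : (∑ π, if ∀ x, (π x).1.isLeft = x.1.isLeft then term π else 0) =
      pfSum A₁ * pfSum A₂ := by
    let e := Equiv.sumProdDistrib ι ι' Bool
    have he : ∀ x, (e x).isLeft = x.1.isLeft := by rintro ⟨a | a, β⟩ <;> rfl
    have h := sum_perm_isLeft (κ := ι × Bool) (κ' := ι' × Bool) fun σ => term (e.permCongr.symm σ)
    have h' : (∑ π, if ∀ x, (π x).1.isLeft = x.1.isLeft then term π else 0) =
        ∑ σ, if ∀ x, (σ x).isLeft = x.isLeft then term (e.permCongr.symm σ) else 0 := by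
      refine sum_equiv e.permCongr _ _ fun π => ?_
      rw [Equiv.symm_apply_apply]
      congr 1
      rw [eq_iff_iff]
      simp only [Equiv.permCongr_apply, he]
      exact ⟨fun H x => by rw [H, ← he, Equiv.apply_symm_apply],
        fun H x => by simpa [he] using H (e x)⟩
    rw [h', h]
    unfold pfSum
    rw [sum_mul_sum]
    refine sum_congr rfl fun a _ => sum_congr rfl fun b _ => ?_
    simp only [term]
    rw [Equiv.permCongr_symm, Equiv.Perm.sign_permCongr, Equiv.Perm.sign_sumCongr,
      Fintype.prod_sum_type]
    simp only [Units.val_mul, Int.cast_mul]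
    rw [mul_mul_mul_comm]
    simp only [Equiv.permCongr_apply, Equiv.symm_symm]
    rfl
  have hmain : N * pfSum A = (card (ι ⊕ ι')).factorial * (pfSum A₁ * pfSum A₂) := by
    have : pfSum A = ∑ π, term π := rfl
    rw [this, mul_sum]
    simp_rw [hcount]
    rw [sum_comm]
    have : ∀ τ, (∑ π, if ∀ x, ((π * tau τ) x).1.isLeft = x.1.isLeft then term (π * tau τ) else 0) =
        pfSum A₁ * pfSum A₂ := fun τ => by
      rw [← hS]
      exact Equiv.sum_comp (Equiv.mulRight (tau τ))
        fun π => if ∀ x, (π x).1.isLeft = x.1.isLeft then term π else 0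
    simp_rw [this]
    rw [sum_const, nsmul_eq_mul, card_univ, Fintype.card_perm]
  rw [hN] at hmain
  rw [pf_eq_pfSum, pf_eq_pfSum, pf_eq_pfSum]
  have f1 : ((card ι).factorial : ℂ) ≠ 0 := by exact_mod_cast Nat.factorial_ne_zero _
  have f2 : ((card ι').factorial : ℂ) ≠ 0 := by exact_mod_cast Nat.factorial_ne_zero _
  have f3 : ((card (ι ⊕ ι')).factorial : ℂ) ≠ 0 := by
    exact_mod_cast Nat.factorial_ne_zero _
  have f4 : (2 : ℂ) ^ card (ι ⊕ ι') = 2 ^ card ι * 2 ^ card ι' := by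
    rw [Fintype.card_sum, pow_add]
  rw [f4]
  field_simp
  linear_combination hmain

/-- The directional derivative of the Pfaffian. -/
def pfD (A B : RowMat ι) : ℂ := ((2 : ℂ) ^ card ι * (card ι).factorial)⁻¹ *
    ∑ π : Perm (ι × Bool), ((Equiv.Perm.sign π : ℤ) : ℂ) *
      ∑ i, (∏ j ∈ univ.erase i, A (π (j, false)) (π (j, true))) * B (π (i, false)) (π (i, true))

lemma hasDerivAt_pf (A B : RowMat ι) :
    HasDerivAt (fun t : ℂ => pf (A + t • B)) (pfD A B) 0 := by
  unfold pf pfD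
  refine HasDerivAt.const_mul _ (HasDerivAt.fun_sum fun π _ => HasDerivAt.const_mul _ ?_)
  have h : ∀ i ∈ (univ : Finset ι),
      HasDerivAt (fun t : ℂ => (A + t • B) (π (i, false)) (π (i, true)))
        (B (π (i, false)) (π (i, true))) 0 := by
    intro i _
    simpa [Matrix.add_apply, Matrix.smul_apply] using
      ((hasDerivAt_id (0 : ℂ)).mul_const (B (π (i, false)) (π (i, true)))).const_add
        (A (π (i, false)) (π (i, true)))
  simpa using HasDerivAt.fun_finsetProd h

lemma pfD_add (A B C : RowMat ι) :
    pfD A (B + C) = pfD A B + pfD A C := by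
  simp only [pfD, Matrix.add_apply, mul_add, sum_add_distrib]

lemma pfD_smul (c : ℂ) (A B : RowMat ι) :
    pfD A (c • B) = c * pfD A B := by
  simp only [pfD, Matrix.smul_apply, smul_eq_mul, mul_sum]
  refine sum_congr rfl fun π _ => sum_congr rfl fun i _ => ?_
  ring

lemma pfD_sum {κ : Type*} (s : Finset κ) (A : RowMat ι)
    (B : κ → RowMat ι) : pfD A (∑ k ∈ s, B k) = ∑ k ∈ s, pfD A (B k) :=
  map_sum (⟨⟨pfD A, pfD_add A⟩, fun c B => pfD_smul c A B⟩ : RowMat ι →ₗ[ℂ] ℂ) B s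

lemma continuous_pf : Continuous fun A : (ι × Bool) → (ι × Bool) → ℂ => pf (Matrix.of A) := by
  unfold pf
  simp only [of_apply]
  fun_prop

lemma tendsto_pf {κ : Type*} {l : Filter κ} {A : κ → RowMat ι}
    {A₀ : RowMat ι} (hA : ∀ x y, Tendsto (fun k => A k x y) l (𝓝 (A₀ x y))) :
    Tendsto (fun k => pf (A k)) l (𝓝 (pf A₀)) :=
  (continuous_pf.tendsto _).comp (tendsto_pi_nhds.2 fun x => tendsto_pi_nhds.2 fun y => hA x y)

/-- First order expansion of a continuously differentiable function at points tending to a zero. -/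
lemma tendsto_div_of_contDiff {E κ : Type*} [NormedAddCommGroup E] [NormedSpace ℂ E]
    {l : Filter κ} {F : ℂ × E → ℂ} (hF : ContDiff ℂ 1 F) {e : κ → E} {e₀ : E} {η : κ → ℂ} {D : ℂ}
    (hD : HasDerivAt (fun t => F (t, e₀)) D 0) (he : Tendsto e l (𝓝 e₀)) (hη : Tendsto η l (𝓝 0))
    (hη0 : ∀ᶠ k in l, η k ≠ 0) (h0 : ∀ᶠ k in l, F (0, e k) = 0) :
    Tendsto (fun k => F (η k, e k) / η k) l (𝓝 D) := by
  have hs := (hF.contDiffAt (x := (0, e₀))).hasStrictFDerivAt one_ne_zero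
  have hD' : fderiv ℂ F (0, e₀) (1, 0) = D := by
    have h1 : HasDerivAt (fun t : ℂ => ((t, e₀) : ℂ × E)) (1, 0) 0 :=
      (hasDerivAt_id 0).prodMk (hasDerivAt_const _ _)
    have h2 : HasDerivAt (fun t : ℂ => F (t, e₀)) (fderiv ℂ F (0, e₀) (1, 0)) 0 :=
      HasFDerivAt.comp_hasDerivAt (0 : ℂ) hs.hasFDerivAt h1
    exact h2.unique hD
  have ht : Tendsto (fun k => ((η k, e k), ((0 : ℂ), e k))) l (𝓝 ((0, e₀), (0, e₀))) :=
    (hη.prodMk_nhds he).prodMk_nhds (tendsto_const_nhds.prodMk_nhds he)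
  have hsub : ∀ k, ((η k, e k) : ℂ × E) - (0, e k) = η k • ((1, 0) : ℂ × E) := fun k => by
    ext <;> simp
  have h2 := IsLittleO.tendsto_div_nhds_zero
    (f := fun k => F (η k, e k) - F (0, e k) - η k * D) (g := η) (l := l) (by
      refine ((hs.isLittleO.comp_tendsto ht).congr_left fun k => ?_).trans_isBigO
        (IsBigO.of_bound ‖((1, 0) : ℂ × E)‖ (Eventually.of_forall fun k => ?_))
      · simp only [Function.comp, hsub, map_smul, hD', smul_eq_mul]
      · simp only [Function.comp, hsub, norm_smul]
        rw [mul_comm])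
  have h3 := h2.add_const D
  rw [zero_add] at h3
  refine h3.congr' ?_
  filter_upwards [hη0, h0] with k hk hk0
  rw [hk0]
  field_simp
  ring

lemma tendsto_pf_div {κ : Type*} {l : Filter κ} {A C : κ → RowMat ι} {A₀ C₀ : RowMat ι} {η : κ → ℂ}
    (hA : ∀ x y, Tendsto (fun k => A k x y) l (𝓝 (A₀ x y)))
    (hC : ∀ x y, Tendsto (fun k => C k x y) l (𝓝 (C₀ x y)))
    (hη : Tendsto η l (𝓝 0)) (hη0 : ∀ᶠ k in l, η k ≠ 0) (h0 : ∀ᶠ k in l, pf (A k) = 0) :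
    Tendsto (fun k => pf (A k + η k • C k) / η k) l (𝓝 (pfD A₀ C₀)) := by
  let N := ι × Bool
  let F : ℂ × (N → N → ℂ) × (N → N → ℂ) → ℂ := fun e =>
    pf (Matrix.of fun x y => e.2.1 x y + e.1 * e.2.2 x y)
  have hF : ContDiff ℂ 1 F := by
    simp only [F, pf, of_apply]
    fun_prop
  exact tendsto_div_of_contDiff (F := F) hF (e := fun k => (A k, C k)) (e₀ := (A₀, C₀))
    (hasDerivAt_pf A₀ C₀)
    ((tendsto_pi_nhds.2 fun x => tendsto_pi_nhds.2 fun y => hA x y).prodMk_nhds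
      (tendsto_pi_nhds.2 fun x => tendsto_pi_nhds.2 fun y => hC x y)) hη hη0
    (h0.mono fun k hk => by
      refine Eq.trans (congrArg pf ?_) hk
      ext x y
      simp)

/-- The matrix `V Wᵀ - W Vᵀ`. -/
def wedge {κ : Type*} (V W : κ → ℂ) : Matrix κ κ ℂ := Matrix.of fun x y => V x * W y - W x * V y

/-- A skew matrix with one more pair of rows: `V`, `W` are the new columns, and `s` is the entry
in the new rows. -/
def bordered (A : RowMat ι) (V W : ι × Bool → ℂ) (s : ℂ) :
    Matrix (Option ι × Bool) (Option ι × Bool) ℂ :=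
  Matrix.of fun
    | (some i, β), (some j, γ) => A (i, β) (j, γ)
    | (some i, β), (none, false) => V (i, β)
    | (some i, β), (none, true) => W (i, β)
    | (none, false), (some j, γ) => -V (j, γ)
    | (none, true), (some j, γ) => -W (j, γ)
    | (none, false), (none, true) => s
    | (none, true), (none, false) => -s
    | (none, false), (none, false) => 0
    | (none, true), (none, true) => 0

lemma pf_bordered_zero (A : RowMat ι) (s : ℂ) :
    pf (bordered A 0 0 s) = s * pf A := by
  rw [← pf_submatrix_equiv (Equiv.optionEquivSumPUnit.{0} ι).symm, pf_sum_blocks, mul_comm, pf_unique]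
  · rfl
  · rfl
  · rintro i β j (_ | _) <;> rfl
  · rintro i β j (_ | _) <;> exact neg_zero

lemma pf_bordered_smul (A : RowMat ι) (V W : ι × Bool → ℂ) (s t : ℂ) :
    pf (bordered A V (t • W) (t * s)) = t * pf (bordered A V W s) := by
  have h := pf_diag_smul (fun x => if x = (none, true) then t else 1) (bordered A V W s)
  rw [Finset.prod_ite_eq' univ (none, true) (fun _ => t), if_pos (mem_univ _)] at h
  rw [← h]
  congr 1
  ext ⟨x | x, _ | _⟩ ⟨y | y, _ | _⟩ <;> simp [bordered, mul_comm]

lemma pf_bordered_add (A : RowMat ι) (V W W' : ι × Bool → ℂ) (s s' : ℂ) :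
    pf (bordered A V (W + W') (s + s')) = pf (bordered A V W s) + pf (bordered A V W' s') := by
  refine pf_add_row (none, true) ?_ ?_ ?_ ?_
  · rintro ⟨x | x, _ | _⟩ ⟨y | y, _ | _⟩ hx hy <;> simp_all [bordered]
  · rintro ⟨x | x, _ | _⟩ ⟨y | y, _ | _⟩ hx hy <;> simp_all [bordered]
  · rintro ⟨y | y, _ | _⟩ hy <;> simp [bordered, add_comm]
  · rintro ⟨y | y, _ | _⟩ hy <;> simp [bordered]

/-- Rows of a bordered matrix. -/
def borderedRows (ι : Type*) : Option ι × Bool ≃ (ι × Bool) ⊕ Bool where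
  toFun := fun
    | (some i, β) => inl (i, β)
    | (none, β) => inr β
  invFun := fun
    | inl x => (some x.1, x.2)
    | inr β => (none, β)
  left_inv := by rintro ⟨_ | _, _⟩ <;> rfl
  right_inv := by rintro (⟨_, _⟩ | _) <;> rfl

lemma pf_bordered_one (A : RowMat ι) (V W : ι × Bool → ℂ) :
    pf (bordered A V W 1) = pf (A - wedge V W) := by
  let e := borderedRows ι
  let Q : Matrix (ι × Bool) Bool ℂ := Matrix.of fun r β => bif β then V r else -W r
  let X : Matrix (ι × Bool) Bool ℂ := Matrix.of fun r β => bif β then W r else V r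
  let J : Matrix Bool Bool ℂ := Matrix.of fun β γ => if β = γ then 0 else bif γ then 1 else -1
  have hE : bordered A V W 1 = (fromBlocks A X (-X.transpose) J).submatrix e e := by
    ext ⟨x | x, _ | _⟩ ⟨y | y, _ | _⟩ <;> simp [bordered, e, borderedRows, X, J]
  have hP : fromBlocks 1 Q 0 1 * fromBlocks A X (-X.transpose) J *
      (fromBlocks 1 Q 0 1).transpose = fromBlocks (A - wedge V W) 0 0 J := by
    rw [Matrix.fromBlocks_transpose, Matrix.fromBlocks_multiply, Matrix.fromBlocks_multiply]
    simp only [Matrix.one_mul, Matrix.zero_mul, Matrix.mul_one, Matrix.mul_zero, zero_add,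
      Matrix.transpose_one, Matrix.transpose_zero]
    have h1 : X + Q * J = 0 := by
      ext r β
      cases β <;> simp [X, Q, J, Matrix.mul_apply]
    have h2 : -X.transpose + J * Q.transpose = 0 := by
      ext β r
      cases β <;> simp [X, Q, J, Matrix.mul_apply]
    have h3 : A + Q * -X.transpose = A - wedge V W := by
      ext r r'
      simp [X, Q, wedge, Matrix.mul_apply]
      ring
    rw [h1, h2, h3, Matrix.zero_mul, add_zero]
  have h := pf_mul_mul_transpose ((fromBlocks 1 Q 0 1).submatrix e e) (bordered A V W 1)
  rw [det_submatrix_equiv_self, Matrix.det_fromBlocks_zero₂₁, det_one,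
    det_one, one_mul, one_mul, hE, Matrix.transpose_submatrix,
    Matrix.submatrix_mul_equiv, Matrix.submatrix_mul_equiv, hP, ← hE] at h
  rw [← h]
  have h4 : (fromBlocks (A - wedge V W) 0 0 J).submatrix e e =
      bordered (A - wedge V W) 0 0 1 := by
    ext ⟨x | x, _ | _⟩ ⟨y | y, _ | _⟩ <;> simp [bordered, e, borderedRows, J]
  rw [h4, pf_bordered_zero, one_mul]

lemma pf_sub_smul_wedge (A : RowMat ι) (V W : ι × Bool → ℂ) (t : ℂ) :
    pf (A - t • wedge V W) = pf A + t * pf (bordered A V W 0) := by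
  have h1 : t • wedge V W = wedge V (t • W) := by
    ext x y
    simp [wedge]
    ring
  have h2 := pf_bordered_add A V (t • W) 0 (t * 0) 1
  have h3 : pf (bordered A V 0 1) = pf A := by
    rw [pf_bordered_one]
    congr 1
    ext x y
    simp [wedge]
  rw [h1, ← pf_bordered_one]
  rw [add_zero, mul_zero, zero_add, h3] at h2
  rw [h2, add_comm, ← pf_bordered_smul, mul_zero]

lemma pf_bordered_eq_neg_pfD (A : RowMat ι) (V W : ι × Bool → ℂ) :
    pf (bordered A V W 0) = -pfD A (wedge V W) := by
  have h := hasDerivAt_pf A (wedge V W)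
  have h' : (fun t : ℂ => pf (A + t • wedge V W)) =
      fun t => pf A - t * pf (bordered A V W 0) := by
    ext t
    have := pf_sub_smul_wedge A V W (-t)
    rw [neg_smul, sub_neg_eq_add] at this
    rw [this]
    ring
  rw [h'] at h
  have h'' := ((hasDerivAt_id (0 : ℂ)).mul_const (pf (bordered A V W 0))).const_sub (pf A)
  have := h.unique h''
  rw [this]
  ring

lemma pf_bordered (A : RowMat ι) (V W : ι × Bool → ℂ) (s : ℂ) :
    pf (bordered A V W s) = s * pf A - pfD A (wedge V W) := by
  have h := pf_bordered_add A V W 0 0 s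
  have h1 := pf_bordered_smul A V 0 1 s
  have h3 : pf (bordered A V 0 1) = pf A := by
    rw [pf_bordered_one]
    congr 1
    ext x y
    simp [wedge]
  rw [smul_zero, mul_one, h3] at h1
  rw [add_zero, zero_add, h1, pf_bordered_eq_neg_pfD] at h
  rw [h]
  ring

/-- Skew-symmetry. -/
def IsSkew {κ : Type*} (A : Matrix κ κ ℂ) : Prop := ∀ x y, A y x = -A x y

lemma pfD_wedge_mulVec {A : RowMat ι} (hA : IsSkew A)
    (c V : ι × Bool → ℂ) : pfD A (wedge (A.mulVec c) V) = (c ⬝ᵥ V) * pf A := by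
  have h := hasDerivAt_pf A (wedge (A.mulVec c) V)
  have hcA : vecMul c A = -A.mulVec c := by
    ext y
    simp only [vecMul, mulVec, dotProduct, Pi.neg_apply, ← sum_neg_distrib]
    exact sum_congr rfl fun x _ => by rw [hA y x]; ring
  have hq : c ⬝ᵥ A.mulVec c = 0 := by
    have : c ⬝ᵥ A.mulVec c = -(c ⬝ᵥ A.mulVec c) := by
      conv_lhs => rw [Matrix.dotProduct_mulVec, hcA, neg_dotProduct, dotProduct_comm]
    exact self_eq_neg.1 this
  have h' : (fun t : ℂ => pf (A + t • wedge (A.mulVec c) V)) =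
      fun t => (1 + t * (c ⬝ᵥ V)) * pf A := by
    ext t
    have hdet : (1 + Matrix.vecMulVec (t • V) c).det = 1 + t * (c ⬝ᵥ V) := by
      rw [Matrix.vecMulVec_eq Unit, Matrix.det_one_add_replicateCol_mul_replicateRow]
      simp
    rw [← hdet, ← pf_mul_mul_transpose]
    congr 1
    rw [Matrix.transpose_add, Matrix.transpose_one, Matrix.transpose_vecMulVec, Matrix.add_mul,
      Matrix.one_mul, Matrix.mul_add, Matrix.mul_one, Matrix.vecMulVec_mul, hcA, Matrix.add_mul,
      Matrix.mul_vecMulVec, Matrix.vecMulVec_mul_vecMulVec]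
    ext x y
    simp only [dotProduct_comm c] at hq ⊢
    simp [wedge, Matrix.vecMulVec_apply, hq]
    ring
  rw [h'] at h
  have h'' := (((hasDerivAt_id (0 : ℂ)).mul_const (c ⬝ᵥ V)).const_add 1).mul_const (pf A)
  rw [h.unique h'']
  ring

lemma pf_eq_zero_of_mulVec_eq_zero {A : RowMat ι} (hA : IsSkew A)
    (c : ι × Bool → ℂ) (x : ι × Bool) (hx : c x ≠ 0) (h : A.mulVec c = 0) : pf A = 0 := by
  have hcA : vecMul c A = 0 := by
    have : vecMul c A = -A.mulVec c := by
      ext y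
      simp only [vecMul, mulVec, dotProduct, Pi.neg_apply, ← sum_neg_distrib]
      exact sum_congr rfl fun x _ => by rw [hA y x]; ring
    rw [this, h, neg_zero]
  let P : RowMat ι := (1 : Matrix _ _ ℂ).updateRow x c
  have hdet : P.det = c x := by
    have := Matrix.det_updateRow_sum (1 : RowMat ι) x c
    rw [det_one, smul_eq_mul, mul_one] at this
    have hc : (∑ k, c k • (1 : RowMat ι) k) = c := by
      funext y
      rw [Finset.sum_apply]
      simp [Matrix.one_apply]
    rw [hc] at this
    exact this
  have h1 := pf_mul_mul_transpose P A
  have hPA : ∀ y, (P * A) x y = 0 := fun y => by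
    have : (P * A) x y = vecMul c A y := by
      simp [P, Matrix.mul_apply, vecMul, dotProduct]
    rw [this, hcA]; rfl
  have hAP : ∀ y, (A * P.transpose) y x = 0 := fun y => by
    have : (A * P.transpose) y x = A.mulVec c y := by
      simp [P, Matrix.mul_apply, mulVec, dotProduct]
    rw [this, h]; rfl
  rw [pf_eq_zero_of_row_eq_zero _ x, hdet] at h1
  · exact (mul_eq_zero.1 h1.symm).resolve_left hx
  · intro y
    rw [Matrix.mul_apply]
    exact sum_eq_zero fun z _ => by rw [hPA, zero_mul]
  · intro y
    rw [Matrix.mul_assoc, Matrix.mul_apply]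
    exact sum_eq_zero fun z _ => by rw [hAP, mul_zero]

end Pfaffian

section PfaffianGlue

lemma exists_sqrt_tendsto_zero {κ : Type*} {l : Filter κ} {ε : κ → ℂ} (hε : Tendsto ε l (𝓝 0)) :
    ∃ η : κ → ℂ, (∀ k, η k * η k = ε k) ∧ Tendsto η l (𝓝 0) := by
  refine ⟨fun k => ε k ^ ((2 : ℕ) : ℂ)⁻¹, fun k => ?_, ?_⟩
  · rw [← sq, Complex.cpow_nat_inv_pow _ two_ne_zero]
  · rw [tendsto_zero_iff_norm_tendsto_zero] at hε ⊢
    have h : (fun k => ‖ε k ^ ((2 : ℕ) : ℂ)⁻¹‖) = fun k => Real.sqrt ‖ε k‖ := by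
      ext k
      rw [eq_comm, Real.sqrt_eq_iff_mul_self_eq (norm_nonneg _) (norm_nonneg _), ← norm_mul, ← sq,
        Complex.cpow_nat_inv_pow _ two_ne_zero]
    rw [h]
    have := (Real.continuous_sqrt.tendsto 0).comp hε
    rwa [Real.sqrt_zero] at this

variable {α β γ κ : Type*} [Fintype α] [DecidableEq α] [Fintype β] [DecidableEq β] [Fintype γ]
  {l : Filter κ} {ε : κ → ℂ}

/-- Two diagonal blocks, of which the first one is of the order `ε⁻¹`. -/
lemma tendsto_pf_glue_even {N : κ → Matrix ((α ⊕ β) × Bool) ((α ⊕ β) × Bool) ℂ} {L : RowMat α}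
    {R : RowMat β} {X Y : (α × Bool) → (β × Bool) → ℂ}
    (hLL : ∀ x y, Tendsto (fun k => ε k * N k (rowMap inl x) (rowMap inl y)) l (𝓝 (L x y)))
    (hRR : ∀ x y, Tendsto (fun k => N k (rowMap inr x) (rowMap inr y)) l (𝓝 (R x y)))
    (hLR : ∀ x y, Tendsto (fun k => N k (rowMap inl x) (rowMap inr y)) l (𝓝 (X x y)))
    (hRL : ∀ x y, Tendsto (fun k => N k (rowMap inr y) (rowMap inl x)) l (𝓝 (Y x y)))
    (hε : Tendsto ε l (𝓝 0)) :
    Tendsto (fun k => ε k ^ card α * pf (N k)) l (𝓝 (pf L * pf R)) := by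
  obtain ⟨η, hηε, hη⟩ := exists_sqrt_tendsto_zero hε
  let d : κ → (α ⊕ β) × Bool → ℂ := fun k x => if x.1.isLeft then η k else 1
  have hprod : ∀ k, ∏ x, d k x = ε k ^ card α := by
    intro k
    simp [d, Fintype.prod_prod_type, hηε]
  have hpf : ∀ k, ε k ^ card α * pf (N k) =
      pf (Matrix.of fun x y => d k x * N k x y * d k y) := fun k => by
    rw [pf_diag_smul, hprod]
  simp_rw [hpf]
  let A₀ : Matrix ((α ⊕ β) × Bool) ((α ⊕ β) × Bool) ℂ := Matrix.of fun
    | (inl i, b), (inl j, c) => L (i, b) (j, c)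
    | (inr i, b), (inr j, c) => R (i, b) (j, c)
    | _, _ => 0
  have h0 : pf L * pf R = pf A₀ := by
    rw [pf_sum_blocks A₀ (fun _ _ _ _ => rfl) (fun _ _ _ _ => rfl)]
    rfl
  rw [h0]
  refine tendsto_pf ?_
  rintro ⟨i | i, b⟩ ⟨j | j, c⟩
  · refine (hLL (i, b) (j, c)).congr fun k => ?_
    simp only [d, of_apply, isLeft_inl, if_true, rowMap]
    rw [← hηε]; ring
  · have := hη.mul (hLR (i, b) (j, c))
    rw [zero_mul] at this
    refine this.congr fun k => ?_
    simp [d]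
  · have := hη.mul (hRL (j, c) (i, b))
    rw [zero_mul] at this
    refine this.congr fun k => ?_
    simp [d, mul_comm]
  · refine (hRR (i, b) (j, c)).congr fun k => ?_
    simp [d]

/-- The rows of a bordered matrix but for the last one. -/
def initRows {α : Type*} : Option (α × Bool) → Option α × Bool
  | none => (none, false)
  | some x => (some x.1, x.2)

/-- Rows on the left: the pairs in `α` and the second row of the extra pair. -/
def rowsL {α β : Type*} : Option (α × Bool) → Option (α ⊕ β) × Bool
  | none => (none, true)
  | some x => (some (inl x.1), x.2)

/-- Rows on the right: the pairs in `β` and the first row of the extra pair. -/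
def rowsR {α β : Type*} : Option (β × Bool) → Option (α ⊕ β) × Bool
  | none => (none, false)
  | some x => (some (inr x.1), x.2)

/-- All rows are on the left or on the right. -/
def sideRows {α β : Type*} : Option (α ⊕ β) × Bool → Option (α × Bool) ⊕ Option (β × Bool)
  | (none, true) => inl none
  | (none, false) => inr none
  | (some (inl i), b) => inl (some (i, b))
  | (some (inr j), b) => inr (some (j, b))

lemma pf_bordered_blocks {L : Matrix (Option α × Bool) (Option α × Bool) ℂ}
    {R : Matrix (Option β × Bool) (Option β × Bool) ℂ} (hL : IsSkew L) (hR : IsSkew R) :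
    pf (bordered (ι := Option (α ⊕ β)) (Matrix.of fun z z' => match sideRows z, sideRows z' with
        | inl x, inl y => L (initRows x) (initRows y)
        | inr x, inr y => R (initRows x) (initRows y)
        | _, _ => 0)
      (fun z => Sum.elim (fun x => L (initRows x) (none, true)) (fun _ => 0) (sideRows z))
      (fun z => Sum.elim (fun _ => 0) (fun y => R (initRows y) (none, true)) (sideRows z)) 0) =
    pf L * pf R := by
  set B := bordered (ι := Option (α ⊕ β)) _ _ _ 0
  let e : Option α ⊕ Option β ≃ Option (Option (α ⊕ β)) :=
    { toFun := fun
        | inl (some i) => some (some (inl i))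
        | inl none => some none
        | inr (some j) => some (some (inr j))
        | inr none => none
      invFun := fun
        | some (some (inl i)) => inl (some i)
        | some none => inl none
        | some (some (inr j)) => inr (some j)
        | none => inr none
      left_inv := by rintro ((_ | _) | (_ | _)) <;> rfl
      right_inv := by rintro (_ | _ | _ | _) <;> rfl }
  let p : Option (Option (α ⊕ β)) × Bool := (some none, false)
  let q : Option (Option (α ⊕ β)) × Bool := (some none, true)
  let r : Option (Option (α ⊕ β)) × Bool := (none, false)
  let σ : Perm (Option (Option (α ⊕ β)) × Bool) := Equiv.swap p q * Equiv.swap q r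
  have hpq : p ≠ q := by simp [p, q]
  have hqr : q ≠ r := by simp [q, r]
  have hpr : p ≠ r := by simp [p, r]
  have hσ : Equiv.Perm.sign σ = 1 := by
    simp only [σ, Equiv.Perm.sign_mul, Equiv.Perm.sign_swap hpq, Equiv.Perm.sign_swap hqr]
    rfl
  have hσp : σ p = q := by
    simp [σ, swap_apply_of_ne_of_ne hpq hpr]
  have hσq : σ q = r := by
    simp [σ, swap_apply_of_ne_of_ne hpr.symm hqr.symm]
  have hσr : σ r = p := by
    simp [σ]
  have hσo : ∀ x, x ≠ p → x ≠ q → x ≠ r → σ x = x := by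
    intro x h1 h2 h3
    simp [σ, swap_apply_of_ne_of_ne h2 h3, swap_apply_of_ne_of_ne h1 h2]
  have hB := pf_submatrix_perm σ B
  rw [hσ, Units.val_one, Int.cast_one, one_mul, ← pf_submatrix_equiv e] at hB
  let ρL : Option α × Bool → Option (Option (α ⊕ β)) × Bool := fun
    | (some i, b) => (some (some (inl i)), b)
    | (none, false) => (some none, true)
    | (none, true) => (none, false)
  let ρR : Option β × Bool → Option (Option (α ⊕ β)) × Bool := fun
    | (some i, b) => (some (some (inr i)), b)
    | (none, b) => (bif b then none else some none, b)
  have hρL : ∀ x, σ (rowMap e (rowMap inl x)) = ρL x := by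
    rintro ⟨_ | i, _ | _⟩
    · exact hσp
    · exact hσq
    all_goals exact hσo _ (by simp [p, e, rowMap]) (by simp [q, e, rowMap]) (by simp [r, e, rowMap])
  have hρR : ∀ x, σ (rowMap e (rowMap inr x)) = ρR x := by
    rintro ⟨_ | i, _ | _⟩
    · exact hσr
    all_goals exact hσo _ (by simp [p, e, rowMap]) (by simp [q, e, rowMap]) (by simp [r, e, rowMap])
  have hdL : ∀ x, 0 = L x x := fun x => (self_eq_neg.1 (hL x x)).symm
  have hdR : ∀ x, 0 = R x x := fun x => (self_eq_neg.1 (hR x x)).symm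
  have hBL : ∀ x y, B (ρL x) (ρL y) = L x y := by
    rintro ⟨_ | i, _ | _⟩ ⟨_ | j, _ | _⟩ <;> first | rfl | exact hdL _ | exact (hL _ _).symm
  have hBR : ∀ x y, B (ρR x) (ρR y) = R x y := by
    rintro ⟨_ | i, _ | _⟩ ⟨_ | j, _ | _⟩ <;> first | rfl | exact hdR _ | exact (hR _ _).symm
  have hBLR : ∀ x y, B (ρL x) (ρR y) = 0 := by
    rintro ⟨_ | i, _ | _⟩ ⟨_ | j, _ | _⟩ <;> first | rfl | exact neg_zero
  have hBRL : ∀ x y, B (ρR x) (ρL y) = 0 := by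
    rintro ⟨_ | i, _ | _⟩ ⟨_ | j, _ | _⟩ <;> first | rfl | exact neg_zero
  rw [← hB, pf_sum_blocks]
  · congr 2
    · ext x y
      simp only [submatrix_apply, hρL, hBL]
    · ext x y
      simp only [submatrix_apply, hρR, hBR]
  · intro i b j c
    rw [submatrix_apply, submatrix_apply, hρL (i, b), hρR (j, c), hBLR]
  · intro i b j c
    rw [submatrix_apply, submatrix_apply, hρL (i, b), hρR (j, c), hBRL]

/-- Two diagonal blocks with an odd number of rows, of which the first one is of the order `ε⁻¹`;
the entries between the blocks are products of vectors in the limit. -/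
lemma tendsto_pf_glue_odd {N : κ → Matrix (Option (α ⊕ β) × Bool) (Option (α ⊕ β) × Bool) ℂ}
    {M : Option (α × Bool) → Option (α × Bool) → ℂ} {D : Option (β × Bool) → Option (β × Bool) → ℂ}
    {L : γ → Matrix (Option α × Bool) (Option α × Bool) ℂ}
    {R : γ → Matrix (Option β × Bool) (Option β × Bool) ℂ}
    (hN : ∀ k, IsSkew (N k)) (hL : ∀ c, IsSkew (L c)) (hR : ∀ c, IsSkew (R c))
    (hM : ∀ c x y, L c (initRows x) (initRows y) = M x y)
    (hD : ∀ c x y, R c (initRows x) (initRows y) = D x y)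
    (hLL : ∀ x y, Tendsto (fun k => ε k * N k (rowsL x) (rowsL y)) l (𝓝 (M x y)))
    (hRR : ∀ x y, Tendsto (fun k => N k (rowsR x) (rowsR y)) l (𝓝 (D x y)))
    (hLR : ∀ x y, Tendsto (fun k => N k (rowsL x) (rowsR y)) l
      (𝓝 (∑ c, L c (initRows x) (none, true) * R c (initRows y) (none, true))))
    (hε : Tendsto ε l (𝓝 0)) (hε0 : ∀ᶠ k in l, ε k ≠ 0) :
    Tendsto (fun k => ε k ^ card α * pf (N k)) l (𝓝 (-∑ c, pf (L c) * pf (R c))) := by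
  obtain ⟨η, hηε, hη⟩ := exists_sqrt_tendsto_zero hε
  have hη0 : ∀ᶠ k in l, η k ≠ 0 := hε0.mono fun k hk h => hk (by rw [← hηε, h, zero_mul])
  let left : Option (α ⊕ β) × Bool → Bool := fun z => (sideRows z).isLeft
  let d : ℂ → Option (α ⊕ β) × Bool → ℂ := fun t z => if left z then t else 1
  have hprod : ∀ t, ∏ x, d t x = t * (t * t) ^ card α := by
    intro t
    simp [d, left, sideRows, Fintype.prod_prod_type, Fintype.prod_option]
  let A : κ → Matrix (Option (α ⊕ β) × Bool) (Option (α ⊕ β) × Bool) ℂ := fun k =>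
    Matrix.of fun z z' => if left z = left z' then d (η k) z * N k z z' * d (η k) z' else 0
  let C : κ → Matrix (Option (α ⊕ β) × Bool) (Option (α ⊕ β) × Bool) ℂ := fun k =>
    Matrix.of fun z z' => if left z = left z' then 0 else N k z z'
  let A₀ : Matrix (Option (α ⊕ β) × Bool) (Option (α ⊕ β) × Bool) ℂ :=
    Matrix.of fun z z' => match sideRows z, sideRows z' with
      | inl x, inl y => M x y
      | inr x, inr y => D x y
      | _, _ => 0
  let V : γ → Option (α ⊕ β) × Bool → ℂ := fun c z =>
    Sum.elim (fun x => L c (initRows x) (none, true)) (fun _ => 0) (sideRows z)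
  let W : γ → Option (α ⊕ β) × Bool → ℂ := fun c z =>
    Sum.elim (fun _ => 0) (fun y => R c (initRows y) (none, true)) (sideRows z)
  have hA0 : ∀ k, pf (A k) = 0 := by
    intro k
    have h := pf_diag_smul (d (-1)) (A k)
    rw [hprod, neg_mul_neg, one_mul, one_pow, mul_one, neg_one_mul] at h
    have h2 : (Matrix.of fun x y => d (-1) x * A k x y * d (-1) y) = A k := by
      ext x y
      by_cases hxy : left x = left y
      · cases hy : left y <;> simp [A, d, hxy, hy]
      · simp [A, hxy]
    rw [h2] at h
    exact self_eq_neg.1 h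
  have hpf : ∀ᶠ k in l, pf (A k + η k • C k) / η k = ε k ^ card α * pf (N k) := by
    filter_upwards [hη0] with k hk
    have h := pf_diag_smul (d (η k)) (N k)
    have h2 : (Matrix.of fun x y => d (η k) x * N k x y * d (η k) y) = A k + η k • C k := by
      ext x y
      cases hx : left x <;> cases hy : left y <;> simp [A, C, d, hx, hy, mul_comm]
    rw [h2, hprod, hηε] at h
    rw [h]
    field_simp
  have hsplit : ∀ z : Option (α ⊕ β) × Bool, (∃ x, z = rowsL x ∧ sideRows z = inl x) ∨
      ∃ x, z = rowsR x ∧ sideRows z = inr x := by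
    rintro ⟨_ | i | i, _ | _⟩
    · exact Or.inr ⟨none, rfl, rfl⟩
    · exact Or.inl ⟨none, rfl, rfl⟩
    · exact Or.inl ⟨some (i, false), rfl, rfl⟩
    · exact Or.inl ⟨some (i, true), rfl, rfl⟩
    · exact Or.inr ⟨some (i, false), rfl, rfl⟩
    · exact Or.inr ⟨some (i, true), rfl, rfl⟩
  have key := tendsto_pf_div (A := A) (C := C) (A₀ := A₀) (C₀ := ∑ c, wedge (V c) (W c)) (η := η)
    (l := l) ?_ ?_ hη hη0 (Eventually.of_forall hA0)
  · have hsum : pfD A₀ (∑ c, wedge (V c) (W c)) = -∑ c, pf (L c) * pf (R c) := by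
      rw [pfD_sum, ← sum_neg_distrib]
      refine sum_congr rfl fun c _ => ?_
      rw [← pf_bordered_blocks (hL c) (hR c), pf_bordered_eq_neg_pfD, neg_neg]
      simp only [A₀, V, W, hM, hD]
    rw [← hsum]
    exact key.congr' hpf
  · intro z z'
    rcases hsplit z with ⟨x, hx, hx'⟩ | ⟨x, hx, hx'⟩ <;>
      rcases hsplit z' with ⟨y, hy, hy'⟩ | ⟨y, hy, hy'⟩
    · have : A₀ z z' = M x y := by simp only [A₀, of_apply, hx', hy']
      rw [this]
      refine (hLL x y).congr fun k => ?_
      simp only [A, d, left, of_apply, hx', hy', isLeft_inl, if_true]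
      rw [← hηε, hx, hy]; ring
    · have : A₀ z z' = 0 := by simp only [A₀, of_apply, hx', hy']
      rw [this]
      refine tendsto_const_nhds.congr fun k => ?_
      simp [A, left, hx', hy']
    · have : A₀ z z' = 0 := by simp only [A₀, of_apply, hx', hy']
      rw [this]
      refine tendsto_const_nhds.congr fun k => ?_
      simp [A, left, hx', hy']
    · have : A₀ z z' = D x y := by simp only [A₀, of_apply, hx', hy']
      rw [this]
      refine (hRR x y).congr fun k => ?_
      simp only [A, d, left, of_apply, hx', hy', Sum.isLeft_inr, if_true]
      rw [hx, hy]
      simp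
  · intro z z'
    rw [Matrix.sum_apply]
    rcases hsplit z with ⟨x, hx, hx'⟩ | ⟨x, hx, hx'⟩ <;>
      rcases hsplit z' with ⟨y, hy, hy'⟩ | ⟨y, hy, hy'⟩
    · simp only [C, wedge, V, W, left, of_apply, hx', hy', elim_inl, isLeft_inl,
        if_true, mul_zero, zero_mul, sub_zero, sum_const_zero]
      exact tendsto_const_nhds
    · simp only [C, wedge, V, W, left, of_apply, hx', hy', elim_inl, elim_inr,
        isLeft_inl, Sum.isLeft_inr, mul_zero, sub_zero, reduceCtorEq, if_false]
      rw [hx, hy]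
      exact hLR x y
    · simp only [C, wedge, V, W, left, of_apply, hx', hy', elim_inl, elim_inr,
        isLeft_inl, Sum.isLeft_inr, mul_zero, zero_sub, reduceCtorEq, if_false,
        sum_neg_distrib, mul_comm (R _ _ _)]
      rw [hx, hy]
      refine (hLR y x).neg.congr' (Eventually.of_forall fun k => (hN k _ _).symm)
    · simp only [C, wedge, V, W, left, of_apply, hx', hy', elim_inr, Sum.isLeft_inr,
        if_true, zero_mul, mul_zero, sub_zero, sum_const_zero]
      exact tendsto_const_nhds

end PfaffianGlue

/-! ### Marked points -/

lemma br_self (u : ℂ × ℂ) : br u u = 0 := by unfold br; ring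

lemma br_swap (u v : ℂ × ℂ) : br v u = -br u v := by unfold br; ring

lemma br_plucker (u v w z : ℂ × ℂ) : br u v * br w z = br u w * br v z - br u z * br v w := by
  unfold br; ring

section Residues

variable {Λ : Type*} [Fintype Λ] [DecidableEq Λ]

lemma sum_erase_div_br (c : Λ → ℂ) (d : Λ → ℂ) (u : Config Λ) (i : Λ) (n : ℂ → ℂ) (hn : n 0 = 0) :
    ∑ j ∈ univ.erase i, c j * d j / n (br (u i) (u j)) = ∑ j, c j * d j / n (br (u i) (u j)) :=
  Finset.sum_subset (Finset.erase_subset _ _) fun j _ hj => by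
    have : j = i := by simpa using hj
    rw [this, br_self, hn, div_zero]

lemma scatEq_eq_sum (s : Λ → Λ → ℂ) (u : Config Λ) (i : Λ) :
    scatEq s u i = ∑ j, s i j * (u j).2 / ((u i).2 * br (u i) (u j)) :=
  sum_erase_div_br _ _ u i (fun t => (u i).2 * t) (mul_zero _)

/-- The residue at the marked point `i`, in a coordinate that depends on whether it is finite, with
numerators `c`. -/
def resAt {Λ : Type*} [Fintype Λ] (c : Λ → ℂ) (u : Config Λ) (i : Λ) : ℂ :=
  if (u i).2 = 0 then ∑ j, c j * (u j).1 / ((u i).1 * br (u i) (u j))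
  else ∑ j, c j * (u j).2 / ((u i).2 * br (u i) (u j))

lemma polP_eq_resAt {m : ℕ} (k : Λ → V m) (u : Config Λ) (i : Λ) (e : V m) :
    polP k u i e = resAt (fun j => e ⬝ᵥ k j) u i := by
  unfold polP resAt
  rw [sum_erase_div_br (fun j => e ⬝ᵥ k j) (fun j => (u j).1) u i (fun t => (u i).1 * t)
    (mul_zero _), sum_erase_div_br (fun j => e ⬝ᵥ k j) (fun j => (u j).2) u i
    (fun t => (u i).2 * t) (mul_zero _)]

lemma resAt_of_finite {Λ : Type*} [Fintype Λ] (c : Λ → ℂ) {u : Config Λ} {i : Λ} (hi : (u i).2 = 1) :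
    resAt c u i = ∑ j, c j * (u j).2 / br (u i) (u j) := by
  simp [resAt, hi]

lemma scatEq_eq_resAt (s : Λ → Λ → ℂ) {u : Config Λ} {i : Λ} (hi : (u i).2 ≠ 0) :
    scatEq s u i = resAt (s i) u i := by
  rw [scatEq_eq_sum, resAt, if_neg hi]

lemma sum_mul_br_div_br (c : Λ → ℂ) (u : Config Λ) (i : Λ) (hu : ∀ j, j ≠ i → br (u i) (u j) ≠ 0)
    (hc : ∑ j ∈ univ.erase i, c j = 0) (z : ℂ × ℂ) :
    ∑ j, c j * br (u j) z / br (u i) (u j) = br (u i) z * resAt c u i := by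
  set P := ∑ j, c j * (u j).1 / br (u i) (u j) with hP
  set Q := ∑ j, c j * (u j).2 / br (u i) (u j) with hQ
  have h1 : ∑ j, c j * br (u j) z / br (u i) (u j) = z.2 * P - z.1 * Q := by
    rw [hP, hQ, mul_sum, mul_sum, ← sum_sub_distrib]
    refine sum_congr rfl fun j _ => ?_
    unfold br; ring
  have h2 : (u i).1 * Q - (u i).2 * P = 0 := by
    rw [← hc, hP, hQ, mul_sum, mul_sum, ← sum_sub_distrib,
      ← Finset.sum_erase_add _ _ (mem_univ i), br_self]
    simp only [div_zero, mul_zero, sub_zero, add_zero]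
    refine sum_congr rfl fun j hj => ?_
    have h := hu j (ne_of_mem_erase hj)
    field_simp
    unfold br; ring
  rw [h1]
  unfold resAt
  split_ifs with h
  · have h3 : ∑ j, c j * (u j).1 / ((u i).1 * br (u i) (u j)) = P / (u i).1 := by
      rw [hP, sum_div]
      refine sum_congr rfl fun j _ => ?_
      rw [div_div, mul_comm (u i).1]
    rw [h3]
    by_cases h0 : (u i).1 = 0
    · have hbr : ∀ j, br (u i) (u j) = 0 := fun j => by simp [br, h, h0]
      simp [hP, hQ, hbr]
    · rw [h, zero_mul, sub_zero, mul_eq_zero, or_iff_right h0] at h2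
      rw [h2]
      unfold br
      rw [h]
      field_simp
      ring
  · have h3 : ∑ j, c j * (u j).2 / ((u i).2 * br (u i) (u j)) = Q / (u i).2 := by
      rw [hQ, sum_div]
      refine sum_congr rfl fun j _ => ?_
      rw [div_div, mul_comm (u i).2]
    rw [h3]
    unfold br
    field_simp
    linear_combination (-z.2) * h2

/-- The scattering equations at all the marked points, in homogeneous form. -/
def SolvesAll {Λ : Type*} [Fintype Λ] (s : Λ → Λ → ℂ) (u : Config Λ) : Prop :=
  ∀ i z, ∑ j, s i j * br (u j) z / br (u i) (u j) = 0

lemma SolvesAll.resAt_eq_zero {s : Λ → Λ → ℂ} {u : Config Λ} (h : SolvesAll s u)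
    (i : Λ) (hu : ∀ j, j ≠ i → br (u i) (u j) ≠ 0)
    (hs : ∑ j ∈ univ.erase i, s i j = 0) (z : ℂ × ℂ) (hz : br (u i) z ≠ 0) :
    resAt (s i) u i = 0 := by
  have := sum_mul_br_div_br (s i) u i hu hs z
  rw [h i z] at this
  exact (mul_eq_zero.1 this.symm).resolve_left hz

/-- The three labels of a gauge are different. -/
def Gauge.Distinct {Λ : Type*} (g : Gauge Λ) : Prop :=
  g.zero ≠ g.one ∧ g.zero ≠ g.inf ∧ g.one ≠ g.inf

lemma solvesAll_of_mem_Sols {s : Λ → Λ → ℂ} {g : Gauge Λ} (hg : g.Distinct) {u : Config Λ}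
    (hu : u ∈ Sols s g) (hsym : ∀ i j, i ≠ j → s i j = s j i)
    (hrow : ∀ i, ∑ j ∈ univ.erase i, s i j = 0) : SolvesAll s u := by
  obtain ⟨⟨h0, h1, hinf, hfin⟩, hne, hsc⟩ := hu
  have hH : ∀ i z, ∑ j, s i j * br (u j) z / br (u i) (u j) = br (u i) z * resAt (s i) u i :=
    fun i z => sum_mul_br_div_br (s i) u i (fun j hj => hne i j hj.symm) (hrow i) z
  have hfree : ∀ i, g.Free i → resAt (s i) u i = 0 := fun i hi => by
    rw [← scatEq_eq_resAt s (by rw [hfin i hi.2.2]; exact one_ne_zero)]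
    exact hsc i hi
  have hsum : ∀ z, ∑ i, br (u i) z * (br (u i) z * resAt (s i) u i) = 0 := by
    intro z
    simp_rw [← hH, mul_sum]
    have hanti : ∑ i, ∑ j, br (u i) z * (s i j * br (u j) z / br (u i) (u j)) =
        -∑ i, ∑ j, br (u i) z * (s i j * br (u j) z / br (u i) (u j)) := by
      conv_lhs => rw [sum_comm]
      simp_rw [← sum_neg_distrib]
      refine sum_congr rfl fun i _ => sum_congr rfl fun j _ => ?_
      by_cases hij : i = j
      · subst hij; simp [br_self]
      · rw [hsym i j hij, br_swap (u i) (u j), div_neg]; ring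
    exact self_eq_neg.1 hanti
  have h3 : ∀ z, br (u g.zero) z ^ 2 * resAt (s g.zero) u g.zero +
      br (u g.one) z ^ 2 * resAt (s g.one) u g.one +
      br (u g.inf) z ^ 2 * resAt (s g.inf) u g.inf = 0 := by
    intro z
    have hsub : ∑ i ∈ {g.zero, g.one, g.inf}, br (u i) z * (br (u i) z * resAt (s i) u i) = 0 := by
      rw [← hsum z]
      refine Finset.sum_subset (Finset.subset_univ _) fun i _ hi => ?_
      simp only [Finset.mem_insert, Finset.mem_singleton, not_or] at hi
      rw [hfree i hi, mul_zero, mul_zero]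
    rw [Finset.sum_insert (by simp [hg.1, hg.2.1]), Finset.sum_insert (by simp [hg.2.2]),
      Finset.sum_singleton] at hsub
    linear_combination hsub
  have e1 := h3 (1, 0)
  have e2 := h3 (0, 1)
  have e3 := h3 (1, 1)
  simp only [h0, h1, hinf, br] at e1 e2 e3
  ring_nf at e1 e2 e3
  intro i z
  rw [hH]
  suffices resAt (s i) u i = 0 by rw [this, mul_zero]
  by_cases hi0 : i = g.zero
  · rw [hi0]; linear_combination (1 / 2 : ℂ) * (e1 + e3 - e2)
  by_cases hi1 : i = g.one
  · rw [hi1]; linear_combination (1 / 2 : ℂ) * (e1 + e2 - e3)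
  by_cases hi2 : i = g.inf
  · rw [hi2]; linear_combination (1 / 2 : ℂ) * (e2 + e3 - e1)
  exact hfree i ⟨hi0, hi1, hi2⟩

end Residues

section Relabel

variable {Λ Λ' : Type*} [Fintype Λ] [DecidableEq Λ] [Fintype Λ'] [DecidableEq Λ']

/-- The image of a gauge under a relabelling. -/
def Gauge.map {Λ Λ' : Type*} (e : Λ' → Λ) (g : Gauge Λ') : Gauge Λ := ⟨e g.zero, e g.one, e g.inf⟩

lemma scatEq_comp (e : Λ' ≃ Λ) {s : Λ → Λ → ℂ} {s' : Λ' → Λ' → ℂ}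
    (hs : ∀ i j, i ≠ j → s' i j = s (e i) (e j)) (u : Config Λ) (i : Λ') :
    scatEq s' (u ∘ e) i = scatEq s u (e i) := by
  rw [scatEq_eq_sum, scatEq_eq_sum]
  refine sum_equiv e _ _ fun j => ?_
  by_cases hij : i = j
  · subst hij; simp [br_self]
  · rw [hs i j hij]; rfl

lemma mem_Sols_comp (e : Λ' ≃ Λ) {s : Λ → Λ → ℂ} {s' : Λ' → Λ' → ℂ}
    (hs : ∀ i j, i ≠ j → s' i j = s (e i) (e j)) (g : Gauge Λ') (u : Config Λ) :
    u ∘ e ∈ Sols s' g ↔ u ∈ Sols s (g.map e) := by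
  have hall : ∀ {p : Λ → Prop}, (∀ i, p (e i)) ↔ ∀ i, p i := 
    ⟨fun h i => by simpa using h (e.symm i), fun h i => h _⟩
  simp only [Sols, Set.mem_ofPred_eq, Gauge.Normalised, Gauge.Free, scatEq_comp e hs]
  refine and_congr (and_congr Iff.rfl (and_congr Iff.rfl (and_congr Iff.rfl ?_))) (and_congr ?_ ?_)
  · refine Iff.trans ?_ hall
    exact forall_congr' fun i => imp_congr (e.injective.ne_iff (y := g.inf)).symm Iff.rfl
  · refine Iff.trans (forall_congr' fun i => ?_) hall
    refine Iff.trans (forall_congr' fun j => ?_) hall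
    exact imp_congr e.injective.ne_iff.symm Iff.rfl
  · refine Iff.trans (forall_congr' fun i => ?_) hall
    simp only [Gauge.map, ne_eq, e.injective.eq_iff]

lemma jac_comp (e : Λ' ≃ Λ) {s : Λ → Λ → ℂ} {s' : Λ' → Λ' → ℂ}
    (hs : ∀ i j, i ≠ j → s' i j = s (e i) (e j)) (g : Gauge Λ') (u : Config Λ) :
    jac s' g (u ∘ e) = jac s (g.map e) u := by
  let e' : {i // g.Free i} ≃ {i // (g.map e).Free i} := e.subtypeEquiv fun i => by
    simp only [Gauge.Free, Gauge.map, ne_eq, e.injective.eq_iff]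
  unfold jac
  rw [← det_submatrix_equiv_self e']
  congr 1
  ext i j
  have hij : e' i = e' j ↔ i = j := e'.injective.eq_iff
  simp only [submatrix_apply, of_apply, hij]
  split_ifs with h
  · congr 1
    refine Finset.sum_equiv e (fun k => ?_) fun k hk => ?_
    · simp only [Finset.mem_erase, mem_univ, and_true]
      exact not_congr (e.injective.eq_iff (b := i.1)).symm
    · rw [hs _ _ (ne_of_mem_erase hk).symm]; rfl
  · rw [hs _ _ fun h' => h (Subtype.ext h')]; rfl

lemma chySum_comp (e : Λ' ≃ Λ) {s : Λ → Λ → ℂ} {s' : Λ' → Λ' → ℂ}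
    (hs : ∀ i j, i ≠ j → s' i j = s (e i) (e j)) (g : Gauge Λ') (U : Set (Config Λ))
    (f : Config Λ → ℂ) :
    chySum s (g.map e) U f = chySum s' g {u | u ∘ e.symm ∈ U} fun u => f (u ∘ e.symm) := by
  unfold chySum
  congr 1
  let E : Config Λ ≃ Config Λ' := Equiv.arrowCongr e.symm (Equiv.refl _)
  have hE : ∀ u, E u = u ∘ e := fun u => rfl
  have hE' : ∀ u, (E u) ∘ e.symm = u := fun u => by ext i <;> simp [hE]
  refine finsum_eq_of_bijective E E.bijective fun u => ?_
  have hmem : (E u ∈ Sols s' g ∩ {u | u ∘ e.symm ∈ U}) ↔ u ∈ Sols s (g.map e) ∩ U := by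
    refine and_congr ?_ ?_
    · exact mem_Sols_comp e hs g u
    · change E u ∘ e.symm ∈ U ↔ _
      rw [hE']
  have hJ : jac s' g (E u) = jac s (g.map e) u := jac_comp e hs g u
  have hf : f (E u ∘ e.symm) = f u := congrArg f (hE' u)
  simp only [hf, hJ, hmem]

lemma generic_comp (e : Λ' ≃ Λ) {s : Λ → Λ → ℂ} {s' : Λ' → Λ' → ℂ}
    (hs : ∀ i j, i ≠ j → s' i j = s (e i) (e j)) (g : Gauge Λ') (h : Generic s (g.map e)) :
    Generic s' g := by
  have hu : ∀ u : Config Λ', (u ∘ e.symm) ∘ e = u := fun u => by ext i <;> simp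
  have hmem : ∀ u, u ∈ Sols s' g → u ∘ e.symm ∈ Sols s (g.map e) := fun u h => by
    rw [← mem_Sols_comp e hs, hu]; exact h
  refine ⟨?_, fun u h' => ?_⟩
  · refine (h.1.image fun u => u ∘ e).subset fun u h' => ⟨_, hmem u h', hu u⟩
  · rw [← hu u, jac_comp e hs]
    exact h.2 _ (hmem u h')

end Relabel

/-! ### Branches of solutions -/

lemma exists_branch {P Z : Type*} [NormedAddCommGroup P] [NormedSpace ℂ P] [CompleteSpace P]
    [NormedAddCommGroup Z] [NormedSpace ℂ Z] [FiniteDimensional ℂ Z] {G : P × Z → Z} {p₀ : P}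
    {z₀ : Z} (hG : ContDiffAt ℂ 1 G (p₀, z₀)) (h0 : G (p₀, z₀) = 0)
    (hinj : ∀ h, HasDerivAt (fun t : ℂ => G (p₀, z₀ + t • h)) 0 0 → h = 0) :
    ∃ φ : P → Z, φ p₀ = z₀ ∧ Tendsto φ (𝓝 p₀) (𝓝 z₀) ∧ (∀ᶠ p in 𝓝 p₀, G (p, φ p) = 0) ∧
      ∀ᶠ q in 𝓝 (p₀, z₀), G q = 0 → q.2 = φ q.1 := by
  have : CompleteSpace Z := FiniteDimensional.complete ℂ Z
  have hker : ∀ h, (fderiv ℂ G (p₀, z₀) ∘L .inr ℂ P Z) h = 0 → h = 0 := by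
    intro h hh
    refine hinj h ?_
    have h1 : HasDerivAt (fun t : ℂ => ((p₀, z₀ + t • h) : P × Z)) (0, h) 0 := by
      refine (hasDerivAt_const _ _).prodMk ?_
      simpa using ((hasDerivAt_id (0 : ℂ)).smul_const h).const_add z₀
    have h2 : HasFDerivAt G (fderiv ℂ G (p₀, z₀)) ((fun t : ℂ => ((p₀, z₀ + t • h) : P × Z)) 0) := by
      simpa using (hG.differentiableAt one_ne_zero).hasFDerivAt
    have h3 := h2.comp_hasDerivAt (0 : ℂ) h1
    have h4 : fderiv ℂ G (p₀, z₀) (0, h) = 0 := hh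
    rw [h4] at h3
    exact h3
  have hinv : (fderiv ℂ G (p₀, z₀) ∘L .inr ℂ P Z).IsInvertible := by
    let D := fderiv ℂ G (p₀, z₀) ∘L .inr ℂ P Z
    have hD : Function.Injective D.toLinearMap := (injective_iff_map_eq_zero D.toLinearMap).2 hker
    exact ⟨(LinearEquiv.ofInjectiveEndo D.toLinearMap hD).toContinuousLinearEquiv, by
      ext h; rfl⟩
  refine ⟨hG.implicitFunction one_ne_zero hinv,
    hG.implicitFunction_apply_self one_ne_zero hinv, ?_, ?_, ?_⟩
  · have := (hG.hasStrictFDerivAt_implicitFunction one_ne_zero hinv).continuousAt.tendsto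
    have h := hG.implicitFunction_apply_self one_ne_zero hinv
    simp only at this h
    rwa [h] at this
  · filter_upwards [hG.eventually_apply_implicitFunction one_ne_zero hinv] with p hp
    rw [hp, h0]
  · filter_upwards [hG.eventually_apply_eq_iff_implicitFunction one_ne_zero hinv] with q hq hq0
    exact (hq.1 (hq0.trans h0.symm)).symm

lemma exists_branches_of_isCompact {P Z : Type*} [TopologicalSpace Z] {C : Set Z}
    (hC : IsCompact C) {l : Filter P} {Q : P → Z → Prop} {good : (P → Z) → Prop}
    (h : ∀ z ∈ C, ∃ Φ : Set (P → Z), Φ.Finite ∧ (∀ φ ∈ Φ, good φ) ∧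
      ∀ᶠ q in l ×ˢ 𝓝 z, Q q.1 q.2 → ∃ φ ∈ Φ, q.2 = φ q.1) :
    ∃ Φ : Set (P → Z), Φ.Finite ∧ (∀ φ ∈ Φ, good φ) ∧
      ∀ᶠ p in l, ∀ z ∈ C, Q p z → ∃ φ ∈ Φ, z = φ p := by
  refine hC.induction_on (p := fun S => ∃ Φ : Set (P → Z), Φ.Finite ∧ (∀ φ ∈ Φ, good φ) ∧
      ∀ᶠ p in l, ∀ z ∈ S, Q p z → ∃ φ ∈ Φ, z = φ p) ?_ ?_ ?_ ?_
  · exact ⟨∅, Set.finite_empty, by simp, by simp⟩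
  · rintro S S' hSS' ⟨Φ, h1, h2, h3⟩
    exact ⟨Φ, h1, h2, h3.mono fun p hp z hz => hp z (hSS' hz)⟩
  · rintro S S' ⟨Φ, h1, h2, h3⟩ ⟨Φ', h1', h2', h3'⟩
    refine ⟨Φ ∪ Φ', h1.union h1', ?_, ?_⟩
    · rintro φ (hφ | hφ)
      · exact h2 φ hφ
      · exact h2' φ hφ
    · filter_upwards [h3, h3'] with p hp hp'
      rintro z (hz | hz) hQ
      · obtain ⟨φ, hφ, e⟩ := hp z hz hQ
        exact ⟨φ, Or.inl hφ, e⟩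
      · obtain ⟨φ, hφ, e⟩ := hp' z hz hQ
        exact ⟨φ, Or.inr hφ, e⟩
  · intro z hz
    obtain ⟨Φ, h1, h2, h3⟩ := h z hz
    rw [eventually_prod_iff] at h3
    obtain ⟨pa, hpa, pb, hpb, h3⟩ := h3
    refine ⟨{z | pb z}, mem_nhdsWithin_of_mem_nhds hpb, Φ, h1, h2, ?_⟩
    filter_upwards [hpa] with p hp z' hz' using h3 hp hz'

/-! ### Continuity and derivatives of the scattering equations -/

section Tendsto

variable {Λ κ : Type*} [Fintype Λ] [DecidableEq Λ] {l : Filter κ} {s : κ → Λ → Λ → ℂ}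
  {s₀ : Λ → Λ → ℂ} {u : κ → Config Λ} {u₀ : Config Λ}

lemma tendsto_br {p q : κ → ℂ × ℂ} {p₀ q₀ : ℂ × ℂ} (hp : Tendsto p l (𝓝 p₀))
    (hq : Tendsto q l (𝓝 q₀)) : Tendsto (fun k => br (p k) (q k)) l (𝓝 (br p₀ q₀)) :=
  (((continuous_fst.tendsto _).comp hp).mul ((continuous_snd.tendsto _).comp hq)).sub
    (((continuous_snd.tendsto _).comp hp).mul ((continuous_fst.tendsto _).comp hq))

lemma tendsto_scatEq (hs : ∀ i j, Tendsto (fun k => s k i j) l (𝓝 (s₀ i j)))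
    (hu : ∀ i, Tendsto (fun k => u k i) l (𝓝 (u₀ i)))
    (hne : ∀ i j, i ≠ j → br (u₀ i) (u₀ j) ≠ 0) (i : Λ) (hi : (u₀ i).2 ≠ 0) :
    Tendsto (fun k => scatEq (s k) (u k) i) l (𝓝 (scatEq s₀ u₀ i)) := by
  refine tendsto_finsetSum _ fun j hj => ?_
  have h2 : ∀ j, Tendsto (fun k => (u k j).2) l (𝓝 (u₀ j).2) := fun j =>
    (continuous_snd.tendsto _).comp (hu j)
  exact ((hs i j).mul (h2 j)).div ((h2 i).mul (tendsto_br (hu i) (hu j)))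
    (mul_ne_zero hi (hne i j (ne_of_mem_erase hj).symm))

/-- The matrix whose determinant is `jac`. -/
def jacMat (s : Λ → Λ → ℂ) (g : Gauge Λ) (u : Config Λ) :
    Matrix {i // g.Free i} {i // g.Free i} ℂ :=
  Matrix.of fun i j =>
    if i = j then
      -∑ k ∈ univ.erase i.1, s i.1 k * (u k).2 / br (u i.1) (u k) ^ 2
    else s i.1 j.1 / br (u i.1) (u j.1) ^ 2

lemma jac_eq_det (s : Λ → Λ → ℂ) (g : Gauge Λ) (u : Config Λ) : jac s g u = (jacMat s g u).det :=
  rfl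

lemma tendsto_det {n : Type*} [Fintype n] [DecidableEq n] {A : κ → Matrix n n ℂ}
    {A₀ : Matrix n n ℂ} (h : ∀ i j, Tendsto (fun k => A k i j) l (𝓝 (A₀ i j))) :
    Tendsto (fun k => (A k).det) l (𝓝 A₀.det) :=
  ((continuous_id.matrix_det).tendsto A₀).comp
    (tendsto_pi_nhds.2 fun i => tendsto_pi_nhds.2 fun j => h i j)

lemma tendsto_jacMat (hs : ∀ i j, Tendsto (fun k => s k i j) l (𝓝 (s₀ i j)))
    (hu : ∀ i, Tendsto (fun k => u k i) l (𝓝 (u₀ i)))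
    (hne : ∀ i j, i ≠ j → br (u₀ i) (u₀ j) ≠ 0) (g : Gauge Λ) (i j : {i // g.Free i}) :
    Tendsto (fun k => jacMat (s k) g (u k) i j) l (𝓝 (jacMat s₀ g u₀ i j)) := by
  simp only [jacMat, of_apply]
  split_ifs with h
  · refine (tendsto_finsetSum _ fun j hj => ?_).neg
    exact ((hs _ j).mul ((continuous_snd.tendsto _).comp (hu j))).div
      ((tendsto_br (hu _) (hu j)).pow 2)
      (pow_ne_zero 2 (hne _ j (ne_of_mem_erase hj).symm))
  · exact (hs _ _).div ((tendsto_br (hu _) (hu _)).pow 2)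
      (pow_ne_zero 2 (hne _ _ fun h' => h (Subtype.ext h')))

lemma tendsto_jac (hs : ∀ i j, Tendsto (fun k => s k i j) l (𝓝 (s₀ i j)))
    (hu : ∀ i, Tendsto (fun k => u k i) l (𝓝 (u₀ i)))
    (hne : ∀ i j, i ≠ j → br (u₀ i) (u₀ j) ≠ 0) (g : Gauge Λ) :
    Tendsto (fun k => jac (s k) g (u k)) l (𝓝 (jac s₀ g u₀)) :=
  tendsto_det (tendsto_jacMat hs hu hne g)

lemma jacMat_mulVec (s : Λ → Λ → ℂ) (g : Gauge Λ) (u : Config Λ) (q : Λ → ℂ)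
    (hq : ∀ i, ¬ g.Free i → q i = 0) (hu : ∀ i, g.Free i → (u i).2 = 1) (i : {i // g.Free i}) :
    (jacMat s g u).mulVec (fun j => q j) i =
      ∑ j, -(s i j * (q i - q j) * (u j).2) / br (u i) (u j) ^ 2 := by
  have h1 : ∀ j : {i // g.Free i}, jacMat s g u i j * q j =
      (if i = j then -(∑ k, s i k * (u k).2 / br (u i) (u k) ^ 2) * q i else 0) +
        s i j * (q j * (u j).2) / br (u i) (u j) ^ 2 := by
    intro j
    simp only [jacMat, of_apply]
    split_ifs with h
    · subst h
      rw [sum_erase_div_br (s i) (fun k => (u k).2) u i (fun t => t ^ 2) (by simp), br_self]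
      simp
    · rw [hu j j.2]; ring
  rw [mulVec, dotProduct]
  simp_rw [h1]
  rw [sum_add_distrib, Finset.sum_ite_eq univ i, if_pos (mem_univ _)]
  have h2 : ∑ j : {i // g.Free i}, s i j * (q j * (u j).2) / br (u i) (u j) ^ 2 =
      ∑ j, s i j * (q j * (u j).2) / br (u i) (u j) ^ 2 := by
    symm
    refine Fintype.sum_of_injective _ Subtype.val_injective _ _ ?_ (fun _ => rfl) |>.symm
    intro j hj
    rw [hq j fun h => hj ⟨⟨j, h⟩, rfl⟩]
    simp
  rw [h2, neg_mul, sum_mul, ← sum_neg_distrib, ← sum_add_distrib]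
  refine sum_congr rfl fun j _ => ?_
  ring

lemma hasDerivAt_scatEq (s : Λ → Λ → ℂ) (u : ℂ → Config Λ) (q : Λ → ℂ) (i : Λ)
    (hu : ∀ t j, u t j = ((u 0 j).1 + t * q j, (u 0 j).2)) (hi : (u 0 i).2 = 1)
    (h2 : ∀ j, (u 0 j).2 = 1 ∨ (u 0 j).2 = 0) (hne : ∀ j, j ≠ i → br (u 0 i) (u 0 j) ≠ 0) :
    HasDerivAt (fun t => scatEq s (u t) i)
      (∑ j, -(s i j * (q i - q j) * (u 0 j).2) / br (u 0 i) (u 0 j) ^ 2) 0 := by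
  simp_rw [scatEq_eq_sum]
  refine HasDerivAt.fun_sum fun j _ => ?_
  rcases eq_or_ne j i with rfl | hj
  · simp only [br_self, mul_zero, div_zero, zero_pow two_ne_zero]
    exact hasDerivAt_const _ _
  rcases h2 j with h | h
  · have hb := hne j hj
    have e : (fun t => s i j * (u t j).2 / ((u t i).2 * br (u t i) (u t j))) =
        fun t => s i j * (br (u 0 i) (u 0 j) + t * (q i - q j))⁻¹ := by
      ext t
      rw [hu t i, hu t j]
      simp only [h, hi, br, mul_one, one_mul]
      rw [div_eq_mul_inv]
      congr 2
      ring
    rw [e, h]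
    have h3 : HasDerivAt (fun t : ℂ => br (u 0 i) (u 0 j) + t * (q i - q j)) (q i - q j) 0 := by
      simpa using ((hasDerivAt_id (0 : ℂ)).mul_const (q i - q j)).const_add (br (u 0 i) (u 0 j))
    have h4 := (h3.inv (by simpa using hb)).const_mul (s i j)
    refine HasDerivAt.congr_deriv h4 ?_
    rw [zero_mul, add_zero]
    ring
  · have e : (fun t => s i j * (u t j).2 / ((u t i).2 * br (u t i) (u t j))) = fun _ => 0 := by
      ext t
      rw [hu t j, h]; simp
    rw [e, h]
    simpa using hasDerivAt_const (0 : ℂ) (0 : ℂ)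

end Tendsto

section Smooth

variable {E Λ : Type*} [NormedAddCommGroup E] [NormedSpace ℂ E] [Fintype Λ] [DecidableEq Λ]

lemma contDiffAt_br {p q : E → ℂ × ℂ} {e₀ : E} (hp : ContDiffAt ℂ 1 p e₀)
    (hq : ContDiffAt ℂ 1 q e₀) : ContDiffAt ℂ 1 (fun e => br (p e) (q e)) e₀ := by
  unfold br
  fun_prop

lemma contDiffAt_scatEq {s : E → Λ → Λ → ℂ} {u : E → Config Λ} {e₀ : E}
    (hs : ∀ i j, ContDiffAt ℂ 1 (fun e => s e i j) e₀)
    (hu : ∀ i, ContDiffAt ℂ 1 (fun e => u e i) e₀) (i : Λ) (hi : (u e₀ i).2 ≠ 0)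
    (hne : ∀ j, j ≠ i → br (u e₀ i) (u e₀ j) ≠ 0) :
    ContDiffAt ℂ 1 (fun e => scatEq (s e) (u e) i) e₀ := by
  refine ContDiffAt.sum fun j hj => ?_
  exact ((hs i j).mul (hu j).snd).div ((hu i).snd.mul (contDiffAt_br (hu i) (hu j)))
    (mul_ne_zero hi (hne j (ne_of_mem_erase hj)))

end Smooth

/-! ### Degenerating configurations -/

section Conf

variable {A B : Type*}

/-- The configuration with the points `ε x_i`, `i : A`, close to `0`, and the other points at
`y`. -/
def conf (ε : ℂ) (x : A → ℂ) (y : B → ℂ × ℂ) : Config (A ⊕ B) := Sum.elim (fun i => (ε * x i, 1)) y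

/-- The points `x` and the node at `∞`. -/
def leftConf (x : A → ℂ) : Config (Option A) := fun o => o.elim (1, 0) fun i => (x i, 1)

/-- The points `y` and the node at `0`. -/
def rightConf (y : B → ℂ × ℂ) : Config (Option B) := fun o => o.elim (0, 1) y

lemma br_conf_inl_inl (ε : ℂ) (x : A → ℂ) (y : B → ℂ × ℂ) (i j : A) :
    br (conf ε x y (.inl i)) (conf ε x y (.inl j)) = ε * (x i - x j) := by
  simp only [conf, elim_inl, br]; ring

lemma tendsto_conf_inl {κ : Type*} {l : Filter κ} {ε : κ → ℂ} {x : κ → A → ℂ} {x₀ : A → ℂ}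
    {y : κ → B → ℂ × ℂ} (hε : Tendsto ε l (𝓝 0)) (hx : ∀ i, Tendsto (fun k => x k i) l (𝓝 (x₀ i)))
    (i : A) : Tendsto (fun k => conf (ε k) (x k) (y k) (.inl i)) l (𝓝 (0, 1)) := by
  have h := hε.mul (hx i)
  rw [zero_mul] at h
  exact h.prodMk_nhds tendsto_const_nhds

/-- The contribution of the points of `B` to the scattering equation of a point of `A`. -/
def crossRes [Fintype B] (s : A ⊕ B → A ⊕ B → ℂ) (ε : ℂ) (x : A → ℂ) (y : B → ℂ × ℂ) (i : A) : ℂ :=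
  ∑ k : B, s (.inl i) (.inr k) * (y k).2 / br (ε * x i, 1) (y k)

variable [Fintype A] [DecidableEq A] [Fintype B] [DecidableEq B]

lemma scatEq_conf_inl (s : A ⊕ B → A ⊕ B → ℂ) (ε : ℂ) (x : A → ℂ) (y : B → ℂ × ℂ)
    (i : A) : scatEq s (conf ε x y) (.inl i) =
      ε⁻¹ * ∑ k : A, s (.inl i) (.inl k) / (x i - x k) + crossRes s ε x y i := by
  rw [scatEq_eq_sum, sum_sum_type]
  simp_rw [br_conf_inl_inl]
  simp only [conf, elim_inl, elim_inr, mul_one, one_mul, crossRes]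
  congr 1
  rw [mul_sum]
  refine sum_congr rfl fun k _ => ?_
  rw [div_mul_eq_div_div, div_eq_mul_inv _ ε, div_eq_mul_inv, div_eq_mul_inv]
  ring

lemma tendsto_crossRes {κ : Type*} {l : Filter κ} {s : κ → A ⊕ B → A ⊕ B → ℂ}
    {s₀ : A ⊕ B → A ⊕ B → ℂ} (hs : ∀ i j, Tendsto (fun k => s k i j) l (𝓝 (s₀ i j)))
    {ε : κ → ℂ} {x : κ → A → ℂ} {x₀ : A → ℂ} {y : κ → B → ℂ × ℂ} {y₀ : B → ℂ × ℂ}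
    (hε : Tendsto ε l (𝓝 0)) (hx : ∀ i, Tendsto (fun k => x k i) l (𝓝 (x₀ i)))
    (hy : ∀ j, Tendsto (fun k => y k j) l (𝓝 (y₀ j))) (h0 : ∀ j, br (0, 1) (y₀ j) ≠ 0) (i : A) :
    Tendsto (fun k => crossRes (s k) (ε k) (x k) (y k) i) l (𝓝 (crossRes s₀ 0 x₀ y₀ i)) := by
  refine tendsto_finsetSum _ fun j _ => ?_
  have h1 : Tendsto (fun k => ((ε k * x k i, 1) : ℂ × ℂ)) l (𝓝 (0 * x₀ i, 1)) :=
    (hε.mul (hx i)).prodMk_nhds tendsto_const_nhds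
  refine ((hs _ _).mul ((continuous_snd.tendsto _).comp (hy j))).div (tendsto_br h1 (hy j)) ?_
  simpa using h0 j

lemma scatEq_leftConf {s : A ⊕ B → A ⊕ B → ℂ} {sL : Option A → Option A → ℂ}
    (hsL : ∀ i j, i ≠ j → sL (some i) (some j) = s (.inl i) (.inl j)) (x : A → ℂ) (i : A) :
    scatEq sL (leftConf x) (some i) = ∑ k : A, s (.inl i) (.inl k) / (x i - x k) := by
  rw [scatEq_eq_sum, sum_option]
  simp only [leftConf, elim_none, elim_some, mul_zero, zero_div, zero_add, one_mul, mul_one, br]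
  refine sum_congr rfl fun k _ => ?_
  rcases eq_or_ne i k with rfl | h
  · simp
  · rw [hsL i k h]

lemma scatEq_rightConf {s : A ⊕ B → A ⊕ B → ℂ} {sR : Option B → Option B → ℂ}
    (hsR : ∀ i j, i ≠ j → sR (some i) (some j) = s (.inr i) (.inr j))
    (hsN : ∀ j, sR (some j) none = ∑ i, s (.inr j) (.inl i)) (x : A → ℂ) (y : B → ℂ × ℂ) (j : B) :
    scatEq sR (rightConf y) (some j) = scatEq s (conf 0 x y) (.inr j) := by
  rw [scatEq_eq_sum, scatEq_eq_sum, sum_option, sum_sum_type]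
  simp only [rightConf, conf, elim_none, elim_some, elim_inl, elim_inr, mul_one, zero_mul]
  congr 1
  · rw [hsN, sum_div]
  · refine sum_congr rfl fun k _ => ?_
    rcases eq_or_ne j k with rfl | h
    · simp [br_self]
    · rw [hsR j k h]

/-! ### Limit of the Jacobian -/

/-- The labels of the free points on the three sides: of the channel, `μ`, and of the
complement. -/
def freeSum (a μ : A) (b c : B) (haμ : a ≠ μ) : (Off a μ ⊕ Unit) ⊕ Off b c →
      {i // (⟨.inl a, .inr b, .inr c⟩ : Gauge (A ⊕ B)).Free i}
  | .inl (.inl i) => ⟨.inl i.1, by simp [Gauge.Free, i.2.1]⟩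
  | .inl (.inr _) => ⟨.inl μ, by simp [Gauge.Free, haμ.symm]⟩
  | .inr j => ⟨.inr j.1, by simp [Gauge.Free, j.2]⟩

lemma freeSum_bijective (a μ : A) (b c : B) (haμ : a ≠ μ) :
    Function.Bijective (freeSum a μ b c haμ) := by
  constructor
  · rintro ((⟨i, hi⟩ | _) | ⟨j, hj⟩) ((⟨i', hi'⟩ | _) | ⟨j', hj'⟩) h <;>
      simp_all [freeSum, Subtype.ext_iff]
    exact absurd h.symm hi'.2
  · rintro ⟨i | j, h⟩
    · by_cases hi : i = μ
      · exact ⟨.inl (.inr ()), by simp [freeSum, hi]⟩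
      · exact ⟨.inl (.inl ⟨i, by simpa [Gauge.Free] using h, hi⟩), rfl⟩
    · exact ⟨.inr ⟨j, by simpa [Gauge.Free] using h⟩, rfl⟩

lemma sum_eq_sum_free (a μ : A) (f : A → ℂ) (ha : f a = 0) :
    ∑ i, f i = (∑ i : Off a μ, f i.1) + f μ := by
  rw [← Finset.sum_subtype (univ.filter fun i => i ≠ a ∧ i ≠ μ) (by simp) f,
    sum_filter, ← Finset.sum_erase_add _ _ (mem_univ μ),
    ← Finset.sum_erase_add _ (fun i => if i ≠ a ∧ i ≠ μ then f i else 0) (mem_univ μ)]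
  simp only [ne_eq, not_true_eq_false, and_false, if_false, add_zero, add_left_inj]
  refine sum_congr rfl fun i hi => ?_
  split_ifs with h
  · rfl
  · have : i = a := by
      by_contra h'
      exact h ⟨h', ne_of_mem_erase hi⟩
    rw [this, ha]

/-- The entries of `jacMat`, for all pairs of labels. -/
def jacEntry {Λ : Type*} [Fintype Λ] [DecidableEq Λ] (s : Λ → Λ → ℂ) (u : Config Λ) (i j : Λ) : ℂ :=
  if i = j then -∑ k ∈ univ.erase i, s i k * (u k).2 / br (u i) (u k) ^ 2
  else s i j / br (u i) (u j) ^ 2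

lemma jacMat_apply {Λ : Type*} [Fintype Λ] [DecidableEq Λ] (s : Λ → Λ → ℂ) (g : Gauge Λ)
    (u : Config Λ) (i j : {i // g.Free i}) : jacMat s g u i j = jacEntry s u i.1 j.1 := by
  simp only [jacMat, jacEntry, of_apply, Subtype.ext_iff]

lemma jacEntry_self {Λ : Type*} [Fintype Λ] [DecidableEq Λ] (s : Λ → Λ → ℂ) (u : Config Λ) (i : Λ) :
    jacEntry s u i i = -∑ k, s i k * (u k).2 / br (u i) (u k) ^ 2 := by
  rw [jacEntry, if_pos rfl,
    sum_erase_div_br (s i) (fun k => (u k).2) u i (fun t => t ^ 2) (by simp)]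

lemma jacEntry_of_ne {Λ : Type*} [Fintype Λ] [DecidableEq Λ] (s : Λ → Λ → ℂ) (u : Config Λ)
    {i j : Λ} (h : i ≠ j) : jacEntry s u i j = s i j / br (u i) (u j) ^ 2 := if_neg h

lemma jacEntry_symm {Λ : Type*} [Fintype Λ] [DecidableEq Λ] {s : Λ → Λ → ℂ}
    (hs : ∀ i j, s i j = s j i) (u : Config Λ) (i j : Λ) : jacEntry s u i j = jacEntry s u j i := by
  rcases eq_or_ne i j with rfl | h
  · rfl
  · rw [jacEntry_of_ne s u h, jacEntry_of_ne s u h.symm, hs, br_swap (u i), neg_sq]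

lemma mul_sum_jacEntry_conf (s : A ⊕ B → A ⊕ B → ℂ) {ε : ℂ} (hε : ε ≠ 0) (x : A → ℂ)
    (y : B → ℂ × ℂ) (i : A) (hsc : scatEq s (conf ε x y) (.inl i) = 0) :
    ε * ∑ k, jacEntry s (conf ε x y) (.inl i) (.inl k) * x k = crossRes s ε x y i -
        ε * x i * ∑ j, s (.inl i) (.inr j) * (y j).2 / br (ε * x i, 1) (y j) ^ 2 := by
  have h1 : ∀ k, jacEntry s (conf ε x y) (.inl i) (.inl k) * x k =
      (if i = k then -(∑ k, s (.inl i) k * (conf ε x y k).2 /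
        br (conf ε x y (.inl i)) (conf ε x y k) ^ 2) * x i else 0) +
        s (.inl i) (.inl k) * x k / (ε * (x i - x k)) ^ 2 := by
    intro k
    split_ifs with h
    · subst h
      rw [jacEntry_self]; simp
    · rw [jacEntry_of_ne _ _ (by simpa using h), br_conf_inl_inl]; ring
  simp_rw [h1]
  rw [sum_add_distrib, Finset.sum_ite_eq univ i, if_pos (mem_univ _), sum_sum_type]
  simp_rw [br_conf_inl_inl]
  simp only [conf, elim_inl, elim_inr, mul_one]
  have h2 := scatEq_conf_inl s ε x y i
  rw [hsc] at h2
  have h3 : crossRes s ε x y i = -(ε⁻¹ * ∑ k : A, s (.inl i) (.inl k) / (x i - x k)) := by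
    linear_combination -h2
  have h4 : ∀ k, s (.inl i) (.inl k) * x k / (ε * (x i - x k)) ^ 2 =
      x i * (s (.inl i) (.inl k) / (ε * (x i - x k)) ^ 2) -
        (ε⁻¹) ^ 2 * (s (.inl i) (.inl k) / (x i - x k)) := by
    intro k
    rcases eq_or_ne (x i) (x k) with h | h
    · rw [h]; simp
    · have := sub_ne_zero.2 h
      field_simp
      ring
  simp_rw [h4]
  rw [h3, sum_sub_distrib, ← mul_sum, ← mul_sum]
  field_simp
  ring

variable {κ : Type*} {l : Filter κ} {s : κ → A ⊕ B → A ⊕ B → ℂ}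
  {s₀ : A ⊕ B → A ⊕ B → ℂ} {sL : Option A → Option A → ℂ} {sR : Option B → Option B → ℂ}
  {ε : κ → ℂ} {x : κ → A → ℂ} {x₀ : A → ℂ} {y : κ → B → ℂ × ℂ} {y₀ : B → ℂ × ℂ}

lemma tendsto_jacEntry_left (hs : ∀ i j, Tendsto (fun k => s k i j) l (𝓝 (s₀ i j)))
    (hsL : ∀ i j, i ≠ j → sL (some i) (some j) = s₀ (.inl i) (.inl j)) (hε : Tendsto ε l (𝓝 0))
    (hε0 : ∀ᶠ k in l, ε k ≠ 0) (hx : ∀ i, Tendsto (fun k => x k i) l (𝓝 (x₀ i)))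
    (hy : ∀ j, Tendsto (fun k => y k j) l (𝓝 (y₀ j))) (hne : ∀ i j, i ≠ j → x₀ i ≠ x₀ j)
    (h0 : ∀ j, br (0, 1) (y₀ j) ≠ 0) (i j : A) :
    Tendsto (fun k => ε k ^ 2 * jacEntry (s k) (conf (ε k) (x k) (y k)) (.inl i) (.inl j)) l
      (𝓝 (jacEntry sL (leftConf x₀) (some i) (some j))) := by
  have hmain : ∀ j, i ≠ j → Tendsto (fun k => ε k ^ 2 * (s k (.inl i) (.inl j) /
      br (conf (ε k) (x k) (y k) (.inl i)) (conf (ε k) (x k) (y k) (.inl j)) ^ 2)) l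
      (𝓝 (s₀ (.inl i) (.inl j) / (x₀ i - x₀ j) ^ 2)) := by
    intro j hij
    refine ((hs _ _).div (((hx i).sub (hx j)).pow 2)
      (pow_ne_zero 2 (sub_ne_zero.2 (hne i j hij)))).congr' ?_
    filter_upwards [hε0] with k hk
    rw [br_conf_inl_inl, mul_pow]
    field_simp
    rfl
  rcases eq_or_ne i j with rfl | hij
  · simp_rw [jacEntry_self]
    have h1 : ∀ k, ε k ^ 2 * -∑ j, s k (.inl i) j * (conf (ε k) (x k) (y k) j).2 /
        br (conf (ε k) (x k) (y k) (.inl i)) (conf (ε k) (x k) (y k) j) ^ 2 =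
        -(∑ j : A, ε k ^ 2 * (s k (.inl i) (.inl j) /
          br (conf (ε k) (x k) (y k) (.inl i)) (conf (ε k) (x k) (y k) (.inl j)) ^ 2) +
        ε k ^ 2 * ∑ j : B, s k (.inl i) (.inr j) * (y k j).2 /
          br (conf (ε k) (x k) (y k) (.inl i)) (y k j) ^ 2) := by
      intro k
      rw [sum_sum_type, ← mul_sum, mul_neg, ← mul_add]
      simp [conf]
    simp_rw [h1]
    have h2 : -∑ k, sL (some i) k * (leftConf x₀ k).2 / br (leftConf x₀ (some i)) (leftConf x₀ k) ^ 2
        = -(∑ j : A, s₀ (.inl i) (.inl j) / (x₀ i - x₀ j) ^ 2 + 0 ^ 2 *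
          ∑ j : B, s₀ (.inl i) (.inr j) * (y₀ j).2 / br (0, 1) (y₀ j) ^ 2) := by
      rw [sum_option]
      simp only [leftConf, elim_none, elim_some, mul_zero, zero_div, zero_add,
        mul_one, br, ne_eq, OfNat.ofNat_ne_zero, not_false_eq_true, zero_pow, zero_mul, add_zero,
        one_mul]
      congr 1
      refine sum_congr rfl fun j _ => ?_
      rcases eq_or_ne i j with rfl | h
      · simp
      · rw [hsL i j h]
    rw [h2]
    refine ((tendsto_finsetSum _ fun j _ => ?_).add ((hε.pow 2).mul
      (tendsto_finsetSum _ fun j _ => ?_))).neg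
    · rcases eq_or_ne i j with rfl | h
      · simpa [br_self] using tendsto_const_nhds
      · exact hmain j h
    · exact ((hs _ _).mul ((continuous_snd.tendsto _).comp (hy j))).div
        ((tendsto_br (tendsto_conf_inl hε hx i) (hy j)).pow 2) (pow_ne_zero 2 (h0 j))
  · have hij' : (inl i : A ⊕ B) ≠ .inl j := by simpa using hij
    simp_rw [fun k => jacEntry_of_ne (s k) (conf (ε k) (x k) (y k)) hij']
    rw [jacEntry_of_ne _ _ (by simpa using hij), hsL i j hij]
    simpa [leftConf, br] using hmain j hij

lemma tendsto_jacEntry_cross (hs : ∀ i j, Tendsto (fun k => s k i j) l (𝓝 (s₀ i j)))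
    (hε : Tendsto ε l (𝓝 0)) (hx : ∀ i, Tendsto (fun k => x k i) l (𝓝 (x₀ i)))
    (hy : ∀ j, Tendsto (fun k => y k j) l (𝓝 (y₀ j)))
    (h0 : ∀ j, br (0, 1) (y₀ j) ≠ 0) (i : A) (j : B) :
    Tendsto (fun k => jacEntry (s k) (conf (ε k) (x k) (y k)) (.inr j) (.inl i)) l
      (𝓝 (s₀ (.inr j) (.inl i) / br (y₀ j) (0, 1) ^ 2)) := by
  have hij' : (inr j : A ⊕ B) ≠ .inl i := by simp
  simp_rw [fun k => jacEntry_of_ne (s k) (conf (ε k) (x k) (y k)) hij']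
  refine (hs _ _).div ((tendsto_br (hy j) (tendsto_conf_inl hε hx i)).pow 2) (pow_ne_zero 2 ?_)
  rw [br_swap]
  exact neg_ne_zero.2 (h0 j)

lemma tendsto_jacEntry_right (hs : ∀ i j, Tendsto (fun k => s k i j) l (𝓝 (s₀ i j)))
    (hsR : ∀ i j, i ≠ j → sR (some i) (some j) = s₀ (.inr i) (.inr j))
    (hsN : ∀ j, sR (some j) none = ∑ i, s₀ (.inr j) (.inl i))
    (hε : Tendsto ε l (𝓝 0)) (hx : ∀ i, Tendsto (fun k => x k i) l (𝓝 (x₀ i)))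
    (hy : ∀ j, Tendsto (fun k => y k j) l (𝓝 (y₀ j)))
    (h0 : ∀ j, br (0, 1) (y₀ j) ≠ 0) (hne : ∀ i j, i ≠ j → br (y₀ i) (y₀ j) ≠ 0) (i j : B) :
    Tendsto (fun k => jacEntry (s k) (conf (ε k) (x k) (y k)) (.inr i) (.inr j)) l
      (𝓝 (jacEntry sR (rightConf y₀) (some i) (some j))) := by
  have h0' : br (y₀ i) (0, 1) ≠ 0 := by
    rw [br_swap]; exact neg_ne_zero.2 (h0 i)
  rcases eq_or_ne i j with rfl | hij
  · simp_rw [jacEntry_self, sum_sum_type]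
    rw [sum_option]
    have h2 : sR (some i) none * (rightConf y₀ none).2 /
        br (rightConf y₀ (some i)) (rightConf y₀ none) ^ 2 =
        ∑ j : A, s₀ (.inr i) (.inl j) * 1 / br (y₀ i) (0, 1) ^ 2 := by
      simp [hsN, sum_div, rightConf]
    have h3 : ∑ j, sR (some i) (some j) * (rightConf y₀ (some j)).2 /
        br (rightConf y₀ (some i)) (rightConf y₀ (some j)) ^ 2 =
        ∑ j : B, s₀ (.inr i) (.inr j) * (y₀ j).2 / br (y₀ i) (y₀ j) ^ 2 := by
      refine sum_congr rfl fun j _ => ?_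
      rcases eq_or_ne i j with rfl | h
      · simp [br_self]
      · rw [hsR i j h]; rfl
    rw [h2, h3]
    refine ((tendsto_finsetSum _ fun j _ => ?_).add (tendsto_finsetSum _ fun j _ => ?_)).neg
    · exact ((hs _ _).mul ((continuous_snd.tendsto _).comp (tendsto_conf_inl hε hx j))).div
        ((tendsto_br (hy i) (tendsto_conf_inl hε hx j)).pow 2) (pow_ne_zero 2 h0')
    · rcases eq_or_ne i j with rfl | h
      · simpa [br_self] using tendsto_const_nhds
      · exact ((hs _ _).mul ((continuous_snd.tendsto _).comp (hy j))).div
          ((tendsto_br (hy i) (hy j)).pow 2) (pow_ne_zero 2 (hne i j h))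
  · have hij' : (inr i : A ⊕ B) ≠ .inr j := by simpa using hij
    simp_rw [fun k => jacEntry_of_ne (s k) (conf (ε k) (x k) (y k)) hij']
    rw [jacEntry_of_ne _ _ (by simpa using hij), hsR i j hij]
    exact (hs _ _).div ((tendsto_br (hy i) (hy j)).pow 2) (pow_ne_zero 2 (hne i j hij))

/-- The pairings of the two sides; the node of the complement collects the pairings of the
channel. -/
structure SidePairings (s₀ : A ⊕ B → A ⊕ B → ℂ) (sL : Option A → Option A → ℂ)
    (sR : Option B → Option B → ℂ) : Prop where
  left : ∀ i j, i ≠ j → sL (some i) (some j) = s₀ (.inl i) (.inl j)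
  right : ∀ i j, i ≠ j → sR (some i) (some j) = s₀ (.inr i) (.inr j)
  node : ∀ j, sR (some j) none = ∑ i, s₀ (.inr j) (.inl i)

/-- The block matrix of derivatives of the rescaled scattering equations (of the channel, their
`x`-combination, of the complement) with respect to `x`, `ε` and `y`. -/
def rescaledJac (s : A ⊕ B → A ⊕ B → ℂ) (ε : ℂ) (x : A → ℂ) (y : B → ℂ × ℂ) (a μ : A) (b c : B) :
    Matrix ((Off a μ ⊕ Unit) ⊕ Off b c) ((Off a μ ⊕ Unit) ⊕ Off b c) ℂ :=
  let N := jacEntry s (conf ε x y)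
  fromBlocks (fromBlocks (.of fun i k => ε ^ 2 * N (.inl i.1) (.inl k.1))
      (.of fun i _ => ε * ∑ k, N (.inl i.1) (.inl k) * x k)
      (.of fun _ k => ε ^ 2 * ∑ i, x i * N (.inl i) (.inl k.1))
      (.of fun _ _ => ε * ∑ i, x i * ∑ k, N (.inl i) (.inl k) * x k))
    (.of fun i j => Sum.elim (fun i => ε * N (.inl i.1) (.inr j.1))
      (fun _ => ε * ∑ i, x i * N (.inl i) (.inr j.1)) i)
    (.of fun j i => Sum.elim (fun i => ε * N (.inr j.1) (.inl i.1))
      (fun _ => ∑ i, N (.inr j.1) (.inl i) * x i) i)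
    (.of fun j k => N (.inr j.1) (.inr k.1))

lemma det_rescale {F F' : Type*} [Fintype F] [DecidableEq F] [Fintype F'] [DecidableEq F'] (ε : ℂ)
    (x : F → ℂ) (N : Matrix ((F ⊕ Unit) ⊕ F') ((F ⊕ Unit) ⊕ F') ℂ) :
    (fromBlocks (fromBlocks (.of fun i k => ε ^ 2 * N (.inl (.inl i)) (.inl (.inl k)))
        (.of fun i u => ε * ((∑ k, N (.inl (.inl i)) (.inl (.inl k)) * x k) +
          N (.inl (.inl i)) (.inl (.inr u))))
        (.of fun u k => ε ^ 2 * ((∑ i, x i * N (.inl (.inl i)) (.inl (.inl k))) +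
          N (.inl (.inr u)) (.inl (.inl k))))
        (.of fun u v => ε * ((∑ i, x i * ((∑ k, N (.inl (.inl i)) (.inl (.inl k)) * x k) +
          N (.inl (.inl i)) (.inl (.inr v)))) + ((∑ k, N (.inl (.inr u)) (.inl (.inl k)) * x k) +
          N (.inl (.inr u)) (.inl (.inr v))))))
      (.of fun i j => Sum.elim (fun i => ε * N (.inl (.inl i)) (.inr j))
        (fun u => ε * ((∑ i, x i * N (.inl (.inl i)) (.inr j)) + N (.inl (.inr u)) (.inr j))) i)
      (.of fun j i => Sum.elim (fun i => ε * N (.inr j) (.inl (.inl i)))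
        (fun u => (∑ i, N (.inr j) (.inl (.inl i)) * x i) + N (.inr j) (.inl (.inr u))) i)
      (.of fun j k => N (.inr j) (.inr k))).det = ε ^ (2 * card F + 1) * N.det := by
  let L : Matrix ((F ⊕ Unit) ⊕ F') ((F ⊕ Unit) ⊕ F') ℂ :=
    fromBlocks (fromBlocks (Matrix.diagonal fun _ => ε) 0
      (.of fun _ i => ε * x i) (Matrix.diagonal fun _ => ε)) 0 0 1
  let T : Matrix ((F ⊕ Unit) ⊕ F') ((F ⊕ Unit) ⊕ F') ℂ :=
    fromBlocks (fromBlocks (Matrix.diagonal fun _ => ε) (.of fun i _ => x i) 0 1) 0 0 1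
  have hL : L.det = ε ^ (card F + 1) := by
    simp only [L, Matrix.det_fromBlocks_zero₂₁, Matrix.det_fromBlocks_zero₁₂, Matrix.det_diagonal,
      det_one, mul_one, Finset.prod_const, card_univ, Fintype.card_unit, pow_succ,
      pow_zero, one_mul]
  have hT : T.det = ε ^ card F := by
    simp only [T, Matrix.det_fromBlocks_zero₂₁, Matrix.det_diagonal,
      det_one, mul_one, Finset.prod_const, card_univ]
  have h1 : ∀ (g : (F ⊕ Unit) ⊕ F' → ℂ) (i : F), ∑ r, L (.inl (.inl i)) r * g r =
      ε * g (.inl (.inl i)) := fun g i => by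
    simp [L, sum_sum_type, Matrix.diagonal_apply]
  have h2 : ∀ (g : (F ⊕ Unit) ⊕ F' → ℂ) (i : Unit), ∑ r, L (.inl (.inr i)) r * g r =
      ε * ((∑ i, x i * g (.inl (.inl i))) + g (.inl (.inr i))) := fun g i => by
    simp [L, sum_sum_type, mul_add, mul_sum, mul_assoc]
  have h3 : ∀ (g : (F ⊕ Unit) ⊕ F' → ℂ) (i : F'), ∑ r, L (.inr i) r * g r =
      g (.inr i) := fun g i => by
    simp [L, sum_sum_type, Matrix.one_apply]
  have k1 : ∀ (g : (F ⊕ Unit) ⊕ F' → ℂ) (i : F), ∑ r, g r * T r (.inl (.inl i)) =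
      ε * g (.inl (.inl i)) := fun g i => by
    simp [T, sum_sum_type, Matrix.diagonal_apply, mul_comm]
  have k2 : ∀ (g : (F ⊕ Unit) ⊕ F' → ℂ) (i : Unit), ∑ r, g r * T r (.inl (.inr i)) =
      (∑ i, g (.inl (.inl i)) * x i) + g (.inl (.inr i)) := fun g i => by
    simp [T, sum_sum_type]
  have k3 : ∀ (g : (F ⊕ Unit) ⊕ F' → ℂ) (i : F'), ∑ r, g r * T r (.inr i) =
      g (.inr i) := fun g i => by
    simp [T, sum_sum_type, Matrix.one_apply]
  rw [show ε ^ (2 * card F + 1) * N.det = (L * (N * T)).det by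
    rw [Matrix.det_mul, Matrix.det_mul, hL, hT]; ring]
  congr 1
  ext p q
  simp only [Matrix.mul_apply]
  rcases p with (i | i) | j <;> rcases q with (k | k) | k <;>
    simp only [Matrix.fromBlocks_apply₁₁, Matrix.fromBlocks_apply₁₂,
      Matrix.fromBlocks_apply₂₁, Matrix.fromBlocks_apply₂₂, of_apply, elim_inl,
      elim_inr, h1, h2, h3, k1, k2, k3] <;>
    simp only [pow_two, mul_assoc, mul_add, mul_sum, mul_left_comm _ ε]

lemma det_rescaledJac (s : A ⊕ B → A ⊕ B → ℂ) (ε : ℂ) (x : A → ℂ) (y : B → ℂ × ℂ) {a μ : A}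
    {b c : B} (haμ : a ≠ μ) (ha : x a = 0) (hμ : x μ = 1) :
    (rescaledJac s ε x y a μ b c).det = ε ^ (2 * card (Off a μ) + 1) *
        jac s ⟨.inl a, .inr b, .inr c⟩ (conf ε x y) := by
  have hN : ∀ p q, jacMat s ⟨.inl a, .inr b, .inr c⟩ (conf ε x y) p q =
      jacEntry s (conf ε x y) p.1 q.1 := jacMat_apply _ _ _
  rw [jac_eq_det, ← det_submatrix_equiv_self
    (Equiv.ofBijective _ (freeSum_bijective a μ b c haμ)), ← det_rescale ε (fun i => x i.1)]
  have hsum : ∀ f : A → ℂ, ∑ i, x i * f i =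
      (∑ i : Off a μ, x i.1 * f i.1) + f μ := fun f => by
    rw [sum_eq_sum_free a μ _ (by simp [ha]), hμ, one_mul]
  have hsum' : ∀ f : A → ℂ, ∑ i, f i * x i =
      (∑ i : Off a μ, f i.1 * x i.1) + f μ := fun f => by
    simp_rw [mul_comm (f _)]; exact hsum f
  simp only [rescaledJac, hsum, hsum', submatrix_apply, Equiv.ofBijective_apply, hN, freeSum]

lemma tendsto_jac_conf (hs : ∀ i j, Tendsto (fun k => s k i j) l (𝓝 (s₀ i j)))
    (hsym : ∀ k i j, s k i j = s k j i) (hS : SidePairings s₀ sL sR) (hε : Tendsto ε l (𝓝 0))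
    (hε0 : ∀ᶠ k in l, ε k ≠ 0) (hx : ∀ i, Tendsto (fun k => x k i) l (𝓝 (x₀ i)))
    (hy : ∀ j, Tendsto (fun k => y k j) l (𝓝 (y₀ j))) (hneL : ∀ i j, i ≠ j → x₀ i ≠ x₀ j)
    (h0 : ∀ j, br (0, 1) (y₀ j) ≠ 0) (hneR : ∀ i j, i ≠ j → br (y₀ i) (y₀ j) ≠ 0) {a μ : A}
    {b c : B} (haμ : a ≠ μ) (ha : ∀ k, x k a = 0) (hμ : ∀ k, x k μ = 1)
    (hsc : ∀ᶠ k in l, ∀ i, i ≠ a → scatEq (s k) (conf (ε k) (x k) (y k)) (.inl i) = 0) :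
    Tendsto (fun k => ε k ^ (2 * card (Off a μ) + 1) *
        jac (s k) ⟨.inl a, .inr b, .inr c⟩ (conf (ε k) (x k) (y k))) l
      (𝓝 ((∑ i, x₀ i * crossRes s₀ 0 x₀ y₀ i) * jac sL ⟨some a, some μ, none⟩ (leftConf x₀) *
        jac sR ⟨none, some b, some c⟩ (rightConf y₀))) := by
  simp_rw [← fun k => det_rescaledJac (s k) (ε k) (x k) (y k) (b := b) (c := c) haμ (ha k) (hμ k)]
  let F := Off a μ
  let F' := Off b c
  let M₀ : Matrix ((F ⊕ Unit) ⊕ F') ((F ⊕ Unit) ⊕ F') ℂ := fromBlocks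
      (fromBlocks (.of fun i k => jacEntry sL (leftConf x₀) (some i.1) (some k.1))
        (.of fun i _ => crossRes s₀ 0 x₀ y₀ i.1) 0
        (Matrix.diagonal fun _ => ∑ i, x₀ i * crossRes s₀ 0 x₀ y₀ i)) 0
      (.of fun j i => Sum.elim (fun _ => 0)
        (fun _ => ∑ i, s₀ (.inr j.1) (.inl i) / br (y₀ j.1) (0, 1) ^ 2 * x₀ i) i)
      (.of fun j k => jacEntry sR (rightConf y₀) (some j.1) (some k.1))
  have hdet : M₀.det = (∑ i, x₀ i * crossRes s₀ 0 x₀ y₀ i) *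
      jac sL ⟨some a, some μ, none⟩ (leftConf x₀) * jac sR ⟨none, some b, some c⟩ (rightConf y₀) := by
    simp only [M₀, Matrix.det_fromBlocks_zero₁₂, Matrix.det_fromBlocks_zero₂₁, Matrix.det_diagonal,
      Finset.univ_unique, Finset.prod_singleton]
    have hLe : ∀ i : A, (⟨some a, some μ, none⟩ : Gauge (Option A)).Free (some i) ↔
        i ≠ a ∧ i ≠ μ := fun i => by simp [Gauge.Free]
    have hRe : ∀ j : B, (⟨none, some b, some c⟩ : Gauge (Option B)).Free (some j) ↔
        j ≠ b ∧ j ≠ c := fun j => by simp [Gauge.Free]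
    let eL : F ≃ {i // (⟨some a, some μ, none⟩ : Gauge (Option A)).Free i} :=
      Equiv.ofBijective (fun i => ⟨some i.1, (hLe _).2 i.2⟩) ⟨fun i j h =>
        Subtype.ext (by simpa [Subtype.ext_iff] using h), by
        rintro ⟨_ | i, hi⟩
        · exact absurd rfl hi.2.2
        · exact ⟨⟨i, (hLe i).1 hi⟩, rfl⟩⟩
    let eR : F' ≃ {i // (⟨none, some b, some c⟩ : Gauge (Option B)).Free i} :=
      Equiv.ofBijective (fun i => ⟨some i.1, (hRe _).2 i.2⟩) ⟨fun i j h =>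
        Subtype.ext (by simpa [Subtype.ext_iff] using h), by
        rintro ⟨_ | i, hi⟩
        · exact absurd rfl hi.1
        · exact ⟨⟨i, (hRe i).1 hi⟩, rfl⟩⟩
    rw [jac_eq_det, jac_eq_det, ← det_submatrix_equiv_self eL,
      ← det_submatrix_equiv_self eR, mul_comm (Matrix.det _)]
    congr 3
    · ext i j
      exact (jacMat_apply sL _ (leftConf x₀) (eL i) (eL j)).symm
    · ext i j
      exact (jacMat_apply sR _ (rightConf y₀) (eR i) (eR j)).symm
  rw [← hdet]
  have hH := tendsto_crossRes hs hε hx hy h0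
  have hrow : ∀ i, i ≠ a → Tendsto (fun k => ε k * ∑ q, jacEntry (s k) (conf (ε k) (x k) (y k))
      (.inl i) (.inl q) * x k q) l (𝓝 (crossRes s₀ 0 x₀ y₀ i)) := by
    intro i hi
    have h1 : Tendsto (fun k => ε k * x k i * ∑ j, s k (.inl i) (.inr j) * (y k j).2 /
        br (ε k * x k i, 1) (y k j) ^ 2) l
        (𝓝 (0 * x₀ i * ∑ j, s₀ (.inl i) (.inr j) * (y₀ j).2 / br (0, 1) (y₀ j) ^ 2)) :=
      (hε.mul (hx i)).mul (tendsto_finsetSum _ fun j _ =>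
        ((hs _ _).mul ((continuous_snd.tendsto _).comp (hy j))).div
          ((tendsto_br (tendsto_conf_inl (y := y) hε hx i) (hy j)).pow 2) (pow_ne_zero 2 (h0 j)))
    have h2 := (hH i).sub h1
    rw [zero_mul, zero_mul, sub_zero] at h2
    refine h2.congr' ?_
    filter_upwards [hsc, hε0] with k hk hk0
    exact (mul_sum_jacEntry_conf (s k) hk0 (x k) (y k) i (hk i hi)).symm
  have hcr := tendsto_jacEntry_cross hs hε hx hy h0
  have hcr' : ∀ i j, Tendsto (fun k => jacEntry (s k) (conf (ε k) (x k) (y k)) (.inl i) (.inr j)) l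
      (𝓝 (s₀ (.inr j) (.inl i) / br (y₀ j) (0, 1) ^ 2)) := fun i j => by
    simp_rw [fun k => jacEntry_symm (hsym k) (conf (ε k) (x k) (y k)) (.inl i) (.inr j)]
    exact hcr i j
  refine tendsto_det ?_
  rintro ((i | i) | j) ((k | k) | k) <;>
    simp only [rescaledJac, M₀, Matrix.fromBlocks_apply₁₁, Matrix.fromBlocks_apply₁₂,
        Matrix.fromBlocks_apply₂₁, Matrix.fromBlocks_apply₂₂, of_apply, elim_inl,
        elim_inr, Matrix.zero_apply, Matrix.diagonal_apply_eq]
  · exact tendsto_jacEntry_left hs hS.left hε hε0 hx hy hneL h0 i.1 k.1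
  · exact hrow i.1 i.2.1
  · simpa using hε.mul (hcr' i.1 k.1)
  · have h := hε.mul (hrow k.1 k.2.1)
    rw [zero_mul] at h
    refine h.congr fun q => ?_
    rw [pow_two, mul_assoc]
    congr 2
    refine sum_congr rfl fun p _ => ?_
    rw [jacEntry_symm (hsym q), mul_comm]
  · have h : Tendsto (fun q => ∑ i, x q i * (ε q * ∑ p, jacEntry (s q) (conf (ε q) (x q) (y q))
      (.inl i) (.inl p) * x q p)) l (𝓝 (∑ i, x₀ i * crossRes s₀ 0 x₀ y₀ i)) := by
      refine tendsto_finsetSum _ fun i _ => ?_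
      rcases eq_or_ne i a with rfl | hi
      · rcases l.eq_or_neBot with rfl | hl
        · exact tendsto_bot
        · have : x₀ i = 0 := tendsto_nhds_unique_of_eventuallyEq (hx i) tendsto_const_nhds
            (Eventually.of_forall ha)
          simp [ha, this]
      · exact (hx i).mul (hrow i hi)
    refine h.congr fun q => ?_
    rw [mul_sum]
    exact sum_congr rfl fun p _ => by ring
  · have h := hε.mul (tendsto_finsetSum univ fun i _ => (hx i).mul (hcr' i k.1))
    rw [zero_mul] at h
    exact h
  · simpa using hε.mul (hcr k.1 j.1)
  · exact tendsto_finsetSum _ fun i _ => (hcr i j.1).mul (hx i)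
  · exact tendsto_jacEntry_right hs hS.right hS.node hε hx hy h0 hneR j.1 k.1

/-! ### Rescaled scattering equations -/

/-- The positions `x` in the channel, with `x_a = 0`, `x_μ = 1`. -/
def chanPts (a μ : A) (ξ : Off a μ → ℂ) (i : A) : ℂ :=
  if h : i ≠ a ∧ i ≠ μ then ξ ⟨i, h⟩ else if i = a then 0 else 1

/-- The points outside of the channel, with `b` at `1` and `c` at `∞`. -/
def compPts (b c : B) (ζ : Off b c → ℂ) (j : B) : ℂ × ℂ :=
  if h : j ≠ b ∧ j ≠ c then (ζ ⟨j, h⟩, 1) else if j = b then (1, 1) else (1, 0)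

lemma chanPts_left (a μ : A) (ξ : Off a μ → ℂ) : chanPts a μ ξ a = 0 := by
  simp [chanPts]

lemma chanPts_right {a μ : A} (h : a ≠ μ) (ξ : Off a μ → ℂ) :
    chanPts a μ ξ μ = 1 := by
  simp [chanPts, h.symm]

lemma chanPts_free (a μ : A) (ξ : Off a μ → ℂ) (i : Off a μ) :
    chanPts a μ ξ i.1 = ξ i := by
  simp [chanPts, i.2]

lemma compPts_left (b c : B) (ζ : Off b c → ℂ) : compPts b c ζ b = (1, 1) := by
  simp [compPts]

lemma compPts_right {b c : B} (h : b ≠ c) (ζ : Off b c → ℂ) :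
    compPts b c ζ c = (1, 0) := by
  simp [compPts, h.symm]

lemma compPts_free (b c : B) (ζ : Off b c → ℂ) (j : Off b c) :
    compPts b c ζ j.1 = (ζ j, 1) := by
  simp [compPts, j.2]

lemma chanPts_restrict {a μ : A} {x : A → ℂ} (ha : x a = 0) (hμ : x μ = 1) :
    chanPts a μ (fun i => x i.1) = x := by
  ext i
  unfold chanPts
  split_ifs with h h'
  · rfl
  · rw [h', ha]
  · have : i = μ := by tauto
    rw [this, hμ]

lemma compPts_restrict {b c : B} {y : B → ℂ × ℂ} (hb : y b = (1, 1)) (hc : y c = (1, 0))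
    (hf : ∀ j, j ≠ c → (y j).2 = 1) : compPts b c (fun j => (y j.1).1) = y := by
  ext1 j
  unfold compPts
  split_ifs with h h'
  · exact Prod.ext rfl (hf j h.2).symm
  · rw [h', hb]
  · have : j = c := by tauto
    rw [this, hc]

lemma compPts_snd (b c : B) (ζ : Off b c → ℂ) {j : B} (h : j ≠ c) :
    (compPts b c ζ j).2 = 1 := by
  unfold compPts
  split_ifs with h1 h2 <;> simp_all

lemma continuous_chanPts (a μ : A) (i : A) : Continuous fun ξ => chanPts a μ ξ i := by
  unfold chanPts
  split_ifs <;> fun_prop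

lemma continuous_compPts (b c : B) (j : B) : Continuous fun ζ => compPts b c ζ j := by
  unfold compPts
  split_ifs <;> fun_prop

/-- The points of a degenerating configuration and of its limit are distinct. -/
def ConfDistinct (ε : ℂ) (x : A → ℂ) (y : B → ℂ × ℂ) : Prop :=
  (∀ i j, i ≠ j → x i ≠ x j) ∧ (∀ i j, br (ε * x i, 1) (y j) ≠ 0) ∧
    ∀ i j, i ≠ j → br (y i) (y j) ≠ 0

/-- The sum of the pairings in the channel. -/
def chanSum (s : A ⊕ B → A ⊕ B → ℂ) : ℂ := (∑ i : A, ∑ k ∈ univ.erase i, s (.inl i) (.inl k)) / 2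

lemma sum_mul_sum_div (s : A ⊕ B → A ⊕ B → ℂ) (hsym : ∀ i j, s i j = s j i) {x : A → ℂ}
    (hx : ∀ i j, i ≠ j → x i ≠ x j) :
    ∑ i, x i * ∑ k, s (.inl i) (.inl k) / (x i - x k) = chanSum s := by
  have h1 : ∑ i, x i * ∑ k, s (.inl i) (.inl k) / (x i - x k) =
      ∑ i, ∑ k, x i * (s (.inl i) (.inl k) / (x i - x k)) := by simp_rw [mul_sum]
  have h2 : ∑ i, ∑ k, x i * (s (.inl i) (.inl k) / (x i - x k)) =
      ∑ i, ∑ k, x k * (s (.inl i) (.inl k) / (x k - x i)) := by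
    rw [sum_comm]
    refine sum_congr rfl fun i _ => sum_congr rfl fun k _ => ?_
    rw [hsym]
  have h3 : ∑ i, ∑ k, x i * (s (.inl i) (.inl k) / (x i - x k)) +
      ∑ i, ∑ k, x k * (s (.inl i) (.inl k) / (x k - x i)) =
      ∑ i : A, ∑ k ∈ univ.erase i, s (.inl i) (.inl k) := by
    rw [← sum_add_distrib]
    refine sum_congr rfl fun i _ => ?_
    rw [← sum_add_distrib, ← add_sum_erase _ _ (mem_univ i)]
    simp only [sub_self, div_zero, mul_zero, add_zero, zero_add]
    refine sum_congr rfl fun k hk => ?_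
    have h4 : x i - x k ≠ 0 := sub_ne_zero.2 (hx i k (ne_of_mem_erase hk).symm)
    rw [← neg_sub (x i) (x k)]
    field_simp
    ring
  rw [h1, chanSum, ← h3, ← h2]
  ring

/-- The rescaled scattering equations in the unknowns `ε`, `x`, `y`. -/
def rescaledEqs (s : A ⊕ B → A ⊕ B → ℂ) (a μ : A) (b c : B)
    (z : ℂ × (Off a μ → ℂ) × (Off b c → ℂ)) :
    ℂ × (Off a μ → ℂ) × (Off b c → ℂ) :=
  let x := chanPts a μ z.2.1
  let y := compPts b c z.2.2
  (chanSum s + z.1 * ∑ i, x i * crossRes s z.1 x y i,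
    fun i => (∑ k : A, s (.inl i.1) (.inl k) / (x i.1 - x k)) + z.1 * crossRes s z.1 x y i.1,
    fun j => scatEq s (conf z.1 x y) (.inr j.1))

lemma mem_Sols_conf {s : A ⊕ B → A ⊕ B → ℂ} (hsym : ∀ i j, s i j = s j i) {a μ : A} {b c : B}
    (haμ : a ≠ μ) (hbc : b ≠ c) {z : ℂ × (Off a μ → ℂ) × (Off b c → ℂ)} (hz : z.1 ≠ 0)
    (hd : ConfDistinct z.1 (chanPts a μ z.2.1) (compPts b c z.2.2)) :
    conf z.1 (chanPts a μ z.2.1) (compPts b c z.2.2) ∈ Sols s ⟨.inl a, .inr b, .inr c⟩ ↔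
      rescaledEqs s a μ b c z = 0 := by
  set x := chanPts a μ z.2.1 with hx
  set y := compPts b c z.2.2 with hy
  obtain ⟨hd1, hd2, hd3⟩ := hd
  have hsc : ∀ i, scatEq s (conf z.1 x y) (.inl i) = 0 ↔
      (∑ k : A, s (.inl i) (.inl k) / (x i - x k)) + z.1 * crossRes s z.1 x y i = 0 := by
    intro i
    rw [scatEq_conf_inl, ← mul_right_inj' hz, mul_zero, mul_add, mul_inv_cancel_left₀ hz]
  have hG1 : chanSum s + z.1 * ∑ i, x i * crossRes s z.1 x y i =
      ∑ i, x i * ((∑ k : A, s (.inl i) (.inl k) / (x i - x k)) + z.1 * crossRes s z.1 x y i) := by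
    rw [← sum_mul_sum_div s hsym hd1, mul_sum, ← sum_add_distrib]
    exact sum_congr rfl fun i _ => by ring
  have hxa : x a = 0 := chanPts_left a μ _
  have hxμ : x μ = 1 := chanPts_right haμ _
  have hrhs : rescaledEqs s a μ b c z = 0 ↔ (∀ i, i ≠ a → scatEq s (conf z.1 x y) (.inl i) = 0) ∧
      ∀ j : Off b c, scatEq s (conf z.1 x y) (.inr j.1) = 0 := by
    have : rescaledEqs s a μ b c z = (chanSum s + z.1 * ∑ i, x i * crossRes s z.1 x y i,
      fun i => (∑ k : A, s (.inl i.1) (.inl k) / (x i.1 - x k)) + z.1 * crossRes s z.1 x y i.1,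
      fun j => scatEq s (conf z.1 x y) (.inr j.1)) := rfl
    rw [this, hG1]
    simp only [Prod.mk_eq_zero, funext_iff, Pi.zero_apply, hsc]
    constructor
    · rintro ⟨h1, h2, h3⟩
      refine ⟨fun i hi => ?_, h3⟩
      by_cases hiμ : i = μ
      · rw [sum_eq_sum_free a μ _ (by simp [hxa])] at h1
        rw [sum_eq_zero fun i _ => by rw [h2 i, mul_zero], zero_add, hxμ, one_mul] at h1
        rw [hiμ, hxμ, h1]
      · exact h2 ⟨i, hi, hiμ⟩
    · rintro ⟨h1, h2⟩
      refine ⟨sum_eq_zero fun i _ => ?_, fun i => h1 i.1 i.2.1, h2⟩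
      rcases eq_or_ne i a with rfl | hi
      · rw [hxa, zero_mul]
      · rw [h1 i hi, mul_zero]
  rw [hrhs]
  constructor
  · rintro ⟨-, -, h⟩
    exact ⟨fun i hi => h _ (by simp [Gauge.Free, hi]), fun j => h _ (by simp [Gauge.Free, j.2])⟩
  · rintro ⟨h1, h2⟩
    refine ⟨⟨?_, ?_, ?_, ?_⟩, ?_, ?_⟩
    · simp [conf, hxa]
    · exact compPts_left b c _
    · exact compPts_right hbc _
    · rintro (i | j) h
      · rfl
      · exact compPts_snd b c _ (by simpa using h)
    · rintro (i | i) (j | j) hij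
      · rw [br_conf_inl_inl]
        exact mul_ne_zero hz (sub_ne_zero.2 (hd1 i j (by simpa using hij)))
      · exact hd2 i j
      · rw [br_swap]
        exact neg_ne_zero.2 (hd2 j i)
      · exact hd3 i j (by simpa using hij)
    · rintro (i | j) h
      · exact h1 i (by simpa [Gauge.Free] using h)
      · exact h2 ⟨j, by simpa [Gauge.Free] using h⟩

lemma confDistinct_of_mem_Sols {s : A ⊕ B → A ⊕ B → ℂ} {g : Gauge (A ⊕ B)} {ε : ℂ} {x : A → ℂ}
    {y : B → ℂ × ℂ} (h : conf ε x y ∈ Sols s g) : ConfDistinct ε x y := by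
  refine ⟨fun i j hij hx => h.2.1 (.inl i) (.inl j) (by simpa using hij) ?_, fun i j =>
    h.2.1 (.inl i) (.inr j) (by simp), fun i j hij => h.2.1 (.inr i) (.inr j) (by simpa using hij)⟩
  rw [br_conf_inl_inl, hx, sub_self, mul_zero]

variable {a μ : A} {b c : B}

lemma mem_Sols_sides (hS : SidePairings s₀ sL sR) (haμ : a ≠ μ) (hbc : b ≠ c) (hst : chanSum s₀ = 0)
    {ξ : Off a μ → ℂ} {ζ : Off b c → ℂ} :
    ConfDistinct 0 (chanPts a μ ξ) (compPts b c ζ) ∧ rescaledEqs s₀ a μ b c (0, ξ, ζ) = 0 ↔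
      leftConf (chanPts a μ ξ) ∈ Sols sL ⟨some a, some μ, none⟩ ∧
        rightConf (compPts b c ζ) ∈ Sols sR ⟨none, some b, some c⟩ := by
  have hG : rescaledEqs s₀ a μ b c (0, ξ, ζ) = 0 ↔
      (∀ i : Off a μ, scatEq sL (leftConf (chanPts a μ ξ)) (some i.1) = 0) ∧
        ∀ j : Off b c, scatEq sR (rightConf (compPts b c ζ)) (some j.1) = 0 := by
    simp only [rescaledEqs, scatEq_leftConf hS.left, hst,
      scatEq_rightConf hS.right hS.node (chanPts a μ ξ), zero_mul, add_zero, Prod.mk_eq_zero, true_and,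
      funext_iff, Pi.zero_apply]
  rw [hG]
  constructor
  · rintro ⟨⟨h1, h2, h3⟩, h4, h5⟩
    refine ⟨⟨⟨?_, ?_, rfl, ?_⟩, ?_, ?_⟩, ⟨⟨rfl, ?_, ?_, ?_⟩, ?_, ?_⟩⟩
    · simp [leftConf, chanPts_left]
    · simp [leftConf, chanPts_right haμ]
    · rintro (_ | i) h
      · exact absurd rfl h
      · rfl
    · rintro (_ | i) (_ | j) h
      · exact absurd rfl h
      · simp [leftConf, br]
      · simp [leftConf, br]
      · simpa [leftConf, br, sub_eq_zero] using h1 i j (by simpa using h)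
    · rintro (_ | i) h
      · exact absurd rfl h.2.2
      · exact h4 ⟨i, by simpa [Gauge.Free] using h⟩
    · exact compPts_left b c _
    · exact compPts_right hbc _
    · rintro (_ | j) h
      · rfl
      · exact compPts_snd b c _ (by simpa using h)
    · rintro (_ | i) (_ | j) h
      · exact absurd rfl h
      · simpa [rightConf] using h2 a j
      · rw [br_swap]
        simpa [rightConf] using h2 a i
      · exact h3 i j (by simpa using h)
    · rintro (_ | j) h
      · exact absurd rfl h.1
      · exact h5 ⟨j, by simpa [Gauge.Free] using h⟩
  · rintro ⟨⟨-, h1, h2⟩, -, h3, h4⟩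
    refine ⟨⟨?_, ?_, ?_⟩, ?_, ?_⟩
    · intro i j hij
      have := h1 (some i) (some j) (by simpa using hij)
      simpa [leftConf, br, sub_eq_zero] using this
    · intro i j
      rw [zero_mul]
      exact h3 none (some j) (by simp)
    · exact fun i j hij => h3 (some i) (some j) (by simpa using hij)
    · exact fun i => h2 _ (by simp [Gauge.Free, i.2])
    · exact fun j => h4 _ (by simp [Gauge.Free, j.2])

lemma leftConf_of_mem_Sols {v : Config (Option A)} (hv : v ∈ Sols sL ⟨some a, some μ, none⟩) :
    leftConf (chanPts a μ fun i => (v (some i.1)).1) = v := by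
  obtain ⟨⟨h0, h1, h2, h3⟩, -⟩ := hv
  rw [chanPts_restrict (x := fun i => (v (some i)).1) (by simp_all) (by simp_all)]
  ext1 o
  cases o with
  | none => exact h2.symm
  | some i => exact Prod.ext rfl (h3 _ (by simp)).symm

lemma rightConf_of_mem_Sols {w : Config (Option B)} (hw : w ∈ Sols sR ⟨none, some b, some c⟩) :
    rightConf (compPts b c fun j => (w (some j.1)).1) = w := by
  obtain ⟨⟨h0, h1, h2, h3⟩, -⟩ := hw
  rw [compPts_restrict (y := fun j => w (some j)) h1 h2 fun j hj => h3 _ (by simpa using hj)]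
  ext1 o
  cases o with
  | none => exact h0.symm
  | some i => rfl

lemma hasDerivAt_components {ι κ : Type*} [Fintype ι] [Fintype κ]
    {f : ℂ → ℂ × (ι → ℂ) × (κ → ℂ)} (h : HasDerivAt f 0 0) :
    Tendsto (fun t => t⁻¹ * ((f t).1 - (f 0).1)) (𝓝[≠] 0) (𝓝 0) ∧
      (∀ i, HasDerivAt (fun t => (f t).2.1 i) 0 0) ∧ ∀ i, HasDerivAt (fun t => (f t).2.2 i) 0 0 := by
  have h1 : HasDerivAt (fun t => (f t).1) 0 0 :=
    (ContinuousLinearMap.fst ℂ ℂ ((ι → ℂ) × (κ → ℂ))).hasFDerivAt.comp_hasDerivAt 0 h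
  have h2 : HasDerivAt (fun t => (f t).2) 0 0 :=
    (ContinuousLinearMap.snd ℂ ℂ ((ι → ℂ) × (κ → ℂ))).hasFDerivAt.comp_hasDerivAt 0 h
  have h3 : HasDerivAt (fun t => (f t).2.1) 0 0 :=
    (ContinuousLinearMap.fst ℂ (ι → ℂ) (κ → ℂ)).hasFDerivAt.comp_hasDerivAt 0 h2
  have h4 : HasDerivAt (fun t => (f t).2.2) 0 0 :=
    (ContinuousLinearMap.snd ℂ (ι → ℂ) (κ → ℂ)).hasFDerivAt.comp_hasDerivAt 0 h2
  refine ⟨?_, fun i => hasDerivAt_pi.1 h3 i, fun i => hasDerivAt_pi.1 h4 i⟩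
  simpa [hasDerivAt_iff_tendsto_slope_zero] using h1

variable {P : Type*} [NormedAddCommGroup P] [NormedSpace ℂ P] {s : P → A ⊕ B → A ⊕ B → ℂ}

lemma contDiff_chanPts (a μ : A) (i : A) : ContDiff ℂ 1 fun ξ => chanPts a μ ξ i := by
  unfold chanPts
  split_ifs <;> fun_prop

lemma contDiff_compPts (b c : B) (j : B) : ContDiff ℂ 1 fun ζ => compPts b c ζ j := by
  unfold compPts
  split_ifs <;> fun_prop

lemma compPts_snd_cases (b c : B) (ζ : Off b c → ℂ) (j : B) :
    (compPts b c ζ j).2 = 1 ∨ (compPts b c ζ j).2 = 0 := by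
  unfold compPts
  split_ifs <;> simp

lemma contDiffAt_rescaledEqs (hs : ∀ i j, ContDiff ℂ 1 fun p => s p i j) {p₀ : P}
    {z₀ : ℂ × (Off a μ → ℂ) × (Off b c → ℂ)}
    (hd : ConfDistinct z₀.1 (chanPts a μ z₀.2.1) (compPts b c z₀.2.2)) :
    ContDiffAt ℂ 1 (fun q : P × ℂ × (Off a μ → ℂ) ×
      (Off b c → ℂ) => rescaledEqs (s q.1) a μ b c q.2) (p₀, z₀) := by
  obtain ⟨hd1, hd2, hd3⟩ := hd
  let Q := P × ℂ × (Off a μ → ℂ) × (Off b c → ℂ)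
  have hs' : ∀ i j, ContDiffAt ℂ 1 (fun q : Q => s q.1 i j) (p₀, z₀) := fun i j =>
    ((hs i j).comp contDiff_fst).contDiffAt
  have hx : ∀ i, ContDiffAt ℂ 1 (fun q : Q => chanPts a μ q.2.2.1 i) (p₀, z₀) := fun i =>
    ((contDiff_chanPts a μ i).comp (contDiff_fst.comp (contDiff_snd.comp contDiff_snd))).contDiffAt
  have hy : ∀ j, ContDiffAt ℂ 1 (fun q : Q => compPts b c q.2.2.2 j) (p₀, z₀) := fun j =>
    ((contDiff_compPts b c j).comp (contDiff_snd.comp (contDiff_snd.comp contDiff_snd))).contDiffAt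
  have hε : ContDiffAt ℂ 1 (fun q : Q => q.2.1) (p₀, z₀) :=
    (contDiff_fst.comp contDiff_snd).contDiffAt
  have hH : ∀ i, ContDiffAt ℂ 1 (fun q : Q => crossRes (s q.1) q.2.1 (chanPts a μ q.2.2.1)
      (compPts b c q.2.2.2) i) (p₀, z₀) := fun i =>
    ContDiffAt.sum fun j _ => ((hs' _ _).mul (hy j).snd).div
      (contDiffAt_br ((hε.mul (hx i)).prodMk contDiffAt_const) (hy j)) (hd2 i j)
  refine ContDiffAt.prodMk ?_ (ContDiffAt.prodMk ?_ ?_)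
  · refine ContDiffAt.add ?_ (hε.mul (ContDiffAt.sum fun i _ => (hx i).mul (hH i)))
    exact (ContDiffAt.sum fun i _ => ContDiffAt.sum fun k _ => hs' _ _).div_const _
  · refine contDiffAt_pi.2 fun i => ?_
    refine (ContDiffAt.sum fun k _ => ?_).add (hε.mul (hH i.1))
    rcases eq_or_ne i.1 k with h | h
    · simp only [h, sub_self, div_zero]
      exact contDiffAt_const
    · exact (hs' _ _).div ((hx i.1).sub (hx k)) (sub_ne_zero.2 (hd1 _ _ h))
  · refine contDiffAt_pi.2 fun j => ?_
    refine contDiffAt_scatEq hs' ?_ _ ?_ ?_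
    · rintro (i | j)
      · exact (hε.mul (hx i)).prodMk contDiffAt_const
      · exact hy j
    · have := compPts_snd b c z₀.2.2 j.2.2
      simp [conf, this]
    · rintro (i | k) h
      · rw [br_swap]
        exact neg_ne_zero.2 (hd2 i j.1)
      · exact hd3 _ _ (by simpa using h.symm)

lemma eq_zero_of_hasDerivAt_rescaledEqs {s₀ : A ⊕ B → A ⊕ B → ℂ} {sL : Option A → Option A → ℂ}
    {sR : Option B → Option B → ℂ} (hS : SidePairings s₀ sL sR) (hst : chanSum s₀ = 0)
    {ξ : Off a μ → ℂ} {ζ : Off b c → ℂ} (hd : ConfDistinct 0 (chanPts a μ ξ) (compPts b c ζ))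
    (hF : ∑ i, chanPts a μ ξ i * crossRes s₀ 0 (chanPts a μ ξ) (compPts b c ζ) i ≠ 0)
    (hJL : jac sL ⟨some a, some μ, none⟩ (leftConf (chanPts a μ ξ)) ≠ 0)
    (hJR : jac sR ⟨none, some b, some c⟩ (rightConf (compPts b c ζ)) ≠ 0)
    {h : ℂ × (Off a μ → ℂ) × (Off b c → ℂ)}
    (hder : HasDerivAt (fun t : ℂ => rescaledEqs s₀ a μ b c ((0, ξ, ζ) + t • h)) 0 0) :
    h = 0 := by
  obtain ⟨e', ξ', ζ'⟩ := h
  have hxt : ∀ i, Tendsto (fun t : ℂ => chanPts a μ (ξ + t • ξ') i) (𝓝[≠] 0)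
      (𝓝 (chanPts a μ ξ i)) := fun i => by
    have : Continuous fun t : ℂ => chanPts a μ (ξ + t • ξ') i :=
      (continuous_chanPts a μ i).comp (by fun_prop)
    simpa using (this.tendsto 0).mono_left nhdsWithin_le_nhds
  have hyt : ∀ j, Tendsto (fun t : ℂ => compPts b c (ζ + t • ζ') j) (𝓝[≠] 0)
      (𝓝 (compPts b c ζ j)) := fun j => by
    have : Continuous fun t : ℂ => compPts b c (ζ + t • ζ') j :=
      (continuous_compPts b c j).comp (by fun_prop)
    simpa using (this.tendsto 0).mono_left nhdsWithin_le_nhds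
  have hd0 : ∀ j, br (0, 1) (compPts b c ζ j) ≠ 0 := fun j => by simpa using hd.2.1 a j
  have he : e' = 0 := by
    have h1 := (hasDerivAt_components hder).1
    have h2 : Tendsto (fun t : ℂ => ∑ i, chanPts a μ (ξ + t • ξ') i *
        crossRes s₀ (t * e') (chanPts a μ (ξ + t • ξ')) (compPts b c (ζ + t • ζ')) i) (𝓝[≠] 0)
        (𝓝 (∑ i, chanPts a μ ξ i * crossRes s₀ 0 (chanPts a μ ξ) (compPts b c ζ) i)) := by
      refine tendsto_finsetSum _ fun i _ => (hxt i).mul ?_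
      refine tendsto_crossRes (s := fun _ => s₀) (ε := fun t => t * e')
        (x := fun t => chanPts a μ (ξ + t • ξ')) (y := fun t => compPts b c (ζ + t • ζ'))
        (fun _ _ => tendsto_const_nhds) ?_ hxt hyt hd0 i
      have : Continuous fun t : ℂ => t * e' := by fun_prop
      simpa using (this.tendsto 0).mono_left (nhdsWithin_le_nhds (s := {0}ᶜ))
    have h1' := h1.congr' (f₂ := fun t : ℂ => e' * ∑ i, chanPts a μ (ξ + t • ξ') i *
        crossRes s₀ (t * e') (chanPts a μ (ξ + t • ξ')) (compPts b c (ζ + t • ζ')) i) (by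
      filter_upwards [self_mem_nhdsWithin] with t ht
      have ht : t ≠ 0 := ht
      have e1 : (rescaledEqs s₀ a μ b c ((0, ξ, ζ) + t • (e', ξ', ζ'))).1 = chanSum s₀ +
          (0 + t * e') * ∑ i, chanPts a μ (ξ + t • ξ') i * crossRes s₀ (0 + t * e')
            (chanPts a μ (ξ + t • ξ')) (compPts b c (ζ + t • ζ')) i := rfl
      have e2 : (rescaledEqs s₀ a μ b c ((0, ξ, ζ) + (0 : ℂ) • (e', ξ', ζ'))).1 = chanSum s₀ +
          (0 + 0 * e') * ∑ i, chanPts a μ (ξ + (0 : ℂ) • ξ') i * crossRes s₀ (0 + 0 * e')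
            (chanPts a μ (ξ + (0 : ℂ) • ξ')) (compPts b c (ζ + (0 : ℂ) • ζ')) i := rfl
      rw [e1, e2, hst]
      simp only [zero_add, zero_mul, sub_zero]
      rw [mul_assoc, inv_mul_cancel_left₀ ht])
    have h3 := tendsto_nhds_unique (tendsto_const_nhds.mul h2) h1'
    exact (mul_eq_zero.1 h3).resolve_right hF
  subst he
  have hz : ∀ t : ℂ, ((0, ξ, ζ) + t • (0, ξ', ζ') : ℂ × (Off a μ → ℂ) ×
      (Off b c → ℂ)) = (0, ξ + t • ξ', ζ + t • ζ') := fun t => by simp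
  simp_rw [hz] at hder
  have hq : ∀ t i, chanPts a μ (ξ + t • ξ') i = chanPts a μ ξ i + t *
      (if h : i ≠ a ∧ i ≠ μ then ξ' ⟨i, h⟩ else 0) := fun t i => by
    unfold chanPts
    split_ifs <;> simp
  have hq' : ∀ t j, compPts b c (ζ + t • ζ') j = ((compPts b c ζ j).1 + t *
      (if h : j ≠ b ∧ j ≠ c then ζ' ⟨j, h⟩ else 0), (compPts b c ζ j).2) := fun t j => by
    unfold compPts
    split_ifs <;> simp
  have hξ : ξ' = 0 := by
    let q : Option A → ℂ := fun o => o.elim 0 fun i => if h : i ≠ a ∧ i ≠ μ then ξ' ⟨i, h⟩ else 0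
    have hmul : (jacMat sL ⟨some a, some μ, none⟩ (leftConf (chanPts a μ ξ))).mulVec
        (fun j => q j) = 0 := by
      ext ⟨o, ho⟩
      rw [jacMat_mulVec]
      · obtain _ | i := o
        · exact absurd rfl ho.2.2
        have h1 := hasDerivAt_scatEq sL (fun t => leftConf (chanPts a μ (ξ + t • ξ'))) q (some i)
          (by
            rintro t (_ | j)
            · simp [leftConf, q]
            · simp only [leftConf, elim_some, hq t, q, zero_smul, add_zero]) rfl
          (by rintro (_ | j) <;> simp [leftConf]) (by
            rintro (_ | j) hj
            · simp [leftConf, br]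
            · have := hd.1 i j (by simpa using hj.symm)
              simpa [leftConf, br, sub_eq_zero] using this)
        have h2 := (hasDerivAt_components hder).2.1 ⟨i, by simpa [Gauge.Free] using ho⟩
        simp only [zero_smul, add_zero] at h1
        refine h1.unique (h2.congr_of_eventuallyEq (Eventually.of_forall fun t => ?_))
        simp only [rescaledEqs, zero_mul, add_zero]
        exact scatEq_leftConf hS.left _ i
      · rintro (_ | i) hi
        · rfl
        · simp only [q, elim_some]
          rw [dif_neg fun h => hi (by simp [Gauge.Free, h])]
      · rintro (_ | i) hi
        · exact absurd rfl hi.2.2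
        · rfl
    have h3 := Matrix.eq_zero_of_mulVec_eq_zero (by rwa [← jac_eq_det]) hmul
    ext i
    have h4 := congrFun h3 ⟨some i.1, by simp [Gauge.Free, i.2]⟩
    simpa [q, i.2] using h4
  have hζ : ζ' = 0 := by
    let q : Option B → ℂ := fun o => o.elim 0 fun i => if h : i ≠ b ∧ i ≠ c then ζ' ⟨i, h⟩ else 0
    have hmul : (jacMat sR ⟨none, some b, some c⟩ (rightConf (compPts b c ζ))).mulVec
        (fun j => q j) = 0 := by
      ext ⟨o, ho⟩
      rw [jacMat_mulVec]
      · obtain _ | i := o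
        · exact absurd rfl ho.1
        have hi' : i ≠ c := by
          rintro rfl
          exact ho.2.2 rfl
        have h1 := hasDerivAt_scatEq sR (fun t => rightConf (compPts b c (ζ + t • ζ'))) q (some i)
          (by
            rintro t (_ | j)
            · simp [rightConf, q]
            · simp only [rightConf, elim_some, hq' t, q, zero_smul, add_zero])
          (compPts_snd b c _ hi')
          (by
            rintro (_ | j)
            · simp [rightConf]
            · exact compPts_snd_cases b c _ j) (by
            rintro (_ | j) hj
            · have := hd0 i
              rw [br_swap]
              simpa [rightConf] using this
            · have := hd.2.2 i j (by simpa using hj.symm)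
              simpa [rightConf] using this)
        have h2 := (hasDerivAt_components hder).2.2 ⟨i, by simpa [Gauge.Free] using ho⟩
        simp only [zero_smul, add_zero] at h1
        refine h1.unique (h2.congr_of_eventuallyEq (Eventually.of_forall fun t => ?_))
        simp only [rescaledEqs]
        exact scatEq_rightConf hS.right hS.node _ _ i
      · rintro (_ | i) hi
        · rfl
        · simp only [q, elim_some]
          rw [dif_neg fun h => hi (by simp [Gauge.Free, h])]
      · rintro (_ | i) hi
        · exact absurd rfl hi.1
        · refine compPts_snd b c _ ?_
          rintro rfl
          exact hi.2.2 rfl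
    have h3 := Matrix.eq_zero_of_mulVec_eq_zero (by rwa [← jac_eq_det]) hmul
    ext i
    have h4 := congrFun h3 ⟨some i.1, by simp [Gauge.Free, i.2]⟩
    simpa [q, i.2] using h4
  rw [hξ, hζ]
  rfl

/-! ### The solutions of a degenerating channel -/

/-- The unknowns `x`, `y` of `degen`, without the condition on `ε`. -/
def region (a μ : A) (b c : B) (δ : ℝ) : Set ((Off a μ → ℂ) × (Off b c → ℂ)) :=
  {q | (∀ i, ‖chanPts a μ q.1 i‖ ≤ δ⁻¹ ∧ ∀ j, i ≠ j → δ ≤ ‖chanPts a μ q.1 i - chanPts a μ q.1 j‖) ∧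
    ∀ i, δ ≤ ‖(compPts b c q.2 i).1‖ ∧ ‖(compPts b c q.2 i).1‖ ≤ δ⁻¹ ∧
      ∀ j, i ≠ j → δ ≤ ‖br (compPts b c q.2 i) (compPts b c q.2 j)‖}

lemma continuous_br {E : Type*} [TopologicalSpace E] {p q : E → ℂ × ℂ} (hp : Continuous p)
    (hq : Continuous q) : Continuous fun e => br (p e) (q e) := by
  unfold br
  fun_prop

lemma isCompact_region (a μ : A) (b c : B) {δ : ℝ} (hδ : 0 < δ) :
    IsCompact (region a μ b c δ) := by
  have hx : ∀ i, Continuous fun q : (Off a μ → ℂ) × (Off b c → ℂ) => chanPts a μ q.1 i := fun i =>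
    (continuous_chanPts a μ i).comp continuous_fst
  have hy : ∀ i, Continuous fun q : (Off a μ → ℂ) × (Off b c → ℂ) => compPts b c q.2 i := fun i =>
    (continuous_compPts b c i).comp continuous_snd
  refine Metric.isCompact_of_isClosed_isBounded ?_ ?_
  · simp only [region, Set.ofPred_and, Set.ofPred_forall]
    refine IsClosed.inter (isClosed_iInter fun i => IsClosed.inter ?_ ?_)
      (isClosed_iInter fun i => IsClosed.inter ?_ (IsClosed.inter ?_ ?_))
    · exact isClosed_le (hx i).norm continuous_const
    · exact isClosed_iInter fun j => isClosed_iInter fun _ =>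
        isClosed_le continuous_const ((hx i).sub (hx j)).norm
    · exact isClosed_le continuous_const (hy i).fst.norm
    · exact isClosed_le (hy i).fst.norm continuous_const
    · exact isClosed_iInter fun j => isClosed_iInter fun _ =>
        isClosed_le continuous_const (continuous_br (hy i) (hy j)).norm
  · refine (Metric.isBounded_closedBall (x := 0) (r := δ⁻¹)).subset ?_
    rintro ⟨ξ, ζ⟩ ⟨h1, h2⟩
    have h0 : 0 ≤ δ⁻¹ := (inv_pos.2 hδ).le
    rw [mem_closedBall_zero_iff, norm_prod_le_iff, pi_norm_le_iff_of_nonneg h0,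
      pi_norm_le_iff_of_nonneg h0]
    refine ⟨fun i => ?_, fun j => ?_⟩
    · simpa [chanPts_free] using (h1 i.1).1
    · simpa [compPts_free] using (h2 j.1).2.1

lemma confDistinct_of_mem_region {δ : ℝ} (hδ : 0 < δ) {q : (Off a μ → ℂ) × (Off b c → ℂ)}
    (hq : q ∈ region a μ b c δ) : ConfDistinct 0 (chanPts a μ q.1) (compPts b c q.2) := by
  refine ⟨fun i j hij h => ?_, fun i j h => ?_, fun i j hij h => ?_⟩
  · have := (hq.1 i).2 j hij
    rw [h, sub_self, norm_zero] at this
    linarith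
  · have := (hq.2 j).1
    have h' : (compPts b c q.2 j).1 = 0 := by simpa [br] using h
    rw [h', norm_zero] at this
    linarith
  · have := (hq.2 i).2.2 j hij
    rw [h, norm_zero] at this
    linarith

lemma eventually_mem_region {q₀ : (Off a μ → ℂ) × (Off b c → ℂ)}
    (hd : ConfDistinct 0 (chanPts a μ q₀.1) (compPts b c q₀.2)) :
    ∀ᶠ δ in 𝓝[>] (0 : ℝ), ∀ᶠ q in 𝓝 q₀, q ∈ region a μ b c δ := by
  have hx : ∀ i, Continuous fun q : (Off a μ → ℂ) × (Off b c → ℂ) => chanPts a μ q.1 i := fun i =>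
    (continuous_chanPts a μ i).comp continuous_fst
  have hy : ∀ i, Continuous fun q : (Off a μ → ℂ) × (Off b c → ℂ) => compPts b c q.2 i := fun i =>
    (continuous_compPts b c i).comp continuous_snd
  have hle : ∀ {F : (Off a μ → ℂ) × (Off b c → ℂ) → ℂ},
      Continuous F → ∀ᶠ δ in 𝓝[>] (0 : ℝ), ∀ᶠ q in 𝓝 q₀, ‖F q‖ ≤ δ⁻¹ := fun {F} hF => by
    filter_upwards [tendsto_inv_nhdsGT_zero.eventually_gt_atTop ‖F q₀‖] with δ hδ
    exact (hF.norm.continuousAt.eventually_lt_const hδ).mono fun q hq => hq.le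
  have hge : ∀ {F : (Off a μ → ℂ) × (Off b c → ℂ) → ℂ},
      Continuous F → F q₀ ≠ 0 → ∀ᶠ δ in 𝓝[>] (0 : ℝ), ∀ᶠ q in 𝓝 q₀, δ ≤ ‖F q‖ :=
    fun {F} hF h0 => by
    filter_upwards [nhdsWithin_le_nhds (eventually_lt_nhds (norm_pos_iff.2 h0))] with δ hδ
    exact (hF.norm.continuousAt.eventually_const_lt hδ).mono fun q hq => hq.le
  have h1 : ∀ i j, ∀ᶠ δ in 𝓝[>] (0 : ℝ), ∀ᶠ q in 𝓝 q₀,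
      i ≠ j → δ ≤ ‖chanPts a μ q.1 i - chanPts a μ q.1 j‖ := fun i j => by
    by_cases hij : i = j
    · exact Eventually.of_forall fun δ => Eventually.of_forall fun q h => absurd hij h
    · exact (hge ((hx i).sub (hx j)) (sub_ne_zero.2 (hd.1 i j hij))).mono fun δ h =>
        h.mono fun q hq _ => hq
  have h2 : ∀ i j, ∀ᶠ δ in 𝓝[>] (0 : ℝ), ∀ᶠ q in 𝓝 q₀,
      i ≠ j → δ ≤ ‖br (compPts b c q.2 i) (compPts b c q.2 j)‖ := fun i j => by
    by_cases hij : i = j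
    · exact Eventually.of_forall fun δ => Eventually.of_forall fun q h => absurd hij h
    · exact (hge (continuous_br (hy i) (hy j)) (hd.2.2 i j hij)).mono fun δ h =>
        h.mono fun q hq _ => hq
  have h3 : ∀ j, (compPts b c q₀.2 j).1 ≠ 0 := fun j h => hd.2.1 a j (by simp [br, h])
  filter_upwards [eventually_all.2 fun i => hle (hx i), eventually_all.2 fun i =>
    eventually_all.2 fun j => h1 i j, eventually_all.2 fun i => hge (hy i).fst (h3 i),
    eventually_all.2 fun i => hle (hy i).fst, eventually_all.2 fun i =>
    eventually_all.2 fun j => h2 i j] with δ k1 k2 k3 k4 k5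
  filter_upwards [eventually_all.2 k1, eventually_all.2 fun i => eventually_all.2 (k2 i),
    eventually_all.2 k3, eventually_all.2 k4, eventually_all.2 fun i => eventually_all.2 (k5 i)]
    with q m1 m2 m3 m4 m5
  exact ⟨fun i => ⟨m1 i, m2 i⟩, fun i => ⟨m3 i, m4 i, m5 i⟩⟩

lemma conf_mem_degen_iff {s : A ⊕ B → A ⊕ B → ℂ} {δ ρ : ℝ} (haμ : a ≠ μ) {u : Config (A ⊕ B)}
    (hu : u ∈ Sols s ⟨.inl a, .inr b, .inr c⟩) :
    u ∈ degen (Set.range inl) (.inl μ) δ ρ ↔ ∃ ε ξ ζ, ε ≠ 0 ∧ ‖ε‖ < ρ ∧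
      (ξ, ζ) ∈ region a μ b c δ ∧ u = conf ε (chanPts a μ ξ) (compPts b c ζ) := by
  obtain ⟨⟨h0, h1, h2, h3⟩, -⟩ := hu
  constructor
  · rintro ⟨ε, x, hε, hρ, hx, hS, hT⟩
    have hε0 : ε ≠ 0 := norm_pos_iff.1 hε
    have hxa : x (.inl a) = 0 := by
      have h4 := (hS (.inl a) ⟨a, rfl⟩).1
      simp only at h0
      rw [h0, Prod.mk.injEq] at h4
      exact (mul_eq_zero.1 h4.1.symm).resolve_left hε0
    have e1 : chanPts a μ (fun i => x (.inl i.1)) = fun i => x (.inl i) :=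
      chanPts_restrict (x := fun i => x (.inl i)) hxa hx
    have e2 : compPts b c (fun j => (u (.inr j.1)).1) = fun j => u (.inr j) :=
      compPts_restrict (y := fun j => u (.inr j)) h1 h2 fun j hj => h3 _ (by simpa using hj)
    refine ⟨ε, fun i => x (.inl i.1), fun j => (u (.inr j.1)).1, hε0, hρ, ⟨?_, ?_⟩, ?_⟩
    · rw [e1]
      exact fun i => ⟨(hS _ ⟨i, rfl⟩).2.1, fun j hij => (hS _ ⟨i, rfl⟩).2.2 _ ⟨j, rfl⟩
        (by simpa using hij)⟩
    · rw [e2]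
      exact fun i => ⟨(hT (.inr i) (by simp)).1, (hT (.inr i) (by simp)).2.1, fun j hij =>
        (hT (.inr i) (by simp)).2.2 (.inr j) (by simp) (by simpa using hij)⟩
    · rw [e1, e2]
      ext1 (i | j)
      · exact (hS _ ⟨i, rfl⟩).1
      · rfl
  · rintro ⟨ε, ξ, ζ, hε, hρ, ⟨h4, h5⟩, rfl⟩
    refine ⟨ε, Sum.elim (chanPts a μ ξ) 0, norm_pos_iff.2 hε, hρ, chanPts_right haμ _, ?_, ?_⟩
    · rintro _ ⟨i, rfl⟩
      refine ⟨rfl, (h4 i).1, ?_⟩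
      rintro _ ⟨j, rfl⟩ hij
      exact (h4 i).2 j (by simpa using hij)
    · rintro (i | i) hi
      · exact absurd ⟨i, rfl⟩ hi
      · refine ⟨(h5 i).1, (h5 i).2.1, ?_⟩
        rintro (j | j) hj hij
        · exact absurd ⟨j, rfl⟩ hj
        · exact (h5 i).2.2 j (by simpa using hij)

variable [CompleteSpace P] {p₀ : P}

/-- Data of a degenerating channel at `p₀`: the pairings of the two sides, generic solutions on
both sides. -/
structure Channel (s : P → A ⊕ B → A ⊕ B → ℂ) (p₀ : P) (sL : Option A → Option A → ℂ)
    (sR : Option B → Option B → ℂ) (a μ : A) (b c : B) : Prop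
    extends SidePairings (s p₀) sL sR where
  smooth : ∀ i j, ContDiff ℂ 1 fun p => s p i j
  symm : ∀ p i j, s p i j = s p j i
  ne_left : a ≠ μ
  ne_right : b ≠ c
  chanSum_eq_zero : chanSum (s p₀) = 0
  genericL : Generic sL ⟨some a, some μ, none⟩
  genericR : Generic sR ⟨none, some b, some c⟩
  calF_ne_zero : ∀ v ∈ Sols sL ⟨some a, some μ, none⟩, ∀ w ∈ Sols sR ⟨none, some b, some c⟩,
    calF (fun i j => s p₀ (.inl i) (.inr j)) (fun i => v (some i)) (w none)
      (fun j => w (some j)) ≠ 0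

/-- The unknowns at a pair of solutions on the two sides. -/
def sideParam (a μ : A) (b c : B) (vw : Config (Option A) × Config (Option B)) :
    ℂ × (Off a μ → ℂ) × (Off b c → ℂ) :=
  (0, fun i => (vw.1 (some i.1)).1, fun j => (vw.2 (some j.1)).1)

lemma sum_mul_crossRes (s : A ⊕ B → A ⊕ B → ℂ) (x : A → ℂ) (y : B → ℂ × ℂ) :
    ∑ i, x i * crossRes s 0 x y i = calF (fun i j => s (.inl i) (.inr j))
      (fun i => leftConf x (some i)) (rightConf y none) (fun j => rightConf y (some j)) := by
  unfold calF crossRes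
  refine sum_congr rfl fun i _ => ?_
  rw [mul_sum]
  refine sum_congr rfl fun j _ => ?_
  simp only [leftConf, rightConf, elim_some, elim_none, zero_mul]
  ring

/-- The pairs of solutions on the two sides. -/
def sidePairs (sL : Option A → Option A → ℂ) (sR : Option B → Option B → ℂ) (a μ : A) (b c : B) :
    Set (Config (Option A) × Config (Option B)) :=
  Sols sL ⟨some a, some μ, none⟩ ×ˢ Sols sR ⟨none, some b, some c⟩

lemma Channel.exists_branches (h : Channel s p₀ sL sR a μ b c) :
    ∃ φ : Config (Option A) × Config (Option B) → P → ℂ × (Off a μ → ℂ) × (Off b c → ℂ),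
      ∀ vw ∈ sidePairs sL sR a μ b c, Tendsto (φ vw) (𝓝 p₀) (𝓝 (sideParam a μ b c vw)) ∧
        (∀ᶠ p in 𝓝 p₀, rescaledEqs (s p) a μ b c (φ vw p) = 0) ∧
        ∀ᶠ q in 𝓝 (p₀, sideParam a μ b c vw), rescaledEqs (s q.1) a μ b c q.2 = 0 →
          q.2 = φ vw q.1 := by
  have key : ∀ vw ∈ sidePairs sL sR a μ b c, ∃ φ : P → ℂ × (Off a μ → ℂ) × (Off b c → ℂ),
      Tendsto φ (𝓝 p₀) (𝓝 (sideParam a μ b c vw)) ∧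
        (∀ᶠ p in 𝓝 p₀, rescaledEqs (s p) a μ b c (φ p) = 0) ∧
        ∀ᶠ q in 𝓝 (p₀, sideParam a μ b c vw), rescaledEqs (s q.1) a μ b c q.2 = 0 →
          q.2 = φ q.1 := by
    rintro ⟨v, w⟩ ⟨hv, hw⟩
    have hv' := leftConf_of_mem_Sols hv
    have hw' := rightConf_of_mem_Sols hw
    have h1 := (mem_Sols_sides (ξ := fun i => (v (some i.1)).1) (ζ := fun j => (w (some j.1)).1)
      h.toSidePairings h.ne_left h.ne_right h.chanSum_eq_zero).2
      ⟨by rw [hv']; exact hv, by rw [hw']; exact hw⟩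
    have hd := h1.1
    have hF := h.calF_ne_zero v hv w hw
    have hJL := h.genericL.2 v hv
    have hJR := h.genericR.2 w hw
    have hG := contDiffAt_rescaledEqs (s := s) (a := a) (μ := μ) (b := b) (c := c) (p₀ := p₀)
      (z₀ := sideParam a μ b c (v, w)) h.smooth hd
    obtain ⟨φ, -, h2, h3, h4⟩ := exists_branch hG h1.2 fun k hk =>
      eq_zero_of_hasDerivAt_rescaledEqs h.toSidePairings h.chanSum_eq_zero hd
        (by rw [sum_mul_crossRes, hv', hw']; exact hF) (by rw [hv']; exact hJL)
        (by rw [hw']; exact hJR) hk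
    exact ⟨φ, h2, h3, h4⟩
  classical
  choose! φ hφ using key
  exact ⟨φ, hφ⟩

lemma Channel.eventually_eq_branch (h : Channel s p₀ sL sR a μ b c)
    {φ : Config (Option A) × Config (Option B) → P → ℂ × (Off a μ → ℂ) × (Off b c → ℂ)}
    (hφ : ∀ vw ∈ sidePairs sL sR a μ b c, ∀ᶠ q in 𝓝 (p₀, sideParam a μ b c vw),
      rescaledEqs (s q.1) a μ b c q.2 = 0 → q.2 = φ vw q.1) {δ : ℝ} (hδ : 0 < δ) :
    ∃ ρ₀ > 0, ∀ᶠ p in 𝓝 p₀, ∀ ε ξ ζ, ‖ε‖ < ρ₀ → (ξ, ζ) ∈ region a μ b c δ →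
      rescaledEqs (s p) a μ b c (ε, ξ, ζ) = 0 →
        ∃ vw ∈ sidePairs sL sR a μ b c, (ε, ξ, ζ) = φ vw p := by
  have key : ∀ᶠ x in 𝓝 ((p₀, 0) : P × ℂ), ∀ q ∈ region a μ b c δ,
      rescaledEqs (s x.1) a μ b c (x.2, q) = 0 →
        ∃ vw ∈ sidePairs sL sR a μ b c, (x.2, q) = φ vw x.1 := by
    refine (isCompact_region a μ b c hδ).eventually_forall_of_forall_eventually ?_
    rintro ⟨ξ, ζ⟩ hq
    have hd := confDistinct_of_mem_region hδ hq
    have hT : Tendsto (fun x : (P × ℂ) × (Off a μ → ℂ) ×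
        (Off b c → ℂ) => (x.1.1, x.1.2, x.2)) (𝓝 ((p₀, 0), (ξ, ζ)))
        (𝓝 (p₀, 0, ξ, ζ)) := by
      refine Continuous.tendsto' ?_ _ _ rfl
      fun_prop
    suffices hE : ∀ᶠ q in 𝓝 (p₀, ((0, ξ, ζ) : ℂ × (Off a μ → ℂ) ×
        (Off b c → ℂ))), rescaledEqs (s q.1) a μ b c q.2 = 0 →
        ∃ vw ∈ sidePairs sL sR a μ b c, q.2 = φ vw q.1 by
      filter_upwards [hT.eventually hE] with x hx using hx
    by_cases h0 : rescaledEqs (s p₀) a μ b c (0, ξ, ζ) = 0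
    · obtain ⟨hv, hw⟩ := (mem_Sols_sides h.toSidePairings h.ne_left h.ne_right
        h.chanSum_eq_zero).1 ⟨hd, h0⟩
      have e : sideParam a μ b c (leftConf (chanPts a μ ξ), rightConf (compPts b c ζ)) =
          (0, ξ, ζ) := by
        simp [sideParam, leftConf, rightConf, chanPts_free, compPts_free]
      have h1 := hφ (leftConf (chanPts a μ ξ), rightConf (compPts b c ζ)) ⟨hv, hw⟩
      rw [e] at h1
      exact h1.mono fun q hq hq0 => ⟨_, ⟨hv, hw⟩, hq hq0⟩
    · have hG := (contDiffAt_rescaledEqs (s := s) (a := a) (μ := μ) (b := b) (c := c) (p₀ := p₀)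
        (z₀ := (0, ξ, ζ)) h.smooth hd).continuousAt
      exact (hG.eventually_ne h0).mono fun q hq hq0 => absurd hq0 hq
  rw [nhds_prod_eq, eventually_prod_iff] at key
  obtain ⟨pa, hpa, pb, hpb, key⟩ := key
  obtain ⟨ρ₀, hρ₀, hball⟩ := Metric.eventually_nhds_iff_ball.1 hpb
  refine ⟨ρ₀, hρ₀, hpa.mono fun p hp ε ξ ζ hε hq h0 => ?_⟩
  exact key hp (hball ε (by simpa using hε)) (ξ, ζ) hq h0

/-- The configuration with given unknowns. -/
def paramConf (a μ : A) (b c : B) (z : ℂ × (Off a μ → ℂ) × (Off b c → ℂ)) : Config (A ⊕ B) :=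
  conf z.1 (chanPts a μ z.2.1) (compPts b c z.2.2)

lemma paramConf_injective {z z' : ℂ × (Off a μ → ℂ) × (Off b c → ℂ)} (haμ : a ≠ μ) (hz : z.1 ≠ 0)
    (h : paramConf a μ b c z = paramConf a μ b c z') : z = z' := by
  have h1 : ∀ i, z.1 * chanPts a μ z.2.1 i = z'.1 * chanPts a μ z'.2.1 i := fun i =>
    congrArg Prod.fst (congrFun h (.inl i))
  have h2 : ∀ j, compPts b c z.2.2 j = compPts b c z'.2.2 j := fun j => congrFun h (.inr j)
  have h3 : z.1 = z'.1 := by simpa [chanPts_right haμ] using h1 μ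
  refine Prod.ext h3 (Prod.ext (funext fun i => ?_) (funext fun j => ?_))
  · have := h1 i.1
    rw [chanPts_free, chanPts_free, ← h3] at this
    exact mul_left_cancel₀ hz this
  · have := h2 j.1
    rw [compPts_free, compPts_free] at this
    exact congrArg Prod.fst this

lemma confDistinct_sideParam (h : Channel s p₀ sL sR a μ b c)
    {vw : Config (Option A) × Config (Option B)} (hvw : vw ∈ sidePairs sL sR a μ b c) :
    ConfDistinct 0 (chanPts a μ (sideParam a μ b c vw).2.1)
      (compPts b c (sideParam a μ b c vw).2.2) :=
  ((mem_Sols_sides h.toSidePairings h.ne_left h.ne_right h.chanSum_eq_zero).2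
    ⟨by rw [sideParam, leftConf_of_mem_Sols hvw.1]; exact hvw.1,
      by rw [sideParam, rightConf_of_mem_Sols hvw.2]; exact hvw.2⟩).1

lemma sideParam_injOn : Set.InjOn (sideParam a μ b c) (sidePairs sL sR a μ b c) := by
  intro vw h vw' h' e
  have e1 := congrArg (fun z => z.2.1) e
  have e2 := congrArg (fun z => z.2.2) e
  simp only [sideParam] at e1 e2
  refine Prod.ext ?_ ?_
  · rw [← leftConf_of_mem_Sols h.1, ← leftConf_of_mem_Sols h'.1, e1]
  · rw [← rightConf_of_mem_Sols h.2, ← rightConf_of_mem_Sols h'.2, e2]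

lemma eventually_confDistinct {κ : Type*} {l : Filter κ} {z : κ → ℂ ×
      (Off a μ → ℂ) × (Off b c → ℂ)} {q₀}
    (hz : Tendsto z l (𝓝 (0, q₀))) (hd : ConfDistinct 0 (chanPts a μ q₀.1) (compPts b c q₀.2)) :
    ∀ᶠ k in l, ConfDistinct (z k).1 (chanPts a μ (z k).2.1) (compPts b c (z k).2.2) := by
  have hε : Tendsto (fun k => (z k).1) l (𝓝 0) := (continuous_fst.tendsto _).comp hz
  have hx : ∀ i, Tendsto (fun k => chanPts a μ (z k).2.1 i) l (𝓝 (chanPts a μ q₀.1 i)) := fun i =>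
    (((continuous_chanPts a μ i).comp (continuous_fst.comp continuous_snd)).tendsto _).comp hz
  have hy : ∀ j, Tendsto (fun k => compPts b c (z k).2.2 j) l (𝓝 (compPts b c q₀.2 j)) := fun j =>
    (((continuous_compPts b c j).comp (continuous_snd.comp continuous_snd)).tendsto _).comp hz
  have h1 : ∀ i j, ∀ᶠ k in l, i ≠ j → chanPts a μ (z k).2.1 i ≠ chanPts a μ (z k).2.1 j :=
    fun i j => by
    by_cases hij : i = j
    · exact Eventually.of_forall fun k h => absurd hij h
    · have := ((hx i).sub (hx j)).eventually_ne (sub_ne_zero.2 (hd.1 i j hij))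
      exact this.mono fun k hk _ => sub_ne_zero.1 hk
  have h2 : ∀ i j, ∀ᶠ k in l,
      br ((z k).1 * chanPts a μ (z k).2.1 i, 1) (compPts b c (z k).2.2 j) ≠ 0 := fun i j =>
    (tendsto_br ((hε.mul (hx i)).prodMk_nhds tendsto_const_nhds) (hy j)).eventually_ne (hd.2.1 i j)
  have h3 : ∀ i j, ∀ᶠ k in l, i ≠ j →
      br (compPts b c (z k).2.2 i) (compPts b c (z k).2.2 j) ≠ 0 := fun i j => by
    by_cases hij : i = j
    · exact Eventually.of_forall fun k h => absurd hij h
    · exact ((tendsto_br (hy i) (hy j)).eventually_ne (hd.2.2 i j hij)).mono fun k hk _ => hk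
  filter_upwards [eventually_all.2 fun i => eventually_all.2 (h1 i),
    eventually_all.2 fun i => eventually_all.2 (h2 i),
    eventually_all.2 fun i => eventually_all.2 (h3 i)] with k k1 k2 k3
  exact ⟨k1, k2, k3⟩

lemma Channel.exists_param (h : Channel s p₀ sL sR a μ b c) :
    ∃ φ : Config (Option A) × Config (Option B) → P → ℂ × (Off a μ → ℂ) × (Off b c → ℂ),
      (∀ vw ∈ sidePairs sL sR a μ b c, Tendsto (φ vw) (𝓝 p₀) (𝓝 (sideParam a μ b c vw))) ∧
      (∀ᶠ p in 𝓝 p₀, ∀ vw ∈ sidePairs sL sR a μ b c, rescaledEqs (s p) a μ b c (φ vw p) = 0 ∧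
        (chanSum (s p) ≠ 0 → (φ vw p).1 ≠ 0 ∧
          paramConf a μ b c (φ vw p) ∈ Sols (s p) ⟨.inl a, .inr b, .inr c⟩)) ∧
      (∀ᶠ p in 𝓝 p₀, Set.InjOn (fun vw => φ vw p) (sidePairs sL sR a μ b c)) ∧
      ∃ δ₀ > 0, ∀ δ, 0 < δ → δ < δ₀ → ∃ ρ₀ > 0, ∀ ρ, 0 < ρ → ρ < ρ₀ → ∀ᶠ p in 𝓝 p₀,
        chanSum (s p) ≠ 0 →
        Sols (s p) ⟨.inl a, .inr b, .inr c⟩ ∩ degen (Set.range inl) (.inl μ) δ ρ =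
          (fun vw => paramConf a μ b c (φ vw p)) '' sidePairs sL sR a μ b c := by
  obtain ⟨φ, hφ⟩ := h.exists_branches
  have hfin : (sidePairs sL sR a μ b c).Finite := h.genericL.1.prod h.genericR.1
  have hsol : ∀ᶠ p in 𝓝 p₀, ∀ vw ∈ sidePairs sL sR a μ b c,
      rescaledEqs (s p) a μ b c (φ vw p) = 0 ∧ (chanSum (s p) ≠ 0 → (φ vw p).1 ≠ 0 ∧
          paramConf a μ b c (φ vw p) ∈ Sols (s p) ⟨.inl a, .inr b, .inr c⟩) := by
    rw [hfin.eventually_all]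
    intro vw hvw
    filter_upwards [(hφ vw hvw).2.1, eventually_confDistinct (hφ vw hvw).1
      (confDistinct_sideParam h hvw)] with p hp hpd
    refine ⟨hp, fun hst => ?_⟩
    have hε : (φ vw p).1 ≠ 0 := fun h0 => hst (by
      have := congrArg Prod.fst hp
      simpa [rescaledEqs, h0] using this)
    exact ⟨hε, (mem_Sols_conf (h.symm p) h.ne_left h.ne_right hε hpd).2 hp⟩
  have hinj : ∀ᶠ p in 𝓝 p₀, Set.InjOn (fun vw => φ vw p) (sidePairs sL sR a μ b c) := by
    unfold Set.InjOn
    rw [hfin.eventually_all]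
    intro vw hvw
    rw [hfin.eventually_all]
    intro vw' hvw'
    by_cases he : vw = vw'
    · exact Eventually.of_forall fun p _ => he
    · have hne : sideParam a μ b c vw ≠ sideParam a μ b c vw' := fun h => he
        (sideParam_injOn hvw hvw' h)
      filter_upwards [((hφ vw hvw).1.prodMk_nhds (hφ vw' hvw').1).eventually
        (isOpen_ne_fun continuous_fst continuous_snd |>.mem_nhds hne)] with p hp h
      exact absurd h hp
  refine ⟨φ, fun vw hvw => (hφ vw hvw).1, hsol, hinj, ?_⟩
  have hδ : ∀ᶠ δ in 𝓝[>] (0 : ℝ), ∀ vw ∈ sidePairs sL sR a μ b c,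
      ∀ᶠ q in 𝓝 (sideParam a μ b c vw).2, q ∈ region a μ b c δ := by
    rw [hfin.eventually_all]
    exact fun vw hvw => eventually_mem_region (confDistinct_sideParam h hvw)
  obtain ⟨δ₀, hδ₀, hδ⟩ := mem_nhdsGT_iff_exists_Ioo_subset.1 hδ
  refine ⟨δ₀, hδ₀, fun δ h0 h1 => ?_⟩
  obtain ⟨ρ₀, hρ₀, hbr⟩ := h.eventually_eq_branch (fun vw hvw => (hφ vw hvw).2.2) h0
  refine ⟨ρ₀, hρ₀, fun ρ hρ hρ' => ?_⟩
  have hin : ∀ᶠ p in 𝓝 p₀, ∀ vw ∈ sidePairs sL sR a μ b c,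
      (φ vw p).2 ∈ region a μ b c δ ∧ ‖(φ vw p).1‖ < ρ := by
    rw [hfin.eventually_all]
    intro vw hvw
    have h2 : Tendsto (fun p => (φ vw p).2) (𝓝 p₀) (𝓝 (sideParam a μ b c vw).2) :=
      (continuous_snd.tendsto _).comp (hφ vw hvw).1
    have h3 : Tendsto (fun p => ‖(φ vw p).1‖) (𝓝 p₀) (𝓝 ‖(0 : ℂ)‖) :=
      ((continuous_fst.tendsto _).comp (hφ vw hvw).1).norm
    rw [norm_zero] at h3
    exact (h2.eventually (hδ ⟨h0, h1⟩ vw hvw)).and (h3.eventually_lt_const hρ)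
  filter_upwards [hsol, hbr, hin] with p hp hp' hpin hst
  ext u
  constructor
  · rintro ⟨hu, hud⟩
    obtain ⟨ε, ξ, ζ, hε, hερ, hreg, rfl⟩ := (conf_mem_degen_iff h.ne_left hu).1 hud
    have hz := (mem_Sols_conf (z := (ε, ξ, ζ)) (h.symm p) h.ne_left h.ne_right hε
      (confDistinct_of_mem_Sols hu)).1 hu
    obtain ⟨vw, hvw, e⟩ := hp' ε ξ ζ (hερ.trans hρ') hreg hz
    exact ⟨vw, hvw, by simp only [← e]; rfl⟩
  · rintro ⟨vw, hvw, rfl⟩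
    have hmem := ((hp vw hvw).2 hst).2
    exact ⟨hmem, (conf_mem_degen_iff h.ne_left hmem).2 ⟨_, _, _, ((hp vw hvw).2 hst).1,
      (hpin vw hvw).2, (hpin vw hvw).1, rfl⟩⟩

/-- The rescaled integrand `f` tends to `R` on all degenerating solutions. -/
def HasChanLimit (s : P → A ⊕ B → A ⊕ B → ℂ) (g : Gauge (A ⊕ B)) (l : Filter P)
    (v : Config (Option A)) (w : Config (Option B)) (n : ℕ) (f : P → Config (A ⊕ B) → ℂ)
    (R : ℂ) : Prop :=
  ∀ (ε : P → ℂ) (x : P → A → ℂ) (y : P → B → ℂ × ℂ), Tendsto ε l (𝓝 0) →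
    (∀ᶠ p in l, ε p ≠ 0 ∧ conf (ε p) (x p) (y p) ∈ Sols (s p) g) →
    (∀ i, Tendsto (fun p => x p i) l (𝓝 (v (some i)).1)) →
    (∀ j, Tendsto (fun p => y p j) l (𝓝 (w (some j)))) →
    Tendsto (fun p => ε p ^ n * f p (conf (ε p) (x p) (y p))) l (𝓝 R)

lemma Channel.tendsto_degen (h : Channel s p₀ sL sR a μ b c) {l : Filter P} (hl : l ≤ 𝓝 p₀)
    (hst : ∀ᶠ p in l, chanSum (s p) ≠ 0) {f : P → Config (A ⊕ B) → ℂ} {J : Type*} [Fintype J]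
    {fL : J → Config (Option A) → ℂ} {fR : J → Config (Option B) → ℂ}
    (hf : ∀ vw ∈ sidePairs sL sR a μ b c, HasChanLimit s ⟨.inl a, .inr b, .inr c⟩ l vw.1 vw.2
      (2 * (card (Off a μ) + 1)) f (∑ α, fL α vw.1 * fR α vw.2)) :
    ∃ δ₀ > 0, ∀ δ, 0 < δ → δ < δ₀ → ∃ ρ₀ > 0, ∀ ρ, 0 < ρ → ρ < ρ₀ →
      (∀ᶠ p in l, (Sols (s p) ⟨.inl a, .inr b, .inr c⟩ ∩
        degen (Set.range inl) (.inl μ) δ ρ).Finite) ∧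
      Tendsto (fun p => chanSum (s p) * chySum (s p) ⟨.inl a, .inr b, .inr c⟩
        (degen (Set.range inl) (.inl μ) δ ρ) (f p)) l
        (𝓝 (∑ α, chySum sL ⟨some a, some μ, none⟩ Set.univ (fL α) *
          chySum sR ⟨none, some b, some c⟩ Set.univ (fR α))) := by
  obtain ⟨φ, hφ, hsol, hinj, δ₀, hδ₀, hδ⟩ := h.exists_param
  have hfin : (sidePairs sL sR a μ b c).Finite := h.genericL.1.prod h.genericR.1
  refine ⟨δ₀, hδ₀, fun δ h0 h1 => ?_⟩
  obtain ⟨ρ₀, hρ₀, hρ⟩ := hδ δ h0 h1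
  refine ⟨ρ₀, hρ₀, fun ρ hρ0 hρ1 => ?_⟩
  have hset := hl (hρ ρ hρ0 hρ1)
  refine ⟨?_, ?_⟩
  · filter_upwards [hset, hst] with p hp hps
    rw [hp hps]
    exact hfin.image _
  have hterm : ∀ vw ∈ sidePairs sL sR a μ b c, Tendsto (fun p => chanSum (s p) *
      (f p (paramConf a μ b c (φ vw p)) /
        jac (s p) ⟨.inl a, .inr b, .inr c⟩ (paramConf a μ b c (φ vw p)))) l
      (𝓝 (-(∑ α, fL α vw.1 * fR α vw.2) / (jac sL ⟨some a, some μ, none⟩ vw.1 *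
        jac sR ⟨none, some b, some c⟩ vw.2))) := by
    intro vw hvw
    have hz : Tendsto (φ vw) l (𝓝 (sideParam a μ b c vw)) := (hφ vw hvw).mono_left hl
    have hε : Tendsto (fun p => (φ vw p).1) l (𝓝 0) := (continuous_fst.tendsto _).comp hz
    have hx : ∀ i, Tendsto (fun p => chanPts a μ (φ vw p).2.1 i) l
        (𝓝 (chanPts a μ (sideParam a μ b c vw).2.1 i)) := fun i =>
      (((continuous_chanPts a μ i).comp (continuous_fst.comp continuous_snd)).tendsto _).comp hz
    have hy : ∀ j, Tendsto (fun p => compPts b c (φ vw p).2.2 j) l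
        (𝓝 (compPts b c (sideParam a μ b c vw).2.2 j)) := fun j =>
      (((continuous_compPts b c j).comp (continuous_snd.comp continuous_snd)).tendsto _).comp hz
    have hv := leftConf_of_mem_Sols hvw.1
    have hw := rightConf_of_mem_Sols hvw.2
    have hd := confDistinct_sideParam h hvw
    have hd0 : ∀ j, br (0, 1) (compPts b c (sideParam a μ b c vw).2.2 j) ≠ 0 := fun j => by
      simpa using hd.2.1 a j
    have hs : ∀ i j, Tendsto (fun p => s p i j) l (𝓝 (s p₀ i j)) := fun i j =>
      ((h.smooth i j).continuous.tendsto p₀).mono_left hl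
    have hgood : ∀ᶠ p in l, rescaledEqs (s p) a μ b c (φ vw p) = 0 ∧ (φ vw p).1 ≠ 0 ∧
        paramConf a μ b c (φ vw p) ∈ Sols (s p) ⟨.inl a, .inr b, .inr c⟩ := by
      filter_upwards [hl hsol, hst] with p hp hps
      exact ⟨(hp vw hvw).1, (hp vw hvw).2 hps⟩
    have hF := h.calF_ne_zero _ hvw.1 _ hvw.2
    have hFr := tendsto_finsetSum univ fun i _ => (hx i).mul (tendsto_crossRes hs hε hx hy hd0 i)
    rw [sum_mul_crossRes, sideParam, hv, hw] at hFr
    have hJ := tendsto_jac_conf (b := b) (c := c) hs h.symm h.toSidePairings hε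
      (hgood.mono fun p hp => hp.2.1) hx hy hd.1 hd0 hd.2.2 h.ne_left
      (fun p => chanPts_left a μ _) (fun p => chanPts_right h.ne_left _)
      (hgood.mono fun p hp i hi => hp.2.2.2.2 (.inl i) (by simp [Gauge.Free, hi]))
    rw [sum_mul_crossRes, sideParam, hv, hw] at hJ
    have hJ0 : jac sL ⟨some a, some μ, none⟩ vw.1 * jac sR ⟨none, some b, some c⟩ vw.2 ≠ 0 :=
      mul_ne_zero (h.genericL.2 _ hvw.1) (h.genericR.2 _ hvw.2)
    have hfl := hf vw hvw (fun p => (φ vw p).1) (fun p => chanPts a μ (φ vw p).2.1)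
      (fun p => compPts b c (φ vw p).2.2) hε (hgood.mono fun p hp => hp.2)
      (fun i => by
        have := hx i
        rw [show chanPts a μ (sideParam a μ b c vw).2.1 i = (vw.1 (some i)).1 by
          conv_rhs => rw [← hv]
          rfl] at this
        exact this)
      (fun j => by
        have := hy j
        rw [show compPts b c (sideParam a μ b c vw).2.2 j = vw.2 (some j) by
          conv_rhs => rw [← hw]
          rfl] at this
        exact this)
    have hlim := (hFr.neg.mul hfl).div hJ (by rw [mul_assoc]; exact mul_ne_zero hF hJ0)
    have e1 : ∀ F S a b : ℂ, F ≠ 0 → a * b ≠ 0 → -F * S / (F * a * b) = -S / (a * b) := by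
      intro F S a b hF hab
      rw [mul_assoc, neg_mul, ← mul_neg, mul_div_mul_left _ _ hF]
    rw [e1 _ _ _ _ hF hJ0] at hlim
    refine hlim.congr' ?_
    filter_upwards [hgood] with p hp
    have h2 : chanSum (s p) = -((φ vw p).1 * ∑ i, chanPts a μ (φ vw p).2.1 i *
        crossRes (s p) (φ vw p).1 (chanPts a μ (φ vw p).2.1) (compPts b c (φ vw p).2.2) i) :=
      eq_neg_of_add_eq_zero_left (congrArg Prod.fst hp.1)
    have hε0 := hp.2.1
    simp only [Pi.div_apply]
    rw [h2]
    unfold paramConf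
    rw [show 2 * (card (Off a μ) + 1) = (2 * card (Off a μ) + 1) + 1 by ring, pow_succ]
    rw [show ∀ F e E f J : ℂ, -F * (E * e * f) / (E * J) = E * (-F * (e * f)) / (E * J) by
      intros; ring_nf, mul_div_mul_left _ _ (pow_ne_zero _ hε0)]
    ring
  have hsum : Tendsto (fun p => -∑ vw ∈ hfin.toFinset, chanSum (s p) *
      (f p (paramConf a μ b c (φ vw p)) /
        jac (s p) ⟨.inl a, .inr b, .inr c⟩ (paramConf a μ b c (φ vw p)))) l
      (𝓝 (-∑ vw ∈ hfin.toFinset, (-(∑ α, fL α vw.1 * fR α vw.2) /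
        (jac sL ⟨some a, some μ, none⟩ vw.1 * jac sR ⟨none, some b, some c⟩ vw.2)))) :=
    (tendsto_finsetSum _ fun vw hvw => hterm vw (hfin.mem_toFinset.1 hvw)).neg
  have hval : -∑ vw ∈ hfin.toFinset, (-(∑ α, fL α vw.1 * fR α vw.2) /
        (jac sL ⟨some a, some μ, none⟩ vw.1 * jac sR ⟨none, some b, some c⟩ vw.2)) =
      ∑ α, chySum sL ⟨some a, some μ, none⟩ Set.univ (fL α) *
          chySum sR ⟨none, some b, some c⟩ Set.univ (fR α) := by
    have e1 : hfin.toFinset = h.genericL.1.toFinset ×ˢ h.genericR.1.toFinset := by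
      ext ⟨v, w⟩
      simp [sidePairs]
    simp only [chySum, Set.inter_univ]
    simp_rw [finsum_mem_eq_finite_toFinset_sum _ h.genericL.1,
      finsum_mem_eq_finite_toFinset_sum _ h.genericR.1, neg_mul_neg, sum_mul_sum]
    rw [e1, ← sum_neg_distrib, Finset.sum_product]
    symm
    rw [sum_comm]
    refine sum_congr rfl fun v _ => ?_
    rw [sum_comm]
    refine sum_congr rfl fun w _ => ?_
    rw [neg_div, neg_neg, sum_div]
    exact sum_congr rfl fun α _ => div_mul_div_comm _ _ _ _
  rw [hval] at hsum
  refine hsum.congr' ?_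
  filter_upwards [hset, hst, hl hinj, hl hsol] with p hp hps hpi hpsol
  have hinj' : Set.InjOn (fun vw => paramConf a μ b c (φ vw p)) (sidePairs sL sR a μ b c) :=
    fun vw hvw vw' hvw' e => hpi hvw hvw' (paramConf_injective h.ne_left ((hpsol vw hvw).2 hps).1 e)
  rw [chySum, hp hps, finsum_mem_image hinj', finsum_mem_eq_finite_toFinset_sum _ hfin, mul_neg,
    mul_sum]

/-! ### Solutions away from the degenerations -/

section Bulk

variable {Λ : Type*} [Fintype Λ] [DecidableEq Λ]

/-- The configuration in the gauge `g` with the free points at `θ`. -/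
def gaugeConf (g : Gauge Λ) (θ : {i // g.Free i} → ℂ) : Config Λ := fun i =>
  if h : g.Free i then (θ ⟨i, h⟩, 1) else if i = g.zero then (0, 1) else if i = g.one then (1, 1)
  else (1, 0)

lemma gaugeConf_free (g : Gauge Λ) (θ : {i // g.Free i} → ℂ) (i : {i // g.Free i}) :
    gaugeConf g θ i.1 = (θ i, 1) := by
  rw [gaugeConf, dif_pos i.2]

lemma gaugeConf_of_normalised {g : Gauge Λ} {u : Config Λ} (hu : g.Normalised u) :
    gaugeConf g (fun i => (u i.1).1) = u := by
  obtain ⟨h0, h1, h2, h3⟩ := hu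
  ext1 i
  unfold gaugeConf
  split_ifs with h h' h''
  · exact Prod.ext rfl (h3 i h.2.2).symm
  · rw [h', h0]
  · rw [h'', h1]
  · have : i = g.inf := by
      unfold Gauge.Free at h
      tauto
    rw [this, h2]

lemma contDiff_gaugeConf (g : Gauge Λ) (i : Λ) : ContDiff ℂ 1 fun θ => gaugeConf g θ i := by
  unfold gaugeConf
  split_ifs <;> fun_prop

lemma gaugeConf_snd_cases (g : Gauge Λ) (θ : {i // g.Free i} → ℂ) (i : Λ) :
    (gaugeConf g θ i).2 = 1 ∨ (gaugeConf g θ i).2 = 0 := by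
  unfold gaugeConf
  split_ifs <;> simp

variable {s : P → Λ → Λ → ℂ} {g : Gauge Λ}

lemma exists_bulk_branch (hs : ∀ i j, ContDiff ℂ 1 fun p => s p i j) {θ₀ : {i // g.Free i} → ℂ}
    (hne : ∀ i j, i ≠ j → br (gaugeConf g θ₀ i) (gaugeConf g θ₀ j) ≠ 0)
    (hsc : ∀ i, g.Free i → scatEq (s p₀) (gaugeConf g θ₀) i = 0)
    (hJ : jac (s p₀) g (gaugeConf g θ₀) ≠ 0) :
    ∃ φ : P → {i // g.Free i} → ℂ, Tendsto φ (𝓝 p₀) (𝓝 θ₀) ∧ ∀ᶠ q in 𝓝 (p₀, θ₀),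
      (∀ i, g.Free i → scatEq (s q.1) (gaugeConf g q.2) i = 0) → q.2 = φ q.1 := by
  have hG : ContDiffAt ℂ 1 (fun q : P × ({i // g.Free i} → ℂ) => fun i : {i // g.Free i} =>
      scatEq (s q.1) (gaugeConf g q.2) i.1) (p₀, θ₀) := by
    refine contDiffAt_pi.2 fun i => contDiffAt_scatEq (fun _ _ =>
      ((hs _ _).comp contDiff_fst).contDiffAt) (fun j =>
      ((contDiff_gaugeConf g j).comp contDiff_snd).contDiffAt) _ ?_ fun j hj => hne _ _ hj.symm
    simp [gaugeConf_free]
  obtain ⟨φ, -, h1, -, h2⟩ := exists_branch hG (funext fun i => hsc i.1 i.2) fun h hh => by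
    let q : Λ → ℂ := fun i => if hi : g.Free i then h ⟨i, hi⟩ else 0
    have hmul : (jacMat (s p₀) g (gaugeConf g θ₀)).mulVec (fun j => q j) = 0 := by
      ext i
      rw [jacMat_mulVec]
      · have h1 := hasDerivAt_scatEq (s p₀) (fun t => gaugeConf g (θ₀ + t • h)) q i.1
          (by
            intro t j
            simp only [zero_smul, add_zero, q, gaugeConf]
            split_ifs <;> simp) (by simp [gaugeConf_free])
          (fun j => gaugeConf_snd_cases g _ j)
          (fun j hj => by simpa using hne i.1 j hj.symm)
        have h2 := hasDerivAt_pi.1 hh i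
        simp only [zero_smul, add_zero] at h1
        exact h1.unique h2
      · exact fun i hi => dif_neg hi
      · exact fun i hi => by rw [gaugeConf_free g θ₀ ⟨i, hi⟩]
    have h3 := Matrix.eq_zero_of_mulVec_eq_zero (by rwa [← jac_eq_det]) hmul
    ext i
    have h4 := congrFun h3 i
    simpa [q, i.2] using h4
  exact ⟨φ, h1, h2.mono fun q hq h0 => hq (funext fun i => h0 i.1 i.2)⟩

lemma tendsto_mul_chySum_bulk (hs : ∀ i j, ContDiff ℂ 1 fun p => s p i j) {l : Filter P}
    (hl : l ≤ 𝓝 p₀) {t : P → ℂ} (ht : Tendsto t l (𝓝 0)) {f : P → Config Λ → ℂ}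
    (hf : ∀ (u : P → Config Λ) (u₀ : Config Λ), (∀ i j, i ≠ j → br (u₀ i) (u₀ j) ≠ 0) →
      (∀ p i, (u p i).2 = 1 ∨ u p i = (1, 0)) → (∀ i, Tendsto (fun p => u p i) l (𝓝 (u₀ i))) →
      (fun p => f p (u p)) =O[l] fun _ => (1 : ℝ)) {δ : ℝ} (hδ : 0 < δ)
    (U : P → Set (Config Λ)) (hU : ∀ᶠ p in l, Sols (s p) g ∩ U p ⊆ bulk (s p) g δ) :
    (∀ᶠ p in l, (Sols (s p) g ∩ U p).Finite) ∧
      Tendsto (fun p => t p * chySum (s p) g (U p) (f p)) l (𝓝 0) := by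
  let C : Set ({i // g.Free i} → ℂ) := {θ | (∀ i j, i ≠ j →
    δ ≤ ‖br (gaugeConf g θ i) (gaugeConf g θ j)‖) ∧ ∀ i, ‖(gaugeConf g θ i).1‖ ≤ δ⁻¹}
  have hc : ∀ i, Continuous fun θ => gaugeConf g θ i := fun i => (contDiff_gaugeConf g i).continuous
  have hC : IsCompact C := by
    refine Metric.isCompact_of_isClosed_isBounded ?_ ?_
    · simp only [C, Set.ofPred_and, Set.ofPred_forall]
      exact IsClosed.inter (isClosed_iInter fun i => isClosed_iInter fun j =>
        isClosed_iInter fun _ => isClosed_le continuous_const (continuous_br (hc i) (hc j)).norm)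
        (isClosed_iInter fun i => isClosed_le (hc i).fst.norm continuous_const)
    · refine (Metric.isBounded_closedBall (x := 0) (r := δ⁻¹)).subset fun θ hθ => ?_
      rw [mem_closedBall_zero_iff, pi_norm_le_iff_of_nonneg (inv_pos.2 hδ).le]
      intro i
      simpa [gaugeConf_free] using hθ.2 i.1
  obtain ⟨Φ, hΦ, hgood, hbr⟩ := exists_branches_of_isCompact hC (l := l)
    (Q := fun p θ => gaugeConf g θ ∈ Sols (s p) g ∧ δ ≤ ‖jac (s p) g (gaugeConf g θ)‖)
    (good := fun φ => ∃ θ₀, (∀ i j, i ≠ j → br (gaugeConf g θ₀ i) (gaugeConf g θ₀ j) ≠ 0) ∧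
      jac (s p₀) g (gaugeConf g θ₀) ≠ 0 ∧ Tendsto φ (𝓝 p₀) (𝓝 θ₀)) (fun θ hθ => by
      have hne : ∀ i j, i ≠ j → br (gaugeConf g θ i) (gaugeConf g θ j) ≠ 0 := fun i j hij h => by
        have := hθ.1 i j hij
        rw [h, norm_zero] at this
        linarith
      have hq1 : ∀ i j, Tendsto (fun q : P × ({i // g.Free i} → ℂ) => s q.1 i j) (l ×ˢ 𝓝 θ)
          (𝓝 (s p₀ i j)) := fun i j =>
        (((hs i j).continuous.tendsto p₀).mono_left hl).comp tendsto_fst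
      have hq2 : ∀ i, Tendsto (fun q : P × ({i // g.Free i} → ℂ) => gaugeConf g q.2 i) (l ×ˢ 𝓝 θ)
          (𝓝 (gaugeConf g θ i)) := fun i => ((hc i).tendsto θ).comp tendsto_snd
      by_cases hJ : jac (s p₀) g (gaugeConf g θ) = 0
      · refine ⟨∅, Set.finite_empty, by simp, ?_⟩
        have h1 := (tendsto_jac hq1 hq2 hne g).norm
        rw [hJ, norm_zero] at h1
        filter_upwards [h1.eventually_lt_const hδ] with q hq hQ
        exact absurd hQ.2 (not_le.2 hq)
      by_cases hsc : ∀ i, g.Free i → scatEq (s p₀) (gaugeConf g θ) i = 0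
      · obtain ⟨φ, h1, h2⟩ := exists_bulk_branch hs hne hsc hJ
        refine ⟨{φ}, Set.finite_singleton _, by rintro _ rfl; exact ⟨θ, hne, hJ, h1⟩, ?_⟩
        have h3 : l ×ˢ 𝓝 θ ≤ 𝓝 (p₀, θ) := by
          rw [nhds_prod_eq]
          exact Filter.prod_mono_left _ hl
        filter_upwards [h3 h2] with q hq hQ
        exact ⟨φ, rfl, hq hQ.1.2.2⟩
      · push Not at hsc
        obtain ⟨i, hi, h0⟩ := hsc
        refine ⟨∅, Set.finite_empty, by simp, ?_⟩
        have h1 := tendsto_scatEq hq1 hq2 hne i (by rw [gaugeConf_free g θ ⟨i, hi⟩]; simp)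
        filter_upwards [h1.eventually_ne h0] with q hq hQ
        exact absurd (hQ.1.2.2 i hi) hq)
  have hsub : ∀ᶠ p in l, Sols (s p) g ∩ U p ⊆ (fun φ => gaugeConf g (φ p)) '' Φ := by
    filter_upwards [hbr, hU] with p hp hpU u hu
    have hb := hpU hu
    have e := gaugeConf_of_normalised hu.1.1
    obtain ⟨φ, hφ, h1⟩ := hp (fun i => (u i.1).1) ⟨by rw [e]; exact hb.1, by rw [e]; exact hb.2.1⟩
      (by rw [e]; exact ⟨hu.1, hb.2.2⟩)
    exact ⟨φ, hφ, by simp only [← h1]; exact e⟩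
  have hfin : ∀ᶠ p in l, (Sols (s p) g ∩ U p).Finite := hsub.mono fun p hp =>
    (hΦ.image _).subset hp
  refine ⟨hfin, ?_⟩
  have hO : (fun p => ∑ φ ∈ hΦ.toFinset, ‖f p (gaugeConf g (φ p)) /
      jac (s p) g (gaugeConf g (φ p))‖) =O[l] fun _ => (1 : ℝ) := by
    refine IsBigO.fun_sum fun φ hφ => ?_
    obtain ⟨θ₀, h1, h2, h3⟩ := hgood φ (hΦ.mem_toFinset.1 hφ)
    have hφt : ∀ i, Tendsto (fun p => gaugeConf g (φ p) i) l (𝓝 (gaugeConf g θ₀ i)) := fun i =>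
      ((hc i).tendsto θ₀).comp (h3.mono_left hl)
    have hJ := tendsto_jac (fun i j => ((hs i j).continuous.tendsto p₀).mono_left hl) hφt h1 g
    have h4 := hf _ _ h1 (fun p i => ?_) hφt
    · have h5 := h4.mul ((hJ.inv₀ h2).isBigO_one ℝ)
      simp only [mul_one] at h5
      exact h5.norm_left
    · unfold gaugeConf
      split_ifs <;> simp
  have hle : ∀ᶠ p in l, ‖chySum (s p) g (U p) (f p)‖ ≤ ‖∑ φ ∈ hΦ.toFinset,
      ‖f p (gaugeConf g (φ p)) / jac (s p) g (gaugeConf g (φ p))‖‖ := by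
    classical
    filter_upwards [hsub, hfin] with p hp hpf
    rw [chySum, norm_neg, finsum_mem_eq_finite_toFinset_sum _ hpf, Real.norm_eq_abs,
      abs_of_nonneg (Finset.sum_nonneg fun _ _ => norm_nonneg _)]
    refine (norm_sum_le _ _).trans ?_
    have h1 : hpf.toFinset ⊆ hΦ.toFinset.image fun φ => gaugeConf g (φ p) := by
      intro u hu
      obtain ⟨φ, hφ, e⟩ := hp (hpf.mem_toFinset.1 hu)
      exact Finset.mem_image.2 ⟨φ, hΦ.mem_toFinset.2 hφ, e⟩
    refine (Finset.sum_le_sum_of_subset_of_nonneg h1 fun _ _ _ => norm_nonneg _).trans ?_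
    exact Finset.sum_image_le_of_nonneg fun _ _ => norm_nonneg _
  have h6 : (fun p => chySum (s p) g (U p) (f p)) =O[l] fun _ => (1 : ℝ) :=
    (IsBigO.of_bound' hle).trans hO
  have h7 := ((isLittleO_one_iff ℝ).2 ht).mul_isBigO h6
  simp only [mul_one] at h7
  exact (isLittleO_one_iff ℝ).1 h7

end Bulk

lemma degen_subset {Λ : Type*} (S : Set Λ) (μ : Λ) {δ δ' ρ : ℝ} (h0 : 0 < δ') (h : δ' ≤ δ) :
    degen S μ δ ρ ⊆ degen S μ δ' ρ := by
  have hi : δ⁻¹ ≤ δ'⁻¹ := inv_anti₀ h0 h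
  rintro u ⟨ε, x, h1, h2, h3, h4, h5⟩
  exact ⟨ε, x, h1, h2, h3, fun i hi' => ⟨(h4 i hi').1, (h4 i hi').2.1.trans hi, fun j hj hij =>
    h.trans ((h4 i hi').2.2 j hj hij)⟩, fun p hp => ⟨h.trans (h5 p hp).1, (h5 p hp).2.1.trans hi,
    fun q hq hpq => h.trans ((h5 p hp).2.2 q hq hpq)⟩⟩

lemma chySum_add_compl {Λ : Type*} [Fintype Λ] [DecidableEq Λ] {s : Λ → Λ → ℂ} {g : Gauge Λ}
    {U : Set (Config Λ)} (h1 : (Sols s g ∩ U).Finite) (h2 : (Sols s g ∩ Uᶜ).Finite)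
    (f : Config Λ → ℂ) : chySum s g Set.univ f = chySum s g U f + chySum s g Uᶜ f := by
  unfold chySum
  have e : Sols s g ∩ Set.univ = Sols s g ∩ U ∪ Sols s g ∩ Uᶜ := by
    rw [← Set.inter_union_distrib_left, Set.union_compl_self]
  rw [e, finsum_mem_union (disjoint_compl_right.mono Set.inter_subset_right Set.inter_subset_right)
    h1 h2, neg_add]

lemma Channel.tendsto_full (h : Channel s p₀ sL sR a μ b c) {l : Filter P} (hl : l ≤ 𝓝 p₀)
    (hst : ∀ᶠ p in l, chanSum (s p) ≠ 0) {f : P → Config (A ⊕ B) → ℂ} {J : Type*} [Fintype J]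
    {fL : J → Config (Option A) → ℂ} {fR : J → Config (Option B) → ℂ}
    (hf : ∀ vw ∈ sidePairs sL sR a μ b c, HasChanLimit s ⟨.inl a, .inr b, .inr c⟩ l vw.1 vw.2
      (2 * (card (Off a μ) + 1)) f (∑ α, fL α vw.1 * fR α vw.2))
    (hfb : ∀ (u : P → Config (A ⊕ B)) (u₀ : Config (A ⊕ B)),
      (∀ i j, i ≠ j → br (u₀ i) (u₀ j) ≠ 0) → (∀ p i, (u p i).2 = 1 ∨ u p i = (1, 0)) →
      (∀ i, Tendsto (fun p => u p i) l (𝓝 (u₀ i))) →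
      (fun p => f p (u p)) =O[l] fun _ => (1 : ℝ)) {δ : ℝ} (hδ : 0 < δ)
    (hsub : ∀ ρ, 0 < ρ → ∀ᶠ p in l, Sols (s p) ⟨.inl a, .inr b, .inr c⟩ ⊆
      degen (Set.range inl) (.inl μ) δ ρ ∪ bulk (s p) ⟨.inl a, .inr b, .inr c⟩ δ) :
    Tendsto (fun p => chanSum (s p) * chySum (s p) ⟨.inl a, .inr b, .inr c⟩ Set.univ (f p)) l
        (𝓝 (∑ α, chySum sL ⟨some a, some μ, none⟩ Set.univ (fL α) *
          chySum sR ⟨none, some b, some c⟩ Set.univ (fR α))) := by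
  obtain ⟨δ₀, hδ₀, H⟩ := h.tendsto_degen hl hst hf
  have hδ' : 0 < min δ (δ₀ / 2) := lt_min hδ (half_pos hδ₀)
  obtain ⟨ρ₀, hρ₀, H⟩ := H _ hδ' ((min_le_right _ _).trans_lt (half_lt_self hδ₀))
  obtain ⟨hfin, hlim⟩ := H _ (half_pos hρ₀) (half_lt_self hρ₀)
  have ht : Tendsto (fun p => chanSum (s p)) l (𝓝 0) := by
    rw [← h.chanSum_eq_zero]
    exact (tendsto_finsetSum _ fun i _ => tendsto_finsetSum _ fun k _ =>
      ((h.smooth _ _).continuous.tendsto p₀).mono_left hl).div_const _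
  obtain ⟨hfin', hlim'⟩ := tendsto_mul_chySum_bulk (g := ⟨.inl a, .inr b, .inr c⟩) h.smooth hl ht
    hfb hδ (fun _ => (degen (Set.range inl) (.inl μ) (min δ (δ₀ / 2)) (ρ₀ / 2))ᶜ) (by
      filter_upwards [hsub _ (half_pos hρ₀)] with p hp u hu
      exact (hp hu.1).resolve_left fun hd => hu.2 (degen_subset _ _ hδ' (min_le_left _ _) hd))
  have := hlim.add hlim'
  rw [add_zero] at this
  refine this.congr' ?_
  filter_upwards [hfin, hfin'] with p h1 h2
  rw [chySum_add_compl h1 h2, mul_add]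

end Conf

/-! ### The matrix `M` -/

section ChyMat

variable {Λ : Type*} [Fintype Λ] [DecidableEq Λ] {m : ℕ}

/-- The vector of a row: momentum or polarisation. -/
def rowVec (k e : Λ → V m) (x : Λ × Bool) : V m := if x.2 then e x.1 else k x.1

/-- The tree-level propagator. -/
def brInv (u : Config Λ) (i j : Λ) : ℂ := (br (u i) (u j))⁻¹

notation:max "treeMat" k:max e:max u:max => chyMat k e (brInv u) u

lemma chyMat_of_ne (k e : Λ → V m) (S : Λ → Λ → ℂ) (u : Config Λ) {x y : Λ × Bool}
    (h : x.1 ≠ y.1) : chyMat k e S u x y = (rowVec k e x ⬝ᵥ rowVec k e y) * S x.1 y.1 := by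
  simp [chyMat, rowVec, h]

lemma chyMat_false_true (k e : Λ → V m) (S : Λ → Λ → ℂ) (u : Config Λ) (i : Λ) :
    chyMat k e S u (i, false) (i, true) = polP k u i (e i) := by
  simp [chyMat]

lemma chyMat_true_false (k e : Λ → V m) (S : Λ → Λ → ℂ) (u : Config Λ) (i : Λ) :
    chyMat k e S u (i, true) (i, false) = -polP k u i (e i) := by
  simp [chyMat]

lemma chyMat_same (k e : Λ → V m) (S : Λ → Λ → ℂ) (u : Config Λ) (x : Λ × Bool) :
    chyMat k e S u x x = 0 := by
  simp [chyMat]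

lemma isSkew_chyMat (k e : Λ → V m) (u : Config Λ) : IsSkew (treeMat k e u) := by
  rintro ⟨i, b⟩ ⟨j, c⟩
  by_cases h : i = j
  · subst h
    cases b <;> cases c <;> simp [chyMat_same, chyMat_false_true, chyMat_true_false]
  · rw [chyMat_of_ne k e _ u (x := (j, c)) (y := (i, b)) (Ne.symm h),
      chyMat_of_ne k e _ u (x := (i, b)) (y := (j, c)) h, dotProduct_comm, brInv, brInv,
      br_swap, inv_neg, mul_neg]

lemma IsSkew.submatrix {κ κ' : Type*} {A : Matrix κ κ ℂ} (h : IsSkew A) (f : κ' → κ) :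
    IsSkew (A.submatrix f f) := fun x y => h (f x) (f y)

lemma polP_add (k : Λ → V m) (u : Config Λ) (i : Λ) (e e' : V m) :
    polP k u i (e + e') = polP k u i e + polP k u i e' := by
  simp only [polP_eq_resAt, resAt]
  split_ifs <;> simp only [add_dotProduct, add_mul, add_div, sum_add_distrib]

lemma polP_smul (k : Λ → V m) (u : Config Λ) (i : Λ) (c : ℂ) (e : V m) :
    polP k u i (c • e) = c * polP k u i e := by
  simp only [polP_eq_resAt, resAt]
  split_ifs <;> simp only [smul_dotProduct, smul_eq_mul, mul_sum, mul_assoc, mul_div_assoc]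

lemma sum_chyMat_false (k e : Λ → V m) (u : Config Λ) (j : Λ) (z : ℂ × ℂ)
    (h : ∑ i, (k j ⬝ᵥ k i) * br (u i) z / br (u j) (u i) = 0) :
    ∑ i, treeMat k e u (j, false) (i, false) * br (u i) z = 0 := by
  rw [← h]
  refine sum_congr rfl fun i _ => ?_
  by_cases hij : j = i
  · subst hij
    simp [chyMat_same, br_self]
  · rw [chyMat_of_ne _ _ _ _ hij]
    simp only [rowVec, Bool.false_eq_true, if_false, brInv]
    ring

lemma sum_chyMat_true (k e : Λ → V m) (u : Config Λ) (j : Λ) (z : ℂ × ℂ)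
    (hu : ∀ i, i ≠ j → br (u j) (u i) ≠ 0) (hk : ∑ i, k i = 0) (he : e j ⬝ᵥ k j = 0) :
    ∑ i, treeMat k e u (j, true) (i, false) * br (u i) z = 0 := by
  have h1 : ∑ i ∈ univ.erase j, e j ⬝ᵥ k i = 0 := by
    rw [← add_right_inj (e j ⬝ᵥ k j), add_sum_erase _ (fun i => e j ⬝ᵥ k i) (mem_univ j),
      ← dotProduct_sum, hk, he, dotProduct_zero, add_zero]
  have h2 := sum_mul_br_div_br (fun i => e j ⬝ᵥ k i) u j hu h1 z
  rw [← polP_eq_resAt] at h2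
  rw [← add_sum_erase _ _ (mem_univ j), chyMat_true_false]
  rw [← add_sum_erase _ _ (mem_univ j), br_self, div_zero, zero_add] at h2
  have h3 : ∀ i ∈ univ.erase j, treeMat k e u (j, true) (i, false) * br (u i) z =
      (e j ⬝ᵥ k i) * br (u i) z / br (u j) (u i) := fun i hi => by
    rw [chyMat_of_ne _ _ _ _ (ne_of_mem_erase hi).symm]
    simp only [rowVec, Bool.false_eq_true, if_false, if_true, brInv]
    ring
  rw [sum_congr rfl h3, h2]
  ring

/-- Momentum conservation, masslessness, transversality and the scattering equations. -/
structure OnShell (k : Λ → V m) (u : Config Λ) : Prop where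
  sum_eq_zero : ∑ i, k i = 0
  distinct : ∀ i j, i ≠ j → br (u i) (u j) ≠ 0
  solves : SolvesAll (fun i j => k i ⬝ᵥ k j) u

lemma OnShell.sum_chyMat {k : Λ → V m} {u : Config Λ} (h : OnShell k u) (e : Λ → V m)
    (x : Λ × Bool) (hx : x.2 = true → e x.1 ⬝ᵥ k x.1 = 0) (z : ℂ × ℂ) :
    ∑ i, treeMat k e u x (i, false) * br (u i) z = 0 := by
  obtain ⟨j, _ | _⟩ := x
  · exact sum_chyMat_false k e u j z (h.solves j z)
  · exact sum_chyMat_true k e u j z (fun i hi => h.distinct j i hi.symm) h.sum_eq_zero (hx rfl)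

lemma redPf_swap (k e : Λ → V m) (a b : Λ) (u : Config Λ) : redPf k e a b u = redPf k e b a u := by
  let E : Option (Off a b) ≃ Option (Off b a) :=
    Equiv.optionCongr (Equiv.subtypeEquivRight fun i => and_comm)
  let σ : Perm (Option (Off a b) × Bool) := Equiv.swap (none, false) (none, true)
  unfold redPf
  rw [br_swap (u a) (u b), ← pf_submatrix_equiv E, div_neg, ← neg_div]
  congr 1
  have h := pf_submatrix_perm σ ((chyMat k e (fun i j => (br (u i) (u j))⁻¹) u).submatrix
    (redRow a b) (redRow a b))
  rw [Equiv.Perm.sign_swap (by simp)] at h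
  have h' : pf ((chyMat k e (fun i j => (br (u i) (u j))⁻¹) u).submatrix (redRow a b)
      (redRow a b)) = -pf (((chyMat k e (fun i j => (br (u i) (u j))⁻¹) u).submatrix
        (redRow a b) (redRow a b)).submatrix σ σ) := by
    rw [h]
    simp
  rw [h']
  congr 2
  ext x y
  have hr : ∀ x, redRow a b (σ x) = redRow b a (rowMap E x) := by
    rintro ⟨_ | i, _ | _⟩
    · simp only [σ, Equiv.swap_apply_left]; rfl
    · simp only [σ, Equiv.swap_apply_right]; rfl
    · simp only [σ]; rw [swap_apply_of_ne_of_ne (by simp) (by simp)]; rfl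
    · simp only [σ]; rw [swap_apply_of_ne_of_ne (by simp) (by simp)]; rfl
  simp only [submatrix_apply, hr]

end ChyMat

/-! ### Two marked legs -/

section Marked

variable {Y : Type*} [Fintype Y] [DecidableEq Y] {m : ℕ} (kk : Bool ⊕ Y → V m) (ε : Y → V m)
  (u : Config (Bool ⊕ Y))

/-- The matrix `M₃` at `q = 0`. -/
def M30 : RowMat Y := (treeMat kk (marked 0 0 ε) u).submatrix (rowMap inr) (rowMap inr)

lemma M3_zero : M3 kk ε 0 u = M30 kk ε u := by
  have : szego 0 u = brInv u := by
    ext i j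
    simp [szego, brInv]
  rw [M3, M30, this]

lemma scalHalf_eq : scalHalf kk ε u = pf (M30 kk ε u) / brPM u ^ 2 := by
  rw [scalHalf, M3_zero]

/-- The column of a polarisation `E` on a marked leg. -/
def markedCol (b : Bool) (E : V m) (x : Y × Bool) : ℂ :=
  (rowVec kk (marked 0 0 ε) (.inr x.1, x.2) ⬝ᵥ E) / br (u (.inr x.1)) (u (.inl b))

lemma chyMat_marked_inr (E E' : V m) (x y : Y × Bool) :
    treeMat kk (marked E E' ε) u (.inr x.1, x.2) (.inr y.1, y.2) = M30 kk ε u x y := by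
  obtain ⟨i, b⟩ := x
  obtain ⟨j, c⟩ := y
  simp only [M30, submatrix_apply, chyMat, of_apply, marked, elim_inr]

lemma redPf_marked (E E' : V m) : redPf kk (marked E E' ε) (.inl true) (.inl false) u =
      pf (bordered (M30 kk ε u) (markedCol kk ε u true E) (markedCol kk ε u false E')
        ((E ⬝ᵥ E') / brPM u)) / brPM u := by
  let e : Option Y ≃ Option {i : Bool ⊕ Y // i ≠ .inl true ∧ i ≠ .inl false} :=
    Equiv.optionCongr (Equiv.ofBijective (fun y => ⟨.inr y, by simp⟩) ⟨fun y y' h => by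
      simpa using h, by
      rintro ⟨(_ | _) | y, h1, h2⟩
      · exact absurd rfl h2
      · exact absurd rfl h1
      · exact ⟨y, rfl⟩⟩)
  unfold redPf
  rw [← pf_submatrix_equiv e]
  congr 2
  have hskew : IsSkew (chyMat kk (marked E E' ε) (fun i j => (br (u i) (u j))⁻¹) u) :=
    isSkew_chyMat kk (marked E E' ε) u
  have hV : ∀ (x : Y × Bool) (b : Bool), chyMat kk (marked E E' ε) (fun i j => (br (u i) (u j))⁻¹) u
      (.inr x.1, x.2) (.inl b, true) = markedCol kk ε u b (bif b then E else E') x := by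
    rintro ⟨i, c⟩ b
    rw [chyMat_of_ne _ _ _ _ (by simp)]
    cases c <;> simp [markedCol, rowVec, marked, div_eq_mul_inv]
  have h0 : ∀ x, chyMat kk (marked E E' ε) (fun i j => (br (u i) (u j))⁻¹) u x x = 0 :=
    chyMat_same _ _ _ _
  have hpm : chyMat kk (marked E E' ε) (fun i j => (br (u i) (u j))⁻¹) u (.inl true, true)
      (.inl false, true) = (E ⬝ᵥ E') / brPM u := by
    rw [chyMat_of_ne _ _ _ _ (by simp)]
    simp [rowVec, marked, brPM, div_eq_mul_inv]
  ext ⟨_ | x, _ | _⟩ ⟨_ | y, _ | _⟩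
  · exact h0 (.inl true, true)
  · exact hpm
  · exact (hskew (.inr y, false) (.inl true, true)).trans (congrArg Neg.neg (hV (y, false) true))
  · exact (hskew (.inr y, true) (.inl true, true)).trans (congrArg Neg.neg (hV (y, true) true))
  · exact (hskew (.inl true, true) (.inl false, true)).trans (congrArg Neg.neg hpm)
  · exact h0 (.inl false, true)
  · exact (hskew (.inr y, false) (.inl false, true)).trans (congrArg Neg.neg (hV (y, false) false))
  · exact (hskew (.inr y, true) (.inl false, true)).trans (congrArg Neg.neg (hV (y, true) false))
  · exact hV (x, false) true
  · exact hV (x, false) false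
  · exact chyMat_marked_inr kk ε u E E' (x, false) (y, false)
  · exact chyMat_marked_inr kk ε u E E' (x, false) (y, true)
  · exact hV (x, true) true
  · exact hV (x, true) false
  · exact chyMat_marked_inr kk ε u E E' (x, true) (y, false)
  · exact chyMat_marked_inr kk ε u E E' (x, true) (y, true)

lemma redPf_marked_eq (E E' : V m) : redPf kk (marked E E' ε) (.inl true) (.inl false) u =
      ((E ⬝ᵥ E') / brPM u * pf (M30 kk ε u) - pfD (M30 kk ε u)
        (wedge (markedCol kk ε u true E) (markedCol kk ε u false E'))) / brPM u := by
  rw [redPf_marked, pf_bordered]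

/-! ### State sums of a vector in the loop -/

lemma wedge_self_swap {κ : Type*} (V W : κ → ℂ) : wedge W V = (-1 : ℂ) • wedge V W := by
  ext x y
  simp [wedge]

/-- A standard basis vector. -/
def basisVec (α : Fin m) : V m := Pi.single α 1

lemma dotProduct_basisVec (v : V m) (α : Fin m) : v ⬝ᵥ basisVec α = v α := by
  simp [basisVec]

lemma M3_eq (t : ℂ) (hne : ∀ i j, i ≠ j → br (u i) (u j) ≠ 0) :
    M3 kk ε t u = M30 kk ε u + t • (brPM u • ∑ α, wedge
      (markedCol kk ε u false (basisVec α)) (markedCol kk ε u true (basisVec α))) := by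
  ext ⟨i, b⟩ ⟨j, c⟩
  have hW : (∑ α : Fin m, wedge (markedCol kk ε u false (basisVec α))
      (markedCol kk ε u true (basisVec α))) (i, b) (j, c) =
      (rowVec kk (marked 0 0 ε) (.inr i, b) ⬝ᵥ rowVec kk (marked 0 0 ε) (.inr j, c)) *
        ((br (u (.inr i)) (u (.inl false)) * br (u (.inr j)) (u (.inl true)))⁻¹ -
          (br (u (.inr i)) (u (.inl true)) * br (u (.inr j)) (u (.inl false)))⁻¹) := by
    rw [Matrix.sum_apply]
    simp only [wedge, of_apply, markedCol, dotProduct_basisVec]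
    rw [dotProduct, sum_mul]
    refine sum_congr rfl fun α _ => ?_
    rw [mul_inv, mul_inv]
    ring
  simp only [Matrix.add_apply, Matrix.smul_apply, smul_eq_mul, hW]
  by_cases h : i = j
  · subst h
    have e : M3 kk ε t u (i, b) (i, c) = M30 kk ε u (i, b) (i, c) := by
      simp [M3, M30, chyMat]
    rw [e, mul_comm (br (u (.inr i)) (u (.inl false))), sub_self]
    ring
  · have h' : (.inr i : Bool ⊕ Y) ≠ .inr j := by simpa using h
    have e1 : M3 kk ε t u (i, b) (j, c) = (rowVec kk (marked 0 0 ε) (.inr i, b) ⬝ᵥ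
        rowVec kk (marked 0 0 ε) (.inr j, c)) * szego t u (.inr i) (.inr j) :=
      chyMat_of_ne kk (marked 0 0 ε) (szego t u) u (x := (inr i, b)) (y := (inr j, c)) h'
    have e2 : M30 kk ε u (i, b) (j, c) = (rowVec kk (marked 0 0 ε) (.inr i, b) ⬝ᵥ
        rowVec kk (marked 0 0 ε) (.inr j, c)) * brInv u (.inr i) (.inr j) :=
      chyMat_of_ne kk (marked 0 0 ε) (brInv u) u (x := (inr i, b)) (y := (inr j, c)) h'
    rw [e1, e2, szego, brInv]
    have h1 := hne _ _ h'
    have h2 := hne (.inr i) (.inl true) (by simp)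
    have h3 := hne (.inr i) (.inl false) (by simp)
    have h4 := hne (.inr j) (.inl true) (by simp)
    have h5 := hne (.inr j) (.inl false) (by simp)
    have hp := br_plucker (u (.inr i)) (u (.inr j)) (u (.inl true)) (u (.inl false))
    have hp' : br (u (.inr i)) (u (.inr j)) * brPM u =
        br (u (.inr i)) (u (.inl true)) * br (u (.inr j)) (u (.inl false)) -
          br (u (.inr i)) (u (.inl false)) * br (u (.inr j)) (u (.inl true)) := hp
    have key : (br (u (.inr i)) (u (.inr j)))⁻¹ * ((br (u (.inr i)) (u (.inr j)) * brPM u) ^ 2 /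
        (br (u (.inr i)) (u (.inl true)) * br (u (.inr i)) (u (.inl false)) *
          br (u (.inr j)) (u (.inl true)) * br (u (.inr j)) (u (.inl false)))) =
        brPM u * ((br (u (.inr i)) (u (.inl false)) * br (u (.inr j)) (u (.inl true)))⁻¹ -
          (br (u (.inr i)) (u (.inl true)) * br (u (.inr j)) (u (.inl false)))⁻¹) := by
      rw [pow_two, mul_assoc (br (u (.inr i)) (u (.inr j))), mul_div_assoc,
        inv_mul_cancel_left₀ h1, ← mul_assoc, mul_comm (brPM u) (br _ _), hp']
      field_simp
    linear_combination (rowVec kk (marked 0 0 ε) (.inr i, b) ⬝ᵥ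
        rowVec kk (marked 0 0 ε) (.inr j, c)) * t * key

lemma deriv_pf_M3 (hne : ∀ i j, i ≠ j → br (u i) (u j) ≠ 0) :
    deriv (fun t => pf (M3 kk ε t u)) 0 = brPM u * ∑ α, pfD (M30 kk ε u) (wedge
      (markedCol kk ε u false (basisVec α)) (markedCol kk ε u true (basisVec α))) := by
  simp_rw [M3_eq kk ε u _ hne]
  rw [(hasDerivAt_pf _ _).deriv, pfD_smul, pfD_sum]

/-- A vector in the loop, as the sum over the states of the tree with two more legs. -/
lemma nsHalf_eq (d : ℕ) (hne : ∀ i j, i ≠ j → br (u i) (u j) ≠ 0) :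
    nsHalf d kk ε u = (∑ α : Fin m, redPf kk (marked (basisVec α) (basisVec α) ε)
      (.inl true) (.inl false) u) + ((d : ℂ) - 2 - m) * scalHalf kk ε u := by
  have hβ : brPM u ≠ 0 := hne _ _ (by simp)
  have h1 : ∀ α : Fin m, basisVec α ⬝ᵥ basisVec α = 1 := fun α => by
    rw [dotProduct_basisVec]
    simp [basisVec]
  simp_rw [nsHalf, deriv_pf_M3 kk ε u hne, scalHalf_eq, M3_zero, redPf_marked_eq, h1]
  rw [← sum_div, sum_sub_distrib, sum_const, card_univ, Fintype.card_fin]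
  have h2 : ∀ α : Fin m, pfD (M30 kk ε u) (wedge (markedCol kk ε u true (basisVec α))
      (markedCol kk ε u false (basisVec α))) = -pfD (M30 kk ε u) (wedge
      (markedCol kk ε u false (basisVec α)) (markedCol kk ε u true (basisVec α))) := fun α => by
    rw [wedge_self_swap, pfD_smul, neg_one_mul]
  simp_rw [h2, sum_neg_distrib, nsmul_eq_mul]
  field_simp
  ring

lemma markedCol_add (b : Bool) (E E' : V m) :
    markedCol kk ε u b (E + E') = markedCol kk ε u b E + markedCol kk ε u b E' := by
  ext x
  simp [markedCol, dotProduct_add, add_div]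

lemma markedCol_smul (b : Bool) (c : ℂ) (E : V m) :
    markedCol kk ε u b (c • E) = c • markedCol kk ε u b E := by
  ext x
  simp [markedCol, dotProduct_smul, mul_div_assoc]

lemma redPf_marked_add_left (E₁ E₂ E' : V m) :
    redPf kk (marked (E₁ + E₂) E' ε) (.inl true) (.inl false) u =
      redPf kk (marked E₁ E' ε) (.inl true) (.inl false) u +
        redPf kk (marked E₂ E' ε) (.inl true) (.inl false) u := by
  have h : ∀ V V' W : Y × Bool → ℂ, wedge (V + V') W = wedge V W + wedge V' W := fun V V' W => by
    ext x y
    simp only [wedge, of_apply, Pi.add_apply, Matrix.add_apply]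
    ring
  rw [redPf_marked_eq, redPf_marked_eq, redPf_marked_eq, markedCol_add, h, pfD_add, add_dotProduct]
  ring

lemma redPf_marked_smul_left (c : ℂ) (E E' : V m) :
    redPf kk (marked (c • E) E' ε) (.inl true) (.inl false) u =
      c * redPf kk (marked E E' ε) (.inl true) (.inl false) u := by
  have h : ∀ V W : Y × Bool → ℂ, wedge (c • V) W = c • wedge V W := fun V W => by
    ext x y
    simp only [wedge, of_apply, Pi.smul_apply, Matrix.smul_apply, smul_eq_mul]
    ring
  rw [redPf_marked_eq, redPf_marked_eq, markedCol_smul, h, pfD_smul, smul_dotProduct, smul_eq_mul]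
  ring

lemma redPf_marked_add_right (E E₁ E₂ : V m) :
    redPf kk (marked E (E₁ + E₂) ε) (.inl true) (.inl false) u =
      redPf kk (marked E E₁ ε) (.inl true) (.inl false) u +
        redPf kk (marked E E₂ ε) (.inl true) (.inl false) u := by
  have h : ∀ V W W' : Y × Bool → ℂ, wedge V (W + W') = wedge V W + wedge V W' := fun V W W' => by
    ext x y
    simp only [wedge, of_apply, Pi.add_apply, Matrix.add_apply]
    ring
  rw [redPf_marked_eq, redPf_marked_eq, redPf_marked_eq, markedCol_add, h, pfD_add, dotProduct_add]
  ring

lemma redPf_marked_smul_right (c : ℂ) (E E' : V m) :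
    redPf kk (marked E (c • E') ε) (.inl true) (.inl false) u =
      c * redPf kk (marked E E' ε) (.inl true) (.inl false) u := by
  have h : ∀ V W : Y × Bool → ℂ, wedge V (c • W) = c • wedge V W := fun V W => by
    ext x y
    simp only [wedge, of_apply, Pi.smul_apply, Matrix.smul_apply, smul_eq_mul]
    ring
  rw [redPf_marked_eq, redPf_marked_eq, markedCol_smul, h, pfD_smul, dotProduct_smul, smul_eq_mul]
  ring

/-- The reduced Pfaffian as a bilinear form in the polarisations of the marked legs. -/
def redPfForm : V m →ₗ[ℂ] V m →ₗ[ℂ] ℂ :=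
  LinearMap.mk₂ ℂ (fun E E' => redPf kk (marked E E' ε) (.inl true) (.inl false) u)
    (redPf_marked_add_left kk ε u) (redPf_marked_smul_left kk ε u)
    (redPf_marked_add_right kk ε u) (redPf_marked_smul_right kk ε u)

variable {kk ε u}

lemma isSkew_M30 : IsSkew (M30 kk ε u) := (isSkew_chyMat _ _ _).submatrix _

lemma M30_mulVec (h : OnShell kk u) (hε : ∀ y, ε y ⬝ᵥ kk (.inr y) = 0) (z : ℂ × ℂ) (x : Y × Bool) :
    (M30 kk ε u).mulVec (fun y => if y.2 then 0 else br (u (.inr y.1)) z) x =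
      -(markedCol kk ε u true (kk (.inl true)) x * br (u (.inl true)) z +
        markedCol kk ε u false (kk (.inl false)) x * br (u (.inl false)) z) := by
  have h1 := h.sum_chyMat (marked 0 0 ε) (.inr x.1, x.2) (fun _ => hε x.1) z
  rw [sum_sum_type, sum_bool] at h1
  have h2 : ∀ b, treeMat kk (marked 0 0 ε) u (.inr x.1, x.2) (.inl b, false) =
      markedCol kk ε u b (kk (.inl b)) x := fun b => by
    rw [chyMat_of_ne _ _ _ _ (by simp)]
    simp [markedCol, rowVec, brInv, div_eq_mul_inv]
  rw [h2, h2] at h1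
  rw [mulVec, dotProduct, sum_prod_type]
  simp only [sum_bool, if_true, mul_zero, zero_add, Bool.false_eq_true, if_false]
  have h3 : ∑ y, M30 kk ε u x (y, false) * br (u (.inr y)) z =
      ∑ y, treeMat kk (marked 0 0 ε) u (.inr x.1, x.2) (.inr y, false) * br (u (.inr y)) z := rfl
  rw [h3]
  linear_combination h1

lemma sum_unmarked (h : OnShell kk u) :
    ∑ y, kk (.inr y) = -(kk (.inl true) + kk (.inl false)) := by
  have := h.sum_eq_zero
  rw [sum_sum_type, sum_bool] at this
  exact eq_neg_of_add_eq_zero_right this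

lemma dotProduct_markedCol (hne : ∀ i j, i ≠ j → br (u i) (u j) ≠ 0) (b : Bool) (E : V m)
    (h : OnShell kk u) :
    (fun y : Y × Bool => if y.2 then 0 else br (u (.inr y.1)) (u (.inl b))) ⬝ᵥ
      markedCol kk ε u b E = -((kk (.inl true) + kk (.inl false)) ⬝ᵥ E) := by
  rw [← neg_dotProduct, ← sum_unmarked h, sum_dotProduct, dotProduct, sum_prod_type]
  simp only [sum_bool, if_true, zero_mul, zero_add, Bool.false_eq_true, if_false]
  refine sum_congr rfl fun y _ => ?_
  rw [markedCol, mul_div_cancel₀ _ (hne _ _ (by simp))]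
  rfl

/-- Gauge invariance up to scalars, on the first marked leg. -/
lemma redPfForm_momentum_left (h : OnShell kk u) (hε : ∀ y, ε y ⬝ᵥ kk (.inr y) = 0) (E : V m) :
    redPfForm kk ε u (kk (.inl true)) E = -(kk (.inl false) ⬝ᵥ E) * scalHalf kk ε u := by
  have hβ : brPM u ≠ 0 := h.distinct _ _ (by simp)
  have hV : markedCol kk ε u true (kk (.inl true)) = (-(brPM u)⁻¹) • (M30 kk ε u).mulVec
      (fun y => if y.2 then 0 else br (u (.inr y.1)) (u (.inl false))) := by
    ext x
    rw [Pi.smul_apply, M30_mulVec h hε, br_self, mul_zero, add_zero, smul_eq_mul]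
    change _ = -(brPM u)⁻¹ * -(_ * brPM u)
    field_simp
  have hw : ∀ (c : ℂ) (V W : Y × Bool → ℂ), wedge (c • V) W = c • wedge V W := fun c V W => by
    ext x y
    simp only [wedge, of_apply, Pi.smul_apply, Matrix.smul_apply, smul_eq_mul]
    ring
  change redPf kk (marked _ _ ε) _ _ u = _
  rw [redPf_marked_eq, hV, hw, pfD_smul, pfD_wedge_mulVec isSkew_M30,
    dotProduct_markedCol h.distinct false E h, scalHalf_eq, add_dotProduct]
  field_simp
  ring

/-- Gauge invariance up to scalars, on the second marked leg. -/
lemma redPfForm_momentum_right (h : OnShell kk u) (hε : ∀ y, ε y ⬝ᵥ kk (.inr y) = 0) (E : V m) :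
    redPfForm kk ε u E (kk (.inl false)) = -(kk (.inl true) ⬝ᵥ E) * scalHalf kk ε u := by
  have hβ : brPM u ≠ 0 := h.distinct _ _ (by simp)
  have hV : markedCol kk ε u false (kk (.inl false)) = (brPM u)⁻¹ • (M30 kk ε u).mulVec
      (fun y => if y.2 then 0 else br (u (.inr y.1)) (u (.inl true))) := by
    ext x
    rw [Pi.smul_apply, M30_mulVec h hε, br_self, mul_zero, zero_add, smul_eq_mul,
      br_swap (u (.inl true))]
    change _ = (brPM u)⁻¹ * -(_ * -brPM u)
    field_simp
  have hw : ∀ (c : ℂ) (V W : Y × Bool → ℂ), wedge (c • V) W = c • wedge V W := fun c V W => by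
    ext x y
    simp only [wedge, of_apply, Pi.smul_apply, Matrix.smul_apply, smul_eq_mul]
    ring
  change redPf kk (marked _ _ ε) _ _ u = _
  rw [redPf_marked_eq, hV, wedge_self_swap, hw, smul_smul, pfD_smul, pfD_wedge_mulVec isSkew_M30,
    dotProduct_markedCol h.distinct true E h, scalHalf_eq, add_dotProduct, dotProduct_comm E]
  field_simp
  ring

end Marked

/-! ### Completeness of polarisations -/

section Completeness

variable {m : ℕ}

/-- A null vector dual to `p` completes the polarisations and `p` to a basis. -/
lemma PolBasis.exists_dual {p : V m} {e : Fin (m - 2) → V m} (h : PolBasis p e) :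
    ∃ q : V m, q ⬝ᵥ q = 0 ∧ p ⬝ᵥ q = 1 ∧ (∀ r, e r ⬝ᵥ q = 0) ∧
      ∀ v : V m, v = (∑ r, (e r ⬝ᵥ v) • e r) + (q ⬝ᵥ v) • p + (p ⬝ᵥ v) • q := by
  obtain ⟨hp0, hpp, hep, hee⟩ := h
  obtain ⟨α, hα⟩ := Function.ne_iff.1 hp0
  have hm : 2 ≤ m := by
    by_contra! hlt
    have hs : Subsingleton (Fin m) := by
      rw [Fin.subsingleton_iff_le_one]
      omega
    refine hα ?_
    have : p ⬝ᵥ p = p α * p α := by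
      rw [dotProduct, Finset.sum_eq_single α]
      · exact fun β _ hβ => absurd (Subsingleton.elim β α) hβ
      · simp
    simpa [this] using hpp
  obtain ⟨q₀, hq₀⟩ : ∃ q₀ : V m, p ⬝ᵥ q₀ = 1 := by
    refine ⟨(p α)⁻¹ • basisVec α, ?_⟩
    rw [dotProduct_smul, dotProduct_basisVec, smul_eq_mul, inv_mul_cancel₀ hα]
  set q₁ : V m := q₀ - ∑ r, (e r ⬝ᵥ q₀) • e r with hq₁
  have hpe : ∀ r, p ⬝ᵥ e r = 0 := fun r => by rw [dotProduct_comm, hep]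
  have h1 : p ⬝ᵥ q₁ = 1 := by
    simp [hq₁, dotProduct_sub, dotProduct_sum, dotProduct_smul, hpe, hq₀]
  have h2 : ∀ r, e r ⬝ᵥ q₁ = 0 := fun r => by
    simp [hq₁, dotProduct_sub, dotProduct_sum, dotProduct_smul, hee]
  set q : V m := q₁ - ((q₁ ⬝ᵥ q₁) / 2) • p with hq
  have hqq : q ⬝ᵥ q = 0 := by
    simp only [hq, dotProduct_sub, sub_dotProduct, dotProduct_smul, smul_dotProduct, hpp, h1,
      dotProduct_comm q₁ p, smul_eq_mul]
    ring
  have hpq : p ⬝ᵥ q = 1 := by simp [hq, dotProduct_sub, h1, hpp]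
  have heq : ∀ r, e r ⬝ᵥ q = 0 := fun r => by simp [hq, dotProduct_sub, h2, hep]
  refine ⟨q, hqq, hpq, heq, fun v => ?_⟩
  let F : Matrix (Fin (m - 2) ⊕ Bool) (Fin m) ℂ :=
    Matrix.of (Sum.elim e fun b => bif b then p else q)
  let G : Matrix (Fin m) (Fin (m - 2) ⊕ Bool) ℂ :=
    (Matrix.of (Sum.elim e fun b => bif b then q else p)).transpose
  have hFG : F * G = 1 := by
    ext x y
    change (Sum.elim e (fun b => bif b then p else q) x) ⬝ᵥ
      (Sum.elim e (fun b => bif b then q else p) y) = _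
    rcases x with r | b <;> rcases y with s | c
    · simp [hee, Matrix.one_apply]
    · cases c <;> simp [hep, heq]
    · cases b <;> simp [hpe, heq, dotProduct_comm q]
    · cases b <;> cases c <;> simp [hpp, hqq, hpq, dotProduct_comm q p]
  have hGF : G * F = 1 := (Matrix.mul_eq_one_comm_of_card_eq _ _ _ (by simp; omega)).1 hFG
  have hv := congrArg (fun A : Matrix _ _ ℂ => A.mulVec v) hGF
  simp only [Matrix.one_mulVec, ← Matrix.mulVec_mulVec] at hv
  conv_lhs => rw [← hv]
  ext β
  simp only [mulVec, dotProduct, sum_sum_type, sum_bool, F, G,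
    Matrix.transpose_apply, of_apply, elim_inl, elim_inr, cond_true, cond_false,
    Pi.add_apply, Finset.sum_apply, Pi.smul_apply, smul_eq_mul]
  simp only [mul_comm (e _ β), mul_comm (p β), mul_comm (q β)]
  ring

lemma PolBasis.bilin_sum {p q : V m} {e : Fin (m - 2) → V m}
    (hv : ∀ v : V m, v = (∑ r, (e r ⬝ᵥ v) • e r) + (q ⬝ᵥ v) • p + (p ⬝ᵥ v) • q)
    (T : V m →ₗ[ℂ] V m →ₗ[ℂ] ℂ) :
    ∑ α : Fin m, T (basisVec α) (basisVec α) = (∑ r, T (e r) (e r)) + T p q + T q p := by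
  have hb : ∀ v w : V m, T v w = ∑ α, v α * T (basisVec α) w := fun v w => by
    conv_lhs => rw [pi_eq_sum_univ' v]
    simp only [map_sum, map_smul, LinearMap.sum_apply, LinearMap.smul_apply, smul_eq_mul]
    refine sum_congr rfl fun α _ => ?_
    congr 3
  have h1 : ∀ α : Fin m, T (basisVec α) (basisVec α) = (∑ r, e r α * T (basisVec α) (e r)) +
      q α * T (basisVec α) p + p α * T (basisVec α) q := fun α => by
    conv_lhs => rw [hv (basisVec α)]
    rw [← hv (basisVec α)]
    conv_lhs => arg 2; rw [hv (basisVec α)]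
    simp only [map_add, map_sum, map_smul, dotProduct_basisVec, smul_eq_mul]
  simp_rw [h1, sum_add_distrib, ← hb]
  rw [sum_comm]
  simp_rw [← hb]
  ring

/-- The product of two linear forms as a bilinear form. -/
def prodForm (f g : V m →ₗ[ℂ] ℂ) : V m →ₗ[ℂ] V m →ₗ[ℂ] ℂ :=
  LinearMap.mk₂ ℂ (fun v w => f v * g w) (fun _ _ _ => by rw [map_add, add_mul])
    (fun _ _ _ => by rw [map_smul, smul_eq_mul, smul_eq_mul, mul_assoc])
    (fun _ _ _ => by rw [map_add, mul_add])
    (fun _ _ _ => by rw [map_smul, smul_eq_mul, smul_eq_mul, mul_left_comm])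

lemma sum_mul_form_left (v w : V m) (T : V m →ₗ[ℂ] V m →ₗ[ℂ] ℂ) :
    ∑ α, v α * T (basisVec α) w = T v w := by
  conv_rhs => rw [pi_eq_sum_univ' v]
  simp only [map_sum, map_smul, LinearMap.sum_apply, LinearMap.smul_apply, smul_eq_mul]
  rfl

lemma sum_mul_form_right (v w : V m) (T : V m →ₗ[ℂ] V m →ₗ[ℂ] ℂ) :
    ∑ α, w α * T v (basisVec α) = T v w := by
  conv_rhs => rw [pi_eq_sum_univ' w]
  simp only [map_sum, map_smul, smul_eq_mul]
  rfl

/-- The sum over all polarisations of two vectors on a pair of cut legs: the unphysical ones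
contribute like two scalars. -/
lemma PolBasis.contraction {p p' : V m} {e e' : Fin (m - 2) → V m} (h : PolBasis p e)
    (h' : PolBasis p' e') {TL TR : V m →ₗ[ℂ] V m →ₗ[ℂ] ℂ} {sL sR : ℂ}
    (hL₁ : ∀ E, TL p E = (p' ⬝ᵥ E) * sL) (hL₂ : ∀ E, TL E p' = (p ⬝ᵥ E) * sL)
    (hR₁ : ∀ E, TR p' E = (p ⬝ᵥ E) * sR) (hR₂ : ∀ E, TR E p = (p' ⬝ᵥ E) * sR) :
    ∑ α, ∑ γ, TL (basisVec α) (basisVec γ) * TR (basisVec γ) (basisVec α) =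
      (∑ r, ∑ s, TL (e r) (e' s) * TR (e' s) (e r)) + 2 * (sL * sR) := by
  obtain ⟨q, -, hpq, -, hv⟩ := h.exists_dual
  obtain ⟨q', -, -, -, hv'⟩ := h'.exists_dual
  have h1 : ∀ γ, ∑ α, TL (basisVec α) (basisVec γ) * TR (basisVec γ) (basisVec α) =
      (∑ r, TL (e r) (basisVec γ) * TR (basisVec γ) (e r)) + p' γ * sL * TR (basisVec γ) q +
        TL q (basisVec γ) * (p' γ * sR) := fun γ => by
    have := PolBasis.bilin_sum hv (prodForm (TL.flip (basisVec γ)) (TR (basisVec γ)))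
    simp only [prodForm, LinearMap.mk₂_apply, LinearMap.flip_apply] at this
    rw [this, hL₁, hR₂, dotProduct_basisVec]
  have h2 : ∀ r, ∑ γ, TL (e r) (basisVec γ) * TR (basisVec γ) (e r) =
      ∑ s, TL (e r) (e' s) * TR (e' s) (e r) := fun r => by
    have := PolBasis.bilin_sum hv' (prodForm (TL (e r)) (TR.flip (e r)))
    simp only [prodForm, LinearMap.mk₂_apply, LinearMap.flip_apply] at this
    rw [this, hL₂, hR₁, dotProduct_comm p, h.2.2.1 r]
    ring
  rw [sum_comm]
  simp_rw [h1, sum_add_distrib]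
  rw [sum_comm]
  simp_rw [h2]
  have h3 : ∑ γ, p' γ * sL * TR (basisVec γ) q = sL * sR := by
    have := sum_mul_form_left p' q TR
    rw [hR₁, hpq] at this
    simp_rw [mul_right_comm _ sL, ← sum_mul, this]
    ring
  have h4 : ∑ γ, TL q (basisVec γ) * (p' γ * sR) = sL * sR := by
    have := sum_mul_form_right q p' TL
    rw [hL₂, hpq] at this
    simp_rw [← mul_assoc, mul_comm (TL q _), ← sum_mul, this]
    ring
  rw [h3, h4]
  ring

end Completeness

/-! ### Entries of the matrix at a degeneration -/

/-- The points `u` degenerate to `uL`, with the node at infinity, and `uR`, with the node at `0`;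
the labels of the three spheres are related by `φ`, `χ`, `ω`. -/
structure Degeneration {κ A B Λ ΛL ΛR : Type*} (φ : A ⊕ B ≃ Λ) (χ : Option A ≃ ΛL)
    (ω : Option B ≃ ΛR) (l : Filter κ) (ε : κ → ℂ) (x : κ → A → ℂ) (u : κ → Config Λ)
    (uL : Config ΛL) (uR : Config ΛR) : Prop where
  tendsto_zero : Tendsto ε l (𝓝 0)
  ne_zero : ∀ᶠ n in l, ε n ≠ 0
  chan_eq : ∀ n i, u n (φ (.inl i)) = (ε n * x n i, 1)
  tendsto_chan : ∀ i, Tendsto (fun n => x n i) l (𝓝 (uL (χ (some i))).1)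
  left_snd : ∀ i, (uL (χ (some i))).2 = 1
  left_node : uL (χ none) = (1, 0)
  tendsto_comp : ∀ j, Tendsto (fun n => u n (φ (.inr j))) l (𝓝 (uR (ω (some j))))
  comp_snd : ∀ j, ∀ᶠ n in l, (u n (φ (.inr j))).2 = (uR (ω (some j))).2
  right_node : uR (ω none) = (0, 1)
  distinct : ∀ᶠ n in l, ∀ i j, i ≠ j → br (u n i) (u n j) ≠ 0
  distinctL : ∀ i j, i ≠ j → br (uL i) (uL j) ≠ 0
  distinctR : ∀ i j, i ≠ j → br (uR i) (uR j) ≠ 0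

namespace Degeneration

variable {κ A B Λ ΛL ΛR : Type*} [Fintype A] [DecidableEq A] [Fintype B] [DecidableEq B]
  [Fintype Λ] [DecidableEq Λ] [Fintype ΛL] [DecidableEq ΛL] [Fintype ΛR] [DecidableEq ΛR]
  {φ : A ⊕ B ≃ Λ} {χ : Option A ≃ ΛL} {ω : Option B ≃ ΛR} {l : Filter κ} {ε : κ → ℂ}
  {x : κ → A → ℂ} {u : κ → Config Λ} {uL : Config ΛL} {uR : Config ΛR}
  (h : Degeneration φ χ ω l ε x u uL uR)

include h

lemma br_left (i j : A) :
    br (uL (χ (some i))) (uL (χ (some j))) = (uL (χ (some i))).1 - (uL (χ (some j))).1 := by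
  rw [br, h.left_snd, h.left_snd]
  ring

lemma br_chan (n : κ) (i j : A) :
    br (u n (φ (.inl i))) (u n (φ (.inl j))) = ε n * (x n i - x n j) := by
  rw [h.chan_eq, h.chan_eq, br]
  ring

lemma tendsto_inl (i : A) :
    Tendsto (fun n => u n (φ (.inl i))) l (𝓝 (0, 1)) := by
  simp_rw [h.chan_eq]
  have := h.tendsto_zero.mul (h.tendsto_chan i)
  rw [zero_mul] at this
  exact this.prodMk_nhds tendsto_const_nhds

lemma tendsto_inl' (i : A) :
    Tendsto (fun n => u n (φ (.inl i))) l (𝓝 (uR (ω none))) := by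
  rw [h.right_node]
  exact h.tendsto_inl i

lemma br_node (j : B) : br (uR (ω none)) (uR (ω (some j))) ≠ 0 := h.distinctR _ _ (by simp)

lemma tendsto_br_cross (i : A) (j : B) :
    Tendsto (fun n => br (u n (φ (.inl i))) (u n (φ (.inr j)))) l
      (𝓝 (br (uR (ω none)) (uR (ω (some j))))) := tendsto_br (h.tendsto_inl' i) (h.tendsto_comp j)

lemma tendsto_br_comp (i j : B) : Tendsto (fun n => br (u n (φ (.inr i))) (u n (φ (.inr j)))) l
      (𝓝 (br (uR (ω (some i))) (uR (ω (some j))))) :=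
  tendsto_br (h.tendsto_comp i) (h.tendsto_comp j)

lemma tendsto_mul_div_br {c : κ → ℂ} {c₀ : ℂ} (hc : Tendsto c l (𝓝 c₀)) (i j : A) :
    Tendsto (fun n => ε n * (c n / br (u n (φ (.inl i))) (u n (φ (.inl j))))) l
      (𝓝 (c₀ / br (uL (χ (some i))) (uL (χ (some j))))) := by
  rcases eq_or_ne i j with rfl | hij
  · simpa [br_self] using tendsto_const_nhds
  · have h0 := h.distinctL (χ (some i)) (χ (some j)) (by simpa using hij)
    rw [h.br_left] at h0 ⊢
    refine (hc.div ((h.tendsto_chan i).sub (h.tendsto_chan j)) h0).congr' ?_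
    filter_upwards [h.ne_zero] with n hn
    rw [h.br_chan, Pi.div_apply]
    field_simp

lemma tendsto_resAt_left {c : κ → Λ → ℂ} {c₀ : Λ → ℂ}
    {cL : ΛL → ℂ} (hc : ∀ i, Tendsto (fun n => c n i) l (𝓝 (c₀ i)))
    (hcL : ∀ i, cL (χ (some i)) = c₀ (φ (.inl i))) (i : A) :
    Tendsto (fun n => ε n * resAt (c n) (u n) (φ (.inl i))) l
      (𝓝 (resAt cL uL (χ (some i)))) := by
  have h1 : ∀ n, ε n * resAt (c n) (u n) (φ (.inl i)) =
      ∑ j : A, ε n * (c n (φ (.inl j)) / br (u n (φ (.inl i))) (u n (φ (.inl j)))) +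
        ε n * ∑ j : B, c n (φ (.inr j)) * (u n (φ (.inr j))).2 /
          br (u n (φ (.inl i))) (u n (φ (.inr j))) := fun n => by
    rw [resAt_of_finite _ (by rw [h.chan_eq]), ← φ.sum_comp, sum_sum_type, mul_add, mul_sum]
    simp_rw [h.chan_eq, mul_one]
  have h2 : resAt cL uL (χ (some i)) =
      ∑ j : A, c₀ (φ (.inl j)) / br (uL (χ (some i))) (uL (χ (some j))) +
        0 * ∑ j : B, c₀ (φ (.inr j)) * (uR (ω (some j))).2 /
          br (uR (ω none)) (uR (ω (some j))) := by
    rw [resAt_of_finite _ (h.left_snd i), ← χ.sum_comp, sum_option, h.left_node]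
    simp [hcL, h.left_snd]
  simp_rw [h1]
  rw [h2]
  refine (tendsto_finsetSum _ fun j _ => h.tendsto_mul_div_br (hc _) i j).add
    (h.tendsto_zero.mul (tendsto_finsetSum _ fun j _ => ?_))
  exact ((hc _).mul ((continuous_snd.tendsto _).comp (h.tendsto_comp j))).div
    (h.tendsto_br_cross i j) (h.br_node j)

lemma tendsto_resAt_right {c : κ → Λ → ℂ} {c₀ : Λ → ℂ} {cR : ΛR → ℂ}
    (hc : ∀ i, Tendsto (fun n => c n i) l (𝓝 (c₀ i))) (hcR : ∀ j, cR (ω (some j)) = c₀ (φ (.inr j)))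
    (hcN : cR (ω none) = ∑ i, c₀ (φ (.inl i))) (j : B) :
    Tendsto (fun n => resAt (c n) (u n) (φ (.inr j))) l (𝓝 (resAt cR uR (ω (some j)))) := by
  have key : ∀ π : ℂ × ℂ → ℂ, Continuous π → π (uR (ω (some j))) ≠ 0 →
      Tendsto (fun n => ∑ i, c n i * π (u n i) / (π (u n (φ (.inr j))) *
        br (u n (φ (.inr j))) (u n i))) l (𝓝 (∑ i, cR i * π (uR i) / (π (uR (ω (some j))) *
          br (uR (ω (some j))) (uR i)))) := by
    intro π hπ hπ0
    have hπj := (hπ.tendsto _).comp (h.tendsto_comp j)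
    rw [← ω.sum_comp, sum_option, hcN, sum_mul, sum_div]
    simp_rw [← φ.sum_comp (fun i => c _ i * π (u _ i) / (π (u _ (φ (.inr j))) *
        br (u _ (φ (.inr j))) (u _ i))), sum_sum_type]
    refine (tendsto_finsetSum _ fun i _ => ?_).add (tendsto_finsetSum _ fun i _ => ?_)
    · exact ((hc _).mul ((hπ.tendsto _).comp (h.tendsto_inl' i))).div
        (hπj.mul (tendsto_br (h.tendsto_comp j) (h.tendsto_inl' i)))
        (mul_ne_zero hπ0 (h.distinctR _ _ (by simp)))
    · rcases eq_or_ne j i with rfl | hij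
      · simpa [br_self] using tendsto_const_nhds
      · rw [hcR]
        exact ((hc _).mul ((hπ.tendsto _).comp (h.tendsto_comp i))).div
          (hπj.mul (h.tendsto_br_comp j i))
          (mul_ne_zero hπ0 (h.distinctR _ _ (by simpa using hij)))
  by_cases h2 : (uR (ω (some j))).2 = 0
  · have h1 : (uR (ω (some j))).1 ≠ 0 := fun h1 => h.br_node j (by simp [br, h1, h2])
    have := key Prod.fst continuous_fst h1
    rw [resAt, if_pos h2]
    refine this.congr' ?_
    filter_upwards [h.comp_snd j] with n hn
    rw [resAt, if_pos (hn.trans h2)]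
  · have := key Prod.snd continuous_snd h2
    rw [resAt, if_neg h2]
    refine this.congr' ?_
    filter_upwards [h.comp_snd j] with n hn
    rw [resAt, if_neg (by rwa [hn])]

variable {m : ℕ} {k e : κ → Λ → V m} {k₀ e₀ : Λ → V m} {kL eL : ΛL → V m} {kR eR : ΛR → V m}

omit h in
lemma tendsto_dotProduct {v w : κ → V m} {v₀ w₀ : V m} (hv : Tendsto v l (𝓝 v₀))
    (hw : Tendsto w l (𝓝 w₀)) : Tendsto (fun n => v n ⬝ᵥ w n) l (𝓝 (v₀ ⬝ᵥ w₀)) :=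
  tendsto_finsetSum _ fun i _ => (tendsto_pi_nhds.1 hv i).mul (tendsto_pi_nhds.1 hw i)

omit h in
lemma tendsto_rowVec (hk : ∀ i, Tendsto (fun n => k n i) l (𝓝 (k₀ i)))
    (he : ∀ i, Tendsto (fun n => e n i) l (𝓝 (e₀ i))) (r : Λ × Bool) :
    Tendsto (fun n => rowVec (k n) (e n) r) l (𝓝 (rowVec k₀ e₀ r)) := by
  unfold rowVec
  split_ifs
  · exact he _
  · exact hk _

lemma tendsto_chyMat_left (hk : ∀ i, Tendsto (fun n => k n i) l (𝓝 (k₀ i)))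
    (he : ∀ i, Tendsto (fun n => e n i) l (𝓝 (e₀ i))) {r r' : A × Bool}
    (hr : rowVec kL eL (rowMap (χ ∘ some) r) = rowVec k₀ e₀ (rowMap (φ ∘ .inl) r))
    (hr' : rowVec kL eL (rowMap (χ ∘ some) r') = rowVec k₀ e₀ (rowMap (φ ∘ .inl) r'))
    (hd : r.1 = r'.1 → r.2 ≠ r'.2 → ∀ j, eL (χ (some r.1)) ⬝ᵥ kL (χ (some j)) =
      e₀ (φ (.inl r.1)) ⬝ᵥ k₀ (φ (.inl j))) :
    Tendsto (fun n => ε n * treeMat (k n) (e n) (u n) (rowMap (φ ∘ .inl) r)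
      (rowMap (φ ∘ .inl) r')) l (𝓝 (treeMat kL eL uL (rowMap (χ ∘ some) r)
        (rowMap (χ ∘ some) r'))) := by
  obtain ⟨i, b⟩ := r
  obtain ⟨j, c⟩ := r'
  by_cases hij : i = j
  · subst hij
    have hp : b ≠ c → Tendsto (fun n => ε n * polP (k n) (u n) (φ (.inl i)) (e n (φ (.inl i)))) l
        (𝓝 (polP kL uL (χ (some i)) (eL (χ (some i))))) := fun hbc => by
      simp_rw [polP_eq_resAt]
      exact h.tendsto_resAt_left (fun j => tendsto_dotProduct (he _) (hk j)) (hd rfl hbc) i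
    cases b <;> cases c
    · simpa [chyMat_same] using tendsto_const_nhds
    · simpa only [rowMap, Function.comp, chyMat_false_true] using hp (by simp)
    · simpa only [rowMap, Function.comp, chyMat_true_false, mul_neg] using (hp (by simp)).neg
    · simpa [chyMat_same] using tendsto_const_nhds
  · rw [chyMat_of_ne _ _ _ _ (by simpa using hij), hr, hr']
    have hne : ∀ n, ε n * treeMat (k n) (e n) (u n) (rowMap (φ ∘ .inl) (i, b))
        (rowMap (φ ∘ .inl) (j, c)) = ε n * ((rowVec (k n) (e n) (rowMap (φ ∘ .inl) (i, b)) ⬝ᵥ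
          rowVec (k n) (e n) (rowMap (φ ∘ .inl) (j, c))) /
            br (u n (φ (.inl i))) (u n (φ (.inl j)))) := fun n => by
      rw [chyMat_of_ne _ _ _ _ (by simpa using hij), div_eq_mul_inv]
      rfl
    simp_rw [hne]
    exact h.tendsto_mul_div_br (tendsto_dotProduct (tendsto_rowVec hk he _)
      (tendsto_rowVec hk he _)) i j

lemma tendsto_chyMat_right (hk : ∀ i, Tendsto (fun n => k n i) l (𝓝 (k₀ i)))
    (he : ∀ i, Tendsto (fun n => e n i) l (𝓝 (e₀ i))) {r r' : B × Bool}
    (hr : rowVec kR eR (rowMap (ω ∘ some) r) = rowVec k₀ e₀ (rowMap (φ ∘ .inr) r))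
    (hr' : rowVec kR eR (rowMap (ω ∘ some) r') = rowVec k₀ e₀ (rowMap (φ ∘ .inr) r'))
    (hd : r.1 = r'.1 → r.2 ≠ r'.2 → (∀ j, eR (ω (some r.1)) ⬝ᵥ kR (ω (some j)) =
      e₀ (φ (.inr r.1)) ⬝ᵥ k₀ (φ (.inr j))) ∧ eR (ω (some r.1)) ⬝ᵥ kR (ω none) =
        ∑ i, e₀ (φ (.inr r.1)) ⬝ᵥ k₀ (φ (.inl i))) :
    Tendsto (fun n => treeMat (k n) (e n) (u n) (rowMap (φ ∘ .inr) r)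
      (rowMap (φ ∘ .inr) r')) l (𝓝 (treeMat kR eR uR (rowMap (ω ∘ some) r)
        (rowMap (ω ∘ some) r'))) := by
  obtain ⟨i, b⟩ := r
  obtain ⟨j, c⟩ := r'
  by_cases hij : i = j
  · subst hij
    have hp : b ≠ c → Tendsto (fun n => polP (k n) (u n) (φ (.inr i)) (e n (φ (.inr i)))) l
        (𝓝 (polP kR uR (ω (some i)) (eR (ω (some i))))) := fun hbc => by
      simp_rw [polP_eq_resAt]
      exact h.tendsto_resAt_right (fun j => tendsto_dotProduct (he _) (hk j)) (hd rfl hbc).1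
        (hd rfl hbc).2 i
    cases b <;> cases c
    · simpa [chyMat_same] using tendsto_const_nhds
    · simpa only [rowMap, Function.comp, chyMat_false_true] using hp (by simp)
    · simpa only [rowMap, Function.comp, chyMat_true_false, mul_neg] using (hp (by simp)).neg
    · simpa [chyMat_same] using tendsto_const_nhds
  · rw [chyMat_of_ne _ _ _ _ (by simpa using hij), hr, hr']
    have hne : ∀ n, treeMat (k n) (e n) (u n) (rowMap (φ ∘ .inr) (i, b))
        (rowMap (φ ∘ .inr) (j, c)) = (rowVec (k n) (e n) (rowMap (φ ∘ .inr) (i, b)) ⬝ᵥ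
          rowVec (k n) (e n) (rowMap (φ ∘ .inr) (j, c))) *
            (br (u n (φ (.inr i))) (u n (φ (.inr j))))⁻¹ := fun n =>
      chyMat_of_ne _ _ _ _ (by simpa using hij)
    simp_rw [hne]
    exact (tendsto_dotProduct (tendsto_rowVec hk he _) (tendsto_rowVec hk he _)).mul
      ((h.tendsto_br_comp i j).inv₀ (h.distinctR _ _ (by simpa using hij)))

lemma tendsto_chyMat_cross (hk : ∀ i, Tendsto (fun n => k n i) l (𝓝 (k₀ i)))
    (he : ∀ i, Tendsto (fun n => e n i) l (𝓝 (e₀ i))) (r : A × Bool) (r' : B × Bool) :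
    Tendsto (fun n => treeMat (k n) (e n) (u n) (rowMap (φ ∘ .inl) r)
      (rowMap (φ ∘ .inr) r')) l (𝓝 ((rowVec k₀ e₀ (rowMap (φ ∘ .inl) r) ⬝ᵥ
        rowVec k₀ e₀ (rowMap (φ ∘ .inr) r')) / br (uR (ω none)) (uR (ω (some r'.1))))) := by
  have hne : ∀ n, treeMat (k n) (e n) (u n) (rowMap (φ ∘ .inl) r)
      (rowMap (φ ∘ .inr) r') = (rowVec (k n) (e n) (rowMap (φ ∘ .inl) r) ⬝ᵥ
        rowVec (k n) (e n) (rowMap (φ ∘ .inr) r')) *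
          (br (u n (φ (.inl r.1))) (u n (φ (.inr r'.1))))⁻¹ := fun n =>
    chyMat_of_ne _ _ _ _ (by simp)
  simp_rw [hne, div_eq_mul_inv]
  exact (tendsto_dotProduct (tendsto_rowVec hk he _) (tendsto_rowVec hk he _)).mul
    ((h.tendsto_br_cross _ _).inv₀ (h.br_node _))

end Degeneration

section ReducedRows

variable {Λ : Type*} [Fintype Λ] [DecidableEq Λ] {m : ℕ}

lemma chyMat_congr {k : Λ → V m} {e e' : Λ → V m} {S : Λ → Λ → ℂ} {u : Config Λ}
    {x y : Λ × Bool} (hx : e x.1 = e' x.1) (hy : e y.1 = e' y.1) :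
    chyMat k e S u x y = chyMat k e' S u x y := by
  simp only [chyMat, of_apply, hx, hy]

/-- The rows of the reduced Pfaffian, when the legs other than `a`, `b` are labelled by `Z`. -/
def pairRow {Z : Type*} (a b : Λ) (f : Z → Λ) : Option Z × Bool → Λ × Bool
  | (none, false) => (a, true)
  | (none, true) => (b, true)
  | (some i, β) => (f i, β)

lemma redPf_eq_pf {Z : Type*} [Fintype Z] [DecidableEq Z] (k e : Λ → V m) {a b : Λ} (u : Config Λ)
    (f : Z → Λ) (hf : Function.Injective f) (hr : ∀ i, (∃ z, f z = i) ↔ i ≠ a ∧ i ≠ b) :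
    redPf k e a b u = pf ((treeMat k e u).submatrix (pairRow a b f) (pairRow a b f)) /
      br (u a) (u b) := by
  let E : Z ≃ {i // i ≠ a ∧ i ≠ b} := Equiv.ofBijective (fun z => ⟨f z, (hr _).1 ⟨z, rfl⟩⟩)
    ⟨fun z z' h => hf (congrArg Subtype.val h), fun ⟨i, hi⟩ => by
      obtain ⟨z, hz⟩ := (hr i).2 hi
      exact ⟨z, Subtype.ext hz⟩⟩
  unfold redPf
  rw [← pf_submatrix_equiv (Equiv.optionCongr E)]
  congr 2
  ext ⟨_ | x, _ | _⟩ ⟨_ | y, _ | _⟩ <;> rfl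

end ReducedRows

/-! ### Two cut legs -/

section Cut

variable {X : Type*} [Fintype X] [DecidableEq X] {m : ℕ}

/-- The labels of one side, with the node first. -/
def legEquiv (b : Bool) (Y : Type*) : Option (Option Y) ≃ Bool ⊕ Y where
  toFun o := o.elim (inl !b) (leg b)
  invFun := Sum.elim (fun c => if c = b then some none else none) fun y => some (some y)
  left_inv := by rintro (_ | _ | y) <;> cases b <;> simp [leg]
  right_inv := by rintro ((_ | _) | y) <;> cases b <;> simp [leg]

/-- The labels on the two sides of a cut. -/
def cutEquiv (I : Finset X) : Option I ⊕ Option (Out I) ≃ Bool ⊕ X where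
  toFun := Sum.elim (fun i => toX (leg true i)) fun j => toX (leg false j)
  invFun := Sum.elim (fun c => if c then inl none else inr none) fun x =>
    if h : x ∈ I then inl (some ⟨x, h⟩) else inr (some ⟨x, h⟩)
  left_inv := by
    rintro ((_ | ⟨x, h⟩) | (_ | ⟨x, h⟩))
    · simp [leg, toX]
    · simp [leg, toX, h]
    · simp [leg, toX]
    · simp [leg, toX, h]
  right_inv := by
    rintro ((_ | _) | x)
    · simp [leg, toX]
    · simp [leg, toX]
    · by_cases h : x ∈ I <;> simp [leg, toX, h]

/-- Kinematics on the two sides of a cut, up to components that drop out. -/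
structure CutKin (I : Finset X) (kk : Bool ⊕ X → V m) (pol : X → V m)
    (kkL : Bool ⊕ I → V m) (kkR : Bool ⊕ Out I → V m) : Prop where
  left : ∀ i, kkL (.inr i) = kk (.inr i.1)
  right : ∀ i, kkR (.inr i) = kk (.inr i.1)
  leg_left : ∀ i : I, pol i.1 ⬝ᵥ kkL (.inl true) = pol i.1 ⬝ᵥ kk (.inl true)
  leg_right : ∀ i : Out I, pol i.1 ⬝ᵥ kkR (.inl false) = pol i.1 ⬝ᵥ kk (.inl false)
  node : ∀ i : Out I, pol i.1 ⬝ᵥ kkR (.inl true) =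
    pol i.1 ⬝ᵥ kk (.inl true) + ∑ j : I, pol i.1 ⬝ᵥ kk (.inr j.1)

variable {I : Finset X} {κ : Type*} {l : Filter κ} {ε : κ → ℂ} {x : κ → Option I → ℂ}
  {u : κ → Config (Bool ⊕ X)} {uL : Config (Bool ⊕ I)}
  {uR : Config (Bool ⊕ Out I)} {kk : κ → Bool ⊕ X → V m} {pol : κ → X → V m}
  {kk₀ : Bool ⊕ X → V m} {pol₀ : X → V m} {kkL : Bool ⊕ I → V m}
  {kkR : Bool ⊕ Out I → V m}

/-- A cut degenerating with its kinematics. -/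
structure CutLimit (I : Finset X) (l : Filter κ) (ε : κ → ℂ) (x : κ → Option I → ℂ)
    (u : κ → Config (Bool ⊕ X)) (uL : Config (Bool ⊕ I))
    (uR : Config (Bool ⊕ Out I)) (kk : κ → Bool ⊕ X → V m) (pol : κ → X → V m)
    (kk₀ : Bool ⊕ X → V m) (pol₀ : X → V m) (kkL : Bool ⊕ I → V m)
    (kkR : Bool ⊕ Out I → V m) : Prop
    extends Degeneration (cutEquiv I) (legEquiv true _) (legEquiv false _) l ε x u uL uR,
      CutKin I kk₀ pol₀ kkL kkR where
  tendsto_mom : ∀ i, Tendsto (fun n => kk n i) l (𝓝 (kk₀ i))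
  tendsto_pol : ∀ i, Tendsto (fun n => pol n i) l (𝓝 (pol₀ i))

namespace CutLimit

variable (h : CutLimit I l ε x u uL uR kk pol kk₀ pol₀ kkL kkR)

include h

lemma tendsto_marked (E E' : V m) (i : Bool ⊕ X) :
    Tendsto (fun n => marked E E' (pol n) i) l (𝓝 (marked E E' pol₀ i)) := by
  rcases i with c | i
  · exact tendsto_const_nhds
  · exact h.tendsto_pol i

lemma rowVec_left (E E' F : V m) {r : Option I × Bool} (hr : r.1 = none → r.2 = true) :
    rowVec kkL (marked E F fun i => pol₀ i.1) (rowMap (legEquiv true _ ∘ some) r) =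
      rowVec kk₀ (marked E E' pol₀) (rowMap (cutEquiv I ∘ .inl) r) := by
  obtain ⟨_ | i, _ | _⟩ := r
  · exact absurd (hr rfl) (by simp)
  · rfl
  · exact h.left i
  · rfl

lemma rowVec_right (E E' F : V m) {r : Option (Out I) × Bool} (hr : r.1 = none → r.2 = true) :
    rowVec kkR (marked F E' fun i => pol₀ i.1) (rowMap (legEquiv false _ ∘ some) r) =
      rowVec kk₀ (marked E E' pol₀) (rowMap (cutEquiv I ∘ .inr) r) := by
  obtain ⟨_ | i, _ | _⟩ := r
  · exact absurd (hr rfl) (by simp)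
  · rfl
  · exact h.right i
  · rfl

lemma tendsto_left (E E' F : V m) {r r' : Option I × Bool} (hr : r.1 = none → r.2 = true)
    (hr' : r'.1 = none → r'.2 = true) :
    Tendsto (fun n => ε n * treeMat (kk n) (marked E E' (pol n)) (u n)
      (rowMap (cutEquiv I ∘ .inl) r) (rowMap (cutEquiv I ∘ .inl) r')) l
      (𝓝 (treeMat kkL (marked E F fun i => pol₀ i.1) uL
        (rowMap (legEquiv true _ ∘ some) r) (rowMap (legEquiv true _ ∘ some) r'))) := by
  refine h.tendsto_chyMat_left h.tendsto_mom (h.tendsto_marked E E') (h.rowVec_left E E' F hr)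
    (h.rowVec_left E E' F hr')
    fun h1 h2 j => ?_
  obtain ⟨_ | i, b⟩ := r
  · exact absurd ((hr rfl).trans (hr' h1.symm).symm) h2
  · rcases j with _ | j
    · exact h.leg_left i
    · exact congrArg (pol₀ i.1 ⬝ᵥ ·) (h.left j)

lemma tendsto_right (E E' F : V m) {r r' : Option (Out I) × Bool} (hr : r.1 = none → r.2 = true)
    (hr' : r'.1 = none → r'.2 = true) :
    Tendsto (fun n => treeMat (kk n) (marked E E' (pol n)) (u n)
      (rowMap (cutEquiv I ∘ .inr) r) (rowMap (cutEquiv I ∘ .inr) r')) l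
      (𝓝 (treeMat kkR (marked F E' fun i => pol₀ i.1) uR
        (rowMap (legEquiv false _ ∘ some) r) (rowMap (legEquiv false _ ∘ some) r'))) := by
  refine h.tendsto_chyMat_right h.tendsto_mom (h.tendsto_marked E E') (h.rowVec_right E E' F hr)
    (h.rowVec_right E E' F hr')
    fun h1 h2 => ?_
  obtain ⟨_ | i, b⟩ := r
  · exact absurd ((hr rfl).trans (hr' h1.symm).symm) h2
  · refine ⟨fun j => ?_, ?_⟩
    · rcases j with _ | j
      · exact h.leg_right i
      · exact congrArg (pol₀ i.1 ⬝ᵥ ·) (h.right j)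
    · rw [sum_option]
      exact h.node i

lemma tendsto_cross (E E' : V m) (r : Option I × Bool) (r' : Option (Out I) × Bool) :
    Tendsto (fun n => treeMat (kk n) (marked E E' (pol n)) (u n)
      (rowMap (cutEquiv I ∘ .inl) r) (rowMap (cutEquiv I ∘ .inr) r')) l
      (𝓝 ((rowVec kk₀ (marked E E' pol₀) (rowMap (cutEquiv I ∘ .inl) r) ⬝ᵥ
        rowVec kk₀ (marked E E' pol₀) (rowMap (cutEquiv I ∘ .inr) r')) /
          br (uR (.inl true)) (uR (leg false r'.1)))) :=
  h.tendsto_chyMat_cross h.tendsto_mom (h.tendsto_marked E E') r r'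

lemma tendsto_brPM : Tendsto (fun n => brPM (u n)) l (𝓝 (brPM uR)) := h.tendsto_br_cross none none

lemma brPM_right_ne_zero : brPM uR ≠ 0 := h.br_node none

lemma brPM_left : brPM uL = -1 := by
  have h1 : (uL (.inl true)).2 = 1 := h.left_snd none
  have h2 : uL (.inl false) = (1, 0) := h.left_node
  rw [brPM, h2, br, h1]
  simp

lemma tendsto_scalHalf : Tendsto (fun n => ε n ^ I.card * scalHalf (kk n) (pol n) (u n)) l
      (𝓝 (scalHalf kkL (fun i => pol₀ i.1) uL * scalHalf kkR (fun i => pol₀ i.1) uR)) := by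
  let ψ : I ⊕ Out I ≃ X := Equiv.sumCompl (· ∈ I)
  have key : Tendsto (fun n => ε n ^ I.card * pf (M30 (kk n) (pol n) (u n))) l
      (𝓝 (pf (M30 kkL (fun i => pol₀ i.1) uL) * pf (M30 kkR (fun i => pol₀ i.1) uR))) := by
    simp_rw [← pf_submatrix_equiv ψ (M30 _ _ _)]
    rw [← card_coe I]
    let Z : I × Bool → Out I × Bool → ℂ := fun r r' =>
      (rowVec kk₀ (marked 0 0 pol₀) (.inr r.1, r.2) ⬝ᵥ
        rowVec kk₀ (marked 0 0 pol₀) (.inr r'.1, r'.2)) / br (uR (.inl true)) (uR (.inr r'.1))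
    refine tendsto_pf_glue_even (X := Z) (Y := fun r r' => -Z r r') (fun r r' => ?_)
      (fun r r' => ?_) (fun r r' => ?_) (fun r r' => ?_) h.tendsto_zero
    · exact h.tendsto_left 0 0 0 (r := (some r.1, r.2)) (r' := (some r'.1, r'.2)) (by simp)
        (by simp)
    · exact h.tendsto_right 0 0 0 (r := (some r.1, r.2)) (r' := (some r'.1, r'.2)) (by simp)
        (by simp)
    · exact h.tendsto_cross 0 0 (some r.1, r.2) (some r'.1, r'.2)
    · have := (h.tendsto_cross 0 0 (some r.1, r.2) (some r'.1, r'.2)).neg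
      exact this.congr fun n => (isSkew_chyMat _ _ _ _ _).symm
  simp_rw [scalHalf_eq, h.brPM_left, neg_one_sq, div_one, mul_div_assoc']
  exact key.div (h.tendsto_brPM.pow 2) (pow_ne_zero 2 h.brPM_right_ne_zero)

omit h in
lemma redPf_cut {Y : Type*} [Fintype Y] [DecidableEq Y] (k e : Bool ⊕ Y → V m)
    (u : Config (Bool ⊕ Y)) :
    redPf k e (.inl true) (.inl false) u = pf ((treeMat k e u).submatrix
      (pairRow (.inl true) (.inl false) inr) (pairRow (.inl true) (.inl false) inr)) /
        brPM u :=
  redPf_eq_pf k e u inr inr_injective fun i => by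
    rcases i with (_ | _) | i <;> simp

omit h in
lemma redPf_cut_swap {Y Z : Type*} [Fintype Y] [DecidableEq Y] [Fintype Z] [DecidableEq Z]
    (ψ : Z ≃ Y) (k e : Bool ⊕ Y → V m) (u : Config (Bool ⊕ Y)) :
    redPf k e (.inl true) (.inl false) u = -(pf ((treeMat k e u).submatrix
      (pairRow (.inl false) (.inl true) (inr ∘ ψ))
      (pairRow (.inl false) (.inl true) (inr ∘ ψ))) / brPM u) := by
  rw [redPf_swap, redPf_eq_pf k e u (inr ∘ ψ) (inr_injective.comp ψ.injective), brPM,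
    br_swap, div_neg]
  rintro ((_ | _) | i)
  · simp
  · simp
  · simpa using ⟨ψ.symm i, by simp⟩

lemma tendsto_redPf (E E' : V m) :
    Tendsto (fun n => ε n ^ I.card * redPf (kk n) (marked E E' (pol n)) (.inl true) (.inl false)
      (u n)) l (𝓝 (∑ γ : Fin m,
        redPf kkL (marked E (basisVec γ) fun i => pol₀ i.1) (.inl true) (.inl false) uL *
        redPf kkR (marked (basisVec γ) E' fun i => pol₀ i.1) (.inl true) (.inl false) uR)) := by
  let ψ : I ⊕ Out I ≃ X := Equiv.sumCompl (· ∈ I)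
  let N : κ → Matrix (Option (I ⊕ Out I) × Bool) _ ℂ := fun n =>
    (treeMat (kk n) (marked E E' (pol n)) (u n)).submatrix
      (pairRow (.inl false) (.inl true) (inr ∘ ψ))
      (pairRow (.inl false) (.inl true) (inr ∘ ψ))
  let L : V m → Matrix (Option I × Bool) (Option I × Bool) ℂ := fun F =>
    (treeMat kkL (marked E F fun i => pol₀ i.1) uL).submatrix
      (pairRow (.inl true) (.inl false) inr) (pairRow (.inl true) (.inl false) inr)
  let R : V m → Matrix (Option (Out I) × Bool) (Option (Out I) × Bool) ℂ := fun F =>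
    (treeMat kkR (marked F E' fun i => pol₀ i.1) uR).submatrix
      (pairRow (.inl false) (.inl true) inr) (pairRow (.inl false) (.inl true) inr)
  have key : Tendsto (fun n => ε n ^ I.card * pf (N n)) l
      (𝓝 (-∑ γ : Fin m, pf (L (basisVec γ)) * pf (R (basisVec γ)))) := by
    rw [← card_coe I]
    refine tendsto_pf_glue_odd (M := fun x y => L 0 (initRows x) (initRows y))
      (D := fun x y => R 0 (initRows x) (initRows y)) (L := fun γ : Fin m => L (basisVec γ))
      (R := fun γ : Fin m => R (basisVec γ))
      (fun n => (isSkew_chyMat _ _ _).submatrix _) (fun γ => (isSkew_chyMat _ _ _).submatrix _)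
      (fun γ => (isSkew_chyMat _ _ _).submatrix _) ?_ ?_ ?_ ?_ ?_ h.tendsto_zero h.ne_zero
    · intro γ r r'
      refine chyMat_congr ?_ ?_
      · rcases r with _ | r <;> rfl
      · rcases r' with _ | r' <;> rfl
    · intro γ r r'
      refine chyMat_congr ?_ ?_
      · rcases r with _ | r <;> rfl
      · rcases r' with _ | r' <;> rfl
    · rintro (_ | r) (_ | r')
      · exact h.tendsto_left E E' 0 (r := (none, true)) (r' := (none, true)) (by simp) (by simp)
      · exact h.tendsto_left E E' 0 (r := (none, true)) (r' := (some r'.1, r'.2)) (by simp)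
          (by simp)
      · exact h.tendsto_left E E' 0 (r := (some r.1, r.2)) (r' := (none, true)) (by simp) (by simp)
      · exact h.tendsto_left E E' 0 (r := (some r.1, r.2)) (r' := (some r'.1, r'.2)) (by simp)
          (by simp)
    · rintro (_ | r) (_ | r')
      · exact h.tendsto_right E E' 0 (r := (none, true)) (r' := (none, true)) (by simp) (by simp)
      · exact h.tendsto_right E E' 0 (r := (none, true)) (r' := (some r'.1, r'.2)) (by simp)
          (by simp)
      · exact h.tendsto_right E E' 0 (r := (some r.1, r.2)) (r' := (none, true)) (by simp) (by simp)
      · exact h.tendsto_right E E' 0 (r := (some r.1, r.2)) (r' := (some r'.1, r'.2)) (by simp)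
          (by simp)
    · let toL : Option (I × Bool) → Option I × Bool := fun r =>
        r.elim (none, true) fun r => (some r.1, r.2)
      let toR : Option (Out I × Bool) → Option (Out I) × Bool := fun r =>
        r.elim (none, true) fun r => (some r.1, r.2)
      have hLe : ∀ r F, L F (initRows r) (none, true) =
          -(rowVec kk₀ (marked E E' pol₀) (rowMap (cutEquiv I ∘ .inl) (toL r)) ⬝ᵥ F) := by
        intro r F
        have h1 : (toL r).1 = none → (toL r).2 = true := by rcases r with _ | r <;> simp [toL]
        have h2 : pairRow (.inl true) (.inl false) inr (initRows r) =
            rowMap (legEquiv true _ ∘ some) (toL r) := by rcases r with _ | r <;> rfl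
        have h3 : br (uL (leg true (toL r).1)) (uL (.inl false)) = -1 := by
          have h4 : uL (.inl false) = (1, 0) := h.left_node
          have h5 : (uL (leg true (toL r).1)).2 = 1 := h.left_snd _
          rw [h4, br, h5]
          simp
        simp only [L, submatrix_apply]
        rw [h2, chyMat_of_ne _ _ _ _ (by rcases r with _ | r <;> simp [toL, pairRow, legEquiv, leg]),
          h.rowVec_left E E' F h1]
        change _ * (br (uL (leg true (toL r).1)) (uL (.inl false)))⁻¹ = _
        rw [h3]
        simp [rowVec, pairRow, marked]
      have hRe : ∀ r F, R F (initRows r) (none, true) =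
          -((rowVec kk₀ (marked E E' pol₀) (rowMap (cutEquiv I ∘ .inr) (toR r)) ⬝ᵥ F) /
            br (uR (.inl true)) (uR (leg false (toR r).1))) := by
        intro r F
        have h1 : (toR r).1 = none → (toR r).2 = true := by rcases r with _ | r <;> simp [toR]
        have h2 : pairRow (.inl false) (.inl true) inr (initRows r) =
            rowMap (legEquiv false _ ∘ some) (toR r) := by rcases r with _ | r <;> rfl
        simp only [R, submatrix_apply]
        rw [h2, chyMat_of_ne _ _ _ _ (by rcases r with _ | r <;> simp [toR, pairRow, legEquiv, leg]),
          h.rowVec_right E E' F h1]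
        change _ * (br (uR (leg false (toR r).1)) (uR (.inl true)))⁻¹ = _
        rw [br_swap (uR (.inl true)), inv_neg]
        simp [rowVec, pairRow, marked, div_eq_mul_inv]
      intro r r'
      have := h.tendsto_cross E E' (toL r) (toR r')
      have hsum : ∑ γ : Fin m, L (basisVec γ) (initRows r) (none, true) *
          R (basisVec γ) (initRows r') (none, true) =
          (rowVec kk₀ (marked E E' pol₀) (rowMap (cutEquiv I ∘ .inl) (toL r)) ⬝ᵥ
            rowVec kk₀ (marked E E' pol₀) (rowMap (cutEquiv I ∘ .inr) (toR r'))) /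
              br (uR (.inl true)) (uR (leg false (toR r').1)) := by
        simp_rw [hLe, hRe, neg_mul_neg, dotProduct_basisVec]
        rw [dotProduct, sum_div]
        simp_rw [mul_div_assoc]
      rw [hsum]
      rcases r with _ | r <;> rcases r' with _ | r' <;> exact this
  have hl : ∀ n, redPf (kk n) (marked E E' (pol n)) (.inl true) (.inl false) (u n) =
      -(pf (N n) / brPM (u n)) := fun n => redPf_cut_swap ψ _ _ _
  have hL' : ∀ F, redPf kkL (marked E F fun i => pol₀ i.1) (.inl true) (.inl false) uL =
      -pf (L F) := fun F => by rw [redPf_cut, h.brPM_left, div_neg, div_one]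
  have hR' : ∀ F, redPf kkR (marked F E' fun i => pol₀ i.1) (.inl true) (.inl false) uR =
      -(pf (R F) / brPM uR) := fun F => redPf_cut_swap (Equiv.refl _) _ _ _
  simp_rw [hl, hL', hR', mul_neg, neg_mul, neg_neg, mul_div_assoc']
  have := (key.div h.tendsto_brPM h.brPM_right_ne_zero).neg
  rwa [neg_div, neg_neg, sum_div] at this

lemma tendsto_nsHalf (d : ℕ) (hL : OnShell kkL uL) (hR : OnShell kkR uR) {p p' : V m}
    (hp : kkL (.inl true) = p) (hp' : kkL (.inl false) = -p') (hq' : kkR (.inl true) = p')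
    (hq : kkR (.inl false) = -p) (hpol : ∀ i, pol₀ i ⬝ᵥ kk₀ (.inr i) = 0) {e e' : Fin (m - 2) → V m}
    (he : PolBasis p e) (he' : PolBasis p' e') :
    Tendsto (fun n => ε n ^ I.card * nsHalf d (kk n) (pol n) (u n)) l
      (𝓝 (∑ A : CutState m, cutWeight d m A *
        (cutHalf kkL (fun i => pol₀ i.1) (A.map fun c => (e c.1, e' c.2)) uL *
          cutHalf kkR (fun i => pol₀ i.1) (A.map fun c => (e' c.2, e c.1)) uR))) := by
  have hpL : ∀ i : I, pol₀ i.1 ⬝ᵥ kkL (.inr i) = 0 := fun i => by rw [h.left, hpol]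
  have hpR : ∀ i : Out I, pol₀ i.1 ⬝ᵥ kkR (.inr i) = 0 := fun i => by rw [h.right, hpol]
  have h1 := he.contraction he' (TL := redPfForm kkL (fun i => pol₀ i.1) uL)
    (TR := redPfForm kkR (fun i => pol₀ i.1) uR) (sL := scalHalf kkL (fun i => pol₀ i.1) uL)
    (sR := scalHalf kkR (fun i => pol₀ i.1) uR)
    (fun E => by
      have := redPfForm_momentum_left hL hpL E
      rwa [hp, hp', neg_dotProduct, neg_neg] at this)
    (fun E => by
      have := redPfForm_momentum_right hL hpL E
      rw [hp, hp', map_neg] at this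
      linear_combination -this)
    (fun E => by
      have := redPfForm_momentum_left hR hpR E
      rwa [hq, hq', neg_dotProduct, neg_neg] at this)
    (fun E => by
      have := redPfForm_momentum_right hR hpR E
      rw [hq, hq', map_neg] at this
      linear_combination -this)
  have h2 := (tendsto_finsetSum univ fun (α : Fin m) _ =>
    h.tendsto_redPf (basisVec α) (basisVec α)).add (h.tendsto_scalHalf.const_mul ((d : ℂ) - 2 - m))
  have h3 : ∑ A : CutState m, cutWeight d m A *
        (cutHalf kkL (fun i => pol₀ i.1) (A.map fun c => (e c.1, e' c.2)) uL *
          cutHalf kkR (fun i => pol₀ i.1) (A.map fun c => (e' c.2, e c.1)) uR) =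
      ((d : ℂ) - m) * (scalHalf kkL (fun i => pol₀ i.1) uL * scalHalf kkR (fun i => pol₀ i.1) uR) +
        ∑ r, ∑ s, redPfForm kkL (fun i => pol₀ i.1) uL (e r) (e' s) *
          redPfForm kkR (fun i => pol₀ i.1) uR (e' s) (e r) := by
    rw [sum_option, sum_prod_type]
    simp only [cutWeight, one_mul]
    rfl
  have h4 : ∑ α : Fin m, ∑ γ : Fin m,
      redPf kkL (marked (basisVec α) (basisVec γ) fun i => pol₀ i.1) (.inl true) (.inl false) uL *
        redPf kkR (marked (basisVec γ) (basisVec α) fun i => pol₀ i.1) (.inl true) (.inl false) uR =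
      ∑ α, ∑ γ, redPfForm kkL (fun i => pol₀ i.1) uL (basisVec α) (basisVec γ) *
        redPfForm kkR (fun i => pol₀ i.1) uR (basisVec γ) (basisVec α) := rfl
  rw [h4, h1] at h2
  rw [h3]
  convert h2.congr' ?_ using 2
  · ring
  · filter_upwards [h.distinct] with n hn
    rw [nsHalf_eq _ _ _ d hn, mul_add, mul_sum]
    ring

end CutLimit

end Cut

/-! ### Row operations on Pfaffians -/

section RowOperations

variable {ι : Type*} [Fintype ι] [DecidableEq ι]

/-- Replace a row and the corresponding column by linear combinations. -/
def addRows (A : RowMat ι) (x : ι × Bool) (c : ι × Bool → ℂ) :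
    RowMat ι :=
  (1 : RowMat ι).updateRow x c * A * ((1 : RowMat ι).updateRow x c).transpose

lemma pf_addRows (A : RowMat ι) (x : ι × Bool) (c : ι × Bool → ℂ) :
    pf (addRows A x c) = c x * pf A := by
  have h := Matrix.cramer_transpose_apply (1 : RowMat ι) c x
  rw [Matrix.transpose_one, Matrix.cramer_one] at h
  rw [addRows, pf_mul_mul_transpose, ← h]
  rfl

lemma IsSkew.addRows {A : RowMat ι} (hA : IsSkew A) (x : ι × Bool)
    (c : ι × Bool → ℂ) : IsSkew (addRows A x c) := by
  have hT : A.transpose = -A := by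
    ext y z
    exact hA y z
  intro y z
  set P := (1 : RowMat ι).updateRow x c with hP
  have : (OneLoop.addRows A x c).transpose = -OneLoop.addRows A x c := by
    rw [OneLoop.addRows, Matrix.transpose_mul, Matrix.transpose_mul, Matrix.transpose_transpose,
      hT, Matrix.neg_mul, Matrix.mul_neg, Matrix.mul_assoc]
  exact congrFun (congrFun this y) z

lemma updateRow_one_mul (A : RowMat ι) (x : ι × Bool) (c : ι × Bool → ℂ) :
    (1 : RowMat ι).updateRow x c * A = A.updateRow x (vecMul c A) := by
  ext y z
  by_cases h : y = x
  · subst h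
    rw [Matrix.mul_apply, Matrix.updateRow_self, Matrix.updateRow_self]
    rfl
  · rw [Matrix.mul_apply, Matrix.updateRow_ne h, Matrix.updateRow_ne h, ← Matrix.mul_apply,
      Matrix.one_mul]

lemma addRows_of_ne (A : RowMat ι) {x y z : ι × Bool} (c : ι × Bool → ℂ)
    (hy : y ≠ x) (hz : z ≠ x) : addRows A x c y z = A y z := by
  rw [addRows, updateRow_one_mul, Matrix.mul_apply]
  simp [Matrix.updateRow_apply, hy, hz, Matrix.one_apply]

lemma addRows_self_left (A : RowMat ι) {x z : ι × Bool} (c : ι × Bool → ℂ)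
    (hz : z ≠ x) : addRows A x c x z = ∑ y, c y * A y z := by
  rw [addRows, updateRow_one_mul, Matrix.mul_apply]
  simp [Matrix.updateRow_apply, hz, Matrix.one_apply, vecMul, dotProduct]

/-- The Pfaffian is linear in a row and the corresponding column. -/
lemma exists_pf_linear {m : ℕ} {A : V m → RowMat ι} (x : ι × Bool)
    (h0 : ∀ v w r s, r ≠ x → s ≠ x → A v r s = A w r s) (hA : ∀ v, IsSkew (A v))
    (hadd : ∀ v w s, s ≠ x → A (v + w) x s = A v x s + A w x s)
    (hsmul : ∀ (c : ℂ) v s, s ≠ x → A (c • v) x s = c * A v x s) :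
    ∃ f : V m →ₗ[ℂ] ℂ, ∀ v, f v = pf (A v) := by
  refine ⟨⟨⟨fun v => pf (A v), fun v w => ?_⟩, fun c v => ?_⟩, fun v => rfl⟩
  · refine pf_add_row x (fun r s hr hs => h0 _ _ _ _ hr hs) (fun r s hr hs => h0 _ _ _ _ hr hs)
      (fun s hs => hadd v w s hs) fun s hs => ?_
    rw [hA _ x s, hA _ x s, hA _ x s, hadd v w s hs]
    ring
  · have h := pf_diag_smul (fun y => if y = x then c else 1) (A v)
    rw [Finset.prod_ite_eq' univ x (fun _ => c), if_pos (mem_univ _)] at h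
    change pf (A (c • v)) = c * pf (A v)
    rw [← h]
    congr 1
    have hd : ∀ v, A v x x = 0 := fun v => by
      have := hA v x x
      linear_combination this / 2
    ext r s
    by_cases hr : r = x <;> by_cases hs : s = x
    · subst hr; subst hs; simp [hd]
    · subst hr; simp [hs, hsmul]
    · subst hs
      simp only [of_apply, if_neg hr, if_true, one_mul]
      rw [hA _ s r, hsmul _ _ _ hr, hA _ s r]
      ring
    · simp [hr, hs, h0 (c • v) v r s hr hs]

end RowOperations

/-! ### The Pfaffian of a channel with one node -/

section Channel

variable {κ A B β Λ ΛL ΛR : Type*} [Fintype A] [DecidableEq A] [Fintype B] [DecidableEq B]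
  [Fintype β] [DecidableEq β] [Fintype Λ] [DecidableEq Λ] [Fintype ΛL] [DecidableEq ΛL]
  [Fintype ΛR] [DecidableEq ΛR] {m : ℕ}
  {φ : A ⊕ B ≃ Λ} {χ : Option A ≃ ΛL} {ω : Option B ≃ ΛR} {l : Filter κ} {ε : κ → ℂ}
  {x : κ → A → ℂ} {u : κ → Config Λ} {uL : Config ΛL} {uR : Config ΛR}
  {k e : κ → Λ → V m} {k₀ e₀ : Λ → V m} {kL : ΛL → V m} {kR : ΛR → V m} {eL : V m → ΛL → V m}
  {eR : V m → ΛR → V m}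

/-- Rows of the whole: pairs of the channel, `a` first, and further rows `ρ` outside. -/
def chanRow (φ : A ⊕ B ≃ Λ) (a : A) (ρ : β × Bool → B × Bool) :
    Option ({i : A // i ≠ a} ⊕ β) × Bool → Λ × Bool
  | (none, b) => (φ (.inl a), b)
  | (some (.inl i), b) => (φ (.inl i.1), b)
  | (some (.inr j), b) => rowMap (φ ∘ .inr) (ρ (j, b))

/-- Rows on the right: the pair of the node, and the rows `ρ`. -/
def nodeRow (ω : Option B ≃ ΛR) (ρ : β × Bool → B × Bool) : Option β × Bool → ΛR × Bool
  | (none, b) => (ω none, b)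
  | (some j, b) => rowMap (ω ∘ some) (ρ (j, b))

/-- A node degenerating with its kinematics; `eL ν`, `eR ν` are polarisations with `ν` on the
node. -/
structure NodeLimit (φ : A ⊕ B ≃ Λ) (χ : Option A ≃ ΛL) (ω : Option B ≃ ΛR) (a : A)
    (l : Filter κ) (ε : κ → ℂ) (x : κ → A → ℂ) (u : κ → Config Λ) (uL : Config ΛL)
    (uR : Config ΛR) (k e : κ → Λ → V m) (k₀ e₀ : Λ → V m) (kL : ΛL → V m) (kR : ΛR → V m)
    (eL : V m → ΛL → V m) (eR : V m → ΛR → V m) : Prop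
    extends Degeneration φ χ ω l ε x u uL uR where
  tendsto_mom : ∀ i, Tendsto (fun n => k n i) l (𝓝 (k₀ i))
  tendsto_pol : ∀ i, Tendsto (fun n => e n i) l (𝓝 (e₀ i))
  momL : ∀ i, kL (χ (some i)) = k₀ (φ (.inl i))
  momR : ∀ j, kR (ω (some j)) = k₀ (φ (.inr j))
  momN : kR (ω none) = ∑ i, k₀ (φ (.inl i))
  polL : ∀ ν i, eL ν (χ (some i)) = e₀ (φ (.inl i))
  polR : ∀ ν j, eR ν (ω (some j)) = e₀ (φ (.inr j))
  polNL : ∀ ν, eL ν (χ none) = ν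
  polNR : ∀ ν, eR ν (ω none) = ν
  scat : ∀ᶠ n in l, ∀ i, i ≠ a → resAt (fun j => k n (φ (.inl i)) ⬝ᵥ k n j) (u n) (φ (.inl i)) = 0

/-- `k_i · P(σ_i) = 0` on a solution of the scattering equations. -/
lemma OnShell.polP_self {k : Λ → V m} {u : Config Λ} (h : OnShell k u) (i : Λ)
    (hi : k i ⬝ᵥ k i = 0) {j : Λ} (hj : j ≠ i) : polP k u i (k i) = 0 := by
  rw [polP_eq_resAt]
  refine h.solves.resAt_eq_zero i (fun j hj => h.distinct _ _ hj.symm) ?_ (u j)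
    (h.distinct _ _ hj.symm)
  rw [← add_right_inj (k i ⬝ᵥ k i), add_sum_erase _ (fun j => k i ⬝ᵥ k j)
    (mem_univ i), ← dotProduct_sum, h.sum_eq_zero, dotProduct_zero, hi, add_zero]

namespace NodeLimit

variable {a : A} (h : NodeLimit φ χ ω a l ε x u uL uR k e k₀ e₀ kL kR eL eR)

include h

lemma rowVecL (ν : V m) (r : A × Bool) : rowVec kL (eL ν) (rowMap (χ ∘ some) r) =
      rowVec k₀ e₀ (rowMap (φ ∘ .inl) r) := by
  obtain ⟨i, _ | _⟩ := r
  · exact h.momL i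
  · exact h.polL ν i

lemma rowVecR (ν : V m) (r : B × Bool) : rowVec kR (eR ν) (rowMap (ω ∘ some) r) =
      rowVec k₀ e₀ (rowMap (φ ∘ .inr) r) := by
  obtain ⟨i, _ | _⟩ := r
  · exact h.momR i
  · exact h.polR ν i

lemma tendsto_left (ν : V m) (r r' : A × Bool) :
    Tendsto (fun n => ε n * treeMat (k n) (e n) (u n) (rowMap (φ ∘ .inl) r)
      (rowMap (φ ∘ .inl) r')) l (𝓝 (treeMat kL (eL ν) uL (rowMap (χ ∘ some) r)
        (rowMap (χ ∘ some) r'))) :=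
  h.tendsto_chyMat_left h.tendsto_mom h.tendsto_pol (h.rowVecL ν r) (h.rowVecL ν r')
    fun _ _ j => by rw [h.polL, h.momL]

lemma tendsto_right (ν : V m) (r r' : B × Bool) :
    Tendsto (fun n => treeMat (k n) (e n) (u n) (rowMap (φ ∘ .inr) r)
      (rowMap (φ ∘ .inr) r')) l (𝓝 (treeMat kR (eR ν) uR (rowMap (ω ∘ some) r)
        (rowMap (ω ∘ some) r'))) :=
  h.tendsto_chyMat_right h.tendsto_mom h.tendsto_pol (h.rowVecR ν r) (h.rowVecR ν r')
    fun _ _ => ⟨fun j => by rw [h.polR, h.momR], by rw [h.polR, h.momN, dotProduct_sum]⟩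

/-- `v · P` at the node, on the side of the complement. -/
def nodeP (φ : A ⊕ B ≃ Λ) (ω : Option B ≃ ΛR) (k₀ : Λ → V m) (uR : Config ΛR) (v : V m) : ℂ :=
  ∑ j : B, (v ⬝ᵥ k₀ (φ (.inr j))) * (uR (ω (some j))).2 / br (uR (ω none)) (uR (ω (some j)))

lemma polP_node (v : V m) :
    polP kR uR (ω none) v = nodeP φ ω k₀ uR v := by
  rw [polP_eq_resAt, resAt_of_finite _ (by rw [h.right_node]), ← ω.sum_comp, sum_option,
    br_self, div_zero, zero_add]
  simp_rw [h.momR]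
  rfl

lemma sum_chyMat_chan {n : κ}
    {r : A × Bool} (hs : r.2 = false → resAt (fun j => k n (φ (.inl r.1)) ⬝ᵥ k n j) (u n)
      (φ (.inl r.1)) = 0) :
    ∑ j, treeMat (k n) (e n) (u n) (φ (.inl j), false) (rowMap (φ ∘ .inl) r) =
      ∑ j : B, (rowVec (k n) (e n) (rowMap (φ ∘ .inl) r) ⬝ᵥ k n (φ (.inr j))) *
        (u n (φ (.inr j))).2 / br (u n (φ (.inl r.1))) (u n (φ (.inr j))) := by
  obtain ⟨i, c⟩ := r
  have h1 : ∀ j, treeMat (k n) (e n) (u n) (φ (.inl j), false) (φ (.inl i), c) =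
      (if j = i then (if c then polP (k n) (u n) (φ (.inl i)) (e n (φ (.inl i))) else 0) else 0) -
        (rowVec (k n) (e n) (φ (.inl i), c) ⬝ᵥ k n (φ (.inl j))) /
          br (u n (φ (.inl i))) (u n (φ (.inl j))) := fun j => by
    by_cases hj : j = i
    · subst hj
      cases c <;> simp [chyMat_same, chyMat_false_true, br_self]
    · rw [chyMat_of_ne _ _ _ _ (by simpa using hj), if_neg hj, brInv,
        br_swap (u n (φ (.inl i))), inv_neg, dotProduct_comm]
      simp only [rowVec, Bool.false_eq_true, if_false]
      ring
  have h2 : resAt (fun j => rowVec (k n) (e n) (φ (.inl i), c) ⬝ᵥ k n j) (u n) (φ (.inl i)) =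
      (∑ j, (rowVec (k n) (e n) (φ (.inl i), c) ⬝ᵥ k n (φ (.inl j))) /
          br (u n (φ (.inl i))) (u n (φ (.inl j)))) +
      ∑ j : B, (rowVec (k n) (e n) (φ (.inl i), c) ⬝ᵥ k n (φ (.inr j))) *
        (u n (φ (.inr j))).2 / br (u n (φ (.inl i))) (u n (φ (.inr j))) := by
    rw [resAt_of_finite _ (by rw [h.chan_eq]), ← φ.sum_comp, sum_sum_type]
    simp_rw [h.chan_eq, mul_one]
  have h3 : (if c then polP (k n) (u n) (φ (.inl i)) (e n (φ (.inl i))) else 0) =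
      resAt (fun j => rowVec (k n) (e n) (φ (.inl i), c) ⬝ᵥ k n j) (u n) (φ (.inl i)) := by
    cases c
    · simpa [rowVec] using (hs rfl).symm
    · simp [rowVec, polP_eq_resAt]
  change ∑ j, treeMat (k n) (e n) (u n) (φ (.inl j), false) (φ (.inl i), c) = _
  simp_rw [h1, sum_sub_distrib]
  rw [Finset.sum_ite_eq' univ i, if_pos (mem_univ _), h3, h2, add_sub_cancel_left]
  rfl

lemma tendsto_sum_chan {r : A × Bool} (hr : r.2 = false → r.1 ≠ a) :
    Tendsto (fun n => ∑ j, treeMat (k n) (e n) (u n) (φ (.inl j), false) (rowMap (φ ∘ .inl) r)) l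
      (𝓝 (nodeP φ ω k₀ uR (rowVec k₀ e₀ (rowMap (φ ∘ .inl) r)))) := by
  refine Tendsto.congr' ?_ (tendsto_finsetSum _ fun j _ =>
    ((Degeneration.tendsto_dotProduct (Degeneration.tendsto_rowVec h.tendsto_mom h.tendsto_pol _)
      (h.tendsto_mom _)).mul ((continuous_snd.tendsto _).comp (h.tendsto_comp j))).div
        (h.tendsto_br_cross r.1 j) (h.br_node j))
  filter_upwards [h.scat] with n hn
  exact (h.sum_chyMat_chan fun hc => hn _ (hr hc)).symm

lemma tendsto_sum_cross (ν : V m) (r : B × Bool) :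
    Tendsto (fun n => ∑ j, treeMat (k n) (e n) (u n) (φ (.inl j), false) (rowMap (φ ∘ .inr) r)) l
      (𝓝 (treeMat kR (eR ν) uR (ω none, false) (rowMap (ω ∘ some) r))) := by
  have : treeMat kR (eR ν) uR (ω none, false) (rowMap (ω ∘ some) r) =
      ∑ j : A, (k₀ (φ (.inl j)) ⬝ᵥ rowVec k₀ e₀ (rowMap (φ ∘ .inr) r)) /
        br (uR (ω none)) (uR (ω (some r.1))) := by
    rw [chyMat_of_ne _ _ _ _ (by simp), h.rowVecR, ← sum_div, ← sum_dotProduct, ← h.momN,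
      div_eq_mul_inv]
    rfl
  rw [this]
  exact tendsto_finsetSum _ fun j _ =>
    h.tendsto_chyMat_cross h.tendsto_mom h.tendsto_pol (j, false) r

/-- The matrix on the side of the channel, with `ν` on the node. -/
def matL (χ : Option A ≃ ΛL) (a : A) (kL : ΛL → V m) (eL : V m → ΛL → V m) (uL : Config ΛL)
    (ν : V m) : Matrix (Option {i : A // i ≠ a} × Bool) (Option {i : A // i ≠ a} × Bool) ℂ :=
  (treeMat kL (eL ν) uL).submatrix (pairRow (χ (some a)) (χ none) fun i => χ (some i.1))
    (pairRow (χ (some a)) (χ none) fun i => χ (some i.1))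

/-- The matrix on the side of the complement, with `ν` on the node. -/
def matR (ω : Option B ≃ ΛR) (ρ : β × Bool → B × Bool) (kR : ΛR → V m) (eR : V m → ΛR → V m)
    (uR : Config ΛR) (ν : V m) : Matrix (Option β × Bool) (Option β × Bool) ℂ :=
  (treeMat kR (eR ν) uR).submatrix (nodeRow ω ρ) (nodeRow ω ρ)

/-- The row of the channel for a row on its side. -/
def rowA (a : A) : Option ({i : A // i ≠ a} × Bool) → A × Bool :=
  fun r => r.elim (a, true) fun r => (r.1.1, r.2)

lemma matL_node (ν : V m)
    (r : Option ({i : A // i ≠ a} × Bool)) : matL χ a kL eL uL ν (initRows r) (none, true) =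
      -(rowVec k₀ e₀ (rowMap (φ ∘ .inl) (rowA a r)) ⬝ᵥ ν) := by
  have h2 : pairRow (χ (some a)) (χ none) (fun i : {i : A // i ≠ a} => χ (some i.1)) (initRows r) =
      rowMap (χ ∘ some) (rowA a r) := by rcases r with _ | r <;> rfl
  have h3 : br (uL (χ (some (rowA a r).1))) (uL (χ none)) = -1 := by
    rw [h.left_node, br, h.left_snd]
    simp
  rw [matL, submatrix_apply, h2, chyMat_of_ne _ _ _ _ (by simp [pairRow]), h.rowVecL]
  change _ * (br (uL (χ (some (rowA a r).1))) (uL (χ none)))⁻¹ = _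
  rw [h3]
  simp [rowVec, pairRow, h.polNL]

lemma tendsto_pf (ρ : β × Bool → B × Bool) : Tendsto (fun n => ε n ^ card {i : A // i ≠ a} *
      pf ((treeMat (k n) (e n) (u n)).submatrix (chanRow φ a ρ) (chanRow φ a ρ))) l
      (𝓝 (-∑ γ : Fin m, pf (matL χ a kL eL uL (basisVec γ)) *
        pf (matR ω ρ kR eR uR (basisVec γ)))) := by
  let c : Option ({i : A // i ≠ a} ⊕ β) × Bool → ℂ
    | (none, false) => 1
    | (some (.inl _), false) => 1
    | _ => 0
  let N₀ : κ → Matrix (Option ({i : A // i ≠ a} ⊕ β) × Bool) _ ℂ := fun n =>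
    (treeMat (k n) (e n) (u n)).submatrix (chanRow φ a ρ) (chanRow φ a ρ)
  let N := fun n => addRows (N₀ n) (none, false) c
  have hskew : ∀ n, IsSkew (N₀ n) := fun n => (isSkew_chyMat _ _ _).submatrix _
  have hpf : ∀ n, pf (N₀ n) = pf (N n) := fun n => by
    rw [pf_addRows]
    exact (one_mul _).symm
  have hN : ∀ n, IsSkew (N n) := fun n => (hskew n).addRows _ _
  have hsum : ∀ n z, z ≠ (none, false) → N n (none, false) z =
      ∑ j, treeMat (k n) (e n) (u n) (φ (.inl j), false) (chanRow φ a ρ z) := by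
    intro n z hz
    refine (addRows_self_left (N₀ n) c hz).trans ?_
    rw [sum_prod_type, sum_option, sum_sum_type]
    simp only [sum_bool, c, N₀, submatrix_apply, chanRow, one_mul, zero_mul,
      zero_add, sum_const_zero, add_zero]
    rw [← add_sum_erase _ _ (mem_univ a)]
    congr 1
    exact (Finset.sum_subtype (p := fun i => i ≠ a) (univ.erase a) (by simp) fun j =>
      treeMat (k n) (e n) (u n) (φ (.inl j), false) (chanRow φ a ρ z)).symm
  have hoff : ∀ n y z, y ≠ (none, false) → z ≠ (none, false) → N n y z =
      treeMat (k n) (e n) (u n) (chanRow φ a ρ y) (chanRow φ a ρ z) :=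
    fun n y z hy hz => addRows_of_ne _ _ hy hz
  have hself : ∀ n, N n (none, false) (none, false) = 0 := fun n => by
    have := hN n (none, false) (none, false)
    linear_combination this / 2
  have hLne : ∀ r : Option ({i : A // i ≠ a} × Bool),
      rowsL (β := β) r ≠ (none, false) := fun r => by rcases r with _ | r <;> simp [rowsL]
  have hRne : ∀ r : β × Bool, rowsR (α := {i : A // i ≠ a}) (some r) ≠ (none, false) :=
    fun r => by simp [rowsR]
  have hLr : ∀ r, chanRow φ a ρ (rowsL r) = rowMap (φ ∘ .inl) (rowA a r) := fun r => by
    rcases r with _ | r <;> rfl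
  have hLm : ∀ r, pairRow (χ (some a)) (χ none) (fun i : {i : A // i ≠ a} => χ (some i.1))
      (initRows r) = rowMap (χ ∘ some) (rowA a r) := fun r => by rcases r with _ | r <;> rfl
  simp_rw [show ∀ n, pf ((treeMat (k n) (e n) (u n)).submatrix (chanRow φ a ρ)
    (chanRow φ a ρ)) = pf (N n) from hpf]
  have hLa : ∀ ν r r', matL χ a kL eL uL ν (initRows r) (initRows r') =
      treeMat kL (eL ν) uL (rowMap (χ ∘ some) (rowA a r))
        (rowMap (χ ∘ some) (rowA a r')) := fun ν r r' => by
    rw [matL, submatrix_apply, hLm, hLm]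
  refine tendsto_pf_glue_odd (M := fun r r' => matL χ a kL eL uL 0 (initRows r) (initRows r'))
    (D := fun r r' => matR ω ρ kR eR uR 0 (initRows r) (initRows r'))
    (L := fun γ : Fin m => matL χ a kL eL uL (basisVec γ))
    (R := fun γ : Fin m => matR ω ρ kR eR uR (basisVec γ)) hN
    (fun γ => (isSkew_chyMat _ _ _).submatrix _) (fun γ => (isSkew_chyMat _ _ _).submatrix _)
    ?_ ?_ ?_ ?_ ?_ h.tendsto_zero h.ne_zero
  · intro γ r r'
    rw [hLa, hLa]
    exact chyMat_congr (by simp [h.polL]) (by simp [h.polL])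
  · intro γ r r'
    simp only [matR, submatrix_apply]
    rcases r with _ | r <;> rcases r' with _ | r'
    · exact (chyMat_same _ _ _ _ _).trans (chyMat_same _ _ _ _ _).symm
    · simp only [initRows, nodeRow]
      rw [chyMat_of_ne _ _ _ _ (by simp), chyMat_of_ne _ _ _ _ (by simp), h.rowVecR, h.rowVecR]
      rfl
    · simp only [initRows, nodeRow]
      rw [chyMat_of_ne _ _ _ _ (by simp), chyMat_of_ne _ _ _ _ (by simp), h.rowVecR, h.rowVecR]
      rfl
    · exact chyMat_congr (by simp [initRows, nodeRow, h.polR]) (by simp [initRows, nodeRow, h.polR])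
  · intro r r'
    simp_rw [hoff _ _ _ (hLne r) (hLne r'), hLr]
    rw [hLa]
    exact h.tendsto_left 0 _ _
  · rintro (_ | r) (_ | r')
    · simp only [rowsR, hself, matR, submatrix_apply, chyMat_same]
      exact tendsto_const_nhds
    · simp_rw [show rowsR (α := {i : A // i ≠ a}) (β := β) none = (none, false) from rfl,
        hsum _ _ (hRne r')]
      exact h.tendsto_sum_cross 0 (ρ r')
    · simp_rw [show rowsR (α := {i : A // i ≠ a}) (β := β) none = (none, false) from rfl,
        fun n => hN n (none, false) (rowsR (some r)), hsum _ _ (hRne r)]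
      have := (h.tendsto_sum_cross 0 (ρ r)).neg
      rwa [← isSkew_chyMat] at this
    · simp_rw [hoff _ _ _ (hRne r) (hRne r')]
      exact h.tendsto_right 0 _ _
  · rintro r (_ | r')
    · simp_rw [show rowsR (α := {i : A // i ≠ a}) (β := β) none = (none, false) from rfl,
        fun n => hN n (none, false) (rowsL r), hsum _ _ (hLne r), hLr]
      have h1 := (h.tendsto_sum_chan (r := rowA a r)
        (by
          rcases r with _ | r
          · simp [rowA]
          · exact fun _ => r.1.2)).neg
      convert h1 using 2
      have h2 : ∀ γ : Fin m, matR ω ρ kR eR uR (basisVec γ) (initRows none) (none, true) =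
          nodeP φ ω k₀ uR (basisVec γ) := fun γ => by
        rw [← h.polP_node]
        exact (chyMat_false_true _ _ _ _ _).trans (by rw [h.polNR])
      simp_rw [h2, h.matL_node, dotProduct_basisVec, neg_mul, sum_neg_distrib, nodeP]
      simp_rw [mul_sum]
      rw [sum_comm]
      congr 1
      refine sum_congr rfl fun j _ => ?_
      simp_rw [dotProduct_comm (basisVec _), dotProduct_basisVec]
      rw [dotProduct, sum_mul, sum_div]
      exact sum_congr rfl fun γ _ => by ring
    · simp_rw [hoff _ _ _ (hLne r) (hRne r'), hLr]
      have h1 := h.tendsto_chyMat_cross h.tendsto_mom h.tendsto_pol (rowA a r) (ρ r')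
      have h2 : ∀ γ : Fin m, matR ω ρ kR eR uR (basisVec γ) (initRows (some r')) (none, true) =
          -((rowVec k₀ e₀ (rowMap (φ ∘ .inr) (ρ r')) ⬝ᵥ basisVec γ) /
            br (uR (ω none)) (uR (ω (some (ρ r').1)))) := fun γ => by
        simp only [matR, submatrix_apply, initRows, nodeRow]
        rw [chyMat_of_ne _ _ _ _ (by simp), h.rowVecR, brInv, br_swap (uR (ω none)), inv_neg]
        simp [rowVec, h.polNR, div_eq_mul_inv]
      have h3 : ∑ γ : Fin m, matL χ a kL eL uL (basisVec γ) (initRows r) (none, true) *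
          matR ω ρ kR eR uR (basisVec γ) (initRows (some r')) (none, true) =
          (rowVec k₀ e₀ (rowMap (φ ∘ .inl) (rowA a r)) ⬝ᵥ rowVec k₀ e₀ (rowMap (φ ∘ .inr) (ρ r'))) /
              br (uR (ω none)) (uR (ω (some (ρ r').1))) := by
        simp_rw [h2, h.matL_node, dotProduct_basisVec, neg_mul_neg]
        rw [dotProduct, sum_div]
        exact sum_congr rfl fun γ _ => by ring
      rw [h3]
      exact h1

lemma exists_linear_matL :
    ∃ f : V m →ₗ[ℂ] ℂ, ∀ ν, f ν = pf (matL χ a kL eL uL ν) := by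
  have hrow : ∀ r : Option {i : A // i ≠ a} × Bool, r ≠ (none, true) →
      ∃ i, (pairRow (χ (some a)) (χ none) (fun i : {i : A // i ≠ a} => χ (some i.1)) r).1 =
        χ (some i) := by
    rintro ⟨_ | i, _ | _⟩ hr
    · exact ⟨a, rfl⟩
    · exact absurd rfl hr
    · exact ⟨i.1, rfl⟩
    · exact ⟨i.1, rfl⟩
  have hnode : ∀ ν s, s ≠ (none, true) → matL χ a kL eL uL ν (none, true) s =
      (ν ⬝ᵥ rowVec kL (eL 0) (pairRow (χ (some a)) (χ none)
        (fun i : {i : A // i ≠ a} => χ (some i.1)) s)) * brInv uL (χ none) (pairRow (χ (some a))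
          (χ none) (fun i : {i : A // i ≠ a} => χ (some i.1)) s).1 := fun ν s hs => by
    obtain ⟨i, hi⟩ := hrow s hs
    rw [matL, submatrix_apply, chyMat_of_ne _ _ _ _ (by rw [hi]; simp [pairRow])]
    have h1 : rowVec kL (eL ν) (pairRow (χ (some a)) (χ none)
        (fun i : {i : A // i ≠ a} => χ (some i.1)) s) = rowVec kL (eL 0) (pairRow (χ (some a))
          (χ none) (fun i : {i : A // i ≠ a} => χ (some i.1)) s) := by
      simp only [rowVec, hi, h.polL]
    rw [h1]
    simp [rowVec, pairRow, h.polNL]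
  refine exists_pf_linear (none, true) (fun v w r s hr hs => ?_)
    (fun ν => (isSkew_chyMat _ _ _).submatrix _) (fun v w s hs => ?_) fun c v s hs => ?_
  · obtain ⟨i, hi⟩ := hrow r hr
    obtain ⟨j, hj⟩ := hrow s hs
    exact chyMat_congr (by rw [hi, h.polL, h.polL]) (by rw [hj, h.polL, h.polL])
  · rw [hnode _ s hs, hnode _ s hs, hnode _ s hs, add_dotProduct, add_mul]
  · rw [hnode _ s hs, hnode _ s hs, smul_dotProduct, smul_eq_mul, mul_assoc]

lemma exists_linear_matR (ρ : β × Bool → B × Bool) :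
    ∃ f : V m →ₗ[ℂ] ℂ, ∀ ν, f ν = pf (matR ω ρ kR eR uR ν) := by
  have hsome : ∀ ν j b, matR ω ρ kR eR uR ν (none, true) (some j, b) =
      (ν ⬝ᵥ rowVec k₀ e₀ (rowMap (φ ∘ .inr) (ρ (j, b)))) *
        brInv uR (ω none) (ω (some (ρ (j, b)).1)) := fun ν j b => by
    rw [matR, submatrix_apply, nodeRow, nodeRow, chyMat_of_ne _ _ _ _ (by simp), h.rowVecR]
    simp [rowVec, h.polNR]
  have hnone : ∀ ν, matR ω ρ kR eR uR ν (none, true) (none, false) = -polP kR uR (ω none) ν :=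
    fun ν => (chyMat_true_false _ _ _ _ _).trans (by rw [h.polNR])
  refine exists_pf_linear (none, true) ?_ (fun ν => (isSkew_chyMat _ _ _).submatrix _) ?_ ?_
  · rintro v w ⟨_ | i, b⟩ ⟨_ | j, c⟩ hr hs
    · have hb : b = false := by simpa using hr
      have hc : c = false := by simpa using hs
      subst hb hc
      exact (chyMat_same _ _ _ _ _).trans (chyMat_same _ _ _ _ _).symm
    · have hb : b = false := by simpa using hr
      subst hb
      simp only [matR, submatrix_apply, nodeRow]
      rw [chyMat_of_ne _ _ _ _ (by simp), chyMat_of_ne _ _ _ _ (by simp), h.rowVecR, h.rowVecR]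
      rfl
    · have hc : c = false := by simpa using hs
      subst hc
      simp only [matR, submatrix_apply, nodeRow]
      rw [chyMat_of_ne _ _ _ _ (by simp), chyMat_of_ne _ _ _ _ (by simp), h.rowVecR, h.rowVecR]
      rfl
    · exact chyMat_congr (by simp [nodeRow, h.polR]) (by simp [nodeRow, h.polR])
  · rintro v w ⟨_ | j, b⟩ hs
    · have hb : b = false := by simpa using hs
      subst hb
      rw [hnone, hnone, hnone, polP_add]
      ring
    · rw [hsome, hsome, hsome, add_dotProduct, add_mul]
  · rintro c v ⟨_ | j, b⟩ hs
    · have hb : b = false := by simpa using hs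
      subst hb
      rw [hnone, hnone, polP_smul]
      ring
    · rw [hsome, hsome, smul_dotProduct, smul_eq_mul, mul_assoc]

/-- A longitudinal state of the node drops out on the side of the channel. -/
lemma pf_matL_momentum (hL : OnShell kL uL) {p : V m} (hp : kL (χ none) = -p) (hpp : p ⬝ᵥ p = 0)
    (he : ∀ i, e₀ (φ (.inl i)) ⬝ᵥ k₀ (φ (.inl i)) = 0) : pf (matL χ a kL eL uL p) = 0 := by
  let ρ := pairRow (χ (some a)) (χ none) fun i : {i : A // i ≠ a} => χ (some i.1)
  let c : Option {i : A // i ≠ a} × Bool → ℂ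
    | (some i, false) => br (uL (χ (some i.1))) (uL (χ (some a)))
    | (none, true) => -br (uL (χ none)) (uL (χ (some a)))
    | _ => 0
  refine pf_eq_zero_of_mulVec_eq_zero ((isSkew_chyMat _ _ _).submatrix _) c (none, true)
    (neg_ne_zero.2 (h.distinctL _ _ (by simp))) ?_
  ext r
  have h1 : ∀ i, eL p i ⬝ᵥ kL i = 0 := fun i => by
    obtain ⟨_ | j, rfl⟩ := χ.surjective i
    · rw [h.polNL, hp, dotProduct_neg, hpp, neg_zero]
    · rw [h.polL, h.momL, he]
  have h2 := hL.sum_chyMat (eL p) (ρ r) (fun _ => h1 _) (uL (χ (some a)))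
  have h3 : treeMat kL (eL p) uL (ρ r) (χ none, false) =
      -chyMat kL (eL p) (brInv uL) uL (ρ r) (χ none, true) := by
    by_cases hr : (ρ r).1 = χ none
    · have hr' : ρ r = (χ none, true) := by
        obtain ⟨_ | i, _ | _⟩ := r
        · exact absurd hr (by simp [ρ, pairRow])
        · rfl
        · exact absurd hr (by simp [ρ, pairRow])
        · exact absurd hr (by simp [ρ, pairRow])
      have h4 := hL.polP_self (χ none) (by rw [hp, neg_dotProduct, dotProduct_neg, hpp]; simp)
        (j := χ (some a)) (by simp)
      rw [hr', chyMat_same, chyMat_true_false, h.polNL]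
      have h5 : p = (-1 : ℂ) • kL (χ none) := by rw [hp]; simp
      rw [h5, polP_smul, h4, mul_zero, neg_zero]
    · rw [chyMat_of_ne _ _ _ _ hr, chyMat_of_ne _ _ _ _ hr]
      simp only [rowVec, Bool.false_eq_true, if_false, if_true, hp, h.polNL, dotProduct_neg]
      ring
  rw [← χ.sum_comp, sum_option, h3, ← add_sum_erase _ _ (mem_univ a),
    br_self, mul_zero, zero_add, Finset.sum_subtype (p := fun i => i ≠ a) _ (by simp)] at h2
  rw [mulVec, dotProduct, sum_prod_type, sum_option]
  simp only [sum_bool, c, mul_zero, zero_add, add_zero]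
  rw [Pi.zero_apply, ← h2, neg_mul, mul_neg]
  rfl

/-- A longitudinal state of the node drops out on the side of the complement. -/
lemma pf_matR_momentum (ρ : β × Bool → B × Bool) (hR : polP kR uR (ω none) (kR (ω none)) = 0) :
    pf (matR ω ρ kR eR uR (kR (ω none))) = 0 := by
  let c : Option β × Bool → ℂ
    | (none, false) => 1
    | (none, true) => -1
    | _ => 0
  refine pf_eq_zero_of_mulVec_eq_zero ((isSkew_chyMat _ _ _).submatrix _) c (none, true)
    (by simp [c]) ?_
  ext r
  rw [mulVec, dotProduct, sum_prod_type, sum_option]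
  simp only [sum_bool, c, mul_zero, mul_one, add_zero, sum_const_zero,
    matR, submatrix_apply, Pi.zero_apply, mul_neg]
  obtain ⟨_ | j, b⟩ := r
  · cases b
    · simp only [nodeRow]
      rw [chyMat_same, chyMat_false_true, h.polNR, hR]
      simp
    · simp only [nodeRow]
      rw [chyMat_same, chyMat_true_false, h.polNR, hR]
      simp
  · simp only [nodeRow]
    rw [chyMat_of_ne _ _ _ _ (by simp), chyMat_of_ne _ _ _ _ (by simp)]
    simp [rowVec, h.polNR]

/-- The Pfaffian factorises into a sum over the physical states of the node. -/
lemma tendsto_pf_states (ρ : β × Bool → B × Bool) (hL : OnShell kL uL) (hR : polP kR uR (ω none) (kR (ω none)) = 0)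
    (hN : kL (χ none) = -kR (ω none)) (he : ∀ i, e₀ (φ (.inl i)) ⬝ᵥ k₀ (φ (.inl i)) = 0)
    {E : Fin (m - 2) → V m} (hE : PolBasis (kR (ω none)) E) :
    Tendsto (fun n => ε n ^ card {i : A // i ≠ a} *
      pf ((treeMat (k n) (e n) (u n)).submatrix (chanRow φ a ρ) (chanRow φ a ρ))) l
      (𝓝 (-∑ s, pf (matL χ a kL eL uL (E s)) * pf (matR ω ρ kR eR uR (E s)))) := by
  obtain ⟨q, -, -, -, hv⟩ := hE.exists_dual
  obtain ⟨fL, hfL⟩ := h.exists_linear_matL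
  obtain ⟨fR, hfR⟩ := h.exists_linear_matR ρ
  have h1 := h.tendsto_pf ρ
  have h2 := PolBasis.bilin_sum hv (prodForm fL fR)
  simp only [prodForm, LinearMap.mk₂_apply, hfL, hfR] at h2
  rwa [h2, h.pf_matL_momentum hL hN hE.2.1 he, h.pf_matR_momentum ρ hR, zero_mul, mul_zero,
    add_zero, add_zero] at h1

end NodeLimit

end Channel

/-! ### Half-integrands in a channel without loop punctures -/

section Node

variable {X : Type*} [Fintype X] [DecidableEq X] {m : ℕ}

/-- The labels inside and outside of the channel. -/
def chanEquiv (I : Finset X) : I ⊕ (Bool ⊕ Out I) ≃ Bool ⊕ X where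
  toFun := Sum.elim (fun i => inr i.1) toX
  invFun := Sum.elim (fun c => inr (inl c)) fun x =>
    if h : x ∈ I then inl ⟨x, h⟩ else inr (inr ⟨x, h⟩)
  left_inv := by
    rintro (⟨x, h⟩ | (c | ⟨x, h⟩))
    · simp [h]
    · simp [toX]
    · simp [toX, h]
  right_inv := by
    rintro (c | x)
    · simp [toX]
    · by_cases h : x ∈ I <;> simp [toX, h]

/-- The labels of the loop side, with the node first. -/
def nodeEquiv (Y : Type*) : Option (Bool ⊕ Y) ≃ Bool ⊕ Option Y where
  toFun o := o.elim (inr none) toR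
  invFun := Sum.elim (fun c => some (inl c)) fun o => o.elim none fun y => some (inr y)
  left_inv := by rintro (_ | _ | y) <;> simp [toR]
  right_inv := by rintro (c | _ | y) <;> simp [toR]

/-- The rows of the particles, with `a` first. -/
def chanFirst {I : Finset X} (a : I) : Option ({i : I // i ≠ a} ⊕ Out I) ≃ X where
  toFun
    | none => a.1
    | some (inl i) => i.1.1
    | some (inr j) => j.1
  invFun x := if h : x ∈ I then if h' : (⟨x, h⟩ : I) = a then none else
    some (inl ⟨⟨x, h⟩, h'⟩) else some (inr ⟨x, h⟩)
  left_inv := by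
    rintro (_ | ⟨⟨i, hi⟩, hia⟩ | ⟨j, hj⟩)
    · simp [a.2]
    · simp [hi, hia]
    · simp [hj]
  right_inv x := by
    by_cases h : x ∈ I
    · by_cases h' : (⟨x, h⟩ : I) = a
      · subst h'
        simp [h]
      · simp [h, h']
    · simp [h]

/-- Exchange of the two extra elements. -/
def optionSwap (Y : Type*) : Option (Option Y) ≃ Option (Option Y) where
  toFun
    | none => some none
    | some none => none
    | some (some y) => some (some y)
  invFun
    | none => some none
    | some none => none
    | some (some y) => some (some y)
  left_inv := by rintro (_ | _ | y) <;> rfl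
  right_inv := by rintro (_ | _ | y) <;> rfl

/-- The rows of the particles and the marked pair, with `a` first. -/
def chanFirstPair {I : Finset X} (a : I) :
    Option ({i : I // i ≠ a} ⊕ Option (Out I)) ≃ Option X where
  toFun
    | none => some a.1
    | some (inl i) => some i.1.1
    | some (inr none) => none
    | some (inr (some j)) => some j.1
  invFun o := o.elim (some (inr none)) fun x =>
    if h : x ∈ I then if h' : (⟨x, h⟩ : I) = a then none else
      some (inl ⟨⟨x, h⟩, h'⟩) else some (inr (some ⟨x, h⟩))
  left_inv := by
    rintro (_ | ⟨⟨i, hi⟩, hia⟩ | (_ | ⟨j, hj⟩))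
    · simp [a.2]
    · simp [hi, hia]
    · simp
    · simp [hj]
  right_inv := by
    rintro (_ | x)
    · simp
    · by_cases h : x ∈ I
      · by_cases h' : (⟨x, h⟩ : I) = a
        · subst h'
          simp [h]
        · simp [h, h']
      · simp [h]

/-- A channel of particles degenerating with its kinematics. -/
structure ChanLimit (I : Finset X) (a : I) {κ : Type*} (l : Filter κ) (ε : κ → ℂ)
    (x : κ → I → ℂ) (u : κ → Config (Bool ⊕ X)) (uL : Config (Option I))
    (uR : Config (Bool ⊕ Option (Out I))) (kk : κ → Bool ⊕ X → V m) (pol : κ → X → V m)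
    (kk₀ : Bool ⊕ X → V m) (pol₀ : X → V m) (kL : Option I → V m)
    (kR : Bool ⊕ Option (Out I) → V m) : Prop
    extends Degeneration (chanEquiv I) (Equiv.refl _) (nodeEquiv _) l ε x u uL uR where
  tendsto_mom : ∀ i, Tendsto (fun n => kk n i) l (𝓝 (kk₀ i))
  tendsto_pol : ∀ i, Tendsto (fun n => pol n i) l (𝓝 (pol₀ i))
  momL : ∀ i, kL (some i) = kk₀ (.inr i.1)
  momR : ∀ j, kR (toR j) = kk₀ (toX j)
  momN : kR (.inr none) = ∑ i : I, kk₀ (.inr i.1)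
  node : kL none = -kR (.inr none)
  transverse : ∀ i, pol₀ i ⬝ᵥ kk₀ (.inr i) = 0
  onShellL : OnShell kL uL
  nodeR : polP kR uR (.inr none) (kR (.inr none)) = 0
  scat : ∀ᶠ n in l, ∀ i, i ≠ a → resAt (fun j => kk n (.inr i.1) ⬝ᵥ kk n j) (u n) (.inr i.1) = 0

namespace ChanLimit

variable {I : Finset X} {a : I} {κ : Type*} {l : Filter κ} {ε : κ → ℂ}
  {x : κ → I → ℂ} {u : κ → Config (Bool ⊕ X)} {uL : Config (Option I)}
  {uR : Config (Bool ⊕ Option (Out I))} {kk : κ → Bool ⊕ X → V m} {pol : κ → X → V m}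
  {kk₀ : Bool ⊕ X → V m} {pol₀ : X → V m} {kL : Option I → V m}
  {kR : Bool ⊕ Option (Out I) → V m}

/-- Polarisations with `ν` on the node. -/
def withNode {Y : Type*} (pol : Y → V m) (ν : V m) : Option Y → V m := fun o => o.elim ν pol

variable (h : ChanLimit I a l ε x u uL uR kk pol kk₀ pol₀ kL kR)

include h

lemma toNodeLimit (E E' : V m) :
    NodeLimit (chanEquiv I) (Equiv.refl _) (nodeEquiv _) a l ε x u uL uR kk
      (fun n => marked E E' (pol n)) kk₀ (marked E E' pol₀) kL kR
      (withNode fun i : I => pol₀ i.1)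
      (fun ν => marked E E' (withNode (fun i : Out I => pol₀ i.1) ν)) :=
  { h.toDegeneration with
    tendsto_mom := h.tendsto_mom
    tendsto_pol := by
      rintro (c | i)
      · exact tendsto_const_nhds
      · exact h.tendsto_pol i
    momL := h.momL
    momR := h.momR
    momN := h.momN
    polL := fun ν i => rfl
    polR := by rintro ν (c | j) <;> rfl
    polNL := fun ν => rfl
    polNR := fun ν => rfl
    scat := h.scat }

lemma tendsto_brPM : Tendsto (fun n => brPM (u n)) l (𝓝 (brPM uR)) :=
  h.tendsto_br_comp (inl true) (inl false)

lemma brPM_ne_zero : brPM uR ≠ 0 := h.distinctR _ _ (by simp)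

lemma redPf_left (ν : V m) : redPf kL (withNode (fun i => pol₀ i.1) ν) (some a) none uL =
      -pf (NodeLimit.matL (Equiv.refl _) a kL (withNode fun i => pol₀ i.1) uL ν) := by
  have hb : br (uL (some a)) (uL none) = -1 := by
    have h1 : uL none = (1, 0) := h.left_node
    have h2 : (uL (some a)).2 = 1 := h.left_snd a
    rw [h1, br, h2]
    simp
  rw [redPf_eq_pf kL _ uL (fun i : {i : I // i ≠ a} => some i.1)
    (fun i j hij => Subtype.ext (some_injective _ hij)), hb, div_neg, div_one]
  · rfl
  · rintro (_ | i)
    · simp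
    · simp

lemma tendsto_states {β : Type*} [Fintype β] [DecidableEq β] (E E' : V m)
    (ρ : β × Bool → (Bool ⊕ Out I) × Bool) {e : Fin (m - 2) → V m}
    (he : PolBasis (kR (.inr none)) e) :
    Tendsto (fun n => ε n ^ card {i : I // i ≠ a} *
      pf ((treeMat (kk n) (marked E E' (pol n)) (u n)).submatrix
        (chanRow (chanEquiv I) a ρ) (chanRow (chanEquiv I) a ρ))) l
      (𝓝 (∑ s, redPf kL (withNode (fun i => pol₀ i.1) (e s)) (some a) none uL *
        pf (NodeLimit.matR (nodeEquiv _) ρ kR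
          (fun ν => marked E E' (withNode (fun i : Out I => pol₀ i.1) ν)) uR (e s)))) := by
  have := (h.toNodeLimit E E').tendsto_pf_states ρ h.onShellL h.nodeR h.node
    (fun i => h.transverse i.1) he
  simp_rw [h.redPf_left, neg_mul, sum_neg_distrib]
  exact this

lemma tendsto_scalHalf {e : Fin (m - 2) → V m} (he : PolBasis (kR (.inr none)) e) :
    Tendsto (fun n => ε n ^ card {i : I // i ≠ a} * scalHalf (kk n) (pol n) (u n)) l
      (𝓝 (∑ s, redPf kL (withNode (fun i => pol₀ i.1) (e s)) (some a) none uL *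
        scalHalf kR (withNode (fun i : Out I => pol₀ i.1) (e s)) uR)) := by
  have h1 := (h.tendsto_states 0 0 (fun r : Out I × Bool => (.inr r.1, r.2)) he).div
    (h.tendsto_brPM.pow 2) (pow_ne_zero 2 h.brPM_ne_zero)
  have h2 : ∀ n, pf (M30 (kk n) (pol n) (u n)) =
      pf ((treeMat (kk n) (marked 0 0 (pol n)) (u n)).submatrix
        (chanRow (chanEquiv I) a fun r : Out I × Bool => (inr r.1, r.2))
        (chanRow (chanEquiv I) a fun r : Out I × Bool => (inr r.1, r.2))) := fun n => by
    rw [← pf_submatrix_equiv (chanFirst a)]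
    congr 1
    have hr : ∀ r, rowMap inr (rowMap (chanFirst a) r) =
        chanRow (chanEquiv I) a (fun r : Out I × Bool => (inr r.1, r.2)) r := by
      rintro ⟨_ | _ | _, b⟩ <;> rfl
    ext r s
    rw [submatrix_apply, M30, submatrix_apply, hr, hr, submatrix_apply]
  have h3 : ∀ ν, pf (M30 kR (withNode (fun i : Out I => pol₀ i.1) ν) uR) =
      pf (NodeLimit.matR (nodeEquiv _) (fun r : Out I × Bool => (inr r.1, r.2)) kR
        (fun ν => marked 0 0 (withNode (fun i : Out I => pol₀ i.1) ν)) uR ν) := fun ν => by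
    congr 1
    ext ⟨_ | i, b⟩ ⟨_ | j, c⟩ <;> rfl
  simp_rw [scalHalf_eq, h2, h3, mul_div_assoc', ← sum_div]
  exact h1

lemma tendsto_redPf (E E' : V m) {e : Fin (m - 2) → V m} (he : PolBasis (kR (.inr none)) e) :
    Tendsto (fun n => ε n ^ card {i : I // i ≠ a} *
      redPf (kk n) (marked E E' (pol n)) (.inl true) (.inl false) (u n)) l
      (𝓝 (∑ s, redPf kL (withNode (fun i => pol₀ i.1) (e s)) (some a) none uL *
        redPf kR (marked E E' (withNode (fun i : Out I => pol₀ i.1) (e s)))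
          (.inl true) (.inl false) uR)) := by
  have h1 := (h.tendsto_states E E' (pairRow (.inl true) (.inl false) inr) he).div
    h.tendsto_brPM h.brPM_ne_zero
  have h2 : ∀ n, redPf (kk n) (marked E E' (pol n)) (.inl true) (.inl false) (u n) =
      pf ((treeMat (kk n) (marked E E' (pol n)) (u n)).submatrix
        (chanRow (chanEquiv I) a (pairRow (.inl true) (.inl false) inr))
        (chanRow (chanEquiv I) a (pairRow (.inl true) (.inl false) inr))) /
          brPM (u n) := fun n => by
    rw [CutLimit.redPf_cut, ← pf_submatrix_equiv (chanFirstPair a)]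
    congr 2
    have hr : ∀ r, pairRow (.inl true) (.inl false) inr (rowMap (chanFirstPair a) r) =
        chanRow (chanEquiv I) a (pairRow (.inl true) (.inl false) inr) r := by
      rintro ⟨_ | _ | _ | _, _ | _⟩ <;> rfl
    ext r s
    rw [submatrix_apply, submatrix_apply, hr, hr, submatrix_apply]
  have h3 : ∀ ν, redPf kR (marked E E' (withNode (fun i : Out I => pol₀ i.1) ν))
      (.inl true) (.inl false) uR =
      pf (NodeLimit.matR (nodeEquiv _) (pairRow (.inl true) (.inl false) inr) kR
        (fun ν => marked E E' (withNode (fun i : Out I => pol₀ i.1) ν)) uR ν) /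
          brPM uR := fun ν => by
    rw [CutLimit.redPf_cut, ← pf_submatrix_equiv (optionSwap _)]
    congr 2
    have hr : ∀ r, pairRow (.inl true) (.inl false) inr (rowMap (optionSwap (Out I)) r) =
        nodeRow (nodeEquiv _) (pairRow (.inl true) (.inl false) inr) r := by
      rintro ⟨_ | _ | _, _ | _⟩ <;> rfl
    ext r s
    rw [submatrix_apply, submatrix_apply, hr, hr]
    rfl
  simp_rw [h2, h3, mul_div_assoc', ← sum_div]
  exact h1

lemma tendsto_nsHalf (d : ℕ) {e : Fin (m - 2) → V m} (he : PolBasis (kR (.inr none)) e) :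
    Tendsto (fun n => ε n ^ card {i : I // i ≠ a} * nsHalf d (kk n) (pol n) (u n)) l
      (𝓝 (∑ s, redPf kL (withNode (fun i => pol₀ i.1) (e s)) (some a) none uL *
        nsHalf d kR (withNode (fun i : Out I => pol₀ i.1) (e s)) uR)) := by
  have h1 := (tendsto_finsetSum univ fun (α : Fin m) _ =>
    h.tendsto_redPf (basisVec α) (basisVec α) he).add
      ((h.tendsto_scalHalf he).const_mul ((d : ℂ) - 2 - m))
  rw [sum_comm, mul_sum, ← sum_add_distrib] at h1
  have h2 : ∀ ν, nsHalf d kR (withNode (fun i : Out I => pol₀ i.1) ν) uR = _ := fun ν =>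
    nsHalf_eq _ _ uR d h.distinctR
  simp_rw [h2, mul_add, mul_sum]
  convert h1.congr' ?_ using 2
  · exact sum_congr rfl fun s _ => by ring
  · filter_upwards [h.distinct] with n hn
    rw [nsHalf_eq _ _ _ d hn, mul_add, mul_sum]
    ring

end ChanLimit

end Node

/-! ### Parke-Taylor factors -/

section Chain

variable {Λ : Type*}

/-- The product of the `σ_{ij}` of consecutive letters. -/
def chainProd (u : Config Λ) (w : List Λ) : ℂ :=
  (List.zipWith (fun i j => br (u i) (u j)) w w.tail).prod

lemma chainProd_cons_cons (u : Config Λ) (i j : Λ) (w : List Λ) :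
    chainProd u (i :: j :: w) = br (u i) (u j) * chainProd u (j :: w) := by
  simp [chainProd]

lemma chainProd_singleton (u : Config Λ) (i : Λ) : chainProd u [i] = 1 := by simp [chainProd]

lemma chainProd_append (u : Config Λ) (w w' : List Λ) (i : Λ) :
    chainProd u (w ++ i :: w') = chainProd u (w ++ [i]) * chainProd u (i :: w') := by
  induction w with
  | nil => simp [chainProd_singleton]
  | cons j w ih =>
    rcases w with _ | ⟨k, w⟩
    · simp [chainProd_cons_cons, chainProd_singleton]
    · simp only [cons_append, chainProd_cons_cons] at ih ⊢
      rw [ih]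
      ring

lemma zipWith_prod (u : Config Λ) (i j : Λ) (w : List Λ) :
    (List.zipWith (fun i j => br (u i) (u j)) (i :: w) (w ++ [j])).prod =
      chainProd u (i :: (w ++ [j])) := by
  have h := List.zipWith_append (f := fun i j => br (u i) (u j)) (l₁ := i :: w) (l₂ := w ++ [j])
    (l₁' := [j]) (l₂' := []) (by simp)
  rw [chainProd, List.tail_cons, ← cons_append]
  simpa using congrArg List.prod h.symm

lemma ptHalf_cons (u : Config Λ) (i : Λ) (w : List Λ) :
    ptHalf (i :: w) u = -(chainProd u (i :: (w ++ [i])))⁻¹ := by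
  rw [ptHalf, List.rotate_cons_succ, List.rotate_zero, zipWith_prod]

lemma ptHalf_append_singleton (u : Config Λ) (i : Λ) (w : List Λ) :
    ptHalf (w ++ [i]) u = ptHalf (i :: w) u := by
  rcases w with _ | ⟨j, w⟩
  · rfl
  · have h := chainProd_append u (j :: w) [j] i
    simp only [cons_append, chainProd_cons_cons, chainProd_singleton, mul_one] at h
    simp only [cons_append, nil_append, ptHalf_cons, append_assoc, h, chainProd_cons_cons, mul_comm]

lemma cptHalf_eq {Y : Type*} (w : List Y) (u : Config (Bool ⊕ Y)) (h : brPM u ≠ 0) :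
    cptHalf w u = ∑ r ∈ Finset.range w.length, ptHalf (cutWord (w.rotate r)) u := by
  rw [cptHalf, sum_div]
  refine sum_congr rfl fun r _ => ?_
  have h' := chainProd_append u (.inl true :: (w.rotate r).map .inr) [.inl true] (.inl false)
  simp only [cons_append, chainProd_cons_cons, chainProd_singleton, mul_one] at h'
  rw [zipWith_prod, cutWord, ptHalf_cons, append_assoc, List.singleton_append, h', br_swap,
    mul_neg, inv_neg, neg_neg, mul_inv]
  change _ = _ * (brPM u)⁻¹
  field_simp

/-- The number of consecutive pairs of letters with the property `p`. -/
def pairCount (p : Λ → Bool) : List Λ → ℕ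
  | i :: j :: w => (if p i && p j then 1 else 0) + pairCount p (j :: w)
  | _ => 0

/-- The letters with the property `p` form at least one block. -/
lemma pairCount_lt (p : Λ → Bool) : ∀ w : List Λ, (∃ i ∈ w, p i = true) →
    pairCount p w + 1 ≤ w.countP p ∧ (pairCount p w + 1 = w.countP p → ∃ q₁ w' q₂,
      w = q₁ ++ w' ++ q₂ ∧ (∀ i ∈ q₁, p i = false) ∧ (∀ i ∈ w', p i = true) ∧ ∀ i ∈ q₂, p i = false)
  | [], h => by simp at h
  | [i], h => by
    have hi : p i = true := by simpa using h
    exact ⟨by simp [pairCount, hi], fun _ => ⟨[], [i], [], by simp [hi]⟩⟩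
  | i :: j :: w, h => by
    have ih := pairCount_lt p (j :: w)
    by_cases hi : p i = true
    · by_cases hw : ∃ i ∈ j :: w, p i = true
      · obtain ⟨h1, h2⟩ := ih hw
        rw [List.countP_cons_of_pos hi, pairCount]
        by_cases hj : p j = true
        · simp only [hi, hj, Bool.and_self, if_true]
          refine ⟨by omega, fun h3 => ?_⟩
          obtain ⟨q₁, w', q₂, h4, h5, h6, h7⟩ := h2 (by omega)
          have hq : q₁ = [] := by
            rcases q₁ with _ | ⟨k, q₁⟩
            · rfl
            · simp only [cons_append, List.cons.injEq] at h4
              have := h5 k (by simp)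
              rw [← h4.1, hj] at this
              simp at this
          subst hq
          refine ⟨[], i :: w', q₂, by simpa using h4, by simp, ?_, h7⟩
          simpa [hi] using h6
        · simp only [hj, Bool.and_false, Bool.false_eq_true, if_false]
          exact ⟨by omega, fun h3 => by omega⟩
      · have hc : (j :: w).countP p = 0 := by
          rw [countP_eq_zero]
          exact fun k hk h' => hw ⟨k, hk, h'⟩
        have h0 : ∀ w' : List Λ, w'.countP p = 0 → pairCount p w' = 0 := by
          intro w' hw'
          by_contra h0
          induction w' with
          | nil => exact h0 rfl
          | cons a w' ih' =>
            rw [countP_eq_zero] at hw'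
            rcases w' with _ | ⟨b, w'⟩
            · exact h0 rfl
            · refine ih' ?_ ?_
              · rw [countP_eq_zero]
                exact fun k hk => hw' k (by simp [hk])
              · rw [pairCount] at h0
                have := hw' a (by simp)
                simpa [this] using h0
        have hj : p j = false := by
          rw [countP_eq_zero] at hc
          simpa using hc j (by simp)
        rw [List.countP_cons_of_pos hi, pairCount, hc, h0 _ hc]
        refine ⟨by simp [hj], fun _ => ⟨[], [i], j :: w, by simp, by simp, by simp [hi], ?_⟩⟩
        rw [countP_eq_zero] at hc
        simpa using hc
    · have hw : ∃ k ∈ j :: w, p k = true := by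
        obtain ⟨k, hk, h'⟩ := h
        rcases List.mem_cons.1 hk with rfl | hk
        · exact absurd h' hi
        · exact ⟨k, hk, h'⟩
      obtain ⟨h1, h2⟩ := ih hw
      rw [List.countP_cons_of_neg hi, pairCount]
      simp only [hi, Bool.false_and, Bool.false_eq_true, if_false, zero_add]
      refine ⟨h1, fun h3 => ?_⟩
      obtain ⟨q₁, w', q₂, h4, h5, h6⟩ := h2 h3
      exact ⟨i :: q₁, w', q₂, by simp [h4], by simpa [hi] using h5, h6⟩

end Chain

section Lists

variable {Λ X : Type*}

lemma pairCount_cons (p : Λ → Bool) {i : Λ} (hi : p i = false) (w : List Λ) :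
    pairCount p (i :: w) = pairCount p w := by
  cases w <;> simp [pairCount, hi]

lemma pairCount_append_singleton (p : Λ → Bool) {j : Λ} (hj : p j = false) (w : List Λ) :
    pairCount p (w ++ [j]) = pairCount p w := by
  induction w with
  | nil => simp [pairCount]
  | cons i w ih =>
    cases w with
    | nil => simp [pairCount, hj]
    | cons k w => simpa [pairCount] using ih

lemma pairCount_map {Λ' : Type*} (p : Λ → Bool) (f : Λ' → Λ) (w : List Λ') :
    pairCount p (w.map f) = pairCount (p ∘ f) w := by
  induction w with
  | nil => rfl
  | cons i w ih =>
    cases w with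
    | nil => rfl
    | cons k w => simpa [pairCount] using ih

lemma map_restr (p : X → Prop) [DecidablePred p] (w : List X) :
    (restr p w).map Subtype.val = w.filter p := by
  induction w with
  | nil => rfl
  | cons i w ih =>
    by_cases h : p i <;> simp_all [restr]

lemma IsOrdering.rotate {w : List X} (hw : IsOrdering w) (r : ℕ) : IsOrdering (w.rotate r) :=
  ⟨List.nodup_rotate.2 hw.1, by simpa using hw.2⟩

lemma IsOrdering.restr {p : X → Prop} [DecidablePred p] {w : List X} (hw : IsOrdering w) :
    IsOrdering (restr p w) := by
  constructor
  · refine List.Nodup.of_map Subtype.val ?_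
    rw [map_restr]
    exact hw.1.filter _
  · intro x
    exact List.mem_filterMap.2 ⟨x.1, hw.2 _, by simp [x.2]⟩

variable [DecidableEq X] {I : Finset X} {w : List X}

lemma mem_cuts {r : ℕ} :
    r ∈ cuts I w ↔ r < w.length ∧ ∀ x ∈ (w.rotate r).take I.card, x ∈ I := by simp [cuts]

lemma IsOrdering.countP_mem (hw : IsOrdering w) (I : Finset X) :
    w.countP (fun x => decide (x ∈ I)) = I.card := by
  rw [List.countP_eq_length_filter, ← List.toFinset_card_of_nodup (hw.1.filter _)]
  congr 1
  ext x
  simp [hw.2]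

lemma IsOrdering.card_le (hw : IsOrdering w) (I : Finset X) : I.card ≤ w.length :=
  hw.countP_mem I ▸ List.countP_le_length

lemma IsOrdering.length_inBlock (hw : IsOrdering w) (I : Finset X) (r : ℕ) :
    (inBlock I w r).length = I.card := by
  rw [← (hw.rotate r).countP_mem I, List.countP_eq_length_filter, ← map_restr, List.length_map]
  rfl

lemma IsOrdering.rotate_eq (hw : IsOrdering w) {r : ℕ} (hr : r ∈ cuts I w) :
    w.rotate r = (inBlock I w r).map Subtype.val ++ (outBlock I w r).map Subtype.val := by
  have h := (mem_cuts.1 hr).2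
  have hv := hw.rotate r
  rw [inBlock, outBlock, map_restr, map_restr]
  generalize w.rotate r = v at h hv
  have h1 : (v.take I.card).countP (fun x => decide (x ∈ I)) = I.card := by
    rw [List.countP_eq_length.2 (by simpa using h), List.length_take, min_eq_left (hv.card_le I)]
  have h2 := hv.countP_mem I
  rw [← List.take_append_drop I.card v, List.countP_append, h1, Nat.add_eq_left,
    countP_eq_zero] at h2
  have h3 : v.filter (fun x => decide (x ∈ I)) = v.take I.card := by
    conv_lhs => rw [← List.take_append_drop I.card v]
    rw [List.filter_append, List.filter_eq_self.2 (by simpa using h), List.filter_eq_nil_iff.2 h2,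
      List.append_nil]
  have h4 : v.filter (fun x => decide (x ∉ I)) = v.drop I.card := by
    conv_lhs => rw [← List.take_append_drop I.card v]
    rw [List.filter_append, List.filter_eq_nil_iff.2 (by simpa using h),
      List.filter_eq_self.2 (by simpa using h2), nil_append]
  rw [h3, h4, List.take_append_drop]

end Lists

section ChainLimit

variable {κ A B Λ ΛL ΛR : Type*} [Fintype A] [DecidableEq A] [Fintype B] [DecidableEq B]
  [Fintype Λ] [DecidableEq Λ] [Fintype ΛL] [DecidableEq ΛL] [Fintype ΛR] [DecidableEq ΛR]
  {φ : A ⊕ B ≃ Λ} {χ : Option A ≃ ΛL} {ω : Option B ≃ ΛR} {l : Filter κ} {ε : κ → ℂ}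
  {x : κ → A → ℂ} {u : κ → Config Λ} {uL : Config ΛL} {uR : Config ΛR}

namespace Degeneration

lemma exists_tendsto_chainProd (h : Degeneration φ χ ω l ε x u uL uR) :
    ∀ w : List Λ, w.IsChain (· ≠ ·) → ∃ c, Tendsto (fun n =>
      ε n ^ pairCount (fun i => (φ.symm i).isLeft) w * (chainProd (u n) w)⁻¹) l (𝓝 c)
  | [], _ => ⟨1, by simpa [pairCount, chainProd] using tendsto_const_nhds⟩
  | [i], _ => ⟨1, by simpa [pairCount, chainProd] using tendsto_const_nhds⟩
  | i :: j :: w, hw => by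
    obtain ⟨c, hc⟩ := h.exists_tendsto_chainProd (j :: w) (isChain_cons_cons.1 hw).2
    have hij : i ≠ j := (isChain_cons_cons.1 hw).1
    suffices ∃ c', Tendsto (fun n => ε n ^ (if (φ.symm i).isLeft && (φ.symm j).isLeft then 1 else 0)
        * (br (u n i) (u n j))⁻¹) l (𝓝 c') by
      obtain ⟨c', hc'⟩ := this
      refine ⟨c' * c, (hc'.mul hc).congr fun n => ?_⟩
      rw [chainProd_cons_cons, pairCount, pow_add, mul_inv]
      ring
    obtain ⟨i, rfl⟩ := φ.surjective i
    obtain ⟨j, rfl⟩ := φ.surjective j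
    simp only [Equiv.symm_apply_apply]
    rcases i with i | i <;> rcases j with j | j
    · refine ⟨_, (h.tendsto_mul_div_br (c := fun _ => 1) (c₀ := 1) tendsto_const_nhds i j).congr
        fun n => ?_⟩
      simp
    · simpa using ⟨_, (h.tendsto_br_cross i j).inv₀ (h.br_node j)⟩
    · refine ⟨_, (((h.tendsto_br_cross j i).neg.inv₀ (neg_ne_zero.2 (h.br_node i)))).congr
        fun n => ?_⟩
      simp [← br_swap]
    · have := h.distinctR (ω (some i)) (ω (some j)) (by simpa using hij)
      simpa using ⟨_, (h.tendsto_br_comp i j).inv₀ this⟩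

lemma tendsto_chainProd_comp (h : Degeneration φ χ ω l ε x u uL uR) (w : List B)
    (hw : w.IsChain (· ≠ ·)) : Tendsto (fun n => (chainProd (u n) (w.map (φ ∘ .inr)))⁻¹) l
      (𝓝 (chainProd uR (w.map (ω ∘ some)))⁻¹) := by
  induction w with
  | nil => simpa [chainProd] using tendsto_const_nhds
  | cons i w ih =>
    rcases w with _ | ⟨j, w⟩
    · simpa [chainProd] using tendsto_const_nhds
    · obtain ⟨hij, hw⟩ := isChain_cons_cons.1 hw
      simp only [List.map_cons, chainProd_cons_cons, mul_inv] at ih ⊢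
      exact ((h.tendsto_br_comp i j).inv₀ (h.distinctR _ _ (by simpa using hij))).mul (ih hw)

/-- A block of letters inside of the channel. -/
lemma tendsto_chainProd_block (h : Degeneration φ χ ω l ε x u uL uR) (i : A) (w : List A) (j : B)
    (q : List B) (hw : (i :: w).IsChain (· ≠ ·)) (hq : (j :: q).IsChain (· ≠ ·)) :
    Tendsto (fun n => ε n ^ w.length *
      (chainProd (u n) ((i :: w).map (φ ∘ .inl) ++ (j :: q).map (φ ∘ .inr)))⁻¹) l
      (𝓝 ((chainProd uL ((i :: w).map (χ ∘ some)))⁻¹ *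
        (chainProd uR (ω none :: (j :: q).map (ω ∘ some)))⁻¹)) := by
  induction w generalizing i with
  | nil =>
    have := ((h.tendsto_br_cross i j).inv₀ (h.br_node j)).mul (h.tendsto_chainProd_comp _ hq)
    simp only [List.map_cons, List.map_nil, cons_append, nil_append, chainProd_cons_cons,
      chainProd_singleton, mul_inv, inv_one, one_mul, List.length_nil, pow_zero] at this ⊢
    exact this
  | cons i' w ih =>
    obtain ⟨hij, hw⟩ := isChain_cons_cons.1 hw
    have := (h.tendsto_mul_div_br (c := fun _ => 1) (c₀ := 1) tendsto_const_nhds i i').mul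
      (ih i' hw)
    simp only [List.map_cons, cons_append, chainProd_cons_cons, mul_inv, List.length_cons] at this ⊢
    rw [one_div, ← mul_assoc] at this
    refine this.congr fun n => ?_
    rw [pow_succ, one_div]
    simp only [Function.comp]
    ring

lemma tendsto_chainProd (h : Degeneration φ χ ω l ε x u uL uR) {q₁ q₂ : List B} {w : List A}
    (h₁ : q₁ ≠ []) (h₂ : q₂ ≠ []) (h₃ : w ≠ []) (hq₁ : q₁.IsChain (· ≠ ·))
    (hq₂ : q₂.IsChain (· ≠ ·)) (hw : w.IsChain (· ≠ ·)) :
    Tendsto (fun n => ε n ^ (w.length - 1) * (chainProd (u n)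
      (q₁.map (φ ∘ .inr) ++ (w.map (φ ∘ .inl) ++ q₂.map (φ ∘ .inr))))⁻¹) l
      (𝓝 ((chainProd uL (w.map (χ ∘ some)))⁻¹ *
        (chainProd uR (q₁.map (ω ∘ some) ++ ω none :: q₂.map (ω ∘ some)))⁻¹)) := by
  obtain ⟨i, w, rfl⟩ := List.exists_cons_of_ne_nil h₃
  obtain ⟨j, q₂, rfl⟩ := List.exists_cons_of_ne_nil h₂
  have hb := h.tendsto_chainProd_block i w j q₂ hw hq₂
  induction q₁ with
  | nil => exact absurd rfl h₁
  | cons k q₁ ih =>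
    rcases q₁ with _ | ⟨k', q₁⟩
    · have := ((h.tendsto_br_cross i k).neg.inv₀ (neg_ne_zero.2 (h.br_node k))).mul hb
      simp only [← br_swap] at this
      simp only [List.map_cons, List.map_nil, cons_append, nil_append,
        chainProd_cons_cons, mul_inv, List.length_cons, Nat.add_sub_cancel] at this ⊢
      rw [mul_left_comm]
      exact this.congr fun n => mul_left_comm _ _ _
    · obtain ⟨hk, hq₁⟩ := isChain_cons_cons.1 hq₁
      have := ((h.tendsto_br_comp k k').inv₀ (h.distinctR _ _ (by simpa using hk))).mul
        (ih (by simp) hq₁)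
      simp only [List.map_cons, cons_append, chainProd_cons_cons, mul_inv] at this ⊢
      rw [mul_left_comm]
      exact this.congr fun n => mul_left_comm _ _ _

lemma tendsto_chainProd_zero (h : Degeneration φ χ ω l ε x u uL uR) {w : List Λ}
    (hw : w.IsChain (· ≠ ·)) {N : ℕ} (hN : pairCount (fun i => (φ.symm i).isLeft) w < N) :
    Tendsto (fun n => ε n ^ N * (chainProd (u n) w)⁻¹) l (𝓝 0) := by
  obtain ⟨c, hc⟩ := h.exists_tendsto_chainProd w hw
  obtain ⟨k, rfl⟩ := Nat.exists_eq_add_of_lt hN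
  have := (h.tendsto_zero.pow (k + 1)).mul hc
  rw [zero_pow (Nat.succ_ne_zero k), zero_mul] at this
  refine this.congr fun n => ?_
  ring

/-- The Parke-Taylor factor inside of the channel. -/
lemma ptHalf_left (h : Degeneration φ χ ω l ε x u uL uR) {w : List A} (hw : w ≠ []) :
    ptHalf (χ none :: w.map (χ ∘ some)) uL = (chainProd uL (w.map (χ ∘ some)))⁻¹ := by
  obtain ⟨i, w', hw'⟩ := List.exists_cons_of_ne_nil hw
  obtain ⟨w'', j, hw''⟩ := List.eq_nil_or_concat w |>.resolve_left hw
  have h1 : br (uL (χ none)) (uL (χ (some i))) = 1 := by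
    rw [h.left_node, br, h.left_snd]
    simp
  have h2 : br (uL (χ (some j))) (uL (χ none)) = -1 := by
    rw [h.left_node, br, h.left_snd]
    simp
  have h3 := chainProd_append uL (w''.map (χ ∘ some)) [χ none] (χ (some j))
  rw [chainProd_cons_cons, chainProd_singleton, h2] at h3
  have h4 : w.map (χ ∘ some) = w''.map (χ ∘ some) ++ [χ (some j)] := by simp [hw'']
  have h5 : w.map (χ ∘ some) = χ (some i) :: w'.map (χ ∘ some) := by simp [hw']
  rw [ptHalf_cons, h5, cons_append, chainProd_cons_cons, ← cons_append, ← h5, h4,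
    append_assoc, List.singleton_append, h3, h1]
  simp

end Degeneration

end ChainLimit

namespace Degeneration

variable {X : Type*} [Fintype X] [DecidableEq X] {I : Finset X} {κ : Type*} {l : Filter κ}
  {ε : κ → ℂ} {u : κ → Config (Bool ⊕ X)}

lemma tendsto_ptHalf_cut {x : κ → Option I → ℂ} {uL : Config (Bool ⊕ I)}
    {uR : Config (Bool ⊕ Out I)}
    (h : Degeneration (cutEquiv I) (legEquiv true _) (legEquiv false _) l ε x u uL uR)
    {w : List X} (hw : IsOrdering w) (r : ℕ) (hr : r < w.length) :
    Tendsto (fun n => ε n ^ I.card * ptHalf (cutWord (w.rotate r)) (u n)) l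
      (𝓝 (if r ∈ cuts I w then ptHalf (cutWord (inBlock I w r)) uL *
        ptHalf (cutWord (outBlock I w r)) uR else 0)) := by
  have hV : ∀ n, ptHalf (cutWord (w.rotate r)) (u n) = -(chainProd (u n)
      (.inl false :: .inl true :: ((w.rotate r).map .inr ++ [.inl false])))⁻¹ := fun n => by
    rw [cutWord, ← cons_append, ptHalf_append_singleton, ptHalf_cons, cons_append]
  simp_rw [hV, mul_neg]
  split_ifs with hc
  · have h1 := h.tendsto_chainProd (q₁ := [none]) (w := none :: (inBlock I w r).map some)
      (q₂ := (outBlock I w r).map some ++ [none]) (by simp) (by simp) (by simp) (by simp)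
      (List.Pairwise.isChain (List.Nodup.append (((hw.rotate r).restr.1).map
        (some_injective _)) (by simp) (by simp)))
      (List.Pairwise.isChain (List.nodup_cons.2 ⟨by simp, ((hw.rotate r).restr.1).map
        (some_injective _)⟩))
    have h2 := h.ptHalf_left (w := none :: (inBlock I w r).map some) (by simp)
    rw [← h2] at h1
    have h3 : ptHalf (cutWord (outBlock I w r)) uR = -(chainProd uR
      (.inl false :: .inl true :: ((outBlock I w r).map .inr ++ [.inl false])))⁻¹ := by
      rw [cutWord, ← cons_append, ptHalf_append_singleton, ptHalf_cons, cons_append]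
    rw [show ptHalf (cutWord (inBlock I w r)) uL = _ from ptHalf_append_singleton uL _
      (.inl true :: (inBlock I w r).map .inr), h3, mul_neg]
    rw [hw.rotate_eq hc]
    simpa [cutEquiv, legEquiv, toX, leg, Function.comp_def, hw.length_inBlock] using h1.neg
  · rw [← neg_zero]
    have hv := hw.rotate r
    have hc' : ¬∀ x ∈ (w.rotate r).take I.card, x ∈ I := fun h' =>
      hc (mem_cuts.2 ⟨hr, h'⟩)
    generalize w.rotate r = v at hv hc'
    refine (h.tendsto_chainProd_zero ?_ ?_).neg
    · refine isChain_cons_cons.2 ⟨by simp, List.Pairwise.isChain ?_⟩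
      rw [← List.Nodup, ← cons_append]
      refine List.Nodup.append (List.nodup_cons.2 ⟨by simp, hv.1.map inr_injective⟩)
        (by simp) (by simp)
    · rw [pairCount_cons _ (by simp [cutEquiv]), ← cons_append,
        pairCount_append_singleton _ (by simp [cutEquiv])]
      obtain ⟨h1, h2⟩ := pairCount_lt (fun i => ((cutEquiv I).symm i).isLeft)
        (.inl true :: v.map .inr) ⟨.inl true, by simp, by simp [cutEquiv]⟩
      have hp : ∀ x : X, ((cutEquiv I).symm (.inr x)).isLeft = decide (x ∈ I) := fun x => by
        by_cases hx : x ∈ I <;> simp [cutEquiv, hx]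
      have h3 : (.inl true :: v.map .inr : List (Bool ⊕ X)).countP
          (fun i => ((cutEquiv I).symm i).isLeft) = I.card + 1 := by
        rw [List.countP_cons_of_pos (by simp [cutEquiv]), List.countP_map, ← hv.countP_mem I]
        congr 2
        exact funext hp
      rw [h3] at h1 h2
      refine lt_of_le_of_ne (by omega) fun h4 => hc' ?_
      obtain ⟨q₁, w', q₂, h5, h6, h7, h8⟩ := h2 (by omega)
      rcases q₁ with _ | ⟨k, q₁⟩
      · rcases w' with _ | ⟨k, w'⟩
        · have := h8 (.inl true) (by rw [nil_append, nil_append] at h5; simp [← h5])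
          simp [cutEquiv] at this
        · simp only [nil_append, cons_append, List.cons.injEq] at h5
          rw [h5.2, List.countP_cons_of_pos (by simp [cutEquiv]), List.countP_append,
            List.countP_eq_length.2 fun i hi => h7 i (by simp [hi]),
            countP_eq_zero.2 fun i hi => by simp [h8 i hi]] at h3
          intro y hy
          have hy' : inr y ∈ (v.map (inr : X → Bool ⊕ X)).take I.card := by
            rw [← List.map_take]
            exact List.mem_map_of_mem hy
          rw [h5.2, List.take_left' (by omega)] at hy'
          have := h7 _ (List.mem_cons_of_mem _ hy')
          rw [hp] at this
          simpa using this
      · simp only [cons_append, List.cons.injEq] at h5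
        have := h6 k (by simp)
        rw [← h5.1] at this
        simp [cutEquiv] at this

lemma tendsto_cptHalf_cut {x : κ → Option I → ℂ} {uL : Config (Bool ⊕ I)}
    {uR : Config (Bool ⊕ Out I)}
    (h : Degeneration (cutEquiv I) (legEquiv true _) (legEquiv false _) l ε x u uL uR)
    {w : List X} (hw : IsOrdering w) :
    Tendsto (fun n => ε n ^ I.card * cptHalf w (u n)) l
      (𝓝 (∑ r ∈ cuts I w, ptHalf (cutWord (inBlock I w r)) uL *
        ptHalf (cutWord (outBlock I w r)) uR)) := by
  rw [cuts, sum_filter]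
  have := tendsto_finsetSum (Finset.range w.length) fun r hr =>
    h.tendsto_ptHalf_cut hw r (Finset.mem_range.1 hr)
  simp only [cuts, Finset.mem_filter] at this
  refine (this.congr' ?_).trans_eq ?_
  · filter_upwards [h.distinct] with n hn
    rw [cptHalf_eq _ _ (hn _ _ (by simp)), mul_sum]
  · congr 1
    exact sum_congr rfl fun r hr => by simp [Finset.mem_range.1 hr]

end Degeneration

lemma cptHalf_rotate {Y : Type*} (w : List Y) (r : ℕ) (u : Config (Bool ⊕ Y)) (h : brPM u ≠ 0) :
    cptHalf (w.rotate r) u = cptHalf w u := by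
  induction r with
  | zero => simp
  | succ r ih =>
    rw [← ih, ← List.rotate_rotate]
    generalize w.rotate r = v
    rw [cptHalf_eq _ _ h, cptHalf_eq _ _ h, length_rotate]
    simp only [List.rotate_rotate, add_comm 1]
    have h1 := Finset.sum_range_succ (fun t => ptHalf (cutWord (v.rotate t)) u) v.length
    rw [Finset.sum_range_succ', List.rotate_length, List.rotate_zero] at h1
    exact add_right_cancel h1

lemma rotate_append_right {Y : Type*} (w w' : List Y) (s : ℕ) (hs : s ≤ w'.length) :
    (w ++ w').rotate (w.length + s) = w'.drop s ++ (w ++ w'.take s) := by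
  rw [← List.rotate_rotate, List.rotate_append_length_eq, List.rotate_eq_drop_append_take
    (by rw [List.length_append]; omega), List.drop_append_of_le_length hs,
    List.take_append_of_le_length hs, append_assoc]

section

variable {X : Type*} [DecidableEq X] {I : Finset X} {w : List X}

lemma IsOrdering.getElem_mem_iff (hw : IsOrdering w) {r : ℕ} (hr : r ∈ cuts I w) (i : ℕ)
    (hi : i < (w.rotate r).length) : (w.rotate r)[i] ∈ I ↔ i < I.card := by
  rw [List.getElem_of_eq (hw.rotate_eq hr), List.getElem_append]
  simp only [List.length_map, hw.length_inBlock]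
  split_ifs with h
  · simp [h]
  · simpa [h] using ((outBlock I w r)[i - I.card]'_).2

lemma IsOrdering.cuts_unique (hw : IsOrdering w) (h0 : 0 < I.card) (hI : I.card < w.length)
    {r r' : ℕ} (hr : r ∈ cuts I w) (hr' : r' ∈ cuts I w) : r' = r := by
  obtain ⟨hr1, h⟩ := mem_cuts.1 hr
  obtain ⟨hr1', h'⟩ := mem_cuts.1 hr'
  obtain ⟨t, ht, htr⟩ : ∃ t < w.length, (r + t) % w.length = r' := by
    refine ⟨(r' + (w.length - r)) % w.length, Nat.mod_lt _ (by omega), ?_⟩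
    rw [Nat.add_mod_mod, show r + (r' + (w.length - r)) = r' + w.length by omega,
      Nat.add_mod_right, Nat.mod_eq_of_lt hr1']
  suffices t = 0 by rw [← htr, this, add_zero, Nat.mod_eq_of_lt hr1]
  rw [← htr, List.rotate_mod, ← List.rotate_rotate] at h'
  have hvl : (w.rotate r).length = w.length := length_rotate ..
  by_contra htne
  rcases lt_or_ge t I.card with h3 | h3
  · have h4 := h' (((w.rotate r).rotate t)[I.card - t]'(by rw [length_rotate]; omega)) (by
      rw [List.mem_take_iff_getElem]
      exact ⟨I.card - t, by rw [length_rotate]; omega, rfl⟩)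
    rw [List.getElem_rotate, hw.getElem_mem_iff hr, hvl, Nat.sub_add_cancel h3.le,
      Nat.mod_eq_of_lt (by omega)] at h4
    exact lt_irrefl _ h4
  · have h4 := h' (((w.rotate r).rotate t)[0]'(by rw [length_rotate]; omega)) (by
      rw [List.mem_take_iff_getElem]
      exact ⟨0, by rw [length_rotate]; omega, rfl⟩)
    rw [List.getElem_rotate, hw.getElem_mem_iff hr, hvl, zero_add,
      Nat.mod_eq_of_lt (by omega)] at h4
    omega

/-- A word in which `I` is a block has a cut. -/
lemma IsOrdering.exists_mem_cuts (hw : IsOrdering w) (h0 : 0 < I.card) (t : ℕ)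
    (h : ¬pairCount (fun x => decide (x ∈ I)) (w.rotate t) < I.card - 1) :
    ∃ q, q + I.card ≤ w.length ∧ (t + q) % w.length ∈ cuts I w := by
  obtain ⟨i, hi⟩ := Finset.card_pos.1 h0
  obtain ⟨h3, h4⟩ := pairCount_lt (fun x => decide (x ∈ I)) (w.rotate t)
    ⟨i, (hw.rotate t).2 i, by simpa using hi⟩
  have h5 := (hw.rotate t).countP_mem I
  rw [h5] at h3 h4
  obtain ⟨q₁, w', q₂, h7, h8, h9, h10⟩ := h4 (by omega)
  rw [h7, List.countP_append, List.countP_append, countP_eq_zero.2 fun i hi => by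
    simp [h8 i hi], List.countP_eq_length.2 h9, countP_eq_zero.2 fun i hi => by
    simp [h10 i hi]] at h5
  have hl := congrArg List.length h7
  rw [length_rotate, List.length_append, List.length_append] at hl
  refine ⟨q₁.length, by omega, mem_cuts.2 ⟨Nat.mod_lt _ (by omega), ?_⟩⟩
  rw [List.rotate_mod, ← List.rotate_rotate, h7, append_assoc, List.rotate_append_length_eq,
    append_assoc, List.take_left' (by omega)]
  exact fun x hx => by simpa using h9 x hx

end

namespace Degeneration

variable {X : Type*} [Fintype X] [DecidableEq X] {I : Finset X} {κ : Type*} {l : Filter κ}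
  {ε : κ → ℂ} {u : κ → Config (Bool ⊕ X)} {x : κ → I → ℂ}
  {uL : Config (Option I)} {uR : Config (Bool ⊕ Option (Out I))}

lemma tendsto_ptHalf_chan
    (h : Degeneration (chanEquiv I) (Equiv.refl _) (nodeEquiv _) l ε x u uL uR)
    {q₁ q₂ : List (Out I)} {w : List I} (hw : w ≠ []) (hq₁ : q₁.Nodup)
    (hq₂ : q₂.Nodup) (hw' : w.Nodup) :
    Tendsto (fun n => ε n ^ (w.length - 1) * ptHalf (cutWord (q₁.map Subtype.val ++
      (w.map Subtype.val ++ q₂.map Subtype.val))) (u n)) l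
      (𝓝 (ptHalf (w.map some ++ [none]) uL *
        ptHalf (cutWord (q₁.map some ++ none :: q₂.map some)) uR)) := by
  have h1 := h.tendsto_chainProd (q₁ := .inl true :: q₁.map .inr) (w := w)
    (q₂ := q₂.map .inr ++ [.inl false, .inl true]) (by simp) (by simp) hw
    (List.Pairwise.isChain (List.nodup_cons.2 ⟨by simp, hq₁.map inr_injective⟩))
    (List.Pairwise.isChain (List.Nodup.append (hq₂.map inr_injective) (by simp) (by simp)))
    (List.Pairwise.isChain hw')
  have h2 := h.ptHalf_left hw
  rw [← h2] at h1
  rw [ptHalf_append_singleton]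
  simp only [cutWord, ptHalf_cons _ (inl true), mul_neg]
  simpa [chanEquiv, nodeEquiv, toX, toR, Function.comp_def] using h1.neg

lemma tendsto_ptHalf_chan_zero
    (h : Degeneration (chanEquiv I) (Equiv.refl _) (nodeEquiv _) l ε x u uL uR) {w : List X}
    (hw : IsOrdering w) (hI : pairCount (fun x => decide (x ∈ I)) w < I.card - 1) :
    Tendsto (fun n => ε n ^ (I.card - 1) * ptHalf (cutWord w) (u n)) l (𝓝 0) := by
  simp only [cutWord, ptHalf_cons, mul_neg]
  rw [← neg_zero]
  refine (h.tendsto_chainProd_zero ?_ ?_).neg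
  · rw [append_assoc, ← cons_append]
    rcases w with _ | ⟨i, w⟩
    · simp [isChain_cons_cons]
    · rw [List.map_cons, cons_append, cons_append]
      refine isChain_cons_cons.2 ⟨by simp, List.Pairwise.isChain ?_⟩
      exact List.Nodup.append (hw.1.map inr_injective) (by simp) (by simp)
  · rw [← cons_append, pairCount_append_singleton _ (by simp [chanEquiv]),
      pairCount_cons _ (by simp [chanEquiv]), pairCount_append_singleton _ (by simp [chanEquiv]),
      pairCount_map]
    convert hI using 3
    by_cases hx : ‹X› ∈ I <;> simp [chanEquiv, hx]

lemma tendsto_cptHalf_chan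
    (h : Degeneration (chanEquiv I) (Equiv.refl _) (nodeEquiv _) l ε x u uL uR)
    {w : List X} (hw : IsOrdering w) (h0 : 0 < I.card) (hI : I.card < w.length) :
    Tendsto (fun n => ε n ^ (I.card - 1) * cptHalf w (u n)) l
      (𝓝 (∑ r ∈ cuts I w, ptHalf ((inBlock I w r).map some ++ [none]) uL *
        cptHalf (none :: (outBlock I w r).map some) uR)) := by
  have hbr : ∀ᶠ n in l, brPM (u n) ≠ 0 := h.distinct.mono fun n hn => hn _ _ (by simp)
  by_cases hc : (cuts I w).Nonempty
  · obtain ⟨r, hr⟩ := hc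
    have hcuts : cuts I w = {r} :=
      Finset.eq_singleton_iff_unique_mem.2 ⟨hr, fun r' hr' => hw.cuts_unique h0 hI hr hr'⟩
    rw [hcuts, Finset.sum_singleton]
    have hv := hw.rotate_eq hr
    have hPn : (inBlock I w r).Nodup := (hw.rotate r).restr.1
    have hQn : (outBlock I w r).Nodup := (hw.rotate r).restr.1
    have hPl := hw.length_inBlock I r
    have hl : (w.rotate r).length = w.length := length_rotate ..
    suffices Tendsto (fun n => ε n ^ (I.card - 1) * cptHalf (w.rotate r) (u n)) l
        (𝓝 (ptHalf ((inBlock I w r).map some ++ [none]) uL *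
          cptHalf (none :: (outBlock I w r).map some) uR)) from
      this.congr' (hbr.mono fun n hn => by rw [cptHalf_rotate _ _ _ hn])
    have hw' := hw.rotate r
    have hv0 : 0 ∈ cuts I (w.rotate r) := mem_cuts.2 ⟨by omega, by simpa using (mem_cuts.1 hr).2⟩
    generalize w.rotate r = v at hv hl hw' hv0
    generalize inBlock I w r = P at hv hPn hPl
    generalize outBlock I w r = Q at hv hQn
    have hP : P ≠ [] := by
      rintro rfl
      simp at hPl
      omega
    have hvl : v.length = P.length + Q.length := by simp [hv]
    have hlim : ∀ t ∈ Finset.range v.length,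
        Tendsto (fun n => ε n ^ (I.card - 1) * ptHalf (cutWord (v.rotate t)) (u n)) l
          (𝓝 (if t = 0 then ptHalf (P.map some ++ [none]) uL *
            ptHalf (cutWord (none :: Q.map some)) uR else if t < P.length then 0 else
              ptHalf (P.map some ++ [none]) uL *
                ptHalf (cutWord ((none :: Q.map some).rotate (t - P.length + 1))) uR)) := by
      intro t ht
      rw [Finset.mem_range] at ht
      split_ifs with h1 h2
      · have := h.tendsto_ptHalf_chan (q₁ := []) hP List.nodup_nil hQn hPn
        rw [h1, List.rotate_zero, hv, ← hPl]
        simpa using this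
      · refine h.tendsto_ptHalf_chan_zero (hw'.rotate t) ?_
        by_contra h5
        obtain ⟨q, hq, hc⟩ := hw'.exists_mem_cuts h0 t h5
        have := hw'.cuts_unique h0 (by omega) hv0 hc
        rw [Nat.mod_eq_of_lt (by omega)] at this
        omega
      · have := h.tendsto_ptHalf_chan (q₁ := Q.drop (t - P.length)) (q₂ := Q.take (t - P.length))
          hP hQn.drop hQn.take hPn
        have h3 : v.rotate t = (Q.drop (t - P.length)).map Subtype.val ++ (P.map Subtype.val ++
            (Q.take (t - P.length)).map Subtype.val) := by
          have := rotate_append_right (P.map Subtype.val) (Q.map Subtype.val) (t - P.length)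
            (by rw [List.length_map]; omega)
          rw [List.length_map, Nat.add_sub_cancel' (by omega)] at this
          rw [hv, this, List.map_drop, List.map_take]
        have h4 : (none :: Q.map some).rotate (t - P.length + 1) =
            (Q.drop (t - P.length)).map some ++ none :: (Q.take (t - P.length)).map some := by
          have := rotate_append_right [none] (Q.map some) (t - P.length)
            (by rw [List.length_map]; omega)
          rw [List.length_singleton, List.singleton_append, add_comm] at this
          rw [this, List.map_drop, List.map_take, List.singleton_append]
        rw [h3, h4, ← hPl]
        exact this
    have hs := tendsto_finsetSum _ hlim
    refine (hs.congr' (hbr.mono fun n hn => ?_)).trans_eq ?_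
    · rw [cptHalf_eq _ _ hn, mul_sum]
    · congr 1
      rw [cptHalf_eq _ _ (h.distinctR _ _ (by simp)), mul_sum, hvl, Finset.sum_range_add,
        List.length_cons, Finset.sum_range_succ', List.length_map, add_comm]
      congr 1
      · refine sum_congr rfl fun t _ => ?_
        rw [if_neg (by have := List.length_pos_iff.2 hP; omega), if_neg (by omega),
          Nat.add_sub_cancel_left]
      · rw [Finset.sum_eq_single 0, if_pos rfl, List.rotate_zero]
        · intro t ht h1
          rw [if_neg h1, if_pos (Finset.mem_range.1 ht)]
        · intro h1
          simp [hP] at h1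
  · rw [Finset.not_nonempty_iff_eq_empty] at hc
    rw [hc, Finset.sum_empty]
    have hlim : ∀ t ∈ Finset.range w.length,
        Tendsto (fun n => ε n ^ (I.card - 1) * ptHalf (cutWord (w.rotate t)) (u n)) l (𝓝 0) := by
      intro t ht
      refine h.tendsto_ptHalf_chan_zero (hw.rotate t) ?_
      by_contra h6
      obtain ⟨q, -, h7⟩ := hw.exists_mem_cuts h0 t h6
      simp [hc] at h7
    have hs := tendsto_finsetSum _ hlim
    rw [sum_const_zero] at hs
    exact hs.congr' (hbr.mono fun n hn => by
      simp only [cptHalf_eq _ _ hn, mul_sum])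

lemma tendsto_ngonInt_chan
    (h : Degeneration (chanEquiv I) (Equiv.refl _) (nodeEquiv _) l ε x u uL uR) {N : ℕ}
    (hN : N ≠ 0) : Tendsto (fun n => ε n ^ N * ngonInt (u n)) l (𝓝 0) := by
  have hpm : Tendsto (fun n => brPM (u n)) l (𝓝 (brPM uR)) :=
    h.tendsto_br_comp (inl true) (inl false)
  have hpm0 : brPM uR ≠ 0 := h.distinctR _ _ (by simp)
  have key : ∀ (i : X) (c : Bool), ∃ z ≠ 0,
      Tendsto (fun n => br (u n (.inr i)) (u n (.inl c))) l (𝓝 z) := fun i c => by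
    by_cases hi : i ∈ I
    · exact ⟨_, h.br_node (.inl c), h.tendsto_br_cross ⟨i, hi⟩ (.inl c)⟩
    · exact ⟨_, h.distinctR _ _ (by simp [nodeEquiv, toR]),
        h.tendsto_br_comp (.inr ⟨i, hi⟩) (.inl c)⟩
  choose z hz hzt using key
  have h1 := ((hpm.pow 4).inv₀ (pow_ne_zero 4 hpm0)).mul (tendsto_finsetProd univ
    fun i _ => (hpm.div ((hzt i true).mul (hzt i false)) (mul_ne_zero (hz _ _) (hz _ _))).pow 2)
  have h2 := (h.tendsto_zero.pow N).mul h1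
  rwa [zero_pow hN, zero_mul] at h2

lemma tendsto_ngonInt_cut {x : κ → Option I → ℂ} {uL : Config (Bool ⊕ I)}
    {uR : Config (Bool ⊕ Out I)}
    (h : Degeneration (cutEquiv I) (legEquiv true _) (legEquiv false _) l ε x u uL uR) :
    Tendsto (fun n => ε n ^ (2 * I.card) * ngonInt (u n)) l (𝓝 (ngonInt uL * ngonInt uR)) := by
  have hpm : Tendsto (fun n => brPM (u n)) l (𝓝 (brPM uR)) := h.tendsto_br_cross none none
  have hpm0 : brPM uR ≠ 0 := h.distinctR _ _ (by simp)
  have hnode : ∀ o, br (uL (leg true o)) (uL (.inl false)) = -1 := fun o => by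
    have h1 := h.left_node
    have h2 := h.left_snd o
    simp only [legEquiv, Equiv.coe_fn_mk, Option.elim] at h1 h2
    simp only [Bool.not_true] at h1
    simp [br, h1, h2]
  have hL : ∀ i : I, Tendsto (fun n => (ε n * (brPM (u n) /
      (br (u n (.inr i.1)) (u n (.inl true)) * br (u n (.inr i.1)) (u n (.inl false))))) ^ 2) l
      (𝓝 ((brPM uL / (br (uL (.inr i)) (uL (.inl true)) *
        br (uL (.inr i)) (uL (.inl false)))) ^ 2)) := fun i => by
    have h1 := h.tendsto_mul_div_br (hpm.div (h.tendsto_br_cross (some i) none) hpm0) (some i) none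
    have h2 : brPM uL = -1 := hnode none
    have h3 : br (uL (.inr i)) (uL (.inl false)) = -1 := hnode (some i)
    rw [h2, h3]
    refine Tendsto.pow ?_ 2
    convert h1 using 2
    · rw [mul_comm (br _ _), ← div_div]
      rfl
    · change _ = brPM uR / brPM uR / br (uL (.inr i)) (uL (.inl true))
      rw [div_self hpm0, mul_neg, mul_one, neg_div_neg_eq]
  have hR : ∀ i : Out I, Tendsto (fun n => (brPM (u n) /
      (br (u n (.inr i.1)) (u n (.inl true)) * br (u n (.inr i.1)) (u n (.inl false)))) ^ 2) l
      (𝓝 ((brPM uR / (br (uR (.inr i)) (uR (.inl true)) *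
        br (uR (.inr i)) (uR (.inl false)))) ^ 2)) := fun i => by
    refine (hpm.div (Tendsto.mul ?_ (h.tendsto_br_comp (some i) none)) (mul_ne_zero
      (h.distinctR _ _ (by simp)) (h.distinctR _ _ (by simp [legEquiv, leg])))).pow 2
    rw [br_swap]
    exact (h.tendsto_br_cross none (some i)).neg.congr fun n => (br_swap ..).symm
  have h1 := ((hpm.pow 4).inv₀ (pow_ne_zero 4 hpm0)).mul
    ((tendsto_finsetProd univ fun i _ => hL i).mul (tendsto_finsetProd univ fun i _ => hR i))
  have h2 : brPM uL = -1 := hnode none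
  refine (h1.congr fun n => ?_).trans_eq ?_
  · rw [ngonInt, ← Fintype.prod_subtype_mul_prod_subtype (fun x => x ∈ I)]
    simp only [mul_pow, Finset.prod_mul_distrib, Finset.prod_const, card_univ, card_coe, ← pow_mul]
    rw [mul_assoc (ε n ^ _), mul_left_comm]
    congr!
  · congr 1
    rw [ngonInt, ngonInt]
    simp only [h2]
    ring

end Degeneration

section Leading

variable {A B : Type*} [Fintype A] [DecidableEq A] [Fintype B] [DecidableEq B]

/-- The scattering equations of the channel force the sum of its pairings to vanish. -/
lemma chanSum_isBigO {l : Filter ℂ} {s : ℂ → A ⊕ B → A ⊕ B → ℂ} {u : ℂ → Config (A ⊕ B)} {σ : ℂ}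
    {x : A → ℂ} {c C : ℝ} (hl : l ≤ 𝓝 (0 : ℂ)) (hc : 0 < c)
    (hs : ∀ i j, (fun ε => s ε i j) =O[l] fun _ => (1 : ℝ)) (hsym : ∀ ε i j, s ε i j = s ε j i)
    (hE : ∀ᶠ ε in l, (∀ i j, i ≠ j → br (u ε i) (u ε j) ≠ 0) ∧
      ∀ i, (u ε i).2 ≠ 0 → scatEq (s ε) (u ε) i = 0)
    (hA : ∀ i, (∀ᶠ ε in l, (u ε (.inl i)).2 = 1) ∧
      (fun ε => (u ε (.inl i)).1 - (σ + ε * x i)) =O[l] fun ε => ε ^ 2)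
    (hB : ∀ j, ∀ᶠ ε in l, ‖u ε (.inr j)‖ ≤ C ∧ ∀ i, c ≤ ‖br (u ε (.inl i)) (u ε (.inr j))‖) :
    (fun ε => chanSum (s ε)) =O[l] fun ε => ε := by
  have h1 : ∀ᶠ ε in l, chanSum (s ε) = -∑ i, ∑ j, ((u ε (.inl i)).1 - σ) *
      (s ε (.inl i) (.inr j) * ((u ε (.inr j)).2 * (br (u ε (.inl i)) (u ε (.inr j)))⁻¹)) := by
    filter_upwards [hE, eventually_all.2 fun i => (hA i).1] with ε h1 h2
    have hd : ∀ i k, br (u ε (.inl i)) (u ε (.inl k)) = ((u ε (.inl i)).1 - σ) -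
        ((u ε (.inl k)).1 - σ) := fun i k => by rw [br, h2, h2]; ring
    rw [← sum_mul_sum_div (s ε) (hsym ε) (x := fun i => (u ε (.inl i)).1 - σ)
      fun i k hik h => h1.1 (.inl i) (.inl k) (by simpa using hik) (by rw [hd]; exact sub_eq_zero.2 h),
      ← sub_eq_zero, sub_neg_eq_add, ← sum_add_distrib]
    refine sum_eq_zero fun i _ => ?_
    have h3 := h1.2 (.inl i) (by rw [h2]; exact one_ne_zero)
    rw [scatEq_eq_sum, sum_sum_type] at h3
    rw [← mul_sum, ← mul_add]
    refine mul_eq_zero_of_right _ ?_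
    rw [← h3]
    congr 1
    · exact sum_congr rfl fun k _ => by rw [← hd, h2, h2, one_mul, mul_one]
    · exact sum_congr rfl fun k _ => by rw [h2, one_mul, div_eq_mul_inv, mul_assoc]
  suffices (fun ε => ∑ i, ∑ j, ((u ε (.inl i)).1 - σ) * (s ε (.inl i) (.inr j) *
      ((u ε (.inr j)).2 * (br (u ε (.inl i)) (u ε (.inr j)))⁻¹))) =O[l] fun ε => ε from
    this.neg_left.congr' (h1.mono fun ε h => h.symm) .rfl
  have hid : Tendsto (fun ε : ℂ => ε) l (𝓝 0) := hl
  refine IsBigO.fun_sum fun i _ => ?_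
  refine IsBigO.fun_sum fun j _ => ?_
  have h2 : (fun ε => (u ε (.inl i)).1 - σ) =O[l] fun ε => ε := by
    have h3 : (fun ε : ℂ => ε ^ 2) =O[l] fun ε => ε := by
      simpa [pow_two] using (isBigO_refl (fun ε : ℂ => ε) l).mul (hid.isBigO_one ℂ)
    have h4 : (fun ε : ℂ => ε * x i) =O[l] fun ε => ε := by
      simpa [mul_comm] using (isBigO_refl (fun ε : ℂ => ε) l).const_mul_left (x i)
    exact (((hA i).2.trans h3).add h4).congr_left fun ε => by ring
  have h3 : (fun ε => (u ε (.inr j)).2 * (br (u ε (.inl i)) (u ε (.inr j)))⁻¹) =O[l]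
      fun _ => (1 : ℝ) := by
    refine IsBigO.of_bound (C * c⁻¹) ?_
    filter_upwards [hB j] with ε h
    rw [norm_mul, norm_inv, norm_one, mul_one]
    exact mul_le_mul ((norm_snd_le _).trans h.1) (inv_anti₀ hc (h.2 i)) (by positivity)
      ((norm_nonneg _).trans h.1)
  have h4 := ((hs (.inl i) (.inr j)).mul h3).trans
    (isBigO_const_const (1 * 1 : ℝ) (one_ne_zero (α := ℂ)) l)
  simpa using h2.mul h4

end Leading

section Loop

variable {X : Type*} [Fintype X] [DecidableEq X] {m : ℕ}

lemma loopMandel_symm (K : Kin X m) (i j : Bool ⊕ X) : loopMandel K i j = loopMandel K j i := by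
  rcases i with i | i <;> rcases j with j | j <;> simp [loopMandel, mandel, dotProduct_comm]

lemma loopMandel_self {K : Kin X m} (hK : Admissible K) (i : Bool ⊕ X) : loopMandel K i i = 0 := by
  rcases i with i | i
  · rfl
  · simp [loopMandel, mandel, loopMom, marked, (hK.2 i).1]

lemma contDiff_loopMandel (i j : Bool ⊕ X) :
    ContDiff ℂ 1 fun K : Kin X m => loopMandel K i j := by
  have h : ∀ (i : Bool ⊕ X) (a : Fin m), ContDiff ℂ 1 fun K : Kin X m => loopMom K i a := by
    intro i a
    rcases i with (_ | _) | i <;> simp only [loopMom, marked, elim_inl, elim_inr, cond_true,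
      cond_false, Kin.ell, Kin.k, Pi.neg_apply] <;> fun_prop
  have h' : ∀ i j : Bool ⊕ X, ContDiff ℂ 1 fun K : Kin X m => mandel (loopMom K) i j := by
    intro i j
    unfold mandel dotProduct
    exact contDiff_const.mul (ContDiff.sum fun a _ => (h i a).mul (h j a))
  rcases i with i | i <;> rcases j with j | j
  · exact contDiff_const
  all_goals exact h' _ _

lemma loopMandel_isBigO {l : Filter ℂ} {K : ℂ → Kin X m} (hK : K =O[l] fun _ => (1 : ℝ))
    (i j : Bool ⊕ X) : (fun ε => loopMandel (K ε) i j) =O[l] fun _ => (1 : ℝ) := by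
  obtain ⟨C, hC⟩ := hK.bound
  have hcpt : IsCompact (Metric.closedBall (0 : Kin X m) C) := isCompact_closedBall _ _
  obtain ⟨D, hD⟩ := hcpt.exists_bound_of_continuousOn
    (contDiff_loopMandel (m := m) i j).continuous.continuousOn
  refine IsBigO.of_bound D (hC.mono fun ε h => ?_)
  rw [norm_one, mul_one] at h ⊢
  exact hD _ (by simpa using h)

lemma chanSum_chan {K : Kin X m} (hK : Admissible K) (I : Finset X) :
    chanSum (fun i j => loopMandel K (chanEquiv I i) (chanEquiv I j)) = sTilde false I K := by
  unfold chanSum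
  simp_rw [sum_erase (f := fun k => loopMandel K (chanEquiv I (.inl _)) (chanEquiv I (.inl k)))
    _ (loopMandel_self hK _)]
  simp only [chanEquiv, Equiv.coe_fn_mk, elim_inl, loopMandel, mandel, loopMom, marked,
    elim_inr, sTilde, kSum, ← mul_sum, Bool.false_eq_true, if_false,
    ← dotProduct_sum, ← sum_dotProduct]
  rw [← sum_coe_sort I fun i => K.k i]
  ring

lemma chanSum_cut {K : Kin X m} (hK : Admissible K) (I : Finset X) :
    chanSum (fun i j => loopMandel K (cutEquiv I i) (cutEquiv I j)) = sTilde true I K := by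
  unfold chanSum
  simp_rw [sum_erase (f := fun k => loopMandel K (cutEquiv I (.inl _)) (cutEquiv I (.inl k)))
    _ (loopMandel_self hK _)]
  simp only [sum_option, cutEquiv, Equiv.coe_fn_mk, elim_inl, toX, leg, Sum.map_inl,
    Sum.map_inr, id, loopMandel, mandel, loopMom, marked, cond_true,
    elim_inr, sTilde, kSum, ← mul_sum, if_true, zero_add, sum_add_distrib,
    ← dotProduct_sum, ← sum_dotProduct]
  rw [← sum_coe_sort I fun i => K.k i, dotProduct_comm _ K.ell]
  ring

lemma range_chan (I : Finset X) : (chanEquiv I) '' Set.range inl = chan false I := by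
  ext i
  rcases i with c | i <;> simp [chan, chanEquiv]

lemma range_cut (I : Finset X) : (cutEquiv I) '' Set.range inl = chan true I := by
  ext i
  rcases i with (_ | _) | i <;> simp [chan, cutEquiv, toX, leg, Option.exists]

/-- The scattering equations at leading order. -/
theorem sTilde_isBigO {b : Bool} {I : Finset X} {l : Filter ℂ} {K : ℂ → Kin X m}
    {u : ℂ → Config (Bool ⊕ X)} {σ : ℂ} {x : Bool ⊕ X → ℂ} {c C : ℝ} (hl : l ≤ 𝓝 (0 : ℂ))
    (hc : 0 < c) (hK : K =O[l] fun _ => (1 : ℝ))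
    (hE : ∀ᶠ ε in l, Admissible (K ε) ∧ (∀ i j, i ≠ j → br (u ε i) (u ε j) ≠ 0) ∧
      ∀ i, (u ε i).2 ≠ 0 → scatEq (loopMandel (K ε)) (u ε) i = 0)
    (hA : ∀ i ∈ chan b I, (∀ᶠ ε in l, (u ε i).2 = 1) ∧
      (fun ε => (u ε i).1 - (σ + ε * x i)) =O[l] fun ε => ε ^ 2)
    (hB : ∀ j ∉ chan b I, ∀ᶠ ε in l, ‖u ε j‖ ≤ C ∧ ∀ i ∈ chan b I, c ≤ ‖br (u ε i) (u ε j)‖) :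
    (fun ε => sTilde b I (K ε)) =O[l] fun ε => ε := by
  have key : ∀ {A B : Type _} [Fintype A] [DecidableEq A] [Fintype B] [DecidableEq B]
      (φ : A ⊕ B ≃ Bool ⊕ X), φ '' Set.range inl = chan b I →
      (∀ K : Kin X m, Admissible K → chanSum (fun i j => loopMandel K (φ i) (φ j)) =
        sTilde b I K) → (fun ε => sTilde b I (K ε)) =O[l] fun ε => ε := by
    intro A B _ _ _ _ φ h1 h2
    have h3 : ∀ i, φ (.inl i) ∈ chan b I := fun i => h1 ▸ ⟨_, ⟨i, rfl⟩, rfl⟩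
    have h4 : ∀ j, φ (.inr j) ∉ chan b I := fun j => h1 ▸ by simp
    refine (chanSum_isBigO (s := fun ε i j => loopMandel (K ε) (φ i) (φ j))
      (u := fun ε => u ε ∘ φ) (x := fun i => x (φ (.inl i))) hl hc
      (fun i j => loopMandel_isBigO hK _ _) (fun ε i j => loopMandel_symm _ _ _)
      (hE.mono fun ε h => ⟨fun i j hij => h.2.1 _ _ (φ.injective.ne hij), fun i hi => ?_⟩)
      (fun i => hA _ (h3 i)) fun j => (hB _ (h4 j)).mono fun ε h =>
        ⟨h.1, fun i => h.2 _ (h3 i)⟩).congr' (hE.mono fun ε h => h2 _ h.1) .rfl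
    rw [scatEq_comp φ (s := loopMandel (K ε)) fun _ _ _ => rfl]
    exact h.2.2 _ hi
  cases b with
  | false => exact key (chanEquiv I) (range_chan I) fun K hK => chanSum_chan hK I
  | true => exact key (cutEquiv I) (range_cut I) fun K hK => chanSum_cut hK I

end Loop

/-! ### Integrands away from the degenerations -/

section Bounded

variable {κ : Type*} {l : Filter κ}

/-- `f` is bounded along the filter `l`. -/
def BoundedAlong (l : Filter κ) (f : κ → ℂ) : Prop := f =O[l] fun _ => (1 : ℝ)

namespace BoundedAlong

variable {f g : κ → ℂ}

lemma const (z : ℂ) : BoundedAlong l fun _ => z := isBigO_const_const _ one_ne_zero _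

lemma of_tendsto {z : ℂ} (h : Tendsto f l (𝓝 z)) : BoundedAlong l f := h.isBigO_one ℝ

lemma add (hf : BoundedAlong l f) (hg : BoundedAlong l g) : BoundedAlong l fun n => f n + g n :=
  IsBigO.add hf hg

lemma neg (hf : BoundedAlong l f) : BoundedAlong l fun n => -f n := IsBigO.neg_left hf

lemma sub (hf : BoundedAlong l f) (hg : BoundedAlong l g) : BoundedAlong l fun n => f n - g n :=
  IsBigO.sub hf hg

lemma mul (hf : BoundedAlong l f) (hg : BoundedAlong l g) : BoundedAlong l fun n => f n * g n := by
  simpa [BoundedAlong] using IsBigO.mul hf hg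

lemma pow (hf : BoundedAlong l f) (k : ℕ) : BoundedAlong l fun n => f n ^ k := by
  simpa [BoundedAlong] using IsBigO.pow hf k

lemma sum {ι : Type*} {s : Finset ι} {f : ι → κ → ℂ} (h : ∀ i ∈ s, BoundedAlong l (f i)) :
    BoundedAlong l fun n => ∑ i ∈ s, f i n := IsBigO.fun_sum h

lemma prod {ι : Type*} {s : Finset ι} {f : ι → κ → ℂ} (h : ∀ i ∈ s, BoundedAlong l (f i)) :
    BoundedAlong l fun n => ∏ i ∈ s, f i n := by
  induction s using Finset.cons_induction with
  | empty => simpa using const 1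
  | cons a s ha ih =>
    simp only [Finset.prod_cons]
    exact (h a (by simp)).mul (ih fun i hi => h i (by simp [hi]))

lemma dotProduct {m : ℕ} {v w : κ → V m} {v₀ w₀ : V m} (hv : Tendsto v l (𝓝 v₀))
    (hw : Tendsto w l (𝓝 w₀)) : BoundedAlong l fun n => v n ⬝ᵥ w n :=
  of_tendsto (tendsto_finsetSum _ fun a _ => ((continuous_apply a).tendsto _ |>.comp hv).mul
    ((continuous_apply a).tendsto _ |>.comp hw))

lemma pf {ι : Type*} [Fintype ι] [DecidableEq ι] {A : κ → RowMat ι}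
    (h : ∀ x y, BoundedAlong l fun n => A n x y) : BoundedAlong l fun n => pf (A n) := by
  unfold OneLoop.pf
  exact (const _).mul (sum fun π _ => (const _).mul (prod fun i _ => h _ _))

end BoundedAlong

variable {Λ : Type*} [Fintype Λ] [DecidableEq Λ] {m : ℕ}

/-- Marked points converging to pairwise different points. -/
structure Separating (l : Filter κ) (u : κ → Config Λ) (u₀ : Config Λ) : Prop where
  distinct : ∀ i j, i ≠ j → br (u₀ i) (u₀ j) ≠ 0
  normal : ∀ n i, (u n i).2 = 1 ∨ u n i = (1, 0)
  tendsto : ∀ i, Tendsto (fun n => u n i) l (𝓝 (u₀ i))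

namespace Separating

variable {u : κ → Config Λ} {u₀ : Config Λ}

lemma br_inv (h : Separating l u u₀) {i j : Λ} (hij : i ≠ j) :
    BoundedAlong l fun n => (br (u n i) (u n j))⁻¹ :=
  .of_tendsto ((tendsto_br (h.tendsto i) (h.tendsto j)).inv₀ (h.distinct i j hij))

lemma eventually_ne (h : Separating l u u₀) : ∀ᶠ n in l, ∀ i j, i ≠ j → br (u n i) (u n j) ≠ 0 :=
  eventually_all.2 fun i => eventually_all.2 fun j => by
    by_cases hij : i = j
    · exact Eventually.of_forall fun n h => absurd hij h
    · exact ((tendsto_br (h.tendsto i) (h.tendsto j)).eventually_ne (h.distinct i j hij)).mono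
        fun n hn _ => hn

lemma polP (h : Separating l u u₀) {k : κ → Λ → V m} {k₀ : Λ → V m}
    (hk : ∀ i, Tendsto (fun n => k n i) l (𝓝 (k₀ i))) (i : Λ) {e : κ → V m} {e₀ : V m}
    (he : Tendsto e l (𝓝 e₀)) : BoundedAlong l fun n => polP (k n) (u n) i (e n) := by
  have h1 : BoundedAlong l fun n => ∑ j ∈ univ.erase i, (e n ⬝ᵥ k n j) * (u n j).1 *
      (br (u n i) (u n j))⁻¹ := .sum fun j hj => ((BoundedAlong.dotProduct he (hk j)).mul
        (.of_tendsto ((continuous_fst.tendsto _).comp (h.tendsto j)))).mul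
          (h.br_inv (ne_of_mem_erase hj).symm)
  have h2 : BoundedAlong l fun n => ∑ j ∈ univ.erase i, (e n ⬝ᵥ k n j) * (u n j).2 *
      (br (u n i) (u n j))⁻¹ := .sum fun j hj => ((BoundedAlong.dotProduct he (hk j)).mul
        (.of_tendsto ((continuous_snd.tendsto _).comp (h.tendsto j)))).mul
          (h.br_inv (ne_of_mem_erase hj).symm)
  refine IsBigO.trans (IsBigO.of_bound 1 (Eventually.of_forall fun n => ?_))
    (h1.norm_left.add h2.norm_left)
  rw [one_mul]
  refine le_trans ?_ (le_abs_self _)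
  rcases h.normal n i with h3 | h3
  · rw [OneLoop.polP, if_neg (by rw [h3]; exact one_ne_zero)]
    refine le_trans (le_of_eq ?_) (le_add_of_nonneg_left (norm_nonneg _))
    simp only [h3, one_mul, div_eq_mul_inv]
  · rw [OneLoop.polP, if_pos (by rw [h3])]
    refine le_trans (le_of_eq ?_) (le_add_of_nonneg_right (norm_nonneg _))
    simp only [h3, one_mul, div_eq_mul_inv]

lemma chyMat (h : Separating l u u₀) {k e : κ → Λ → V m} {k₀ e₀ : Λ → V m}
    (hk : ∀ i, Tendsto (fun n => k n i) l (𝓝 (k₀ i)))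
    (he : ∀ i, Tendsto (fun n => e n i) l (𝓝 (e₀ i))) (x y : Λ × Bool) :
    BoundedAlong l fun n => treeMat (k n) (e n) (u n) x y := by
  simp only [OneLoop.chyMat, of_apply]
  split_ifs with h1
  · exact .const 0
  · exact h.polP hk _ (he _)
  · exact (h.polP hk _ (he _)).neg
  all_goals exact (BoundedAlong.dotProduct (by first | exact he _ | exact hk _)
    (by first | exact he _ | exact hk _)).mul (h.br_inv h1)

lemma redPf (h : Separating l u u₀) {k e : κ → Λ → V m} {k₀ e₀ : Λ → V m}
    (hk : ∀ i, Tendsto (fun n => k n i) l (𝓝 (k₀ i)))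
    (he : ∀ i, Tendsto (fun n => e n i) l (𝓝 (e₀ i))) {a b : Λ} (hab : a ≠ b) :
    BoundedAlong l fun n => redPf (k n) (e n) a b (u n) := by
  simp only [OneLoop.redPf, div_eq_mul_inv]
  exact (BoundedAlong.pf fun x y => h.chyMat hk he _ _).mul (h.br_inv hab)

lemma chainProd_inv (h : Separating l u u₀) {w : List Λ} (hw : w.IsChain (· ≠ ·)) :
    BoundedAlong l fun n => (chainProd (u n) w)⁻¹ := by
  induction w with
  | nil => simpa [chainProd] using BoundedAlong.const 1
  | cons i w ih =>
    rcases w with _ | ⟨j, w⟩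
    · simpa [chainProd] using BoundedAlong.const 1
    · simp only [chainProd_cons_cons, mul_inv]
      exact (h.br_inv (isChain_cons_cons.1 hw).1).mul (ih (isChain_cons_cons.1 hw).2)

end Separating

end Bounded

section Integrand

variable {X κ : Type*} [Fintype X] [DecidableEq X] {m : ℕ} {l : Filter κ}
  {u : κ → Config (Bool ⊕ X)} {u₀ : Config (Bool ⊕ X)}

namespace Separating

lemma scalHalf (h : Separating l u u₀) {k : κ → Bool ⊕ X → V m} {e : κ → X → V m}
    {k₀ : Bool ⊕ X → V m} {e₀ : X → V m} (hk : ∀ i, Tendsto (fun n => k n i) l (𝓝 (k₀ i)))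
    (he : ∀ i, Tendsto (fun n => e n i) l (𝓝 (e₀ i))) :
    BoundedAlong l fun n => scalHalf (k n) (e n) (u n) := by
  simp only [scalHalf_eq, div_eq_mul_inv, ← inv_pow]
  refine (BoundedAlong.pf fun x y => ?_).mul ((h.br_inv (by simp)).pow 2)
  refine h.chyMat (e₀ := marked 0 0 e₀) hk (fun i => ?_) _ _
  rcases i with (_ | _) | i
  · exact tendsto_const_nhds
  · exact tendsto_const_nhds
  · exact he i

lemma nsHalf (h : Separating l u u₀) (d : ℕ) {k : κ → Bool ⊕ X → V m} {e : κ → X → V m}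
    {k₀ : Bool ⊕ X → V m} {e₀ : X → V m} (hk : ∀ i, Tendsto (fun n => k n i) l (𝓝 (k₀ i)))
    (he : ∀ i, Tendsto (fun n => e n i) l (𝓝 (e₀ i))) :
    BoundedAlong l fun n => nsHalf d (k n) (e n) (u n) := by
  have h1 : BoundedAlong l fun n => (∑ α : Fin m, OneLoop.redPf (k n)
      (marked (basisVec α) (basisVec α) (e n)) (.inl true) (.inl false) (u n)) +
      ((d : ℂ) - 2 - m) * OneLoop.scalHalf (k n) (e n) (u n) := by
    refine .add (.sum fun α _ => h.redPf (e₀ := marked (basisVec α) (basisVec α) e₀) hk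
      (fun i => ?_) (by simp)) (.mul (.const _) (h.scalHalf hk he))
    rcases i with (_ | _) | i
    · exact tendsto_const_nhds
    · exact tendsto_const_nhds
    · exact he i
  exact IsBigO.congr' h1 (h.eventually_ne.mono fun n hn => (nsHalf_eq _ _ _ d hn).symm) .rfl

lemma cptHalf (h : Separating l u u₀) {w : List X} (hw : IsOrdering w) :
    BoundedAlong l fun n => cptHalf w (u n) := by
  have h1 : BoundedAlong l fun n => ∑ r ∈ Finset.range w.length,
      ptHalf (cutWord (w.rotate r)) (u n) := by
    refine .sum fun r _ => ?_
    simp only [cutWord, ptHalf_cons]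
    refine (h.chainProd_inv ?_).neg
    obtain ⟨h2, -⟩ := hw.rotate r
    generalize w.rotate r = v at h2
    rw [append_assoc]
    rcases v with _ | ⟨i, v⟩
    · simp [isChain_cons_cons]
    · rw [List.map_cons, cons_append]
      refine isChain_cons_cons.2 ⟨by simp, List.Pairwise.isChain ?_⟩
      exact List.Nodup.append (h2.map inr_injective) (by simp) (by simp)
  exact IsBigO.congr' h1 (h.eventually_ne.mono fun n hn =>
    (cptHalf_eq _ _ (hn _ _ (by simp))).symm) .rfl

lemma ngonInt (h : Separating l u u₀) : BoundedAlong l fun n => ngonInt (u n) := by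
  have h1 : BoundedAlong l fun n => brPM (u n) :=
    .of_tendsto (tendsto_br (h.tendsto _) (h.tendsto _))
  simp only [OneLoop.ngonInt, div_eq_mul_inv, mul_inv, ← inv_pow]
  exact ((h.br_inv (by simp)).pow 4).mul (.prod fun i _ => (h1.mul ((h.br_inv (by simp)).mul
    (h.br_inv (by simp)))).pow 2)

lemma loopInt {T : Theory X} (hT : T.Valid) {K₀ : Kin X m} {l : Filter (Kin X m)} (hl : l ≤ 𝓝 K₀)
    {u : Kin X m → Config (Bool ⊕ X)} (h : Separating l u u₀) :
    BoundedAlong l fun K => loopInt T K (u K) := by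
  have hk : ∀ i, Tendsto (fun K : Kin X m => loopMom K i) l (𝓝 (loopMom K₀ i)) := fun i =>
    (Continuous.tendsto (by
      rcases i with (_ | _) | i <;> simp only [loopMom, marked, elim_inl, elim_inr,
        cond_true, cond_false, Kin.ell, Kin.k] <;> fun_prop) K₀).mono_left hl
  have he : ∀ i, Tendsto (fun K : Kin X m => K.eps i) l (𝓝 (K₀.eps i)) := fun i =>
    (Continuous.tendsto (by simp only [Kin.eps]; fun_prop) K₀).mono_left hl
  have he' : ∀ i, Tendsto (fun K : Kin X m => K.epst i) l (𝓝 (K₀.epst i)) := fun i =>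
    (Continuous.tendsto (by simp only [Kin.epst]; fun_prop) K₀).mono_left hl
  cases T with
  | nGon => exact h.ngonInt
  | biAdjoint w w' => exact (h.cptHalf hT.1).mul (h.cptHalf hT.2)
  | yangMills d w => exact (h.nsHalf d hk he).mul (h.cptHalf hT)
  | gravity d => exact (h.nsHalf d hk he).mul (h.nsHalf d hk he')
  | pureGravity d =>
    exact ((h.nsHalf d hk he).mul (h.nsHalf d hk he')).sub
      ((BoundedAlong.const _).mul ((h.scalHalf hk he).mul (h.scalHalf hk he')))

end Separating

end Integrand

/-! ### Residues of the one-loop integrand from limits of half-integrands -/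

section Relabel

variable {Λ Λ' : Type*} [Fintype Λ] [DecidableEq Λ] [Fintype Λ'] [DecidableEq Λ']

lemma comp_symm_mem_Sols (e : Λ' ≃ Λ) {s : Λ → Λ → ℂ} {s' : Λ' → Λ' → ℂ}
    (hs : ∀ i j, i ≠ j → s' i j = s (e i) (e j)) (g : Gauge Λ') (u : Config Λ') :
    u ∘ e.symm ∈ Sols s (g.map e) ↔ u ∈ Sols s' g := by
  rw [← mem_Sols_comp e hs, Function.comp_assoc, Equiv.symm_comp_self, Function.comp_id]

lemma comp_symm_mem_degen (e : Λ' ≃ Λ) (S : Set Λ') (μ : Λ') (δ ρ : ℝ) (u : Config Λ') :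
    u ∘ e.symm ∈ degen (e '' S) (e μ) δ ρ ↔ u ∈ degen S μ δ ρ := by
  constructor
  · rintro ⟨ε, x, h1, h2, h3, h4, h5⟩
    refine ⟨ε, x ∘ e, h1, h2, h3, fun i hi => ?_, fun p hp => ?_⟩
    · obtain ⟨h6, h7, h8⟩ := h4 (e i) ⟨i, hi, rfl⟩
      refine ⟨by simpa using h6, h7, fun j hj hij => h8 (e j) ⟨j, hj, rfl⟩ (e.injective.ne hij)⟩
    · obtain ⟨h6, h7, h8⟩ := h5 (e p) (by simpa using hp)
      refine ⟨by simpa using h6, by simpa using h7, fun q hq hpq => ?_⟩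
      simpa using h8 (e q) (by simpa using hq) (e.injective.ne hpq)
  · rintro ⟨ε, x, h1, h2, h3, h4, h5⟩
    refine ⟨ε, x ∘ e.symm, h1, h2, by simpa using h3, ?_, fun p hp => ?_⟩
    · rintro _ ⟨i, hi, rfl⟩
      obtain ⟨h6, h7, h8⟩ := h4 i hi
      refine ⟨by simpa using h6, by simpa using h7, ?_⟩
      rintro _ ⟨j, hj, rfl⟩ hij
      simpa using h8 j hj fun h => hij (by rw [h])
    · have hS : ∀ p, p ∉ e '' S → e.symm p ∉ S := fun p hp h => hp ⟨_, h, by simp⟩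
      obtain ⟨h6, h7, h8⟩ := h5 (e.symm p) (hS p hp)
      exact ⟨h6, h7, fun q hq hpq => h8 _ (hS q hq) (e.symm.injective.ne hpq)⟩

lemma comp_symm_mem_bulk (e : Λ' ≃ Λ) {s : Λ → Λ → ℂ} {s' : Λ' → Λ' → ℂ}
    (hs : ∀ i j, i ≠ j → s' i j = s (e i) (e j)) (g : Gauge Λ') (δ : ℝ) {u : Config Λ'}
    (h : u ∘ e.symm ∈ bulk s (g.map e) δ) : u ∈ bulk s' g δ := by
  obtain ⟨h1, h2, h3⟩ := h
  refine ⟨fun i j hij => ?_, fun i => ?_, ?_⟩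
  · simpa using h1 (e i) (e j) (e.injective.ne hij)
  · simpa using h2 (e i)
  · rwa [← jac_comp e hs, Function.comp_assoc, Equiv.symm_comp_self, Function.comp_id] at h3

end Relabel

section Weights

variable {Λ : Type*} [Fintype Λ] [DecidableEq Λ]

lemma chySum_mul_left (s : Λ → Λ → ℂ) (g : Gauge Λ) (U : Set (Config Λ)) (c : ℂ)
    (f : Config Λ → ℂ) : chySum s g U (fun u => c * f u) = c * chySum s g U f := by
  unfold chySum
  rw [mul_neg, ← smul_eq_mul, smul_finsum]
  congr 2
  funext u
  rw [smul_finsum]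
  simp only [smul_eq_mul, mul_div_assoc]

/-- Solutions of the scattering equations of massless momenta. -/
lemma onShell_of_mem_Sols {m : ℕ} {k : Λ → V m} (hk : ∑ i, k i = 0) (h0 : ∀ i, k i ⬝ᵥ k i = 0)
    {g : Gauge Λ} (hg : g.Distinct) {u : Config Λ} (hu : u ∈ Sols (mandel k) g) : OnShell k u where
  sum_eq_zero := hk
  distinct := hu.2.1
  solves i z := by
    have h := solvesAll_of_mem_Sols hg hu (fun i j _ => by simp [mandel, dotProduct_comm])
      (fun i => by
        rw [sum_erase _ (by simp [mandel, h0])]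
        simp only [mandel]
        rw [← mul_sum, ← dotProduct_sum, hk, dotProduct_zero, mul_zero]) i z
    simp only [mandel, mul_assoc, mul_div_assoc, ← mul_sum] at h
    simpa [mul_div_assoc] using h

lemma resAt_two_mul (c : Λ → ℂ) (u : Config Λ) (i : Λ) :
    resAt (fun j => 2 * c j) u i = 2 * resAt c u i := by
  unfold resAt
  split_ifs <;> simp only [mul_sum, mul_assoc, mul_div_assoc]

end Weights

variable {X : Type*} [Fintype X] [DecidableEq X] {m : ℕ}

variable {A B ΛL ΛR : Type*} [Fintype A] [DecidableEq A] [Fintype B] [DecidableEq B]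
  [Fintype ΛL] [DecidableEq ΛL] [Fintype ΛR] [DecidableEq ΛR]

/-- A factorisation channel, with labels `φ`, `χ`, `ω` of the points and of the points on its two
sides, and with the pairings `sL`, `sR` of the two sides. -/
structure Factorisation (T : Theory X) (β : Bool) (I : Finset X) (K₀ : Kin X m)
    (φ : A ⊕ B ≃ Bool ⊕ X) (χ : Option A ≃ ΛL) (ω : Option B ≃ ΛR) (sL : ΛL → ΛL → ℂ)
    (sR : ΛR → ΛR → ℂ) (a μ : A) (b c : B) : Prop where
  valid : T.Valid
  image : φ '' Set.range inl = chan β I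
  chanSum_eq : ∀ K : Kin X m, Admissible K →
    chanSum (fun i j => loopMandel K (φ i) (φ j)) = sTilde β I K
  admissible : Admissible K₀
  ell_ne_zero : K₀.ell ⬝ᵥ K₀.ell ≠ 0
  sTilde_eq_zero : sTilde β I K₀ = 0
  left : ∀ i j, i ≠ j → sL (χ (some i)) (χ (some j)) = loopMandel K₀ (φ (.inl i)) (φ (.inl j))
  right : ∀ i j, i ≠ j → sR (ω (some i)) (ω (some j)) = loopMandel K₀ (φ (.inr i)) (φ (.inr j))
  node : ∀ j, sR (ω (some j)) (ω none) = ∑ i, loopMandel K₀ (φ (.inr j)) (φ (.inl i))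
  ne_left : a ≠ μ
  ne_right : b ≠ c
  genericL : Generic sL (Gauge.map χ ⟨some a, some μ, none⟩)
  genericR : Generic sR (Gauge.map ω ⟨none, some b, some c⟩)
  calF_ne_zero : ∀ v ∈ Sols sL (Gauge.map χ ⟨some a, some μ, none⟩),
    ∀ w ∈ Sols sR (Gauge.map ω ⟨none, some b, some c⟩),
      calF (fun i j => loopMandel K₀ (φ (.inl i)) (φ (.inr j))) (fun i => v (χ (some i)))
        (w (ω none)) (fun j => w (ω (some j))) ≠ 0

namespace Factorisation

variable {T : Theory X} {β : Bool} {I : Finset X} {K₀ : Kin X m} {φ : A ⊕ B ≃ Bool ⊕ X}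
  {χ : Option A ≃ ΛL} {ω : Option B ≃ ΛR} {sL : ΛL → ΛL → ℂ} {sR : ΛR → ΛR → ℂ} {a μ : A} {b c : B}

lemma channel (h : Factorisation T β I K₀ φ χ ω sL sR a μ b c) :
    Channel (fun (K : Kin X m) i j => loopMandel K (φ i) (φ j)) K₀ (fun i j => sL (χ i) (χ j))
      (fun i j => sR (ω i) (ω j)) a μ b c where
  smooth i j := contDiff_loopMandel _ _
  symm K i j := loopMandel_symm _ _ _
  left := h.left
  right := h.right
  node := h.node
  ne_left := h.ne_left
  ne_right := h.ne_right
  chanSum_eq_zero := (h.chanSum_eq _ h.admissible).trans h.sTilde_eq_zero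
  genericL := generic_comp χ (fun _ _ _ => rfl) _ h.genericL
  genericR := generic_comp ω (fun _ _ _ => rfl) _ h.genericR
  calF_ne_zero v hv w hw := by
    rw [← comp_symm_mem_Sols χ (s := sL) fun _ _ _ => rfl] at hv
    rw [← comp_symm_mem_Sols ω (s := sR) fun _ _ _ => rfl] at hw
    simpa using h.calF_ne_zero _ hv _ hw

/-- The limit of the integrand at the degenerating solutions. -/
def HasLimit (_ : Factorisation T β I K₀ φ χ ω sL sR a μ b c) (F : Config ΛL → Config ΛR → ℂ) :
    Prop :=
  ∀ v ∈ Sols sL (Gauge.map χ ⟨some a, some μ, none⟩),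
    ∀ w ∈ Sols sR (Gauge.map ω ⟨none, some b, some c⟩), ∀ ε x u,
      Degeneration φ χ ω (approach β I K₀) ε x u v w →
      (∀ᶠ K in approach β I K₀, u K ∈ Sols (loopMandel K) (Gauge.map φ ⟨.inl a, .inr b, .inr c⟩)) →
      Tendsto (fun K => ε K ^ (2 * (card (Off a μ) + 1)) *
        loopInt T K (u K)) (approach β I K₀) (𝓝 (F v w))

lemma HasLimit.hasChanLimit {h : Factorisation T β I K₀ φ χ ω sL sR a μ b c}
    {F : Config ΛL → Config ΛR → ℂ} (hF : h.HasLimit F) {vw : Config (Option A) × Config (Option B)}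
    (hvw : vw ∈ sidePairs (fun i j => sL (χ i) (χ j)) (fun i j => sR (ω i) (ω j)) a μ b c) :
    HasChanLimit (fun (K : Kin X m) i j => loopMandel K (φ i) (φ j)) ⟨.inl a, .inr b, .inr c⟩
      (approach β I K₀) vw.1 vw.2 (2 * (card (Off a μ) + 1))
      (fun K u => loopInt T K (u ∘ φ.symm)) (F (vw.1 ∘ χ.symm) (vw.2 ∘ ω.symm)) := by
  obtain ⟨hv, hw⟩ := hvw
  intro ε x y hε hs hx hy
  have hs' : ∀ᶠ K in approach β I K₀, conf (ε K) (x K) (y K) ∘ φ.symm ∈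
      Sols (loopMandel K) (Gauge.map φ ⟨.inl a, .inr b, .inr c⟩) := hs.mono fun K hK =>
    (comp_symm_mem_Sols φ (s := loopMandel K) (fun _ _ _ => rfl) _ _).2 hK.2
  refine hF _ ((comp_symm_mem_Sols χ (s := sL) (fun _ _ _ => rfl) _ _).2 hv) _
    ((comp_symm_mem_Sols ω (s := sR) (fun _ _ _ => rfl) _ _).2 hw) ε x
    (fun K => conf (ε K) (x K) (y K) ∘ φ.symm) ?_ hs'
  obtain ⟨⟨-, -, hv1, hv2⟩, hv3, -⟩ := hv
  obtain ⟨⟨hw0, -, hw1, hw2⟩, hw3, -⟩ := hw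
  refine ⟨hε, hs.mono fun K hK => hK.1, fun K i => by simp [conf], fun i => by simpa using hx i,
    fun i => by simpa using hv2 (some i) (by simp), by simpa using hv1, fun j => ?_, fun j => ?_,
    by simpa using hw0, hs'.mono fun K hK => hK.2.1, fun i j hij => hv3 _ _ (χ.symm.injective.ne hij),
    fun i j hij => hw3 _ _ (ω.symm.injective.ne hij)⟩
  · simpa [conf] using hy j
  · refine hs.mono fun K hK => ?_
    obtain ⟨-, -, h1, h2⟩ := hK.2.1
    by_cases hj : j = c
    · subst hj
      have h3 : y K j = (1, 0) := h1
      have h4 : vw.2 (some j) = (1, 0) := hw1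
      simp [conf, h3, h4]
    · have h3 : (y K j).2 = 1 := h2 (.inr j) (by simpa using hj)
      have h4 : (vw.2 (some j)).2 = 1 := hw2 (some j) (by simpa using hj)
      simp [conf, h3, h4]

/-- The residue in a channel. -/
theorem hasResidue (h : Factorisation T β I K₀ φ χ ω sL sR a μ b c) {J : Type*} [Fintype J]
    {fL : J → Config ΛL → ℂ} {fR : J → Config ΛR → ℂ}
    (hF : h.HasLimit fun v w => ∑ α, fL α v * fR α w) :
    HasResidue T (Gauge.map φ ⟨.inl a, .inr b, .inr c⟩) β I (φ (.inl μ)) K₀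
      ((K₀.ell ⬝ᵥ K₀.ell)⁻¹ * ∑ α, chySum sL (Gauge.map χ ⟨some a, some μ, none⟩) Set.univ (fL α) *
          chySum sR (Gauge.map ω ⟨none, some b, some c⟩) Set.univ (fR α)) := by
  have hl : approach β I K₀ ≤ 𝓝 K₀ := nhdsWithin_le_nhds
  have hK : ∀ᶠ K in approach β I K₀, Admissible K ∧ sTilde β I K ≠ 0 := eventually_mem_nhdsWithin
  have hst : ∀ᶠ K : Kin X m in approach β I K₀, chanSum (fun i j => loopMandel K (φ i) (φ j)) ≠ 0 :=
    hK.mono fun K hK => by rw [h.chanSum_eq K hK.1]; exact hK.2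
  have hell : Tendsto (fun K : Kin X m => (K.ell ⬝ᵥ K.ell)⁻¹) (approach β I K₀)
      (𝓝 (K₀.ell ⬝ᵥ K₀.ell)⁻¹) := by
    refine Tendsto.inv₀ ((Continuous.tendsto ?_ K₀).mono_left hl) h.ell_ne_zero
    simp only [Kin.ell, dotProduct]
    fun_prop
  have hamp : ∀ (U : Set (Config (Bool ⊕ X))) (U' : Set (Config (A ⊕ B))),
      {u | u ∘ φ.symm ∈ U} = U' → ∀ R, Tendsto (fun K : Kin X m =>
        chanSum (fun i j => loopMandel K (φ i) (φ j)) * chySum (fun i j => loopMandel K (φ i) (φ j))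
          ⟨.inl a, .inr b, .inr c⟩ U' fun u => loopInt T K (u ∘ φ.symm)) (approach β I K₀) (𝓝 R) →
      Tendsto (fun K : Kin X m => sTilde β I K *
        loopAmp T (Gauge.map φ ⟨.inl a, .inr b, .inr c⟩) U K) (approach β I K₀)
        (𝓝 ((K₀.ell ⬝ᵥ K₀.ell)⁻¹ * R)) := by
    rintro U _ rfl R hR
    refine (hell.mul hR).congr' (hK.mono fun K hK => ?_)
    beta_reduce
    rw [h.chanSum_eq K hK.1]
    unfold loopAmp
    rw [chySum_comp φ (s := loopMandel K) fun _ _ _ => rfl]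
    exact mul_left_comm _ _ _
  simp_rw [chySum_comp χ (s := sL) (fun _ _ _ => rfl), chySum_comp ω (s := sR) (fun _ _ _ => rfl)]
  have hlim := fun vw hvw => hF.hasChanLimit (vw := vw) hvw
  constructor
  · obtain ⟨δ₀, hδ₀, H⟩ := h.channel.tendsto_degen hl hst
      (fL := fun α v => fL α (v ∘ χ.symm)) (fR := fun α w => fR α (w ∘ ω.symm)) hlim
    refine ⟨δ₀, hδ₀, fun δ h0 h1 => ?_⟩
    obtain ⟨ρ₀, hρ₀, H⟩ := H δ h0 h1
    refine ⟨ρ₀, hρ₀, fun ρ h2 h3 => hamp _ _ ?_ _ (H ρ h2 h3).2⟩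
    rw [← h.image]
    exact Set.ext fun u => comp_symm_mem_degen φ _ _ _ _ u
  · intro δ hδ hsub
    refine hamp _ _ rfl _ (h.channel.tendsto_full hl hst
      (fL := fun α v => fL α (v ∘ χ.symm)) (fR := fun α w => fR α (w ∘ ω.symm)) hlim ?_ hδ ?_)
    · intro u u₀ h1 h2 h3
      refine Separating.loopInt (u₀ := u₀ ∘ φ.symm) h.valid hl (u := fun K => u K ∘ φ.symm)
        ⟨fun i j hij => h1 _ _ (φ.symm.injective.ne hij), fun K i => h2 K _, fun i => h3 _⟩
    · intro ρ hρ
      filter_upwards [hsub ρ hρ] with K hK u hu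
      have := hK ((comp_symm_mem_Sols φ (s := loopMandel K) (fun _ _ _ => rfl) _ _).2 hu)
      rw [← h.image] at this
      exact this.imp (comp_symm_mem_degen φ _ _ _ _ u).1
        (comp_symm_mem_bulk φ (fun _ _ _ => rfl) _ _)

lemma hasResidue_of_weights (h : Factorisation T β I K₀ φ χ ω sL sR a μ b c) {J : Type*} [Fintype J]
    (W : J → ℂ) {fL : J → Config ΛL → ℂ} {fR : J → Config ΛR → ℂ}
    (hF : h.HasLimit fun v w => ∑ α, W α * (fL α v * fR α w)) {R : ℂ}
    (hR : R = (K₀.ell ⬝ᵥ K₀.ell)⁻¹ * ∑ α, W α *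
      (chySum sL (Gauge.map χ ⟨some a, some μ, none⟩) Set.univ (fL α) *
        chySum sR (Gauge.map ω ⟨none, some b, some c⟩) Set.univ (fR α))) :
    HasResidue T (Gauge.map φ ⟨.inl a, .inr b, .inr c⟩) β I (φ (.inl μ)) K₀ R := by
  rw [hR]
  simp_rw [← mul_assoc] at hF
  simp_rw [← mul_assoc (W _), ← chySum_mul_left sL]
  exact h.hasResidue hF

/-- The number of free points of the channel. -/
lemma card_free (h : Factorisation T β I K₀ φ χ ω sL sR a μ b c) :
    2 * (card (Off a μ) + 1) = 2 * (card A - 1) := by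
  have h1 : card (Off a μ) = card A - 2 := by
    rw [card_subtype]
    have : (univ.filter fun i : A => i ≠ a ∧ i ≠ μ) = ({a, μ} : Finset A)ᶜ := by
      ext i
      simp
    rw [this, Finset.card_compl, Finset.card_pair h.ne_left]
  have h2 : 2 ≤ card A := by
    rw [← Finset.card_pair h.ne_left]
    exact Finset.card_le_univ _
  omega

end Factorisation

lemma tendsto_two_mul {κ : Type*} {l : Filter κ} {ε f g : κ → ℂ} {N : ℕ} {z w : ℂ}
    (hf : Tendsto (fun n => ε n ^ N * f n) l (𝓝 z)) (hg : Tendsto (fun n => ε n ^ N * g n) l (𝓝 w)) :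
    Tendsto (fun n => ε n ^ (2 * N) * (f n * g n)) l (𝓝 (z * w)) :=
  (hf.mul hg).congr fun n => by ring

lemma tendsto_loopMom {K₀ : Kin X m} {l : Filter (Kin X m)} (hl : l ≤ 𝓝 K₀) (i : Bool ⊕ X) :
    Tendsto (fun K : Kin X m => loopMom K i) l (𝓝 (loopMom K₀ i)) :=
  (Continuous.tendsto (by
    rcases i with (_ | _) | i <;> simp only [loopMom, marked, elim_inl, elim_inr,
      cond_true, cond_false, Kin.ell, Kin.k] <;> fun_prop) K₀).mono_left hl

lemma continuous_eps : Continuous fun K : Kin X m => K.eps := by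
  unfold Kin.eps
  fun_prop

lemma continuous_epst : Continuous fun K : Kin X m => K.epst := by
  unfold Kin.epst
  fun_prop

section Chan

variable {T : Theory X} {I : Finset X} {K₀ : Kin X m} {a μ : I}
  {b c : Bool ⊕ Out I}

lemma sum_loopMom (K : Kin X m) : ∑ i, loopMom K i = ∑ i, K.k i := by
  simp [loopMom, marked]

lemma sum_kinI (K : Kin X m) (I : Finset X) (hK : ∑ i, K.k i = 0) (ν ν' : V m) :
    ∑ i, loopMom (kinI K I ν ν') i = 0 := by
  rw [sum_loopMom, sum_option, ← hK, ← Fintype.sum_subtype_add_sum_subtype (· ∈ I)]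
  congr 1
  · exact (sum_coe_sort I fun i => K.k i).symm.trans (by congr!)

lemma sum_loopMandel {Y : Type*} [Fintype Y] [DecidableEq Y] {K : Kin Y m} (hK : ∑ i, K.k i = 0) (i : Bool ⊕ Y) :
    ∑ j, loopMandel K i j = 0 := by
  rcases i with i | i
  · simp only [sum_sum_type, loopMandel, mandel, ← mul_sum, ← dotProduct_sum,
      sum_const_zero, zero_add]
    simp [loopMom, marked, hK]
  · have h : ∀ j, loopMandel K (.inr i) j = 2 * (loopMom K (.inr i) ⬝ᵥ loopMom K j) := by
      rintro (j | j) <;> rfl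
    simp_rw [h, ← mul_sum, ← dotProduct_sum, sum_loopMom, hK, dotProduct_zero, mul_zero]

lemma sum_momI (K : Kin X m) (I : Finset X) : ∑ i, momI K I i = 0 := by
  rw [sum_option]
  simp only [momI, Option.elim, kSum]
  rw [sum_coe_sort I fun i => K.k i]
  simp

lemma factorisation_chan (hT : T.Valid) (haμ : a ≠ μ) (hbc : b ≠ c) (hK : Admissible K₀)
    (hell : K₀.ell ⬝ᵥ K₀.ell ≠ 0) (hst : sTilde false I K₀ = 0)
    (hL : Generic (mandel (momI K₀ I)) ⟨some a, some μ, none⟩)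
    (hR : Generic (loopMandel (kinI K₀ I 0 0)) ⟨.inr none, toR b, toR c⟩)
    (hF : ∀ v ∈ Sols (mandel (momI K₀ I)) ⟨some a, some μ, none⟩,
      ∀ w ∈ Sols (loopMandel (kinI K₀ I 0 0)) ⟨.inr none, toR b, toR c⟩,
      calF (fun (i : I) (j : Bool ⊕ Out I) =>
          loopMandel K₀ (inr i.1) (toX j))
        (fun i => v (some i)) (w (inr none)) (fun j => w (toR j)) ≠ 0) :
    Factorisation T false I K₀ (chanEquiv I) (Equiv.refl _) (nodeEquiv _) (mandel (momI K₀ I))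
      (loopMandel (kinI K₀ I 0 0)) a μ b c where
  valid := hT
  image := range_chan I
  chanSum_eq K hK := chanSum_chan hK I
  admissible := hK
  ell_ne_zero := hell
  sTilde_eq_zero := hst
  left i j _ := rfl
  right i j _ := by rcases i with i | i <;> rcases j with j | j <;> rfl
  node j := by
    have h : ∀ v : V m, 2 * (v ⬝ᵥ kSum K₀ I) = ∑ i : I, 2 * (v ⬝ᵥ K₀.k i.1) := fun v => by
      rw [← mul_sum, ← dotProduct_sum, sum_coe_sort I fun i => K₀.k i, kSum]
    rcases j with (_ | _) | j <;> exact h _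
  ne_left := haμ
  ne_right := hbc
  genericL := hL
  genericR := hR
  calF_ne_zero := hF

/-- A factorisation at a node that carries an external momentum. -/
abbrev ChanFact (T : Theory X) (I : Finset X) (K₀ : Kin X m) (a μ : I)
    (b c : Bool ⊕ Out I) : Prop :=
  Factorisation T false I K₀ (chanEquiv I) (Equiv.refl _) (nodeEquiv _) (mandel (momI K₀ I))
    (loopMandel (kinI K₀ I 0 0)) a μ b c

lemma ChanFact.chanLimit (h : ChanFact T I K₀ a μ b c) {v : Config (Option I)}
    {w : Config (Bool ⊕ Option (Out I))} (hv : v ∈ Sols (mandel (momI K₀ I)) ⟨some a, some μ, none⟩)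
    (hw : w ∈ Sols (loopMandel (kinI K₀ I 0 0)) ⟨.inr none, toR b, toR c⟩) {ε : Kin X m → ℂ}
    {x : Kin X m → I → ℂ} {u : Kin X m → Config (Bool ⊕ X)}
    (D : Degeneration (chanEquiv I) (Equiv.refl _) (nodeEquiv _) (approach false I K₀) ε x u v w)
    (hu : ∀ᶠ K in approach false I K₀, u K ∈ Sols (loopMandel K) ⟨.inr a.1, toX b, toX c⟩)
    {f : Kin X m → X → V m} (hf : Continuous f) (hf' : ∀ i, f K₀ i ⬝ᵥ K₀.k i = 0) :
    ChanLimit I a (approach false I K₀) ε x u v w loopMom f (loopMom K₀) (f K₀) (momI K₀ I)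
      (loopMom (kinI K₀ I 0 0)) where
  toDegeneration := D
  tendsto_mom := tendsto_loopMom nhdsWithin_le_nhds
  tendsto_pol i := (((continuous_apply i).comp hf).tendsto K₀).mono_left nhdsWithin_le_nhds
  momL _ := rfl
  momR j := by rcases j with j | j <;> rfl
  momN := (sum_coe_sort I fun i => K₀.k i).symm
  node := rfl
  transverse := hf'
  onShellL := onShell_of_mem_Sols (sum_momI K₀ I) (by
    rintro (_ | i)
    · have := h.sTilde_eq_zero
      simp only [sTilde, Bool.false_eq_true, if_false] at this
      simp [momI, this]
    · exact (h.admissible.2 i.1).1) ⟨by simpa using h.ne_left, by simp, by simp⟩ hv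
  nodeR := by
    have h1 : ∀ i, ∑ j ∈ univ.erase i, loopMandel (kinI K₀ I 0 0) i j = 0 := by
      intro i
      rw [sum_erase, sum_loopMandel]
      · exact sum_loopMom (kinI K₀ I 0 0) ▸ sum_kinI K₀ I h.admissible.1 0 0
      · rcases i with i | _ | i
        · rfl
        · have := h.sTilde_eq_zero
          simp only [sTilde, Bool.false_eq_true, if_false] at this
          simp [loopMandel, mandel, loopMom, marked, kinI, Kin.k, this]
        · exact loopMandel_self h.admissible (.inr i.1)
    have hz : w (.inr none) = (0, 1) := hw.1.1
    have h2 := (solvesAll_of_mem_Sols (g := ⟨.inr none, toR b, toR c⟩) ⟨by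
        rcases b with b | b <;> simp [toR], by rcases c with c | c <;> simp [toR], fun h' =>
        h.ne_right (Sum.map_injective.2 ⟨Function.injective_id, some_injective _⟩ h')⟩ hw (fun i j _ => loopMandel_symm _ _ _) h1).resAt_eq_zero
      (.inr none) (fun j hj => hw.2.1 _ _ hj.symm) (h1 _) (1, 0) (by rw [hz]; simp [br])
    rw [polP_eq_resAt]
    have h3 : loopMandel (kinI K₀ I 0 0) (.inr none) = fun j => 2 *
        (loopMom (kinI K₀ I 0 0) (.inr none) ⬝ᵥ loopMom (kinI K₀ I 0 0) j) := by
      funext j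
      rcases j with j | j <;> rfl
    rw [h3, resAt_two_mul] at h2
    exact (mul_eq_zero.1 h2).resolve_left two_ne_zero
  scat := hu.mono fun K hK i hi => by
    have hfree : Gauge.Free ⟨inr a.1, toX b, toX c⟩ (inr i.1 : Bool ⊕ X) := by
      refine ⟨fun h => hi (Subtype.ext (inr_injective h)), ?_, ?_⟩
      · rcases b with b | b
        · simp [toX]
        · simpa [toX] using fun h : i.1 = b.1 => b.2 (h ▸ i.2)
      · rcases c with b | b
        · simp [toX]
        · simpa [toX] using fun h : i.1 = b.1 => b.2 (h ▸ i.2)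
    have h1 := hK.2.2 _ hfree
    rw [scatEq_eq_resAt _ (by rw [hK.1.2.2.2 _ hfree.2.2]; exact one_ne_zero)] at h1
    have h3 : loopMandel K (.inr i.1) = fun j => 2 * (loopMom K (.inr i.1) ⬝ᵥ loopMom K j) := by
      funext j
      rcases j with j | j <;> rfl
    rw [h3, resAt_two_mul] at h1
    exact (mul_eq_zero.1 h1).resolve_left two_ne_zero

lemma approach_eq_bot (h : ¬∃ x, x ∉ I) : approach false I K₀ = ⊥ := by
  have : {K : Kin X m | Admissible K ∧ sTilde false I K ≠ 0} = ∅ := by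
    ext K
    simp only [Set.mem_ofPred_eq, Set.mem_empty_iff_false, iff_false, not_and, not_not]
    intro hK
    push Not at h
    have h1 : kSum K I = 0 := by rw [kSum, Finset.eq_univ_iff_forall.2 h, hK.1]
    simp [sTilde, h1]
  rw [approach, this, nhdsWithin_empty]

lemma tendsto_cptHalf_chan_approach {v : Config (Option I)} {w : Config (Bool ⊕ Option (Out I))}
    {ε : Kin X m → ℂ} {x : Kin X m → I → ℂ} {u : Kin X m → Config (Bool ⊕ X)}
    (D : Degeneration (chanEquiv I) (Equiv.refl _) (nodeEquiv _) (approach false I K₀) ε x u v w)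
    {q : List X} (hq : IsOrdering q) (a : I) :
    Tendsto (fun K => ε K ^ (I.card - 1) * cptHalf q (u K)) (approach false I K₀)
      (𝓝 (∑ r ∈ cuts I q, ptHalf ((inBlock I q r).map some ++ [none]) v *
        cptHalf (none :: (outBlock I q r).map some) w)) := by
  by_cases h : ∃ x, x ∉ I
  · obtain ⟨y, hy⟩ := h
    refine D.tendsto_cptHalf_chan hq (Finset.card_pos.2 ⟨a.1, a.2⟩)
      (lt_of_lt_of_le (Nat.lt_succ_self _) ?_)
    rw [Nat.succ_eq_add_one, ← Finset.card_insert_of_notMem hy]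
    exact hq.card_le _
  · rw [approach_eq_bot h]
    exact tendsto_bot

namespace ChanFact

lemma hasResidue_sum (h : ChanFact T I K₀ a μ b c) {ι ι' : Type*} [Fintype ι] [Fintype ι']
    {fL : ι → ι' → Config (Option I) → ℂ} {fR : ι → ι' → Config (Bool ⊕ Option (Out I)) → ℂ}
    (hF : h.HasLimit fun v w => ∑ i, ∑ j, fL i j v * fR i j w) :
    HasResidue T ⟨.inr a.1, toX b, toX c⟩ false I (.inr μ.1) K₀ (∑ i, ∑ j,
      treeAmp (momI K₀ I) ⟨some a, some μ, none⟩ (fL i j) * ((K₀.ell ⬝ᵥ K₀.ell)⁻¹ *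
        chySum (loopMandel (kinI K₀ I 0 0)) ⟨.inr none, toR b, toR c⟩ Set.univ (fR i j))) := by
  simp_rw [← Fintype.sum_prod_type' (f := fun i j => fL i j _ * fR i j _)] at hF
  refine (h.hasResidue_of_weights (fun _ : ι × ι' => 1) (fL := fun α => fL α.1 α.2)
    (fR := fun α => fR α.1 α.2) (by simpa using hF) ?_)
  simp_rw [sum_prod_type, mul_sum, one_mul, mul_left_comm _ (K₀.ell ⬝ᵥ K₀.ell)⁻¹]
  rfl

/-- The factorisation into a tree amplitude and a one-loop integrand. -/
theorem hasResidue_residueI (h : ChanFact T I K₀ a μ b c) {e : Fin (m - 2) → V m}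
    (he : T.Spinning → PolBasis (kSum K₀ I) e) :
    HasResidue T ⟨.inr a.1, toX b, toX c⟩ false I (.inr μ.1) K₀
      (residueI T I K₀ e a ⟨some a, some μ, none⟩ ⟨.inr none, toR b, toR c⟩) := by
  have hcard : 2 * (card {i : I // i ≠ a ∧ i ≠ μ} + 1) = 2 * (I.card - 1) := by
    rw [h.card_free, card_coe]
  have hcard' : card {i : I // i ≠ a} = I.card - 1 := by
    rw [← card_coe I]
    simp
  have hns := fun (d : ℕ) (he : PolBasis (kSum K₀ I) e) v hv w hw ε x u D hu f hf hf' =>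
    hcard' ▸ (h.chanLimit (v := v) hv (w := w) hw (ε := ε) (x := x) (u := u) D hu (f := f) hf
      hf').tendsto_nsHalf d he
  have hsc := fun (he : PolBasis (kSum K₀ I) e) v hv w hw ε x u D hu f hf hf' =>
    hcard' ▸ (h.chanLimit (v := v) hv (w := w) hw (ε := ε) (x := x) (u := u) D hu (f := f) hf
      hf').tendsto_scalHalf he
  have h1 : ∀ i, K₀.eps i ⬝ᵥ K₀.k i = 0 := fun i => (h.admissible.2 i).2.1
  have h2 : ∀ i, K₀.epst i ⬝ᵥ K₀.k i = 0 := fun i => (h.admissible.2 i).2.2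
  cases T with
  | nGon =>
    have hF : h.HasLimit fun v w => ∑ α : Empty, α.elim * (α.elim * α.elim) := by
      intro v hv w hw ε x u D hu
      have : I.card ≠ 1 := fun h3 => h.ne_left (Subtype.ext
        (Finset.card_le_one.1 h3.le _ a.2 _ μ.2))
      have h4 := Finset.card_pos.2 ⟨a.1, a.2⟩
      rw [hcard]
      simpa [loopInt] using D.tendsto_ngonInt_chan (N := 2 * (I.card - 1)) (by omega)
    exact h.hasResidue_of_weights (fun α : Empty => α.elim) (fL := fun α => α.elim)
      (fR := fun α => α.elim) hF (by rw [Fintype.sum_empty, mul_zero]; rfl)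
  | biAdjoint q q' =>
    simp_rw [residueI, ← sum_coe_sort (cuts _ _)]
    refine h.hasResidue_sum fun v hv w hw ε x u D hu => ?_
    rw [hcard]
    refine (tendsto_two_mul (tendsto_cptHalf_chan_approach D h.valid.1 a)
      (tendsto_cptHalf_chan_approach D h.valid.2 a)).trans_eq (congrArg 𝓝 ?_)
    simp_rw [← sum_coe_sort (cuts _ _), sum_mul_sum]
    exact sum_congr rfl fun r _ => sum_congr rfl fun r' _ => (mul_mul_mul_comm _ _ _ _).trans rfl
  | yangMills d q =>
    rw [residueI, ← sum_coe_sort (cuts I q)]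
    refine h.hasResidue_sum fun v hv w hw ε x u D hu => ?_
    rw [hcard]
    refine (tendsto_two_mul (hns d (he trivial) v hv w hw ε x u D hu _ continuous_eps h1)
      (tendsto_cptHalf_chan_approach D h.valid a)).trans_eq (congrArg 𝓝 ?_)
    rw [mul_comm, sum_mul_sum, ← sum_coe_sort (cuts I q)]
    refine sum_congr rfl fun r _ => sum_congr rfl fun s _ => ?_
    rw [mul_comm, mul_mul_mul_comm]
    rfl
  | gravity d =>
    refine h.hasResidue_sum fun v hv w hw ε x u D hu => ?_
    rw [hcard]
    refine (tendsto_two_mul (hns d (he trivial) v hv w hw ε x u D hu _ continuous_eps h1)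
      (hns d (he trivial) v hv w hw ε x u D hu _ continuous_epst h2)).trans_eq (congrArg 𝓝 ?_)
    rw [sum_mul_sum]
    refine sum_congr rfl fun r _ => sum_congr rfl fun s _ => ?_
    rw [mul_mul_mul_comm]
    rfl
  | pureGravity d =>
    refine h.hasResidue_sum fun v hv w hw ε x u D hu => ?_
    rw [hcard]
    have h3 := (tendsto_two_mul (hns d (he trivial) v hv w hw ε x u D hu _ continuous_eps h1)
      (hns d (he trivial) v hv w hw ε x u D hu _ continuous_epst h2)).sub
        ((tendsto_two_mul (hsc (he trivial) v hv w hw ε x u D hu _ continuous_eps h1)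
          (hsc (he trivial) v hv w hw ε x u D hu _ continuous_epst h2)).const_mul (alphaB d))
    refine (h3.congr fun K => ?_).trans_eq (congrArg 𝓝 ?_)
    · rw [loopInt]
      ring
    · rw [sum_mul_sum, sum_mul_sum, mul_sum, ← sum_sub_distrib]
      refine sum_congr rfl fun r _ => ?_
      rw [mul_sum, ← sum_sub_distrib]
      refine sum_congr rfl fun s _ => ?_
      rw [mul_mul_mul_comm, mul_mul_mul_comm _ (scalHalf _ _ _), mul_left_comm (alphaB d),
        ← mul_sub]
      rfl

end ChanFact

end Chan

variable {T : Theory X} {I : Finset X} {K₀ : Kin X m} {a μ : Option I}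
  {b c : Option (Out I)} {η : V m}

/-- `η` puts the loop momentum on shell without changing its products with the momenta. -/
structure CutShift (K₀ : Kin X m) (η : V m) : Prop where
  sq : η ⬝ᵥ η = -(K₀.ell ⬝ᵥ K₀.ell)
  ell : η ⬝ᵥ K₀.ell = 0
  mom : ∀ i, η ⬝ᵥ K₀.k i = 0

namespace CutShift

lemma kSum_eq_zero (hη : CutShift K₀ η) (I : Finset X) : η ⬝ᵥ kSum K₀ I = 0 := by
  rw [kSum, dotProduct_sum]
  exact sum_eq_zero fun i _ => hη.mom i

lemma cut_sq (hη : CutShift K₀ η) : (K₀.ell + η) ⬝ᵥ (K₀.ell + η) = 0 := by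
  rw [add_dotProduct, dotProduct_add, dotProduct_add, hη.sq, hη.ell, dotProduct_comm K₀.ell η,
    hη.ell]
  ring

lemma node_sq (hη : CutShift K₀ η) (hst : sTilde true I K₀ = 0) :
    (K₀.ell + η + kSum K₀ I) ⬝ᵥ (K₀.ell + η + kSum K₀ I) = 0 := by
  rw [sTilde, if_pos rfl] at hst
  rw [add_dotProduct _ (kSum K₀ I), dotProduct_add _ _ (kSum K₀ I), hη.cut_sq, dotProduct_add,
    dotProduct_comm (kSum K₀ I), add_dotProduct, hη.kSum_eq_zero]
  linear_combination hst

end CutShift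

lemma sum_momL (K : Kin X m) (I : Finset X) (p : V m) : ∑ i, momL K I p i = 0 := by
  rw [sum_sum_type, sum_bool]
  simp only [momL, marked, elim_inl, elim_inr, cond_true, cond_false, kSum]
  rw [sum_coe_sort I fun i => K.k i]
  abel

lemma sum_momR (K : Kin X m) (I : Finset X) (hK : ∑ i, K.k i = 0) (p : V m) :
    ∑ i, momR K I p i = 0 := by
  rw [sum_sum_type, sum_bool, ← hK, ← Fintype.sum_subtype_add_sum_subtype (· ∈ I)]
  simp only [momR, marked, elim_inl, elim_inr, cond_true, cond_false, kSum]
  rw [← sum_coe_sort I fun i => K.k i, add_neg_eq_of_eq_add (add_comm _ _)]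
  congr 1
  congr!

/-- A factorisation at a node that carries the loop momentum. -/
abbrev CutFact (T : Theory X) (I : Finset X) (K₀ : Kin X m) (p : V m) (a μ : Option I)
    (b c : Option (Out I)) : Prop :=
  Factorisation T true I K₀ (cutEquiv I) (legEquiv true _) (legEquiv false _)
    (mandel (momL K₀ I p)) (mandel (momR K₀ I p)) a μ b c

lemma factorisation_cut (hη : CutShift K₀ η) (hT : T.Valid) (haμ : a ≠ μ) (hbc : b ≠ c)
    (hK : Admissible K₀) (hell : K₀.ell ⬝ᵥ K₀.ell ≠ 0) (hst : sTilde true I K₀ = 0)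
    (hL : Generic (mandel (momL K₀ I (K₀.ell + η))) ⟨leg true a, leg true μ, inl false⟩)
    (hR : Generic (mandel (momR K₀ I (K₀.ell + η))) ⟨inl true, leg false b, leg false c⟩)
    (hF : ∀ v ∈ Sols (mandel (momL K₀ I (K₀.ell + η))) ⟨leg true a, leg true μ, inl false⟩,
      ∀ w ∈ Sols (mandel (momR K₀ I (K₀.ell + η))) ⟨inl true, leg false b, leg false c⟩,
      calF (fun (i : Option I) (j : Option (Out I)) =>
          loopMandel K₀ (toX (leg true i)) (toX (leg false j)))
        (fun i => v (leg true i)) (w (inl true)) (fun j => w (leg false j)) ≠ 0) :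
    CutFact T I K₀ (K₀.ell + η) a μ b c where
  valid := hT
  image := range_cut I
  chanSum_eq K hK := chanSum_cut hK I
  admissible := hK
  ell_ne_zero := hell
  sTilde_eq_zero := hst
  left i j hij := by
    have h : ∀ k : X, (K₀.ell + η) ⬝ᵥ K₀.k k = K₀.ell ⬝ᵥ K₀.k k := fun k => by
      rw [add_dotProduct, hη.mom, add_zero]
    rcases i with _ | i <;> rcases j with _ | j
    · exact absurd rfl hij
    · exact congrArg (2 * ·) (h j)
    · exact congrArg (2 * ·) ((dotProduct_comm _ _).trans ((h i).trans (dotProduct_comm _ _)))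
    · rfl
  right i j hij := by
    have h : ∀ k : X, -(K₀.ell + η) ⬝ᵥ K₀.k k = -K₀.ell ⬝ᵥ K₀.k k := fun k => by
      rw [neg_dotProduct, add_dotProduct, hη.mom, add_zero, neg_dotProduct]
    rcases i with _ | i <;> rcases j with _ | j
    · exact absurd rfl hij
    · exact congrArg (2 * ·) (h j)
    · exact congrArg (2 * ·) ((dotProduct_comm _ _).trans ((h i).trans (dotProduct_comm _ _)))
    · rfl
  node j := by
    have h : ∀ v : V m, 2 * (v ⬝ᵥ kSum K₀ I) = ∑ i : I, 2 * (v ⬝ᵥ K₀.k i.1) := fun v => by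
      rw [← mul_sum, ← dotProduct_sum, sum_coe_sort I fun i => K₀.k i, kSum]
    rw [sum_option]
    rcases j with _ | j
    · refine Eq.trans (b := 2 * (-(K₀.ell + η) ⬝ᵥ (K₀.ell + η + kSum K₀ I))) rfl ?_
      refine Eq.trans ?_ (congrArg (0 + ·) (h (-K₀.ell)))
      rw [dotProduct_add, neg_dotProduct, neg_dotProduct, neg_dotProduct, hη.cut_sq,
        add_dotProduct, hη.kSum_eq_zero]
      ring
    · refine Eq.trans (b := 2 * (K₀.k j.1 ⬝ᵥ (K₀.ell + η + kSum K₀ I))) rfl ?_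
      refine Eq.trans ?_ (congrArg (2 * (K₀.k j.1 ⬝ᵥ K₀.ell) + ·) (h (K₀.k j.1)))
      rw [dotProduct_add, dotProduct_add, dotProduct_comm _ η, hη.mom]
      ring
  ne_left := haμ
  ne_right := hbc
  genericL := hL
  genericR := hR
  calF_ne_zero := hF

lemma leg_injective (β : Bool) {Y : Type*} : Function.Injective (leg β (Y := Y)) := by
  rintro (_ | i) (_ | j) h <;> simp_all [leg]

lemma leg_ne_inl (β : Bool) {Y : Type*} (o : Option Y) : leg β o ≠ inl (!β) := by
  rcases o with _ | i <;> simp [leg]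

namespace CutFact

section Limit

variable {v : Config (Bool ⊕ I)} {w : Config (Bool ⊕ Out I)}
  {ε : Kin X m → ℂ} {x : Kin X m → Option I → ℂ} {u : Kin X m → Config (Bool ⊕ X)}

lemma onShell_left (h : CutFact T I K₀ (K₀.ell + η) a μ b c) (hη : CutShift K₀ η)
    (hv : v ∈ Sols (mandel (momL K₀ I (K₀.ell + η))) ⟨leg true a, leg true μ, .inl false⟩) :
    OnShell (momL K₀ I (K₀.ell + η)) v :=
  onShell_of_mem_Sols (sum_momL K₀ I _) (by
      rintro ((_ | _) | i)
      · exact (neg_dotProduct_neg _ _).trans (hη.node_sq h.sTilde_eq_zero)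
      · exact hη.cut_sq
      · exact (h.admissible.2 i.1).1)
    ⟨(leg_injective true).ne h.ne_left, leg_ne_inl true a, leg_ne_inl true μ⟩ hv

lemma onShell_right (h : CutFact T I K₀ (K₀.ell + η) a μ b c) (hη : CutShift K₀ η)
    (hw : w ∈ Sols (mandel (momR K₀ I (K₀.ell + η))) ⟨.inl true, leg false b, leg false c⟩) :
    OnShell (momR K₀ I (K₀.ell + η)) w :=
  onShell_of_mem_Sols (sum_momR K₀ I h.admissible.1 _) (by
      rintro ((_ | _) | i)
      · exact (neg_dotProduct_neg _ _).trans hη.cut_sq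
      · exact hη.node_sq h.sTilde_eq_zero
      · exact (h.admissible.2 i.1).1)
    ⟨(leg_ne_inl false b).symm, (leg_ne_inl false c).symm, (leg_injective false).ne h.ne_right⟩ hw

lemma cutLimit
    (D : Degeneration (cutEquiv I) (legEquiv true _) (legEquiv false _) (approach true I K₀)
      ε x u v w)
    {f : Kin X m → X → V m} (hf : Continuous f) (hf' : ∀ i, η ⬝ᵥ f K₀ i = 0) :
    CutLimit I (approach true I K₀) ε x u v w loopMom f (loopMom K₀) (f K₀)
      (momL K₀ I (K₀.ell + η)) (momR K₀ I (K₀.ell + η)) where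
  toDegeneration := D
  left _ := rfl
  right _ := rfl
  leg_left i := by
    refine Eq.trans (b := f K₀ i.1 ⬝ᵥ (K₀.ell + η)) rfl ?_
    rw [dotProduct_add, dotProduct_comm _ η, hf', add_zero]
    rfl
  leg_right i := by
    refine Eq.trans (b := f K₀ i.1 ⬝ᵥ -(K₀.ell + η)) rfl ?_
    rw [neg_add, dotProduct_add, dotProduct_neg _ η, dotProduct_comm _ η, hf', neg_zero, add_zero]
    rfl
  node i := by
    refine Eq.trans (b := f K₀ i.1 ⬝ᵥ (K₀.ell + η + kSum K₀ I)) rfl ?_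
    rw [dotProduct_add, dotProduct_add, dotProduct_comm _ η, hf', add_zero, kSum,
      ← sum_coe_sort I fun i => K₀.k i, dotProduct_sum]
    rfl
  tendsto_mom := tendsto_loopMom nhdsWithin_le_nhds
  tendsto_pol i := (((continuous_apply i).comp hf).tendsto K₀).mono_left nhdsWithin_le_nhds

end Limit

set_option maxHeartbeats 1600000 in
/-- The factorisation into two tree amplitudes. -/
theorem hasResidue_residueII (h : CutFact T I K₀ (K₀.ell + η) a μ b c) (hη : CutShift K₀ η)
    {e e' : Fin (m - 2) → V m}
    (he : T.Spinning → (∀ i, η ⬝ᵥ K₀.eps i = 0 ∧ η ⬝ᵥ K₀.epst i = 0) ∧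
      PolBasis (K₀.ell + η) e ∧ PolBasis (K₀.ell + η + kSum K₀ I) e') :
    HasResidue T ⟨toX (leg true a), toX (leg false b), toX (leg false c)⟩ true I (toX (leg true μ))
      K₀ (residueII T I K₀ (K₀.ell + η) e e' ⟨leg true a, leg true μ, .inl false⟩
        ⟨.inl true, leg false b, leg false c⟩) := by
  have hcard : 2 * (card {i : Option I // i ≠ a ∧ i ≠ μ} + 1) = 2 * I.card := by
    rw [h.card_free, Fintype.card_option, card_coe, Nat.add_sub_cancel]
  have hns := fun (d : ℕ) (he : PolBasis (K₀.ell + η) e ∧ PolBasis (K₀.ell + η + kSum K₀ I) e')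
      v hv w hw ε x u D f hf hf' hf'' =>
    (cutLimit (I := I) (v := v) (w := w) (ε := ε) (x := x) (u := u) D (f := f) hf
      hf').tendsto_nsHalf d (onShell_left h hη hv) (onShell_right h hη hw) rfl rfl rfl rfl hf''
        he.1 he.2
  have h1 : ∀ i, K₀.eps i ⬝ᵥ K₀.k i = 0 := fun i => (h.admissible.2 i).2.1
  have h2 : ∀ i, K₀.epst i ⬝ᵥ K₀.k i = 0 := fun i => (h.admissible.2 i).2.2
  cases T with
  | nGon =>
    have hF : h.HasLimit fun v w => ∑ α : Unit, 1 * (ngonInt v * ngonInt w) := by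
      intro v hv w hw ε x u D hu
      rw [hcard]
      simpa [loopInt] using D.tendsto_ngonInt_cut
    exact h.hasResidue_of_weights (fun _ => 1) hF (by
      rw [Fintype.sum_unique, one_mul]
      rfl)
  | biAdjoint q q' =>
    have hF : h.HasLimit fun v w => ∑ α : {r // r ∈ cuts I q} × {r // r ∈ cuts I q'}, 1 *
        ((ptHalf (cutWord (inBlock I q α.1)) v * ptHalf (cutWord (inBlock I q' α.2)) v) *
        (ptHalf (cutWord (outBlock I q α.1)) w * ptHalf (cutWord (outBlock I q' α.2)) w)) := by
      intro v hv w hw ε x u D hu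
      rw [hcard]
      refine (tendsto_two_mul (D.tendsto_cptHalf_cut h.valid.1)
        (D.tendsto_cptHalf_cut h.valid.2)).trans_eq (congrArg 𝓝 ?_)
      beta_reduce
      rw [sum_mul_sum, sum_prod_type, ← sum_coe_sort (cuts I q)]
      simp_rw [← sum_coe_sort (cuts I q')]
      exact sum_congr rfl fun r _ => sum_congr rfl fun r' _ => by ring
    refine h.hasResidue_of_weights (fun _ => 1) hF ?_
    rw [sum_prod_type, residueII, ← sum_coe_sort (cuts I q)]
    refine congrArg _ (sum_congr rfl fun r _ => ?_)
    rw [← sum_coe_sort (cuts I q')]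
    exact sum_congr rfl fun r' _ => by rw [one_mul]; rfl
  | yangMills d q =>
    have hF : h.HasLimit fun v w => ∑ α : {r // r ∈ cuts I q} × CutState m, cutWeight d m α.2 *
        ((halfL K₀ I (K₀.ell + η) e e' K₀.eps α.2 v * ptHalf (cutWord (inBlock I q α.1)) v) *
        (halfR K₀ I (K₀.ell + η) e e' K₀.eps α.2 w * ptHalf (cutWord (outBlock I q α.1)) w)) := by
      intro v hv w hw ε x u D hu
      rw [hcard]
      refine (tendsto_two_mul (hns d (he trivial).2 v hv w hw ε x u D _ continuous_eps
        (fun i => ((he trivial).1 i).1) h1)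
        (D.tendsto_cptHalf_cut h.valid)).trans_eq (congrArg 𝓝 ?_)
      beta_reduce
      rw [mul_comm, sum_mul_sum, sum_prod_type, ← sum_coe_sort (cuts I q)]
      refine sum_congr rfl fun r _ => sum_congr rfl fun s _ => ?_
      rw [mul_comm, mul_assoc, mul_mul_mul_comm]
      rfl
    refine h.hasResidue_of_weights (fun α : {r // r ∈ cuts I q} × CutState m => cutWeight d m α.2) hF ?_
    rw [sum_prod_type, residueII, ← sum_coe_sort (cuts I q)]
    rfl
  | gravity d =>
    have hF : h.HasLimit fun v w => ∑ α : CutState m × CutState m,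
        cutWeight d m α.1 * cutWeight d m α.2 *
        ((halfL K₀ I (K₀.ell + η) e e' K₀.eps α.1 v * halfL K₀ I (K₀.ell + η) e e' K₀.epst α.2 v) *
        (halfR K₀ I (K₀.ell + η) e e' K₀.eps α.1 w *
          halfR K₀ I (K₀.ell + η) e e' K₀.epst α.2 w)) := by
      intro v hv w hw ε x u D hu
      rw [hcard]
      refine (tendsto_two_mul (hns d (he trivial).2 v hv w hw ε x u D _ continuous_eps
        (fun i => ((he trivial).1 i).1) h1) (hns d (he trivial).2 v hv w hw ε x u D _
        continuous_epst (fun i => ((he trivial).1 i).2) h2)).trans_eq (congrArg 𝓝 ?_)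
      beta_reduce
      rw [sum_mul_sum, sum_prod_type]
      refine sum_congr rfl fun r _ => sum_congr rfl fun s _ => ?_
      rw [mul_mul_mul_comm, mul_mul_mul_comm (cutHalf _ _ _ _)]
      rfl
    refine h.hasResidue_of_weights (fun α : CutState m × CutState m => cutWeight d m α.1 * cutWeight d m α.2) hF ?_
    rw [sum_prod_type, residueII]
    rfl
  | pureGravity d =>
    let W : Option (CutState m × CutState m) → ℂ := fun α =>
      α.elim (-alphaB d) fun α => cutWeight d m α.1 * cutWeight d m α.2
    let st : Option (CutState m × CutState m) → CutState m × CutState m := fun α =>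
      α.getD (none, none)
    have hF : h.HasLimit fun v w => ∑ α, W α * ((halfL K₀ I (K₀.ell + η) e e' K₀.eps (st α).1 v *
          halfL K₀ I (K₀.ell + η) e e' K₀.epst (st α).2 v) *
        (halfR K₀ I (K₀.ell + η) e e' K₀.eps (st α).1 w *
          halfR K₀ I (K₀.ell + η) e e' K₀.epst (st α).2 w)) := by
      intro v hv w hw ε x u D hu
      rw [hcard]
      have hη1 := fun i => ((he trivial).1 i).1
      have hη2 := fun i => ((he trivial).1 i).2
      have h3 := (tendsto_two_mul (hns d (he trivial).2 v hv w hw ε x u D _ continuous_eps hη1 h1)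
        (hns d (he trivial).2 v hv w hw ε x u D _ continuous_epst hη2 h2)).sub
          ((tendsto_two_mul (cutLimit D continuous_eps hη1).tendsto_scalHalf
            (cutLimit D continuous_epst hη2).tendsto_scalHalf).const_mul (alphaB d))
      refine (h3.congr fun K => ?_).trans_eq (congrArg 𝓝 ?_)
      · rw [loopInt]
        ring
      · beta_reduce
        rw [sum_mul_sum]
        refine Eq.trans ?_ (sum_option _).symm
        rw [sum_prod_type, sub_eq_neg_add, ← neg_mul]
        refine congrArg₂ (· + ·) (congrArg (fun z : ℂ => -alphaB d * z)
          (mul_mul_mul_comm _ _ _ _)) ?_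
        refine sum_congr rfl fun r _ => sum_congr rfl fun s _ => ?_
        rw [mul_mul_mul_comm, mul_mul_mul_comm (cutHalf _ _ _ _)]
        rfl
    refine h.hasResidue_of_weights W hF ?_
    rw [sum_option, sum_prod_type, residueII]
    refine congrArg _ ?_
    rw [sub_eq_neg_add, ← neg_mul]
    rfl

end CutFact

end OneLoop

end

open OneLoop in
theorem mainTheorem2 {X : Type*} [Fintype X] [DecidableEq X] (m : ℕ) :
    (∀ (b : Bool) (I : Finset X) (l : Filter ℂ) (K : ℂ → Kin X m)
        (u : ℂ → Config (Bool ⊕ X)) (σI : ℂ) (x : Bool ⊕ X → ℂ) (c C : ℝ),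
      l ≤ 𝓝[≠] (0 : ℂ) → 0 < c →
      (K =O[l] fun _ => (1 : ℝ)) →
      (∀ᶠ ε in l, Admissible (K ε) ∧ (∀ i j, i ≠ j → br (u ε i) (u ε j) ≠ 0) ∧
        ∀ i, (u ε i).2 ≠ 0 → scatEq (loopMandel (K ε)) (u ε) i = 0) →
      (∀ i ∈ chan b I, (∀ᶠ ε in l, (u ε i).2 = 1) ∧
        (fun ε => (u ε i).1 - (σI + ε * x i)) =O[l] fun ε => ε ^ 2) →
      (∀ j ∉ chan b I, ∀ᶠ ε in l, ‖u ε j‖ ≤ C ∧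
        ∀ i ∈ chan b I, c ≤ ‖br (u ε i) (u ε j)‖) →
      (fun ε => sTilde b I (K ε)) =O[l] fun ε => ε) ∧
    (∀ (T : Theory X) (I : Finset X) (a μ : {x // x ∈ I}) (b c : Bool ⊕ {x // x ∉ I})
        (K₀ : Kin X m) (e : Fin (m - 2) → V m)
        (g : Gauge (Bool ⊕ X)) (gL : Gauge (Option {x // x ∈ I}))
        (gR : Gauge (Bool ⊕ Option {x // x ∉ I})),
      T.Valid → a ≠ μ → b ≠ c →
      g = ⟨Sum.inr a.1, toX b, toX c⟩ → gL = ⟨some a, some μ, none⟩ →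
      gR = ⟨Sum.inr none, toR b, toR c⟩ →
      Admissible K₀ → K₀.ell ⬝ᵥ K₀.ell ≠ 0 → sTilde false I K₀ = 0 →
      (T.Spinning → PolBasis (kSum K₀ I) e) →
      Generic (mandel (momI K₀ I)) gL → Generic (loopMandel (kinI K₀ I 0 0)) gR →
      (∀ v ∈ Sols (mandel (momI K₀ I)) gL, ∀ w ∈ Sols (loopMandel (kinI K₀ I 0 0)) gR,
        calF (fun (i : {x // x ∈ I}) (j : Bool ⊕ {x // x ∉ I}) =>
            loopMandel K₀ (Sum.inr i.1) (toX j))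
          (fun i => v (some i)) (w (Sum.inr none)) (fun j => w (toR j)) ≠ 0) →
      HasResidue T g false I (Sum.inr μ.1) K₀ (residueI T I K₀ e a gL gR)) ∧
    (∀ (T : Theory X) (I : Finset X) (a μ : Option {x // x ∈ I}) (b c : Option {x // x ∉ I})
        (K₀ : Kin X m) (η : V m) (e e' : Fin (m - 2) → V m)
        (g : Gauge (Bool ⊕ X)) (gL : Gauge (Bool ⊕ {x // x ∈ I}))
        (gR : Gauge (Bool ⊕ {x // x ∉ I})),
      T.Valid → a ≠ μ → b ≠ c →
      g = ⟨toX (leg true a), toX (leg false b), toX (leg false c)⟩ →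
      gL = ⟨leg true a, leg true μ, Sum.inl false⟩ →
      gR = ⟨Sum.inl true, leg false b, leg false c⟩ →
      Admissible K₀ → K₀.ell ⬝ᵥ K₀.ell ≠ 0 → sTilde true I K₀ = 0 →
      η ⬝ᵥ η = -(K₀.ell ⬝ᵥ K₀.ell) → η ⬝ᵥ K₀.ell = 0 → (∀ i, η ⬝ᵥ K₀.k i = 0) →
      (T.Spinning → (∀ i, η ⬝ᵥ K₀.eps i = 0 ∧ η ⬝ᵥ K₀.epst i = 0) ∧
        PolBasis (K₀.ell + η) e ∧ PolBasis (K₀.ell + η + kSum K₀ I) e') →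
      Generic (mandel (momL K₀ I (K₀.ell + η))) gL →
      Generic (mandel (momR K₀ I (K₀.ell + η))) gR →
      (∀ v ∈ Sols (mandel (momL K₀ I (K₀.ell + η))) gL,
        ∀ w ∈ Sols (mandel (momR K₀ I (K₀.ell + η))) gR,
        calF (fun (i : Option {x // x ∈ I}) (j : Option {x // x ∉ I}) =>
            loopMandel K₀ (toX (leg true i)) (toX (leg false j)))
          (fun i => v (leg true i)) (w (Sum.inl true)) (fun j => w (leg false j)) ≠ 0) →
      HasResidue T g true I (toX (leg true μ)) K₀
        (residueII T I K₀ (K₀.ell + η) e e' gL gR)) :=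
  ⟨fun _ _ _ _ _ _ _ _ _ hl hc hK hE hA hB =>
      sTilde_isBigO (hl.trans nhdsWithin_le_nhds) hc hK hE hA hB,
    fun _ _ _ _ _ _ _ _ _ _ _ hT haμ hbc hg hgL hgR hK hell hst he hL hR hF => by
      subst hg hgL hgR
      exact ChanFact.hasResidue_residueI (factorisation_chan hT haμ hbc hK hell hst hL hR hF) he,
    fun _ _ _ _ _ _ _ _ _ _ _ _ _ hT haμ hbc hg hgL hgR hK hell hst h1 h2 h3 he hL hR hF => by
      subst hg hgL hgR
      exact (factorisation_cut ⟨h1, h2, h3⟩ hT haμ hbc hK hell hst hL hR hF).hasResidue_residueII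
        ⟨h1, h2, h3⟩ he⟩
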